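/- **Setting.** Let $X$ be a topological space with a sheaf of commutative $\mathbb C$-algebras $\mathcal O_X$ that is smooth in the following sense. Let $\mathcal T_X$ be the sheaf of $\mathbb C$-linear derivations of $\mathcal O_X$; locally there are functions $x_1,\dots,x_n$ and vector fields $\partial_1,\dots,\partial_n$ with $\partial_i(x_j)=\delta_{ij}$ and $\xi=\sum_i\xi(x_i)\partial_i$ for every local vector field $\xi$. (Smooth complex algebraic varieties, complex manifolds, and $C^\infty$ manifolds with complex-valued functions are examples.) Let $\Omega^p_X$ be the sheaf of alternating $\mathcal O_X$-multilinear $p$-forms on $\mathcal T_X$. A *Courant algebroid* is a sheaf $\mathcal Q$ of $\mathcal O_X$-modules with a $\mathbb C$-bilinear bracket satisfying the Leibniz–Jacobi identity, an $\mathcal O_X$-linear bracket-preserving anchor $\pi:\mathcal Q\to\mathcal T_X$, a symmetric $\mathcal O_X$-bilinear pairing $\langle\ ,\ \rangle$ with values in $\mathcal O_X$, and a derivation $\partial:\mathcal O_X\to\mathcal Q$ that factors through an $\mathcal O_X$-linear map $i:\Omega^1_X\to\mathcal Q$, such that $\pi\partial=0$, $[q,fq']=f[q,q']+\pi(q)(f)q'$,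 $\pi(q)\langle q_1,q_2\rangle=\langle[q,q_1],q_2\rangle+\langle q_1,[q,q_2]\rangle$, $[q,\partial f]=\partial(\pi(q)(f))$, $\langle q,\partial f\rangle=\pi(q)(f)$ and $[q,q']+[q',q]=\partial\langle q,q'\rangle$. A *vertex algebroid* is a sheaf $\mathcal V$ of $\mathbb C$-vector spaces with a unital, not necessarily associative, multiplication $*:\mathcal O_X\otimes_{\mathbb C}\mathcal V\to\mathcal V$ and $[\ ,\ ]$, $\pi$, $\langle\ ,\ \rangle$, $\partial$, $i$ that satisfy the same identities (with $*$ in place of the module structure), except that associativity of the multiplication and linearity of the pairing are replaced by $$f*(g*v)-(fg)*v=\pi(v)(f)*\partial(g)+\pi(v)(g)*\partial(f),\qquad \langle f*v,v'\rangle=f\langle v,v'\rangle-\pi(v)(\pi(v')(f)).$$ Morphisms preserve the sheaf, multiplication, bracket, anchor, pairing and $\partial$. For a Courant or vertex algebroid $\mathcal E$ let $\Omega_{\mathcal E}\subset\mathcal E$ be the subsheaf generated by the sections $f*\partial(g)$; $\mathcal E$ is *exact* if $\pi$ induces $\mathcal E/\Omega_{\mathcal E}\cong\mathcal T_X$. Let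 $\mathcal{ECA}_{\mathcal O_X}$ and $\mathcal{EVA}_{\mathcal O_X}$ be the stacks of exact Courant and exact vertex algebroids. A *Courant* (resp. *vertex*) *extension* of a Lie algebroid $\mathcal A$ is a Courant (resp. vertex) algebroid $\mathcal E$ with an isomorphism of Lie algebroids $\mathcal E/\Omega_{\mathcal E}\cong\mathcal A$. For an $\mathcal A$-invariant symmetric $\mathcal O_X$-bilinear pairing $\langle\ ,\ \rangle$ on $\mathfrak g(\mathcal A)=\ker(\mathcal A\to\mathcal T_X)$ let $\mathcal{CEXT}_{\mathcal O_X}(\mathcal A)_{\langle\ ,\ \rangle}$ be the stack of Courant extensions of $\mathcal A$ that induce $\langle\ ,\ \rangle$ on $\mathfrak g(\mathcal A)$. If $\mathcal Q$ is an exact Courant algebroid and $\mathcal E$ is an exact vertex algebroid, or a Courant extension of $\mathcal A$, let $\mathcal Q+\mathcal E$ be the pushout of $\mathcal Q\times_{\mathcal T_X}\mathcal E$ by the sum map $\Omega^1_X\times\Omega^1_X\to\Omega^1_X$, with componentwise multiplication and bracket, the sum of the pairings, and $\partial$ such that $(\partial f,\partial g)$ represents $\partial f+\partial g$; this gives actions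 of $\mathcal{ECA}_{\mathcal O_X}$ on $\mathcal{EVA}_{\mathcal O_X}$ and on $\mathcal{CEXT}_{\mathcal O_X}(\mathcal A)_{\langle\ ,\ \rangle}$. Let $-\mathcal Q$ be $\mathcal Q$ with the opposite pairing and the opposite $\partial$. **Proposition.** Let $\mathcal A$ be a transitive Lie algebroid on $X$, locally free of finite rank over $\mathcal O_X$, and let $\widehat{\mathcal A}$ be a vertex extension of $\mathcal A$. There is a unique invariant symmetric pairing $\langle\ ,\ \rangle$ on $\mathfrak g(\mathcal A)$ induced by the pairing of $\widehat{\mathcal A}$. For an exact vertex algebroid $\mathcal V$ (on an open subset of $X$) let $\widehat{\mathcal A}-\mathcal V$ be the pushout of $\widehat{\mathcal A}\times_{\mathcal T_X}\mathcal V$ by the difference map $\Omega^1_X\times\Omega^1_X\to\Omega^1_X$, with the operations $$f*(a,v)=(f*a,f*v),\quad [(a_1,v_1),(a_2,v_2)]=([a_1,a_2],[v_1,v_2]),\quad \langle(a_1,v_1),(a_2,v_2)\rangle=\langle a_1,a_2\rangle-\langle v_1,v_2\rangle,$$ with $\partial$ such that $(\partial f,\partial g)$ represents $\partial f-\partial g$,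 and with the projection $(a,v)\mapsto a$ to $\mathcal A$. 1. The assignment $\mathcal V\mapsto\widehat{\mathcal A}-\mathcal V$ extends to a morphism of stacks $\mathcal{EVA}_{\mathcal O_X}\to\mathcal{CEXT}_{\mathcal O_X}(\mathcal A)_{\langle\ ,\ \rangle}$. 2. It anti-commutes with the actions of $\mathcal{ECA}_{\mathcal O_X}$: the rule $(a,(q,v))\mapsto(q,(a,v))$ defines isomorphisms $\widehat{\mathcal A}-(\mathcal Q+\mathcal V)\cong(-\mathcal Q)+(\widehat{\mathcal A}-\mathcal V)$, natural in $\mathcal Q$ and $\mathcal V$. 3. It is an equivalence of stacks in groupoids. 4. The classes of the $\mathcal{ECA}_{\mathcal O_X}$-torsors $\mathcal{EVA}_{\mathcal O_X}$ and $\mathcal{CEXT}_{\mathcal O_X}(\mathcal A)_{\langle\ ,\ \rangle}$ in the Čech hypercohomology group $H^2(X;\Omega^2_X\to\Omega^{3,cl}_X)$ are well defined and opposite to each other. The class in 4 is computed as follows. Choose an open cover $(U_x)$, objects $\mathcal E_x$ on $U_x$, exact Courant algebroids $\mathcal Q_{xy}$ with isomorphisms $\mathcal Q_{xy}+\mathcal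 E_y\cong\mathcal E_x$ on $U_x\cap U_y$, and connections ($\mathcal O_X$-linear isotropic sections of the anchor) $\nabla_{xy}$ on $\mathcal Q_{xy}$. Then the class is that of the cocycle $(B,H)$, where $H_{xy}$ is the curvature of $\nabla_{xy}$, defined by $[\nabla\xi,\nabla\eta]-\nabla[\xi,\eta]=i(H(\xi,\eta,\cdot))$, and $B_{xyz}\in\Omega^2_X$ is the difference of $\nabla_{xy}+\nabla_{yz}$ and $\nabla_{xz}$ under the induced isomorphism $\mathcal Q_{xy}+\mathcal Q_{yz}\cong\mathcal Q_{xz}$. -/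

import Mathlib

open CategoryTheory TopologicalSpace Opposite

universe u

noncomputable section

namespace Algebroids

variable {X : TopCat.{u}}

/-! ### Ringed spaces over `ℂ`, vector fields, differential forms -/

/-- A structure sheaf on `X`: a sheaf of commutative `ℂ`-algebras. -/
abbrev StructureSheaf (X : TopCat.{u}) := TopCat.Sheaf (CommAlgCat.{u} ℂ) X

/-- The `ℂ`-algebra `O(W)` of functions on the open set `W`. -/
abbrev Fn (O : StructureSheaf X) (W : Opens X) : Type u := O.presheaf.obj (op W)

/-- Restriction of functions. -/
def resFn (O : StructureSheaf X) {W V : Opens X} (i : V ≤ W) : Fn O W →ₐ[ℂ] Fn O V :=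
  (O.presheaf.map (homOfLE i).op).hom

theorem resFn_resFn (O : StructureSheaf X) {W V V' : Opens X} (i : V ≤ W) (j : V' ≤ V)
    (f : Fn O W) : resFn O j (resFn O i f) = resFn O (j.trans i) f := by
  have h : O.presheaf.map (homOfLE (j.trans i)).op
      = O.presheaf.map (homOfLE i).op ≫ O.presheaf.map (homOfLE j).op := by
    rw [← O.presheaf.map_comp]; rfl
  simp only [resFn, h]; rfl

theorem resFn_self (O : StructureSheaf X) {W : Opens X} (f : Fn O W) :
    resFn O (le_refl W) f = f := by
  have h : O.presheaf.map (homOfLE (le_refl W)).op = 𝟙 _ := O.presheaf.map_id _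
  simp only [resFn, h]; rfl

/-- The space of vector fields on `W`, as a subspace of a product over the open subsets of `W`:
`ℂ`-linear derivations of the sheaf `O|_W`. -/
def vectorFields (O : StructureSheaf X) (W : Opens X) :
    Submodule ℂ (∀ V : Set.Iic W, Derivation ℂ (Fn O V.1) (Fn O V.1)) where
  carrier := {ξ | ∀ (V : Opens X) (h : V ≤ W) (V' : Opens X) (i : V' ≤ V) (f : Fn O V),
    resFn O i (ξ ⟨V, h⟩ f) = ξ ⟨V', i.trans h⟩ (resFn O i f)}
  add_mem' := by
    intro a b ha hb V h V' i f
    simp [ha V h V' i f, hb V h V' i f]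
  zero_mem' := by intro V h V' i f; simp
  smul_mem' := by
    intro c a ha V h V' i f
    simp [ha V h V' i f]

/-- `T(W)`, the sections over `W` of the tangent sheaf of `(X, O)`. -/
def VF (O : StructureSheaf X) (W : Opens X) : Type u := ↥(vectorFields O W)

namespace VF

variable {O : StructureSheaf X} {W : Opens X}

instance : AddCommGroup (VF O W) := inferInstanceAs (AddCommGroup ↥(vectorFields O W))
instance : Module ℂ (VF O W) := inferInstanceAs (Module ℂ ↥(vectorFields O W))

/-- The derivation of `O(V)` given by a vector field on `W ⊇ V`. -/
def on (ξ : VF O W) {V : Opens X} (h : V ≤ W) : Derivation ℂ (Fn O V) (Fn O V) := ξ.1 ⟨V, h⟩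

/-- The derivation of `O(W)` given by a vector field on `W`. -/
def app (ξ : VF O W) : Derivation ℂ (Fn O W) (Fn O W) := ξ.on le_rfl

theorem res_on (ξ : VF O W) {V V' : Opens X} (h : V ≤ W) (i : V' ≤ V) (f : Fn O V) :
    resFn O i (ξ.on h f) = ξ.on (i.trans h) (resFn O i f) := ξ.2 V h V' i f

/-- A vector field from a compatible family of derivations. -/
def mk (D : ∀ V : Opens X, V ≤ W → Derivation ℂ (Fn O V) (Fn O V))
    (hD : ∀ (V : Opens X) (h : V ≤ W) (V' : Opens X) (i : V' ≤ V) (f : Fn O V),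
      resFn O i (D V h f) = D V' (i.trans h) (resFn O i f)) : VF O W :=
  ⟨fun V => D V.1 V.2, hD⟩

theorem ext' {ξ η : VF O W} (h : ∀ (V : Opens X) (hV : V ≤ W) (f : Fn O V),
    ξ.on hV f = η.on hV f) : ξ = η :=
  Subtype.ext (funext fun V => Derivation.ext (h V.1 V.2))

/-- Restriction of vector fields. -/
def res {V : Opens X} (i : V ≤ W) : VF O W →ₗ[ℂ] VF O V where
  toFun ξ := mk (fun _ h => ξ.on (h.trans i)) (fun _ h _ j f => ξ.res_on (h.trans i) j f)
  map_add' _ _ := rfl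
  map_smul' _ _ := rfl

/-- The `O(W)`-module structure on `T(W)`. -/
instance : Module (Fn O W) (VF O W) where
  smul f ξ := mk (fun _ h => resFn O h f • ξ.on h) (by
    intro V h V' i g
    simp [res_on, resFn_resFn])
  one_smul ξ := ext' fun V h f => by
    change (resFn O h 1 • ξ.on h) f = _
    simp
  mul_smul a b ξ := ext' fun V h f => by
    change (resFn O h (a * b) • ξ.on h) f = (resFn O h a • resFn O h b • ξ.on h) f
    simp [mul_assoc]
  smul_zero a := ext' fun V h f => by
    change (resFn O h a • (0 : Derivation ℂ (Fn O V) (Fn O V))) f = 0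
    simp
  smul_add a ξ η := ext' fun V h f => by
    change (resFn O h a • (ξ.on h + η.on h)) f = (resFn O h a • ξ.on h + resFn O h a • η.on h) f
    simp
  add_smul a b ξ := ext' fun V h f => by
    change (resFn O h (a + b) • ξ.on h) f = (resFn O h a • ξ.on h + resFn O h b • ξ.on h) f
    simp [add_mul]
  zero_smul ξ := ext' fun V h f => by
    change (resFn O h 0 • ξ.on h) f = 0
    simp

/-- The commutator bracket of vector fields. -/
instance : Bracket (VF O W) (VF O W) where
  bracket ξ η := mk (fun _ h => ⁅ξ.on h, η.on h⁆) (by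
    intro V h V' i f
    simp [Derivation.commutator_apply, res_on])

end VF

/-- The space of differential `p`-forms on `W`, as a subspace of a product over the open subsets
of `W`. -/
def forms (O : StructureSheaf X) (p : ℕ) (W : Opens X) :
    Submodule ℂ (∀ V : Set.Iic W, VF O V.1 [⋀^Fin p]→ₗ[Fn O V.1] Fn O V.1) where
  carrier := {ω | ∀ (V : Opens X) (h : V ≤ W) (V' : Opens X) (i : V' ≤ V) (ξ : Fin p → VF O V),
    resFn O i (ω ⟨V, h⟩ ξ) = ω ⟨V', i.trans h⟩ (fun k => VF.res i (ξ k))}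
  add_mem' := by
    intro a b ha hb V h V' i ξ
    simp [ha V h V' i ξ, hb V h V' i ξ]
  zero_mem' := by intro V h V' i ξ; simp
  smul_mem' := by
    intro c a ha V h V' i ξ
    simp [ha V h V' i ξ]

/-- `Ω^p(W)`: alternating `O`-multilinear maps of sheaves `T|_W × ⋯ × T|_W → O|_W`. -/
def Form (O : StructureSheaf X) (p : ℕ) (W : Opens X) : Type u := ↥(forms O p W)

namespace Form

variable {O : StructureSheaf X} {W : Opens X} {p : ℕ}

instance : AddCommGroup (Form O p W) := inferInstanceAs (AddCommGroup ↥(forms O p W))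
instance : Module ℂ (Form O p W) := inferInstanceAs (Module ℂ ↥(forms O p W))

/-- The values of a form on `W` on vector fields on `V ⊆ W`. -/
def on (ω : Form O p W) {V : Opens X} (h : V ≤ W) : VF O V [⋀^Fin p]→ₗ[Fn O V] Fn O V :=
  ω.1 ⟨V, h⟩

theorem res_on (ω : Form O p W) {V V' : Opens X} (h : V ≤ W) (i : V' ≤ V) (ξ : Fin p → VF O V) :
    resFn O i (ω.on h ξ) = ω.on (i.trans h) (fun k => VF.res i (ξ k)) := ω.2 V h V' i ξ

/-- A form from a compatible family of alternating maps. -/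
def mk (ω : ∀ V : Opens X, V ≤ W → VF O V [⋀^Fin p]→ₗ[Fn O V] Fn O V)
    (hω : ∀ (V : Opens X) (h : V ≤ W) (V' : Opens X) (i : V' ≤ V) (ξ : Fin p → VF O V),
      resFn O i (ω V h ξ) = ω V' (i.trans h) (fun k => VF.res i (ξ k))) : Form O p W :=
  ⟨fun V => ω V.1 V.2, hω⟩

/-- Restriction of forms. -/
def res {V : Opens X} (i : V ≤ W) : Form O p W →ₗ[ℂ] Form O p V where
  toFun ω := mk (fun _ h => ω.on (h.trans i)) (fun _ h _ j ξ => ω.res_on (h.trans i) j ξ)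
  map_add' _ _ := rfl
  map_smul' _ _ := rfl

/-- Multiplication of a form by a function. -/
instance : SMul (Fn O W) (Form O p W) where
  smul f ω := mk (fun _ h => resFn O h f • ω.on h) (by
    intro V h V' i ξ
    simp [res_on, resFn_resFn])

/-- Contraction `ι_ξ ω = ω(ξ, ·, …, ·)`. -/
def contract (ξ : VF O W) (ω : Form O (p + 1) W) : Form O p W :=
  mk (fun _ h => (ω.on h).curryLeft (VF.res h ξ)) (by
    intro V h V' i η
    change resFn O i (ω.on h (Matrix.vecCons (VF.res h ξ) η))
      = ω.on (i.trans h) (Matrix.vecCons (VF.res (i.trans h) ξ) (fun k => VF.res i (η k)))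
    rw [res_on]
    congr 1
    funext k
    refine Fin.cases ?_ (fun k => ?_) k
    · rfl
    · rfl)

/-- The differential of a function, `(df)(ξ) = ξ(f)`. -/
def d (f : Fn O W) : Form O 1 W :=
  mk (fun V h => AlternatingMap.ofSubsingleton (Fn O V) (VF O V) (Fn O V) (0 : Fin 1)
      { toFun := fun ξ => ξ.app (resFn O h f)
        map_add' := fun _ _ => rfl
        map_smul' := fun a ξ => by
          change resFn O le_rfl a • ξ.app (resFn O h f) = a • ξ.app (resFn O h f)
          rw [resFn_self] }) (by
    intro V h V' i ξ
    change resFn O i ((ξ 0).on le_rfl (resFn O h f))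
      = (ξ 0).on (le_rfl.trans i) (resFn O (i.trans h) f)
    rw [VF.res_on, resFn_resFn])

/-- The value `(dB)(ξ, η, ζ)` of the exterior derivative of the 2-form `B`
on vector fields on `V ⊆ W`. -/
def d₂ (B : Form O 2 W) {V : Opens X} (h : V ≤ W) (ξ η ζ : VF O V) : Fn O V :=
  ξ.app (B.on h ![η, ζ]) - η.app (B.on h ![ξ, ζ]) + ζ.app (B.on h ![ξ, η])
    - B.on h ![⁅ξ, η⁆, ζ] + B.on h ![⁅ξ, ζ⁆, η] - B.on h ![⁅η, ζ⁆, ξ]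

/-- The value `(dH)(ξ₀, ξ₁, ξ₂, ξ₃)` of the exterior derivative of the 3-form `H`
on vector fields on `V ⊆ W`. -/
def d₃ (H : Form O 3 W) {V : Opens X} (h : V ≤ W) (ξ₀ ξ₁ ξ₂ ξ₃ : VF O V) : Fn O V :=
  ξ₀.app (H.on h ![ξ₁, ξ₂, ξ₃]) - ξ₁.app (H.on h ![ξ₀, ξ₂, ξ₃])
    + ξ₂.app (H.on h ![ξ₀, ξ₁, ξ₃]) - ξ₃.app (H.on h ![ξ₀, ξ₁, ξ₂])
    - H.on h ![⁅ξ₀, ξ₁⁆, ξ₂, ξ₃] + H.on h ![⁅ξ₀, ξ₂⁆, ξ₁, ξ₃] - H.on h ![⁅ξ₀, ξ₃⁆, ξ₁, ξ₂]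
    - H.on h ![⁅ξ₁, ξ₂⁆, ξ₀, ξ₃] + H.on h ![⁅ξ₁, ξ₃⁆, ξ₀, ξ₂] - H.on h ![⁅ξ₂, ξ₃⁆, ξ₀, ξ₁]

theorem d₂_add (B B' : Form O 2 W) {V : Opens X} (h : V ≤ W) (ξ η ζ : VF O V) :
    (B + B').d₂ h ξ η ζ = B.d₂ h ξ η ζ + B'.d₂ h ξ η ζ := by
  have key : ∀ v, (B + B').on h v = B.on h v + B'.on h v := fun _ => rfl
  simp only [d₂, key, map_add]
  abel

theorem d₂_smul (c : ℂ) (B : Form O 2 W) {V : Opens X} (h : V ≤ W) (ξ η ζ : VF O V) :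
    (c • B).d₂ h ξ η ζ = c • B.d₂ h ξ η ζ := by
  have key : ∀ v, (c • B).on h v = c • B.on h v := fun _ => rfl
  simp only [d₂, key, Derivation.map_smul, smul_add, smul_sub]

theorem d₂_zero {V : Opens X} (h : V ≤ W) (ξ η ζ : VF O V) :
    (0 : Form O 2 W).d₂ h ξ η ζ = 0 := by
  have key : ∀ v, (0 : Form O 2 W).on h v = 0 := fun _ => rfl
  simp [d₂, key]

theorem d₃_add (H H' : Form O 3 W) {V : Opens X} (h : V ≤ W) (ξ₀ ξ₁ ξ₂ ξ₃ : VF O V) :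
    (H + H').d₃ h ξ₀ ξ₁ ξ₂ ξ₃ = H.d₃ h ξ₀ ξ₁ ξ₂ ξ₃ + H'.d₃ h ξ₀ ξ₁ ξ₂ ξ₃ := by
  have key : ∀ v, (H + H').on h v = H.on h v + H'.on h v := fun _ => rfl
  simp only [d₃, key, map_add]
  abel

theorem d₃_smul (c : ℂ) (H : Form O 3 W) {V : Opens X} (h : V ≤ W) (ξ₀ ξ₁ ξ₂ ξ₃ : VF O V) :
    (c • H).d₃ h ξ₀ ξ₁ ξ₂ ξ₃ = c • H.d₃ h ξ₀ ξ₁ ξ₂ ξ₃ := by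
  have key : ∀ v, (c • H).on h v = c • H.on h v := fun _ => rfl
  simp only [d₃, key, Derivation.map_smul, smul_add, smul_sub]

/-- `dH = 0`. -/
def IsClosed (H : Form O 3 W) : Prop :=
  ∀ (V : Opens X) (h : V ≤ W) (ξ₀ ξ₁ ξ₂ ξ₃ : VF O V), H.d₃ h ξ₀ ξ₁ ξ₂ ξ₃ = 0

theorem IsClosed.add {H H' : Form O 3 W} (a : H.IsClosed) (b : H'.IsClosed) :
    (H + H').IsClosed := fun V h ξ₀ ξ₁ ξ₂ ξ₃ => by
  rw [d₃_add, a V h ξ₀ ξ₁ ξ₂ ξ₃, b V h ξ₀ ξ₁ ξ₂ ξ₃, add_zero]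

theorem IsClosed.smul (c : ℂ) {H : Form O 3 W} (a : H.IsClosed) :
    (c • H).IsClosed := fun V h ξ₀ ξ₁ ξ₂ ξ₃ => by
  rw [d₃_smul, a V h ξ₀ ξ₁ ξ₂ ξ₃, smul_zero]

theorem IsClosed.zero : (0 : Form O 3 W).IsClosed := fun V h ξ₀ ξ₁ ξ₂ ξ₃ => by
  have key : ∀ v, (0 : Form O 3 W).on h v = 0 := fun _ => rfl
  simp [d₃, key]

end Form

/-- `(X, O)` is smooth: every point has a neighbourhood `U` with a coordinate system, i.e. functions
`x₁, …, xₙ` and vector fields `∂₁, …, ∂ₙ` on `U` such that `∂ᵢ(xⱼ) = δᵢⱼ` and `ξ = ∑ ξ(xᵢ) ∂ᵢ` for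
every vector field `ξ` on an open subset of `U`.  Smooth complex algebraic varieties, complex
manifolds (with their holomorphic functions) and `C^∞` manifolds (with their complex-valued
smooth functions) have this property. -/
def IsSmooth (O : StructureSheaf X) : Prop :=
  ∀ p : X, ∃ (U : Opens X) (_ : p ∈ U) (n : ℕ) (x : Fin n → Fn O U) (D : Fin n → VF O U),
    (∀ i j, (D i).app (x j) = if i = j then 1 else 0) ∧
    ∀ (W : Opens X) (h : W ≤ U) (ξ : VF O W),
      ξ = ∑ i, ξ.app (resFn O h (x i)) • VF.res h (D i)

/-! ### Sheaves of `ℂ`-vector spaces on an open subset -/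

/-- A sheaf of `ℂ`-vector spaces on the open subset `U` of `X`. -/
structure SheafOn (U : Opens X) where
  sec : ∀ W : Opens X, W ≤ U → Type u
  [acg : ∀ W h, AddCommGroup (sec W h)]
  [mod : ∀ W h, Module ℂ (sec W h)]
  res : ∀ {W V : Opens X} (h : W ≤ U) (i : V ≤ W), sec W h →ₗ[ℂ] sec V (i.trans h)
  res_self : ∀ {W : Opens X} (h : W ≤ U) (s : sec W h), res h le_rfl s = s
  res_res : ∀ {W V V' : Opens X} (h : W ≤ U) (i : V ≤ W) (j : V' ≤ V) (s : sec W h),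
    res (i.trans h) j (res h i s) = res h (j.trans i) s
  existsUnique_gluing : ∀ {ι : Type u} (V : ι → Opens X) (h : iSup V ≤ U)
    (s : ∀ a, sec (V a) ((le_iSup V a).trans h)),
    (∀ a b, res ((le_iSup V a).trans h) (inf_le_left : V a ⊓ V b ≤ V a) (s a)
      = res ((le_iSup V b).trans h) (inf_le_right : V a ⊓ V b ≤ V b) (s b)) →
    ∃! t : sec (iSup V) h, ∀ a, res h (le_iSup V a) t = s a

attribute [instance] SheafOn.acg SheafOn.mod

/-- Restriction of a sheaf to a smaller open subset. -/
def SheafOn.restrict {U U' : Opens X} (F : SheafOn U) (i : U' ≤ U) : SheafOn U' where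
  sec W h := F.sec W (h.trans i)
  acg W h := F.acg W (h.trans i)
  mod W h := F.mod W (h.trans i)
  res h j := F.res (h.trans i) j
  res_self h s := F.res_self (h.trans i) s
  res_res h j k s := F.res_res (h.trans i) j k s
  existsUnique_gluing V h s hs := F.existsUnique_gluing V (h.trans i) s hs

/-! ### Lie algebroids -/

/-- A Lie `O`-algebroid on `X`. -/
structure LieAlgebroid (O : StructureSheaf X) extends SheafOn (⊤ : Opens X) where
  act : ∀ W : Opens X, Fn O W →ₗ[ℂ] sec W le_top →ₗ[ℂ] sec W le_top
  bracket : ∀ W : Opens X, sec W le_top →ₗ[ℂ] sec W le_top →ₗ[ℂ] sec W le_top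
  anchor : ∀ W : Opens X, sec W le_top →ₗ[ℂ] VF O W
  res_act : ∀ {W V : Opens X} (i : V ≤ W) (f : Fn O W) (a : sec W le_top),
    res le_top i (act W f a) = act V (resFn O i f) (res le_top i a)
  res_bracket : ∀ {W V : Opens X} (i : V ≤ W) (a b : sec W le_top),
    res le_top i (bracket W a b) = bracket V (res le_top i a) (res le_top i b)
  res_anchor : ∀ {W V : Opens X} (i : V ≤ W) (a : sec W le_top),
    VF.res i (anchor W a) = anchor V (res le_top i a)
  one_act : ∀ {W : Opens X} (a : sec W le_top), act W 1 a = a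
  act_act : ∀ {W : Opens X} (f g : Fn O W) (a : sec W le_top),
    act W f (act W g a) = act W (f * g) a
  bracket_self : ∀ {W : Opens X} (a : sec W le_top), bracket W a a = 0
  jacobi : ∀ {W : Opens X} (a b c : sec W le_top),
    bracket W a (bracket W b c) = bracket W (bracket W a b) c + bracket W b (bracket W a c)
  anchor_act : ∀ {W : Opens X} (f : Fn O W) (a : sec W le_top),
    anchor W (act W f a) = f • anchor W a
  anchor_bracket : ∀ {W : Opens X} (a b : sec W le_top),
    anchor W (bracket W a b) = ⁅anchor W a, anchor W b⁆
  bracket_act : ∀ {W : Opens X} (a b : sec W le_top) (f : Fn O W),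
    bracket W a (act W f b) = act W ((anchor W a).app f) b + act W f (bracket W a b)

namespace LieAlgebroid

variable {O : StructureSheaf X} (A : LieAlgebroid O)

/-- The sections of `A` over `W`. -/
abbrev Sec (W : Opens X) : Type u := A.sec W le_top

/-- `A` is transitive: the anchor map is a surjective map of sheaves. -/
def IsTransitive : Prop :=
  ∀ (W : Opens X) (ξ : VF O W), ∀ p ∈ W, ∃ (V : Opens X) (i : V ≤ W) (_ : p ∈ V) (a : A.Sec V),
    A.anchor V a = VF.res i ξ

/-- `A` is locally free of finite rank as an `O`-module. -/
def IsLocallyFreeOfFiniteRank : Prop :=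
  ∀ p : X, ∃ (U : Opens X) (_ : p ∈ U) (n : ℕ) (b : Fin n → A.Sec U),
    ∀ (W : Opens X) (i : W ≤ U) (a : A.Sec W), ∃! c : Fin n → Fn O W,
      a = ∑ k, A.act W (c k) (A.res le_top i (b k))

/-- The sections over `W` of `𝔤(A)`, the kernel of the anchor map. -/
abbrev isotropy (W : Opens X) : Submodule ℂ (A.Sec W) := LinearMap.ker (A.anchor W)

end LieAlgebroid

/-- An `A`-invariant symmetric `O`-bilinear pairing `𝔤(A) ⊗ 𝔤(A) → O`. -/
structure InvariantPairing {O : StructureSheaf X} (A : LieAlgebroid O) where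
  val : ∀ W : Opens X, A.isotropy W →ₗ[ℂ] A.isotropy W →ₗ[ℂ] Fn O W
  res_val : ∀ {W V : Opens X} (i : V ≤ W) (x y : A.isotropy W) (x' y' : A.isotropy V),
    (x' : A.Sec V) = A.res le_top i x → (y' : A.Sec V) = A.res le_top i y →
      resFn O i (val W x y) = val V x' y'
  symm : ∀ {W : Opens X} (x y : A.isotropy W), val W x y = val W y x
  act_left : ∀ {W : Opens X} (f : Fn O W) (x x' y : A.isotropy W),
    (x' : A.Sec W) = A.act W f x → val W x' y = f * val W x y
  invariant : ∀ {W : Opens X} (a : A.Sec W) (x y x' y' : A.isotropy W),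
    (x' : A.Sec W) = A.bracket W a x → (y' : A.Sec W) = A.bracket W a y →
      (A.anchor W a).app (val W x y) = val W x' y + val W x y'

/-! ### Courant and vertex algebroids -/

/-- The common underlying data of Courant and vertex algebroids on the open set `U`: a sheaf of
`ℂ`-vector spaces with a `ℂ`-bilinear (not necessarily associative) action of `O`, a bracket, an
anchor map, a pairing, a map `∂ : O → E`, and a map `i : Ω¹ → E` (through which `∂` factors,
see `IsCourant` and `IsVertex`); all of them are maps of sheaves. -/
structure Algebroid (O : StructureSheaf X) (U : Opens X) extends SheafOn U where
  act : ∀ {W : Opens X} (h : W ≤ U), Fn O W →ₗ[ℂ] sec W h →ₗ[ℂ] sec W h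
  bracket : ∀ {W : Opens X} (h : W ≤ U), sec W h →ₗ[ℂ] sec W h →ₗ[ℂ] sec W h
  anchor : ∀ {W : Opens X} (h : W ≤ U), sec W h →ₗ[ℂ] VF O W
  pairing : ∀ {W : Opens X} (h : W ≤ U), sec W h →ₗ[ℂ] sec W h →ₗ[ℂ] Fn O W
  der : ∀ {W : Opens X} (h : W ≤ U), Fn O W →ₗ[ℂ] sec W h
  inc : ∀ {W : Opens X} (h : W ≤ U), Form O 1 W →ₗ[ℂ] sec W h
  res_act : ∀ {W V : Opens X} (h : W ≤ U) (i : V ≤ W) (f : Fn O W) (e : sec W h),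
    res h i (act h f e) = act (i.trans h) (resFn O i f) (res h i e)
  res_bracket : ∀ {W V : Opens X} (h : W ≤ U) (i : V ≤ W) (e e' : sec W h),
    res h i (bracket h e e') = bracket (i.trans h) (res h i e) (res h i e')
  res_anchor : ∀ {W V : Opens X} (h : W ≤ U) (i : V ≤ W) (e : sec W h),
    VF.res i (anchor h e) = anchor (i.trans h) (res h i e)
  res_pairing : ∀ {W V : Opens X} (h : W ≤ U) (i : V ≤ W) (e e' : sec W h),
    resFn O i (pairing h e e') = pairing (i.trans h) (res h i e) (res h i e')
  res_der : ∀ {W V : Opens X} (h : W ≤ U) (i : V ≤ W) (f : Fn O W),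
    res h i (der h f) = der (i.trans h) (resFn O i f)
  res_inc : ∀ {W V : Opens X} (h : W ≤ U) (i : V ≤ W) (α : Form O 1 W),
    res h i (inc h α) = inc (i.trans h) (Form.res i α)

namespace Algebroid

variable {O : StructureSheaf X} {U : Opens X}

/-- Restriction to a smaller open subset. -/
def restrict {U' : Opens X} (E : Algebroid O U) (i : U' ≤ U) : Algebroid O U' where
  toSheafOn := E.toSheafOn.restrict i
  act h := E.act (h.trans i)
  bracket h := E.bracket (h.trans i)
  anchor h := E.anchor (h.trans i)
  pairing h := E.pairing (h.trans i)
  der h := E.der (h.trans i)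
  inc h := E.inc (h.trans i)
  res_act h := E.res_act (h.trans i)
  res_bracket h := E.res_bracket (h.trans i)
  res_anchor h := E.res_anchor (h.trans i)
  res_pairing h := E.res_pairing (h.trans i)
  res_der h := E.res_der (h.trans i)
  res_inc h := E.res_inc (h.trans i)

/-- `E` is a Courant algebroid. -/
structure IsCourant (E : Algebroid O U) : Prop where
  one_act : ∀ {W : Opens X} (h : W ≤ U) (q : E.sec W h), E.act h 1 q = q
  act_act : ∀ {W : Opens X} (h : W ≤ U) (f g : Fn O W) (q : E.sec W h),
    E.act h f (E.act h g q) = E.act h (f * g) q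
  jacobi : ∀ {W : Opens X} (h : W ≤ U) (a b c : E.sec W h),
    E.bracket h a (E.bracket h b c)
      = E.bracket h (E.bracket h a b) c + E.bracket h b (E.bracket h a c)
  anchor_act : ∀ {W : Opens X} (h : W ≤ U) (f : Fn O W) (q : E.sec W h),
    E.anchor h (E.act h f q) = f • E.anchor h q
  anchor_bracket : ∀ {W : Opens X} (h : W ≤ U) (q q' : E.sec W h),
    E.anchor h (E.bracket h q q') = ⁅E.anchor h q, E.anchor h q'⁆
  pairing_symm : ∀ {W : Opens X} (h : W ≤ U) (q q' : E.sec W h),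
    E.pairing h q q' = E.pairing h q' q
  pairing_act : ∀ {W : Opens X} (h : W ≤ U) (f : Fn O W) (q q' : E.sec W h),
    E.pairing h (E.act h f q) q' = f * E.pairing h q q'
  der_mul : ∀ {W : Opens X} (h : W ≤ U) (f g : Fn O W),
    E.der h (f * g) = E.act h f (E.der h g) + E.act h g (E.der h f)
  inc_act : ∀ {W : Opens X} (h : W ≤ U) (f : Fn O W) (α : Form O 1 W),
    E.inc h (f • α) = E.act h f (E.inc h α)
  inc_d : ∀ {W : Opens X} (h : W ≤ U) (f : Fn O W), E.inc h (Form.d f) = E.der h f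
  anchor_der : ∀ {W : Opens X} (h : W ≤ U) (f : Fn O W), E.anchor h (E.der h f) = 0
  bracket_act : ∀ {W : Opens X} (h : W ≤ U) (q q' : E.sec W h) (f : Fn O W),
    E.bracket h q (E.act h f q')
      = E.act h f (E.bracket h q q') + E.act h ((E.anchor h q).app f) q'
  pairing_invariant : ∀ {W : Opens X} (h : W ≤ U) (q q₁ q₂ : E.sec W h),
    E.pairing h (E.bracket h q q₁) q₂ + E.pairing h q₁ (E.bracket h q q₂)
      = (E.anchor h q).app (E.pairing h q₁ q₂)
  bracket_der : ∀ {W : Opens X} (h : W ≤ U) (q : E.sec W h) (f : Fn O W),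
    E.bracket h q (E.der h f) = E.der h ((E.anchor h q).app f)
  pairing_der : ∀ {W : Opens X} (h : W ≤ U) (q : E.sec W h) (f : Fn O W),
    E.pairing h q (E.der h f) = (E.anchor h q).app f
  bracket_symm : ∀ {W : Opens X} (h : W ≤ U) (q q' : E.sec W h),
    E.bracket h q q' + E.bracket h q' q = E.der h (E.pairing h q q')

/-- `E` is a vertex algebroid. -/
structure IsVertex (E : Algebroid O U) : Prop where
  one_act : ∀ {W : Opens X} (h : W ≤ U) (v : E.sec W h), E.act h 1 v = v
  jacobi : ∀ {W : Opens X} (h : W ≤ U) (a b c : E.sec W h),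
    E.bracket h a (E.bracket h b c)
      = E.bracket h (E.bracket h a b) c + E.bracket h b (E.bracket h a c)
  anchor_bracket : ∀ {W : Opens X} (h : W ≤ U) (v v' : E.sec W h),
    E.anchor h (E.bracket h v v') = ⁅E.anchor h v, E.anchor h v'⁆
  pairing_symm : ∀ {W : Opens X} (h : W ≤ U) (v v' : E.sec W h),
    E.pairing h v v' = E.pairing h v' v
  anchor_der : ∀ {W : Opens X} (h : W ≤ U) (f : Fn O W), E.anchor h (E.der h f) = 0
  act_act : ∀ {W : Opens X} (h : W ≤ U) (f g : Fn O W) (v : E.sec W h),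
    E.act h f (E.act h g v) - E.act h (f * g) v
      = E.act h ((E.anchor h v).app f) (E.der h g) + E.act h ((E.anchor h v).app g) (E.der h f)
  bracket_act : ∀ {W : Opens X} (h : W ≤ U) (v v' : E.sec W h) (f : Fn O W),
    E.bracket h v (E.act h f v')
      = E.act h ((E.anchor h v).app f) v' + E.act h f (E.bracket h v v')
  bracket_symm : ∀ {W : Opens X} (h : W ≤ U) (v v' : E.sec W h),
    E.bracket h v v' + E.bracket h v' v = E.der h (E.pairing h v v')
  anchor_act : ∀ {W : Opens X} (h : W ≤ U) (f : Fn O W) (v : E.sec W h),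
    E.anchor h (E.act h f v) = f • E.anchor h v
  pairing_act : ∀ {W : Opens X} (h : W ≤ U) (f : Fn O W) (v v' : E.sec W h),
    E.pairing h (E.act h f v) v'
      = f * E.pairing h v v' - (E.anchor h v).app ((E.anchor h v').app f)
  pairing_invariant : ∀ {W : Opens X} (h : W ≤ U) (v v₁ v₂ : E.sec W h),
    (E.anchor h v).app (E.pairing h v₁ v₂)
      = E.pairing h (E.bracket h v v₁) v₂ + E.pairing h v₁ (E.bracket h v v₂)
  der_mul : ∀ {W : Opens X} (h : W ≤ U) (f g : Fn O W),
    E.der h (f * g) = E.act h f (E.der h g) + E.act h g (E.der h f)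
  bracket_der : ∀ {W : Opens X} (h : W ≤ U) (v : E.sec W h) (f : Fn O W),
    E.bracket h v (E.der h f) = E.der h ((E.anchor h v).app f)
  pairing_der : ∀ {W : Opens X} (h : W ≤ U) (v : E.sec W h) (f : Fn O W),
    E.pairing h v (E.der h f) = (E.anchor h v).app f
  inc_act : ∀ {W : Opens X} (h : W ≤ U) (f : Fn O W) (α : Form O 1 W),
    E.inc h (f • α) = E.act h f (E.inc h α)
  inc_d : ∀ {W : Opens X} (h : W ≤ U) (f : Fn O W), E.inc h (Form.d f) = E.der h f

/-- The section `e` belongs to `Ω_E = O * ∂(O)`, the subsheaf of `E` whose sections are locally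
finite sums of sections of the form `f * ∂(g)`. -/
def IsOmega (E : Algebroid O U) {W : Opens X} (h : W ≤ U) (e : E.sec W h) : Prop :=
  ∀ p ∈ W, ∃ (V : Opens X) (i : V ≤ W) (_ : p ∈ V),
    E.res h i e ∈ AddSubgroup.closure
      (Set.range fun fg : Fn O V × Fn O V => E.act (i.trans h) fg.1 (E.der (i.trans h) fg.2))

/-- `E` is exact: the anchor induces an isomorphism `E / Ω_E ≅ T`. -/
structure IsExact (E : Algebroid O U) : Prop where
  surj : ∀ {W : Opens X} (_ : W ≤ U) (ξ : VF O W), ∀ p ∈ W,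
    ∃ (V : Opens X) (i : V ≤ W) (hV : V ≤ U) (_ : p ∈ V) (e : E.sec V hV),
      E.anchor hV e = VF.res i ξ
  ker : ∀ {W : Opens X} (h : W ≤ U) (e : E.sec W h), E.anchor h e = 0 ↔ E.IsOmega h e

/-- Morphisms of (Courant or vertex) algebroids: `ℂ`-linear maps of sheaves which preserve the
action of `O`, bracket, anchor, pairing and `∂`. -/
@[ext]
structure Hom (E E' : Algebroid O U) where
  app : ∀ {W : Opens X} (h : W ≤ U), E.sec W h →ₗ[ℂ] E'.sec W h
  app_res : ∀ {W V : Opens X} (h : W ≤ U) (i : V ≤ W) (e : E.sec W h),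
    app (i.trans h) (E.res h i e) = E'.res h i (app h e)
  app_act : ∀ {W : Opens X} (h : W ≤ U) (f : Fn O W) (e : E.sec W h),
    app h (E.act h f e) = E'.act h f (app h e)
  app_bracket : ∀ {W : Opens X} (h : W ≤ U) (a b : E.sec W h),
    app h (E.bracket h a b) = E'.bracket h (app h a) (app h b)
  anchor_app : ∀ {W : Opens X} (h : W ≤ U) (e : E.sec W h),
    E'.anchor h (app h e) = E.anchor h e
  pairing_app : ∀ {W : Opens X} (h : W ≤ U) (a b : E.sec W h),
    E'.pairing h (app h a) (app h b) = E.pairing h a b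
  app_der : ∀ {W : Opens X} (h : W ≤ U) (f : Fn O W), app h (E.der h f) = E'.der h f

namespace Hom

/-- The identity morphism. -/
def id (E : Algebroid O U) : Hom E E where
  app _ := LinearMap.id
  app_res _ _ _ := rfl
  app_act _ _ _ := rfl
  app_bracket _ _ _ := rfl
  anchor_app _ _ := rfl
  pairing_app _ _ _ := rfl
  app_der _ _ := rfl

/-- Composition of morphisms. -/
def comp {E E' E'' : Algebroid O U} (φ : Hom E E') (ψ : Hom E' E'') : Hom E E'' where
  app h := (ψ.app h).comp (φ.app h)
  app_res h i e := by simp [φ.app_res, ψ.app_res]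
  app_act h f e := by simp [φ.app_act, ψ.app_act]
  app_bracket h a b := by simp [φ.app_bracket, ψ.app_bracket]
  anchor_app h e := by simp [φ.anchor_app, ψ.anchor_app]
  pairing_app h a b := by simp [φ.pairing_app, ψ.pairing_app]
  app_der h f := by simp [φ.app_der, ψ.app_der]

/-- Restriction of a morphism to a smaller open subset. -/
def restrict {E E' : Algebroid O U} (φ : Hom E E') {U' : Opens X} (i : U' ≤ U) :
    Hom (E.restrict i) (E'.restrict i) where
  app h := φ.app (h.trans i)
  app_res h := φ.app_res (h.trans i)
  app_act h := φ.app_act (h.trans i)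
  app_bracket h := φ.app_bracket (h.trans i)
  anchor_app h := φ.anchor_app (h.trans i)
  pairing_app h := φ.pairing_app (h.trans i)
  app_der h := φ.app_der (h.trans i)

end Hom

/-- A map `κ` from the fiber product `E₁ ×_T E₂` to `E` which exhibits `E` as the combination
`E₁ + ε E₂` (the sum for `ε = 1`, the difference for `ε = -1`):  `κ` presents `E` as the push-out
of `E₁ ×_T E₂` by the map `Ω¹ × Ω¹ → Ω¹`, `(α, β) ↦ α + ε β`, and the structure of `E` is the
componentwise one, i.e. `f * (a, b) = (f * a, f * b)`, `[(a, b), (a', b')] = ([a, a'], [b, b'])`,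
`⟨(a, b), (a', b')⟩ = ⟨a, a'⟩ + ε ⟨b, b'⟩`, `(∂ f, ∂ g) = ∂ f + ε ∂ g`. -/
structure Combination (ε : ℤ) (E₁ E₂ E : Algebroid O U) where
  map : ∀ {W : Opens X} (h : W ≤ U) (a : E₁.sec W h) (b : E₂.sec W h),
    E₁.anchor h a = E₂.anchor h b → E.sec W h
  map_res : ∀ {W V : Opens X} (h : W ≤ U) (i : V ≤ W) (a : E₁.sec W h) (b : E₂.sec W h)
    (w : E₁.anchor h a = E₂.anchor h b)
    (w' : E₁.anchor (i.trans h) (E₁.res h i a) = E₂.anchor (i.trans h) (E₂.res h i b)),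
    map (i.trans h) (E₁.res h i a) (E₂.res h i b) w' = E.res h i (map h a b w)
  map_add : ∀ {W : Opens X} (h : W ≤ U) (a a' : E₁.sec W h) (b b' : E₂.sec W h)
    (w : E₁.anchor h a = E₂.anchor h b) (w' : E₁.anchor h a' = E₂.anchor h b')
    (w'' : E₁.anchor h (a + a') = E₂.anchor h (b + b')),
    map h (a + a') (b + b') w'' = map h a b w + map h a' b' w'
  map_act : ∀ {W : Opens X} (h : W ≤ U) (f : Fn O W) (a : E₁.sec W h) (b : E₂.sec W h)
    (w : E₁.anchor h a = E₂.anchor h b)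
    (w' : E₁.anchor h (E₁.act h f a) = E₂.anchor h (E₂.act h f b)),
    map h (E₁.act h f a) (E₂.act h f b) w' = E.act h f (map h a b w)
  map_bracket : ∀ {W : Opens X} (h : W ≤ U) (a a' : E₁.sec W h) (b b' : E₂.sec W h)
    (w : E₁.anchor h a = E₂.anchor h b) (w' : E₁.anchor h a' = E₂.anchor h b')
    (w'' : E₁.anchor h (E₁.bracket h a a') = E₂.anchor h (E₂.bracket h b b')),
    map h (E₁.bracket h a a') (E₂.bracket h b b') w''
      = E.bracket h (map h a b w) (map h a' b' w')
  anchor_map : ∀ {W : Opens X} (h : W ≤ U) (a : E₁.sec W h) (b : E₂.sec W h)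
    (w : E₁.anchor h a = E₂.anchor h b), E.anchor h (map h a b w) = E₁.anchor h a
  pairing_map : ∀ {W : Opens X} (h : W ≤ U) (a a' : E₁.sec W h) (b b' : E₂.sec W h)
    (w : E₁.anchor h a = E₂.anchor h b) (w' : E₁.anchor h a' = E₂.anchor h b'),
    E.pairing h (map h a b w) (map h a' b' w')
      = E₁.pairing h a a' + ε • E₂.pairing h b b'
  map_der : ∀ {W : Opens X} (h : W ≤ U) (f g : Fn O W)
    (w : E₁.anchor h (E₁.der h f) = E₂.anchor h (E₂.der h g)),
    map h (E₁.der h f) (E₂.der h g) w = E.der h f + ε • E.der h g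
  surj : ∀ {W : Opens X} (h : W ≤ U) (e : E.sec W h), ∀ p ∈ W,
    ∃ (V : Opens X) (i : V ≤ W) (_ : p ∈ V) (a : E₁.sec V (i.trans h))
      (b : E₂.sec V (i.trans h)) (w : E₁.anchor (i.trans h) a = E₂.anchor (i.trans h) b),
      map (i.trans h) a b w = E.res h i e
  ker : ∀ {W : Opens X} (h : W ≤ U) (a : E₁.sec W h) (b : E₂.sec W h)
    (w : E₁.anchor h a = E₂.anchor h b),
    map h a b w = 0 ↔ ∃ α : Form O 1 W, a = E₁.inc h α ∧ b = -(ε • E₂.inc h α)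

/-- `-E`: the same sheaf with the same `O`-action, bracket and anchor,
and with the opposite pairing and `∂`. -/
def neg (E : Algebroid O U) : Algebroid O U where
  toSheafOn := E.toSheafOn
  act := E.act
  bracket := E.bracket
  anchor := E.anchor
  pairing h := -E.pairing h
  der h := -E.der h
  inc h := -E.inc h
  res_act := E.res_act
  res_bracket := E.res_bracket
  res_anchor := E.res_anchor
  res_pairing h i e e' := by simp [E.res_pairing]
  res_der h i f := by simp [E.res_der]
  res_inc h i α := by simp [E.res_inc]

theorem IsCourant.neg {E : Algebroid O U} (hE : E.IsCourant) : E.neg.IsCourant where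
  one_act := hE.one_act
  act_act := hE.act_act
  jacobi := hE.jacobi
  anchor_act := hE.anchor_act
  anchor_bracket := hE.anchor_bracket
  pairing_symm {W} h (q q' : E.sec W h) := by
    change -(E.pairing h q q') = -(E.pairing h q' q)
    rw [hE.pairing_symm]
  pairing_act {W} h f (q q' : E.sec W h) := by
    change -(E.pairing h (E.act h f q) q') = f * -(E.pairing h q q')
    rw [hE.pairing_act, mul_neg]
  der_mul h f g := by
    change -(E.der h (f * g)) = E.act h f (-(E.der h g)) + E.act h g (-(E.der h f))
    rw [hE.der_mul, map_neg, map_neg, neg_add]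
  inc_act h f α := by
    change -(E.inc h (f • α)) = E.act h f (-(E.inc h α))
    rw [hE.inc_act, map_neg]
  inc_d h f := by
    change -(E.inc h (Form.d f)) = -(E.der h f)
    rw [hE.inc_d]
  anchor_der h f := by
    change E.anchor h (-(E.der h f)) = 0
    rw [map_neg, hE.anchor_der, neg_zero]
  bracket_act := hE.bracket_act
  pairing_invariant {W} h (q q₁ q₂ : E.sec W h) := by
    change -(E.pairing h (E.bracket h q q₁) q₂) + -(E.pairing h q₁ (E.bracket h q q₂))
      = (E.anchor h q).app (-(E.pairing h q₁ q₂))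
    rw [map_neg, ← hE.pairing_invariant, neg_add]
  bracket_der {W} h (q : E.sec W h) f := by
    change E.bracket h q (-(E.der h f)) = -(E.der h ((E.anchor h q).app f))
    rw [map_neg, hE.bracket_der]
  pairing_der {W} h (q : E.sec W h) f := by
    change -(E.pairing h q (-(E.der h f))) = (E.anchor h q).app f
    rw [map_neg, neg_neg, hE.pairing_der]
  bracket_symm {W} h (q q' : E.sec W h) := by
    change E.bracket h q q' + E.bracket h q' q = -(E.der h (-(E.pairing h q q')))
    rw [map_neg, neg_neg, hE.bracket_symm]

theorem IsExact.neg {E : Algebroid O U} (hE : E.IsExact) : E.neg.IsExact where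
  surj := hE.surj
  ker {W} h e := by
    refine (hE.ker h e).trans ?_
    have key : ∀ (V : Opens X) (i : V ≤ W),
        (Set.range fun fg : Fn O V × Fn O V =>
          E.act (i.trans h) fg.1 (E.der (i.trans h) fg.2))
        = (Set.range fun fg : Fn O V × Fn O V =>
          E.act (i.trans h) fg.1 (-(E.der (i.trans h) fg.2))) := by
      intro V i
      ext x
      constructor
      · rintro ⟨⟨f, g⟩, rfl⟩
        exact ⟨(f, -g), by simp⟩
      · rintro ⟨⟨f, g⟩, rfl⟩
        exact ⟨(f, -g), by simp⟩
    constructor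
    · intro H p hp
      obtain ⟨V, i, hV, hm⟩ := H p hp
      refine ⟨V, i, hV, ?_⟩
      rw [key V i] at hm
      exact hm
    · intro H p hp
      obtain ⟨V, i, hV, hm⟩ := H p hp
      refine ⟨V, i, hV, ?_⟩
      rw [key V i]
      exact hm

/-- Morphisms `E → E'` are also morphisms `-E → -E'`. -/
def Hom.neg {E E' : Algebroid O U} (φ : Hom E E') : Hom E.neg E'.neg where
  app := φ.app
  app_res := φ.app_res
  app_act := φ.app_act
  app_bracket := φ.app_bracket
  anchor_app := φ.anchor_app
  pairing_app h a b := congrArg (- ·) (φ.pairing_app h a b)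
  app_der h f := (map_neg (φ.app h) _).trans (congrArg (- ·) (φ.app_der h f))

end Algebroid

/-! ### The stacks of exact Courant algebroids, exact vertex algebroids, Courant extensions -/

variable (O : StructureSheaf X)

/-- Exact Courant algebroids on `U`: the objects of `ECA(U)`. -/
structure ECAObj (U : Opens X) where
  alg : Algebroid O U
  courant : alg.IsCourant
  exact : alg.IsExact

/-- Exact vertex algebroids on `U`: the objects of `EVA(U)`. -/
structure EVAObj (U : Opens X) where
  alg : Algebroid O U
  vertex : alg.IsVertex
  exact : alg.IsExact

instance (U : Opens X) : Category (ECAObj O U) where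
  Hom V V' := Algebroid.Hom V.alg V'.alg
  id V := Algebroid.Hom.id V.alg
  comp φ ψ := Algebroid.Hom.comp φ ψ

instance (U : Opens X) : Category (EVAObj O U) where
  Hom V V' := Algebroid.Hom V.alg V'.alg
  id V := Algebroid.Hom.id V.alg
  comp φ ψ := Algebroid.Hom.comp φ ψ

variable {O}

theorem Algebroid.IsCourant.restrict {U U' : Opens X} {E : Algebroid O U} (hE : E.IsCourant)
    (i : U' ≤ U) : (E.restrict i).IsCourant where
  one_act h := hE.one_act (h.trans i)
  act_act h := hE.act_act (h.trans i)
  jacobi h := hE.jacobi (h.trans i)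
  anchor_act h := hE.anchor_act (h.trans i)
  anchor_bracket h := hE.anchor_bracket (h.trans i)
  pairing_symm h := hE.pairing_symm (h.trans i)
  pairing_act h := hE.pairing_act (h.trans i)
  der_mul h := hE.der_mul (h.trans i)
  inc_act h := hE.inc_act (h.trans i)
  inc_d h := hE.inc_d (h.trans i)
  anchor_der h := hE.anchor_der (h.trans i)
  bracket_act h := hE.bracket_act (h.trans i)
  pairing_invariant h := hE.pairing_invariant (h.trans i)
  bracket_der h := hE.bracket_der (h.trans i)
  pairing_der h := hE.pairing_der (h.trans i)
  bracket_symm h := hE.bracket_symm (h.trans i)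

theorem Algebroid.IsVertex.restrict {U U' : Opens X} {E : Algebroid O U} (hE : E.IsVertex)
    (i : U' ≤ U) : (E.restrict i).IsVertex where
  one_act h := hE.one_act (h.trans i)
  jacobi h := hE.jacobi (h.trans i)
  anchor_bracket h := hE.anchor_bracket (h.trans i)
  pairing_symm h := hE.pairing_symm (h.trans i)
  anchor_der h := hE.anchor_der (h.trans i)
  act_act h := hE.act_act (h.trans i)
  bracket_act h := hE.bracket_act (h.trans i)
  bracket_symm h := hE.bracket_symm (h.trans i)
  anchor_act h := hE.anchor_act (h.trans i)
  pairing_act h := hE.pairing_act (h.trans i)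
  pairing_invariant h := hE.pairing_invariant (h.trans i)
  der_mul h := hE.der_mul (h.trans i)
  bracket_der h := hE.bracket_der (h.trans i)
  pairing_der h := hE.pairing_der (h.trans i)
  inc_act h := hE.inc_act (h.trans i)
  inc_d h := hE.inc_d (h.trans i)

theorem Algebroid.IsExact.restrict {U U' : Opens X} {E : Algebroid O U} (hE : E.IsExact)
    (i : U' ≤ U) : (E.restrict i).IsExact where
  surj h ξ p hp := by
    obtain ⟨V, j, hV, hpV, e, he⟩ := hE.surj (h.trans i) ξ p hp
    exact ⟨V, j, j.trans h, hpV, e, he⟩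
  ker h e := hE.ker (h.trans i) e

/-- Restriction of exact Courant algebroids. -/
def ECAObj.restrict {U U' : Opens X} (i : U' ≤ U) : ECAObj O U ⥤ ECAObj O U' where
  obj Q := ⟨Q.alg.restrict i, Q.courant.restrict i, Q.exact.restrict i⟩
  map φ := Algebroid.Hom.restrict φ i

/-- Restriction of exact vertex algebroids. -/
def EVAObj.restrict {U U' : Opens X} (i : U' ≤ U) : EVAObj O U ⥤ EVAObj O U' where
  obj V := ⟨V.alg.restrict i, V.vertex.restrict i, V.exact.restrict i⟩
  map φ := Algebroid.Hom.restrict φ i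

/-- `Q ↦ -Q` on exact Courant algebroids. -/
def ECAObj.neg (U : Opens X) : ECAObj O U ⥤ ECAObj O U where
  obj Q := ⟨Q.alg.neg, Q.courant.neg, Q.exact.neg⟩
  map φ := Algebroid.Hom.neg φ

variable (O) in
/-- The stack `EVA` of exact vertex algebroids on `X`. -/
def EVA : Pseudofunctor (LocallyDiscrete (Opens X)ᵒᵖ) Cat.{u, u + 1} :=
  Functor.toPseudofunctor' (I := (Opens X)ᵒᵖ) (B := Cat.{u, u + 1})
    { obj := fun U => Cat.of (EVAObj O U.unop)
      map := fun i => (EVAObj.restrict (leOfHom i.unop)).toCatHom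
      map_id := fun _ => rfl
      map_comp := fun _ _ => rfl }

/-- A map of sheaves `p : E → A|_U` which induces an isomorphism of Lie algebroids
`E / Ω_E ≅ A|_U`. -/
structure Projection (A : LieAlgebroid O) {U : Opens X} (E : Algebroid O U) where
  app : ∀ {W : Opens X} (h : W ≤ U), E.sec W h →ₗ[ℂ] A.Sec W
  app_res : ∀ {W V : Opens X} (h : W ≤ U) (i : V ≤ W) (e : E.sec W h),
    app (i.trans h) (E.res h i e) = A.res le_top i (app h e)
  app_act : ∀ {W : Opens X} (h : W ≤ U) (f : Fn O W) (e : E.sec W h),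
    app h (E.act h f e) = A.act W f (app h e)
  app_bracket : ∀ {W : Opens X} (h : W ≤ U) (a b : E.sec W h),
    app h (E.bracket h a b) = A.bracket W (app h a) (app h b)
  anchor_app : ∀ {W : Opens X} (h : W ≤ U) (e : E.sec W h),
    A.anchor W (app h e) = E.anchor h e
  surj : ∀ {W : Opens X} (_ : W ≤ U) (a : A.Sec W), ∀ p ∈ W,
    ∃ (V : Opens X) (i : V ≤ W) (hV : V ≤ U) (_ : p ∈ V) (e : E.sec V hV),
      app hV e = A.res le_top i a
  ker : ∀ {W : Opens X} (h : W ≤ U) (e : E.sec W h), app h e = 0 ↔ E.IsOmega h e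

namespace Projection

variable {A : LieAlgebroid O} {U : Opens X} {E : Algebroid O U}

/-- Restriction to a smaller open subset. -/
def restrict (p : Projection A E) {U' : Opens X} (i : U' ≤ U) : Projection A (E.restrict i) where
  app h := p.app (h.trans i)
  app_res h := p.app_res (h.trans i)
  app_act h := p.app_act (h.trans i)
  app_bracket h := p.app_bracket (h.trans i)
  anchor_app h := p.anchor_app (h.trans i)
  surj h a x hx := by
    obtain ⟨V, j, hV, hpV, e, he⟩ := p.surj (h.trans i) a x hx
    exact ⟨V, j, j.trans h, hpV, e, he⟩
  ker h e := p.ker (h.trans i) e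

/-- The pairing on `𝔤(A|_U)` induced by the pairing on the extension `E` is `P`. -/
def Induces (p : Projection A E) (P : InvariantPairing A) : Prop :=
  ∀ {W : Opens X} (h : W ≤ U) (e e' : E.sec W h) (x x' : A.isotropy W),
    p.app h e = x → p.app h e' = x' → E.pairing h e e' = P.val W x x'

end Projection

/-- A vertex extension of the Lie algebroid `A` (on the whole of `X`). -/
structure VertexExtension (A : LieAlgebroid O) where
  alg : Algebroid O (⊤ : Opens X)
  vertex : alg.IsVertex
  proj : Projection A alg

/-- Courant extensions of `A|_U` which induce the pairing `P` on `𝔤(A|_U)`: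
the objects of `CEXT(A)_P(U)`. -/
structure CEXTObj (A : LieAlgebroid O) (P : InvariantPairing A) (U : Opens X) where
  alg : Algebroid O U
  courant : alg.IsCourant
  proj : Projection A alg
  induces : proj.Induces P

section CEXT

variable {A : LieAlgebroid O} {P : InvariantPairing A}

/-- Morphisms of Courant extensions of `A`. -/
@[ext]
structure CEXTObj.Hom {U : Opens X} (C C' : CEXTObj A P U) where
  hom : Algebroid.Hom C.alg C'.alg
  proj_hom : ∀ {W : Opens X} (h : W ≤ U) (e : C.alg.sec W h),
    C'.proj.app h (hom.app h e) = C.proj.app h e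

instance (U : Opens X) : Category (CEXTObj A P U) where
  Hom C C' := CEXTObj.Hom C C'
  id C := ⟨Algebroid.Hom.id C.alg, fun _ _ => rfl⟩
  comp φ ψ := ⟨Algebroid.Hom.comp φ.hom ψ.hom,
    fun h e => (ψ.proj_hom h _).trans (φ.proj_hom h e)⟩

/-- Restriction of Courant extensions. -/
def CEXTObj.restrict {U U' : Opens X} (i : U' ≤ U) : CEXTObj A P U ⥤ CEXTObj A P U' where
  obj C := ⟨C.alg.restrict i, C.courant.restrict i, C.proj.restrict i,
    fun h e e' x x' => C.induces (h.trans i) e e' x x'⟩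
  map φ := ⟨φ.hom.restrict i, fun h e => φ.proj_hom (h.trans i) e⟩

variable (A P) in
/-- The stack `CEXT(A)_P` on `X`. -/
def CEXT : Pseudofunctor (LocallyDiscrete (Opens X)ᵒᵖ) Cat.{u, u + 1} :=
  Functor.toPseudofunctor' (I := (Opens X)ᵒᵖ) (B := Cat.{u, u + 1})
    { obj := fun U => Cat.of (CEXTObj A P U.unop)
      map := fun i => (CEXTObj.restrict (leOfHom i.unop)).toCatHom
      map_id := fun _ => rfl
      map_comp := fun _ _ => rfl }

end CEXT

/-! ### The actions of `ECA` -/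

variable (O) in
/-- The action `(Q, V) ↦ Q + V` of `ECA` on `EVA`, with the canonical maps
`Q ×_T V → Q + V`, `(q, v) ↦ σ(q, v)`. -/
structure EVAAction where
  act : ∀ U : Opens X, ECAObj O U × EVAObj O U ⥤ EVAObj O U
  σ : ∀ {U : Opens X} (Q : ECAObj O U) (V : EVAObj O U),
    Algebroid.Combination 1 Q.alg V.alg ((act U).obj (Q, V)).alg
  σ_natural : ∀ {U : Opens X} {Q Q' : ECAObj O U} {V V' : EVAObj O U} (φ : Q ⟶ Q') (ψ : V ⟶ V')
    {W : Opens X} (h : W ≤ U) (q : Q.alg.sec W h) (v : V.alg.sec W h)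
    (w : Q.alg.anchor h q = V.alg.anchor h v)
    (w' : Q'.alg.anchor h (Algebroid.Hom.app φ h q) = V'.alg.anchor h (Algebroid.Hom.app ψ h v)),
    Algebroid.Hom.app ((act U).map (X := (Q, V)) (Y := (Q', V')) (Prod.mkHom φ ψ)) h
        ((σ Q V).map h q v w)
      = (σ Q' V').map h (Algebroid.Hom.app φ h q) (Algebroid.Hom.app ψ h v) w'
  resIso : ∀ {U U' : Opens X} (i : U' ≤ U) (Q : ECAObj O U) (V : EVAObj O U),
    (EVAObj.restrict i).obj ((act U).obj (Q, V))
      ≅ (act U').obj ((ECAObj.restrict i).obj Q, (EVAObj.restrict i).obj V)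
  resIso_σ : ∀ {U U' : Opens X} (i : U' ≤ U) (Q : ECAObj O U) (V : EVAObj O U)
    {W : Opens X} (h : W ≤ U') (q : Q.alg.sec W (h.trans i)) (v : V.alg.sec W (h.trans i))
    (w : Q.alg.anchor (h.trans i) q = V.alg.anchor (h.trans i) v),
    Algebroid.Hom.app (resIso i Q V).hom h ((σ Q V).map (h.trans i) q v w)
      = (σ ((ECAObj.restrict i).obj Q) ((EVAObj.restrict i).obj V)).map h q v w

/-- The action `(Q, C) ↦ Q + C` of `ECA` on `CEXT(A)_P`, with the canonical maps
`Q ×_T C → Q + C`, `(q, c) ↦ σ(q, c)`, over `A`. -/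
structure CEXTAction (A : LieAlgebroid O) (P : InvariantPairing A) where
  act : ∀ U : Opens X, ECAObj O U × CEXTObj A P U ⥤ CEXTObj A P U
  σ : ∀ {U : Opens X} (Q : ECAObj O U) (C : CEXTObj A P U),
    Algebroid.Combination 1 Q.alg C.alg ((act U).obj (Q, C)).alg
  σ_proj : ∀ {U : Opens X} (Q : ECAObj O U) (C : CEXTObj A P U)
    {W : Opens X} (h : W ≤ U) (q : Q.alg.sec W h) (c : C.alg.sec W h)
    (w : Q.alg.anchor h q = C.alg.anchor h c),
    ((act U).obj (Q, C)).proj.app h ((σ Q C).map h q c w) = C.proj.app h c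
  σ_natural : ∀ {U : Opens X} {Q Q' : ECAObj O U} {C C' : CEXTObj A P U}
    (φ : Q ⟶ Q') (ψ : C ⟶ C')
    {W : Opens X} (h : W ≤ U) (q : Q.alg.sec W h) (c : C.alg.sec W h)
    (w : Q.alg.anchor h q = C.alg.anchor h c)
    (w' : Q'.alg.anchor h (Algebroid.Hom.app φ h q)
      = C'.alg.anchor h ((CEXTObj.Hom.hom ψ).app h c)),
    (CEXTObj.Hom.hom ((act U).map (X := (Q, C)) (Y := (Q', C')) (Prod.mkHom φ ψ))).app h
        ((σ Q C).map h q c w)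
      = (σ Q' C').map h (Algebroid.Hom.app φ h q) ((CEXTObj.Hom.hom ψ).app h c) w'
  resIso : ∀ {U U' : Opens X} (i : U' ≤ U) (Q : ECAObj O U) (C : CEXTObj A P U),
    (CEXTObj.restrict i).obj ((act U).obj (Q, C))
      ≅ (act U').obj ((ECAObj.restrict i).obj Q, (CEXTObj.restrict i).obj C)
  resIso_σ : ∀ {U U' : Opens X} (i : U' ≤ U) (Q : ECAObj O U) (C : CEXTObj A P U)
    {W : Opens X} (h : W ≤ U') (q : Q.alg.sec W (h.trans i)) (c : C.alg.sec W (h.trans i))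
    (w : Q.alg.anchor (h.trans i) q = C.alg.anchor (h.trans i) c),
    (CEXTObj.Hom.hom (resIso i Q C).hom).app h ((σ Q C).map (h.trans i) q c w)
      = (σ ((ECAObj.restrict i).obj Q) ((CEXTObj.restrict i).obj C)).map h q c w

/-! ### The functor `V ↦ Â - V` -/

/-- The functor on sections over `U` of a morphism of stacks `EVA → CEXT(A)_P`. -/
def functorOn {A : LieAlgebroid O} {P : InvariantPairing A}
    (F : Pseudofunctor.StrongTrans (EVA O) (CEXT A P)) (U : Opens X) :
    EVAObj O U ⥤ CEXTObj A P U :=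
  (F.app ⟨op U⟩).toFunctor

/-- The compatibility with restriction of a morphism of stacks `EVA → CEXT(A)_P`. -/
def resIsoOf {A : LieAlgebroid O} {P : InvariantPairing A}
    (F : Pseudofunctor.StrongTrans (EVA O) (CEXT A P)) {U U' : Opens X} (i : U' ≤ U)
    (V : EVAObj O U) :
    (functorOn F U').obj ((EVAObj.restrict i).obj V)
      ⟶ (CEXTObj.restrict i).obj ((functorOn F U).obj V) :=
  (F.naturality (Quiver.Hom.toLoc (homOfLE i).op)).hom.toNatTrans.app V

/-- A morphism of stacks `EVA → CEXT(A)_P` of the form `V ↦ Â - V`: its value on `V` is the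
difference of `Â|_U` and `V`, by means of canonical maps
`δ : Â ×_T V → Â - V`, which are compatible with the projections to `A`, natural in `V`, and
compatible with restriction to open subsets. -/
structure DifferenceFunctor {A : LieAlgebroid O} (Ahat : VertexExtension A)
    (P : InvariantPairing A) where
  functor : Pseudofunctor.StrongTrans (EVA O) (CEXT A P)
  δ : ∀ {U : Opens X} (V : EVAObj O U),
    Algebroid.Combination (-1) (Ahat.alg.restrict (le_top : U ≤ ⊤)) V.alg
      ((functorOn functor U).obj V).alg
  δ_proj : ∀ {U : Opens X} (V : EVAObj O U) {W : Opens X} (h : W ≤ U)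
    (a : Ahat.alg.sec W le_top) (v : V.alg.sec W h)
    (w : Ahat.alg.anchor le_top a = V.alg.anchor h v),
    ((functorOn functor U).obj V).proj.app h ((δ V).map h a v w) = Ahat.proj.app le_top a
  δ_natural : ∀ {U : Opens X} {V V' : EVAObj O U} (ψ : V ⟶ V') {W : Opens X} (h : W ≤ U)
    (a : Ahat.alg.sec W le_top) (v : V.alg.sec W h)
    (w : Ahat.alg.anchor le_top a = V.alg.anchor h v)
    (w' : Ahat.alg.anchor le_top a = V'.alg.anchor h (Algebroid.Hom.app ψ h v)),
    (CEXTObj.Hom.hom ((functorOn functor U).map ψ)).app h ((δ V).map h a v w)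
      = (δ V').map h a (Algebroid.Hom.app ψ h v) w'
  δ_res : ∀ {U U' : Opens X} (i : U' ≤ U) (V : EVAObj O U) {W : Opens X} (h : W ≤ U')
    (a : Ahat.alg.sec W le_top) (v : V.alg.sec W (h.trans i))
    (w : Ahat.alg.anchor le_top a = V.alg.anchor (h.trans i) v),
    (CEXTObj.Hom.hom (resIsoOf functor i V)).app h
        ((δ ((EVAObj.restrict i).obj V)).map h a v w)
      = (δ V).map (h.trans i) a v w

namespace DifferenceFunctor

variable {A : LieAlgebroid O} {Ahat : VertexExtension A} {P : InvariantPairing A}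

/-- The functor anti-commutes with the given actions of `ECA`: there are isomorphisms
`Â - (Q + V) ≅ (-Q) + (Â - V)`, natural in `Q` and `V`, given by
`(a, (q, v)) ↦ (q, (a, v))` (as `(a, (q, v))` generate the source, this determines them and makes
them compatible with restriction and with the associativity of the actions). -/
def AntiCommutes (F : DifferenceFunctor Ahat P) (actE : EVAAction O) (actC : CEXTAction A P) :
    Prop :=
  ∀ U : Opens X,
    ∃ θ : actE.act U ⋙ functorOn F.functor U
        ≅ (ECAObj.neg U).prod (functorOn F.functor U) ⋙ actC.act U,
      ∀ (Q : ECAObj O U) (V : EVAObj O U) {W : Opens X} (h : W ≤ U)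
        (a : Ahat.alg.sec W le_top) (q : Q.alg.sec W h) (v : V.alg.sec W h)
        (w₁ : Q.alg.anchor h q = V.alg.anchor h v)
        (w₂ : Ahat.alg.anchor le_top a
          = ((actE.act U).obj (Q, V)).alg.anchor h ((actE.σ Q V).map h q v w₁))
        (w₃ : Ahat.alg.anchor le_top a = V.alg.anchor h v)
        (w₄ : ((ECAObj.neg U).obj Q).alg.anchor h q
          = ((functorOn F.functor U).obj V).alg.anchor h ((F.δ V).map h a v w₃)),
        (CEXTObj.Hom.hom (θ.hom.app (Q, V))).app h
            ((F.δ ((actE.act U).obj (Q, V))).map h a ((actE.σ Q V).map h q v w₁) w₂)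
          = (actC.σ ((ECAObj.neg U).obj Q) ((functorOn F.functor U).obj V)).map h q
              ((F.δ V).map h a v w₃) w₄

end DifferenceFunctor

theorem Form.add_on {p : ℕ} {W V : Opens X} (ω ω' : Form O p W) (h : V ≤ W)
    (v : Fin p → VF O V) : (ω + ω').on h v = ω.on h v + ω'.on h v := rfl

theorem Form.smul_on {p : ℕ} {W V : Opens X} (a : ℂ) (ω : Form O p W) (h : V ≤ W)
    (v : Fin p → VF O V) : (a • ω).on h v = a • ω.on h v := rfl

/-! ### The cohomology group `H²(X; Ω² → Ω^{3,cl})` -/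

/-- An open cover of `X` of the form `(U_x)_{x ∈ X}` with `x ∈ U_x`.  Such covers are cofinal among
all open covers. -/
structure PointedCover (X : TopCat.{u}) where
  nhd : X → Opens X
  mem : ∀ x, x ∈ nhd x

/-- `c ≤ c'` if `c'` refines `c` pointwise. -/
instance : Preorder (PointedCover X) where
  le c c' := ∀ x, c'.nhd x ≤ c.nhd x
  le_refl _ _ := le_rfl
  le_trans _ _ _ h h' x := (h' x).trans (h x)

/-- Čech cochains of total degree two of the complex `Ω² → Ω³`, with `Ω²` in degree zero:
pairs `(B, H)` of `B_{xyz} ∈ Ω²(U_x ∩ U_y ∩ U_z)` and `H_{xy} ∈ Ω³(U_x ∩ U_y)`. -/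
abbrev Cochain (O : StructureSheaf X) (c : PointedCover X) : Type u :=
  (∀ x y z, Form O 2 (c.nhd x ⊓ c.nhd y ⊓ c.nhd z)) × (∀ x y, Form O 3 (c.nhd x ⊓ c.nhd y))

/-- Cocycles: `δB = 0`, `dB = δH`, `dH = 0`. -/
def cocycles (O : StructureSheaf X) (c : PointedCover X) : Submodule ℂ (Cochain O c) where
  carrier := {s |
    (∀ (x y z t : X) (V : Opens X) (hx : V ≤ c.nhd x) (hy : V ≤ c.nhd y) (hz : V ≤ c.nhd z)
      (ht : V ≤ c.nhd t) (ξ : Fin 2 → VF O V),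
      (s.1 y z t).on (le_inf (le_inf hy hz) ht) ξ - (s.1 x z t).on (le_inf (le_inf hx hz) ht) ξ
        + (s.1 x y t).on (le_inf (le_inf hx hy) ht) ξ
        - (s.1 x y z).on (le_inf (le_inf hx hy) hz) ξ = 0) ∧
    (∀ (x y z : X) (V : Opens X) (hx : V ≤ c.nhd x) (hy : V ≤ c.nhd y) (hz : V ≤ c.nhd z)
      (ξ η ζ : VF O V),
      (s.1 x y z).d₂ (le_inf (le_inf hx hy) hz) ξ η ζ
        = (s.2 y z).on (le_inf hy hz) ![ξ, η, ζ] - (s.2 x z).on (le_inf hx hz) ![ξ, η, ζ]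
          + (s.2 x y).on (le_inf hx hy) ![ξ, η, ζ]) ∧
    (∀ x y : X, (s.2 x y).IsClosed)}
  add_mem' := by
    rintro s s' ⟨h₁, h₂, h₃⟩ ⟨h₁', h₂', h₃'⟩
    refine ⟨fun x y z t V hx hy hz ht ξ => ?_, fun x y z V hx hy hz ξ η ζ => ?_,
      fun x y => (h₃ x y).add (h₃' x y)⟩
    · have e := h₁ x y z t V hx hy hz ht ξ
      have e' := h₁' x y z t V hx hy hz ht ξ
      simp only [Prod.fst_add, Pi.add_apply, Form.add_on]
      linear_combination e + e'
    · have e := h₂ x y z V hx hy hz ξ η ζ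
      have e' := h₂' x y z V hx hy hz ξ η ζ
      refine (Form.d₂_add (s.1 x y z) (s'.1 x y z) _ ξ η ζ).trans ?_
      simp only [Prod.snd_add, Pi.add_apply, Form.add_on]
      linear_combination e + e'
  zero_mem' := by
    refine ⟨fun x y z t V hx hy hz ht ξ => ?_, fun x y z V hx hy hz ξ η ζ => ?_,
      fun x y => Form.IsClosed.zero⟩
    · change (0 : Fn O V) - 0 + 0 - 0 = 0
      simp
    · refine (Form.d₂_zero _ ξ η ζ).trans ?_
      change (0 : Fn O V) = 0 - 0 + 0
      simp
  smul_mem' := by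
    rintro a s ⟨h₁, h₂, h₃⟩
    refine ⟨fun x y z t V hx hy hz ht ξ => ?_, fun x y z V hx hy hz ξ η ζ => ?_,
      fun x y => (h₃ x y).smul a⟩
    · have e := h₁ x y z t V hx hy hz ht ξ
      simp only [Prod.smul_fst, Pi.smul_apply, Form.smul_on]
      rw [← smul_sub, ← smul_add, ← smul_sub, e, smul_zero]
    · have e := h₂ x y z V hx hy hz ξ η ζ
      refine (Form.d₂_smul a (s.1 x y z) _ ξ η ζ).trans ?_
      simp only [Prod.smul_snd, Pi.smul_apply, Form.smul_on]
      rw [e, ← smul_sub, ← smul_add]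

/-- Coboundaries: `B = δβ`, `H = dβ + δη` for some `β_{xy} ∈ Ω²(U_x ∩ U_y)` and closed
`η_x ∈ Ω³(U_x)`. -/
def coboundaries (O : StructureSheaf X) (c : PointedCover X) : Submodule ℂ (Cochain O c) where
  carrier := {s | ∃ (β : ∀ x y, Form O 2 (c.nhd x ⊓ c.nhd y)) (η : ∀ x, Form O 3 (c.nhd x)),
    (∀ x, (η x).IsClosed) ∧
    (∀ (x y z : X) (V : Opens X) (hx : V ≤ c.nhd x) (hy : V ≤ c.nhd y) (hz : V ≤ c.nhd z)
      (ξ : Fin 2 → VF O V),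
      (s.1 x y z).on (le_inf (le_inf hx hy) hz) ξ
        = (β y z).on (le_inf hy hz) ξ - (β x z).on (le_inf hx hz) ξ
          + (β x y).on (le_inf hx hy) ξ) ∧
    (∀ (x y : X) (V : Opens X) (hx : V ≤ c.nhd x) (hy : V ≤ c.nhd y) (ξ₀ ξ₁ ξ₂ : VF O V),
      (s.2 x y).on (le_inf hx hy) ![ξ₀, ξ₁, ξ₂]
        = (β x y).d₂ (le_inf hx hy) ξ₀ ξ₁ ξ₂
          + ((η y).on hy ![ξ₀, ξ₁, ξ₂] - (η x).on hx ![ξ₀, ξ₁, ξ₂]))}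
  add_mem' := by
    rintro s s' ⟨β, η, h₁, h₂, h₃⟩ ⟨β', η', h₁', h₂', h₃'⟩
    refine ⟨fun x y => β x y + β' x y, fun x => η x + η' x, fun x => (h₁ x).add (h₁' x),
      fun x y z V hx hy hz ξ => ?_, fun x y V hx hy ξ₀ ξ₁ ξ₂ => ?_⟩
    · have e := h₂ x y z V hx hy hz ξ
      have e' := h₂' x y z V hx hy hz ξ
      simp only [Prod.fst_add, Pi.add_apply, Form.add_on]
      linear_combination e + e'
    · have e := h₃ x y V hx hy ξ₀ ξ₁ ξ₂
      have e' := h₃' x y V hx hy ξ₀ ξ₁ ξ₂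
      rw [Form.d₂_add]
      simp only [Prod.snd_add, Pi.add_apply, Form.add_on]
      linear_combination e + e'
  zero_mem' := by
    refine ⟨fun x y => 0, fun x => 0, fun x => Form.IsClosed.zero,
      fun x y z V hx hy hz ξ => ?_, fun x y V hx hy ξ₀ ξ₁ ξ₂ => ?_⟩
    · change (0 : Fn O V) = 0 - 0 + 0
      simp
    · rw [Form.d₂_zero]
      change (0 : Fn O V) = 0 + (0 - 0)
      simp
  smul_mem' := by
    rintro a s ⟨β, η, h₁, h₂, h₃⟩
    refine ⟨fun x y => a • β x y, fun x => a • η x, fun x => (h₁ x).smul a,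
      fun x y z V hx hy hz ξ => ?_, fun x y V hx hy ξ₀ ξ₁ ξ₂ => ?_⟩
    · simp only [Prod.smul_fst, Pi.smul_apply, Form.smul_on]
      rw [h₂ x y z V hx hy hz ξ, ← smul_sub, ← smul_add]
    · rw [Form.d₂_smul]
      simp only [Prod.smul_snd, Pi.smul_apply, Form.smul_on]
      rw [h₃ x y V hx hy ξ₀ ξ₁ ξ₂, ← smul_sub, ← smul_add]

/-- The second Čech hypercohomology group of the cover `c` with values in `Ω² → Ω^{3,cl}`. -/
abbrev CoverH2 (O : StructureSheaf X) (c : PointedCover X) : Type u :=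
  ↥(cocycles O c) ⧸ (coboundaries O c).comap (cocycles O c).subtype

/-- Restriction of cochains to a refinement. -/
def Cochain.refine (O : StructureSheaf X) {c c' : PointedCover X} (r : c ≤ c') :
    Cochain O c →ₗ[ℂ] Cochain O c' where
  toFun s := (fun x y z => Form.res (inf_le_inf (inf_le_inf (r x) (r y)) (r z)) (s.1 x y z),
    fun x y => Form.res (inf_le_inf (r x) (r y)) (s.2 x y))
  map_add' _ _ := rfl
  map_smul' _ _ := rfl

theorem cocycles_refine (O : StructureSheaf X) {c c' : PointedCover X} (r : c ≤ c')
    (s : Cochain O c) (hs : s ∈ cocycles O c) : Cochain.refine O r s ∈ cocycles O c' :=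
  ⟨fun x y z t V hx hy hz ht ξ =>
      hs.1 x y z t V (hx.trans (r x)) (hy.trans (r y)) (hz.trans (r z)) (ht.trans (r t)) ξ,
    fun x y z V hx hy hz ξ η ζ =>
      hs.2.1 x y z V (hx.trans (r x)) (hy.trans (r y)) (hz.trans (r z)) ξ η ζ,
    fun x y V h => hs.2.2 x y V (h.trans (inf_le_inf (r x) (r y)))⟩

theorem coboundaries_refine (O : StructureSheaf X) {c c' : PointedCover X} (r : c ≤ c')
    (s : Cochain O c) (hs : s ∈ coboundaries O c) : Cochain.refine O r s ∈ coboundaries O c' := by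
  obtain ⟨β, η, h₁, h₂, h₃⟩ := hs
  exact ⟨fun x y => Form.res (inf_le_inf (r x) (r y)) (β x y), fun x => Form.res (r x) (η x),
    fun x V h => h₁ x V (h.trans (r x)),
    fun x y z V hx hy hz ξ => h₂ x y z V (hx.trans (r x)) (hy.trans (r y)) (hz.trans (r z)) ξ,
    fun x y V hx hy => h₃ x y V (hx.trans (r x)) (hy.trans (r y))⟩

/-- The map induced in cohomology by a refinement. -/
def CoverH2.refine (O : StructureSheaf X) (c c' : PointedCover X) (r : c ≤ c') :
    CoverH2 O c →ₗ[ℂ] CoverH2 O c' :=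
  Submodule.mapQ _ _
    ((Cochain.refine O r).restrict (fun s hs => cocycles_refine O r s hs))
    (fun s hs => coboundaries_refine O r s.1 hs)

open Classical in
/-- `H²(X; Ω² → Ω^{3,cl})`: the direct limit over open covers of the Čech hypercohomology. -/
abbrev H2 (O : StructureSheaf X) : Type u :=
  Module.DirectLimit (CoverH2 O) (CoverH2.refine O)

open Classical in
instance (O : StructureSheaf X) : AddCommGroup (H2 O) :=
  Module.DirectLimit.addCommGroup (CoverH2 O) (CoverH2.refine O)

open Classical in
/-- The class of a Čech cocycle in `H²(X; Ω² → Ω^{3,cl})`. -/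
def H2.mk (O : StructureSheaf X) {c : PointedCover X} (s : cocycles O c) : H2 O :=
  Module.DirectLimit.of ℂ (PointedCover X) (CoverH2 O) (CoverH2.refine O) c (Submodule.Quotient.mk s)

/-! ### The classes of the `ECA`-torsors -/

/-- A connection on `E`: an `O`-linear isotropic section of the anchor map. -/
structure Connection {U : Opens X} (E : Algebroid O U) where
  map : ∀ {W : Opens X} (h : W ≤ U), VF O W →ₗ[ℂ] E.sec W h
  map_res : ∀ {W V : Opens X} (h : W ≤ U) (i : V ≤ W) (ξ : VF O W),
    map (i.trans h) (VF.res i ξ) = E.res h i (map h ξ)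
  map_smul : ∀ {W : Opens X} (h : W ≤ U) (f : Fn O W) (ξ : VF O W),
    map h (f • ξ) = E.act h f (map h ξ)
  anchor_map : ∀ {W : Opens X} (h : W ≤ U) (ξ : VF O W), E.anchor h (map h ξ) = ξ
  isotropic : ∀ {W : Opens X} (h : W ≤ U) (ξ η : VF O W), E.pairing h (map h ξ) (map h η) = 0

/-- The curvature of the connection is the 3-form `H`:
`[∇ξ, ∇η] - ∇[ξ, η] = i(ι_η ι_ξ H)`. -/
def Connection.HasCurvature {U : Opens X} {E : Algebroid O U} (N : Connection E)
    (H : Form O 3 U) : Prop :=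
  ∀ {W : Opens X} (h : W ≤ U) (ξ η : VF O W),
    E.bracket h (N.map h ξ) (N.map h η) - N.map h ⁅ξ, η⁆
      = E.inc h (Form.contract η (Form.contract ξ (Form.res h H)))

/-- Data which compute the class of an `ECA`-torsor from local objects `E_x` on `U_x`:
exact Courant algebroids `Q_{xy}` on `U_x ∩ U_y`, isomorphisms `Q_{xy} + E_y ≅ E_x`,
written as maps `φ_{xy} : Q_{xy} ×_T E_y → E_x`, connections `∇_{xy}` on `Q_{xy}`, and the
cocycle `(B, H)`, where `H_{xy}` is the curvature of `∇_{xy}`, and `B_{xyz}` is the difference of the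
connections `∇_{xy} + ∇_{yz}` and `∇_{xz}` under the isomorphism `Q_{xy} + Q_{yz} ≅ Q_{xz}` given
by the two isomorphisms of `Q_{xy} + Q_{yz} + E_z` and `Q_{xz} + E_z` with `E_x`. -/
structure TorsorCocycle (c : PointedCover X) (E : ∀ x, Algebroid O (c.nhd x)) where
  Q : ∀ x y, ECAObj O (c.nhd x ⊓ c.nhd y)
  φ : ∀ x y, Algebroid.Combination 1 (Q x y).alg
    ((E y).restrict (inf_le_right : c.nhd x ⊓ c.nhd y ≤ c.nhd y))
    ((E x).restrict (inf_le_left : c.nhd x ⊓ c.nhd y ≤ c.nhd x))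
  conn : ∀ x y, Connection (Q x y).alg
  cocycle : cocycles O c
  curvature : ∀ x y, (conn x y).HasCurvature (cocycle.1.2 x y)
  difference : ∀ (x y z : X) (W : Opens X) (hx : W ≤ c.nhd x) (hy : W ≤ c.nhd y)
    (hz : W ≤ c.nhd z) (ξ : VF O W) (e : (E z).sec W hz)
    (w₁ : (Q y z).alg.anchor (le_inf hy hz) ((conn y z).map (le_inf hy hz) ξ)
      = (E z).anchor hz e)
    (w₂ : (Q x y).alg.anchor (le_inf hx hy) ((conn x y).map (le_inf hx hy) ξ)
      = (E y).anchor hy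
          ((φ y z).map (le_inf hy hz) ((conn y z).map (le_inf hy hz) ξ) e w₁))
    (w₃ : (Q x z).alg.anchor (le_inf hx hz) ((conn x z).map (le_inf hx hz) ξ)
      = (E z).anchor hz e),
    (φ x y).map (le_inf hx hy) ((conn x y).map (le_inf hx hy) ξ)
        ((φ y z).map (le_inf hy hz) ((conn y z).map (le_inf hy hz) ξ) e w₁) w₂
      = (show (E x).sec W hx from
          (φ x z).map (le_inf hx hz) ((conn x z).map (le_inf hx hz) ξ) e w₃)
        + (E x).inc hx (Form.contract ξ
            (Form.res (le_inf (le_inf hx hy) hz) (cocycle.1.1 x y z)))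

variable (O) in
/-- `κ` is a class of the `ECA`-torsor `EVA` in `H²(X; Ω² → Ω^{3,cl})`. -/
def IsClassOfEVA (κ : H2 O) : Prop :=
  ∃ (c : PointedCover X) (V : ∀ x, EVAObj O (c.nhd x))
    (D : TorsorCocycle c (fun x => (V x).alg)), H2.mk O D.cocycle = κ

/-- `κ` is a class of the `ECA`-torsor `CEXT(A)_P` in `H²(X; Ω² → Ω^{3,cl})`. -/
def IsClassOfCEXT (A : LieAlgebroid O) (P : InvariantPairing A) (κ : H2 O) : Prop :=
  ∃ (c : PointedCover X) (C : ∀ x, CEXTObj A P (c.nhd x))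
    (D : TorsorCocycle c (fun x => (C x).alg)),
    (∀ (x y : X) (W : Opens X) (hx : W ≤ c.nhd x) (hy : W ≤ c.nhd y)
      (q : (D.Q x y).alg.sec W (le_inf hx hy)) (e : (C y).alg.sec W hy)
      (w : (D.Q x y).alg.anchor (le_inf hx hy) q = (C y).alg.anchor hy e),
      (C x).proj.app hx ((D.φ x y).map (le_inf hx hy) q e w) = (C y).proj.app hy e) ∧
    H2.mk O D.cocycle = κ

end Algebroids

end

/-!
The proof rests on one observation: on each extension `E` of a Lie algebroid `A`, whether Courant or
vertex, the subsheaf `Ω_E` is a copy of `Ω¹` on which all operations are forced.  A Courant and a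
vertex algebroid differ only by the corrections to the associativity of the action and to the
linearity of the pairing, which in a vertex algebroid have the coefficient `1` and in a Courant
algebroid the coefficient `0`.  `Algebroid.IsLevel k` (written `IsAlg k`) is the common
generalization with coefficient `k`; sums and differences of algebroids of levels `k₁` and `k₂` have
the level `k₁ + ε k₂` (`combine_isAlg`).  This one construction gives `Q + V`, `Q + C` and `Â - V`.

A map out of a sum or a difference is a relation which is locally the graph of a map, so that all
functors, natural transformations and their coherences are checked on pairs `(a, v)`.  The functor
`V ↦ Â - V` is an equivalence (`DifferenceFunctor.isEquivalence`): an inverse on objects sends `C` to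
`Â - C`, formed over `A`, which is an exact vertex algebroid; morphisms lift because two sections of an
extension with the same image in `A` differ by a unique 1-form.

For the classes, a torsor cocycle is replaced by isometries: a connection on `Q_{xy}` turns
`Q_{xy} + E_y ≅ E_x` into a map `e ↦ (∇(π e), e)` from `E_y` to `E_x` which preserves all of the
structure except the bracket, whose failure is the curvature 3-form (`Isometry.HasCurvature`), and two
such maps differ by a 2-form (`Isometry.Differ`).  Conversely an isometry of curvature `H` is a
torsor datum for `T ⊕ Ω¹` twisted by `H` (`Isometry.combination`).  Isometries compose, curvatures add
up, and changing an isometry by `β` changes the curvature by `dβ`; together with the local existence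
of isometries between extensions which induce the same pairing on `𝔤(A)`, where an arbitrary lift of
coordinate fields is made isotropic by a 1-form, this shows that the class does not depend on any
choice, not even on the extensions (`IsometryCocycle.class_eq`).  Local objects exist: a coordinate
system gives a vertex algebroid structure on `T ⊕ Ω¹` (`Coordinates.vertexAlgebroid`), in which the
pairing is corrected by `-tr(Jξ Jη)`, with `J` the Jacobian matrix.  Finally an isometry `τ` from `V_y`
to `V_x` of curvature `H` induces the isometry `(a, v) ↦ (a, τ v)` from `Â - V_y` to `Â - V_x`, of
curvature `-H`, so that the two classes are opposite (`IsometryCocycle.exists_combine`).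
-/

open CategoryTheory TopologicalSpace Opposite

noncomputable section

namespace Algebroids

variable {X : TopCat.{u}}

section

/-! ### Gluing -/

/-- Homomorphisms `ℂ[t] → O(W)` are the same as functions on `W`: `polyHom f` sends `t` to `f`.
The `ULift` puts `ℂ[t]` in the universe of `O`. -/
def polyHom {R : Type u} [CommRing R] [Algebra ℂ R] (f : R) :
    ULift.{u} (Polynomial ℂ) →ₐ[ℂ] R :=
  (Polynomial.aeval f).comp ULift.algEquiv.toAlgHom

theorem polyHom_X {R : Type u} [CommRing R] [Algebra ℂ R] (f : R) :
    polyHom f ⟨Polynomial.X⟩ = f := by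
  simp [polyHom]

theorem polyHom_ext {R : Type u} [CommRing R] [Algebra ℂ R]
    {φ ψ : ULift.{u} (Polynomial ℂ) →ₐ[ℂ] R} (h : φ ⟨Polynomial.X⟩ = ψ ⟨Polynomial.X⟩) :
    φ = ψ := by
  have : φ.comp ULift.algEquiv.symm.toAlgHom = ψ.comp ULift.algEquiv.symm.toAlgHom :=
    Polynomial.algHom_ext h
  ext x
  exact DFunLike.congr_fun this x.down

/-- The sheaf condition for functions.  As `Hom(ℂ[t], O(W)) = O(W)`, it is the sheaf condition of
the presheaf of sets `W ↦ Hom(ℂ[t], O(W))`. -/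
theorem Fn.existsUnique_gluing (O : StructureSheaf X) {ι : Type u} (V : ι → Opens X)
    (s : ∀ a, Fn O (V a))
    (hs : ∀ a b, resFn O (inf_le_left : V a ⊓ V b ≤ V a) (s a)
      = resFn O (inf_le_right : V a ⊓ V b ≤ V b) (s b)) :
    ∃! t : Fn O (iSup V), ∀ a, resFn O (le_iSup V a) t = s a := by
  let E : CommAlgCat.{u} ℂ := CommAlgCat.of ℂ (ULift.{u} (Polynomial ℂ))
  have hP : TopCat.Presheaf.IsSheaf (X := X) (O.presheaf ⋙ coyoneda.obj (op E)) :=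
    (isSheaf_iff_isSheaf_of_type _ _).2 (O.property E)
  have glue := TopCat.Presheaf.IsSheaf.isSheafUniqueGluing_types (U := V) hP
    (fun a => CommAlgCat.ofHom (polyHom (s a))) (by
      intro a b
      apply CommAlgCat.hom_ext
      apply polyHom_ext
      change resFn O _ (polyHom (s a) _) = resFn O _ (polyHom (s b) _)
      rw [polyHom_X, polyHom_X]
      exact hs a b)
  obtain ⟨t, ht, hu⟩ := glue
  have key : ∀ (t : E ⟶ O.presheaf.obj (op (iSup V))),
      TopCat.Presheaf.IsGluing (O.presheaf ⋙ coyoneda.obj (op E)) V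
        (fun a => CommAlgCat.ofHom (polyHom (s a))) t ↔
      ∀ a, resFn O (le_iSup V a) (t.hom ⟨Polynomial.X⟩) = s a := by
    intro t
    refine forall_congr' fun a => ⟨fun h => ?_, fun h => ?_⟩
    · have := congrArg (fun φ : E ⟶ O.presheaf.obj (op (V a)) => φ.hom ⟨Polynomial.X⟩) h
      exact this.trans (polyHom_X (s a))
    · apply CommAlgCat.hom_ext
      apply polyHom_ext
      exact (h).trans (polyHom_X (s a)).symm
  refine ⟨t.hom ⟨Polynomial.X⟩, (key t).1 ht, fun f hf => ?_⟩
  have := hu (CommAlgCat.ofHom (polyHom f)) ((key _).2 fun a => by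
    refine Eq.trans ?_ (hf a)
    exact congrArg _ (polyHom_X f))
  rw [← this]
  exact (polyHom_X f).symm

/-- The structure sheaf as a sheaf of vector spaces on `U`. -/
def fnSheaf (O : StructureSheaf X) (U : Opens X) : SheafOn U where
  sec W _ := Fn O W
  res _ i := (resFn O i).toLinearMap
  res_self _ f := resFn_self O f
  res_res _ i j f := resFn_resFn O i j f
  existsUnique_gluing V _ s hs := Fn.existsUnique_gluing O V s hs

namespace SheafOn

variable {U : Opens X} (G : SheafOn U)

theorem eq_of_local {W : Opens X} (h : W ≤ U) {s t : G.sec W h}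
    (H : ∀ p ∈ W, ∃ (V : Opens X) (i : V ≤ W) (_ : p ∈ V), G.res h i s = G.res h i t) :
    s = t := by
  choose V i hp e using H
  have key : ∀ {W' : Opens X} (h' : W' ≤ U) (_ : W' = iSup fun p : W => V p.1 p.2)
      (s t : G.sec W' h') (_ : ∀ (p : W) (j : V p.1 p.2 ≤ W'), G.res h' j s = G.res h' j t),
      s = t := by
    rintro _ h' rfl s t e
    obtain ⟨r, -, hr⟩ := G.existsUnique_gluing (fun p : W => V p.1 p.2) h'
      (fun p => G.res h' (le_iSup (fun p : W => V p.1 p.2) p) s)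
      (fun a b => by rw [G.res_res, G.res_res])
    rw [hr s fun _ => rfl, hr t fun p => (e p _).symm]
  refine key h (le_antisymm ?_ ?_) s t fun p j => e p.1 p.2
  · exact fun p hpW => Opens.mem_iSup.2 ⟨⟨p, hpW⟩, hp p hpW⟩
  · exact iSup_le fun p => i p.1 p.2

/-- A condition which has locally a solution, and whose solutions are unique and stable under
restriction, has a solution. -/
theorem exists_of_local {W : Opens X} (h : W ≤ U)
    (R : ∀ (V : Opens X) (i : V ≤ W), G.sec V (i.trans h) → Prop)
    (Rres : ∀ (V : Opens X) (i : V ≤ W) (y : G.sec V (i.trans h)), R V i y →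
      ∀ (V' : Opens X) (j : V' ≤ V), R V' (j.trans i) (G.res (i.trans h) j y))
    (Runiq : ∀ (V : Opens X) (i : V ≤ W) (y y' : G.sec V (i.trans h)), R V i y → R V i y' → y = y')
    (Rex : ∀ p ∈ W, ∃ (V : Opens X) (i : V ≤ W) (_ : p ∈ V) (y : G.sec V (i.trans h)), R V i y) :
    ∃ t : G.sec W h, ∀ (V : Opens X) (i : V ≤ W) (y : G.sec V (i.trans h)), R V i y →
      G.res h i t = y := by
  choose V i hp y hy using Rex
  have hW : W = iSup fun p : W => V p.1 p.2 := by
    refine le_antisymm ?_ (iSup_le fun p => i p.1 p.2)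
    exact fun p hpW => Opens.mem_iSup.2 ⟨⟨p, hpW⟩, hp p hpW⟩
  have key : ∀ {W' : Opens X} (h' : W' ≤ U) (_ : W' = iSup fun p : W => V p.1 p.2),
      ∃ t : G.sec W' h', ∀ (p : W) (j : V p.1 p.2 ≤ W'), G.res h' j t = y p.1 p.2 := by
    rintro _ h' rfl
    obtain ⟨t, ht, -⟩ := G.existsUnique_gluing (fun p : W => V p.1 p.2) h'
      (fun p => y p.1 p.2)
      (fun a b => Runiq _ (inf_le_left.trans (i a.1 a.2)) _ _
        (Rres _ _ _ (hy a.1 a.2) _ inf_le_left) (Rres _ _ _ (hy b.1 b.2) _ inf_le_right))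
    exact ⟨t, fun p j => ht p⟩
  obtain ⟨t, ht⟩ := key h hW
  refine ⟨t, fun V' i' y' hy' => ?_⟩
  refine G.eq_of_local _ fun p hpV => ?_
  refine ⟨V' ⊓ V p (i' hpV), inf_le_left, ⟨hpV, hp _ _⟩, ?_⟩
  rw [G.res_res]
  have e := ht ⟨p, i' hpV⟩ (i _ _)
  have e' := congrArg (G.res _ (inf_le_right : V' ⊓ V p (i' hpV) ≤ _)) e
  rw [G.res_res] at e'
  exact Runiq _ (inf_le_left.trans i') _ _ (e' ▸ Rres _ _ _ (hy _ _) _ inf_le_right)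
    (Rres _ _ _ hy' _ inf_le_left)

end SheafOn

theorem Fn.eq_of_local (O : StructureSheaf X) {W : Opens X} {f g : Fn O W}
    (H : ∀ p ∈ W, ∃ (V : Opens X) (i : V ≤ W) (_ : p ∈ V), resFn O i f = resFn O i g) : f = g :=
  (fnSheaf O W).eq_of_local le_rfl H

end

section

theorem Fn.eq_of_cover (O : StructureSheaf X) {ι : Type u} {V : ι → Opens X} {W : Opens X}
    (h : W ≤ iSup V) {f g : Fn O W}
    (H : ∀ (V' : Opens X) (i : V' ≤ W) (a : ι) (_ : V' ≤ V a), resFn O i f = resFn O i g) :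
    f = g := by
  refine Fn.eq_of_local O fun p hp => ?_
  obtain ⟨a, ha⟩ := Opens.mem_iSup.1 (h hp)
  exact ⟨W ⊓ V a, inf_le_left, ⟨hp, ha⟩, H _ _ a inf_le_right⟩

/-- Functions given locally with respect to a cover `V` of `W`, in a way compatible with
restriction and independent of the members of the cover. -/
theorem Fn.exists_of_cover (O : StructureSheaf X) {ι : Type u} {V : ι → Opens X} {W : Opens X}
    (h : W ≤ iSup V) (s : ∀ (V' : Opens X) (_ : V' ≤ W) (a : ι) (_ : V' ≤ V a), Fn O V')
    (hres : ∀ (V' : Opens X) (i : V' ≤ W) (a : ι) (k : V' ≤ V a) (V'' : Opens X) (j : V'' ≤ V'),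
      resFn O j (s V' i a k) = s V'' (j.trans i) a (j.trans k))
    (hs : ∀ (V' : Opens X) (i : V' ≤ W) (a b : ι) (k : V' ≤ V a) (l : V' ≤ V b),
      s V' i a k = s V' i b l) :
    ∃ t : Fn O W, ∀ (V' : Opens X) (i : V' ≤ W) (a : ι) (k : V' ≤ V a),
      resFn O i t = s V' i a k := by
  obtain ⟨t, ht⟩ := (fnSheaf O W).exists_of_local le_rfl
    (fun V' i y => ∃ (a : ι) (k : V' ≤ V a), y = s V' i a k)
    (by
      rintro V' i y ⟨a, k, rfl⟩ V'' j
      exact ⟨a, j.trans k, hres V' i a k V'' j⟩)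
    (by
      rintro V' i y y' ⟨a, k, rfl⟩ ⟨b, l, rfl⟩
      exact hs V' i a b k l)
    (by
      intro p hp
      obtain ⟨a, ha⟩ := Opens.mem_iSup.1 (h hp)
      exact ⟨W ⊓ V a, inf_le_left, ⟨hp, ha⟩, _, a, inf_le_right, rfl⟩)
  exact ⟨t, fun V' i a k => ht V' i _ ⟨a, k, rfl⟩⟩

namespace VF

variable {O : StructureSheaf X}

theorem smul_on {W V : Opens X} (f : Fn O W) (ξ : VF O W) (h : V ≤ W) (g : Fn O V) :
    (f • ξ).on h g = resFn O h f * ξ.on h g := rfl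

theorem res_smul {W V : Opens X} (i : V ≤ W) (f : Fn O W) (ξ : VF O W) :
    res i (f • ξ) = resFn O i f • res i ξ := ext' fun V' h g => by
  rw [smul_on, resFn_resFn]
  rfl

theorem existsUnique_gluing {ι : Type u} (V : ι → Opens X) (s : ∀ a, VF O (V a))
    (hs : ∀ a b, res (inf_le_left : V a ⊓ V b ≤ V a) (s a)
      = res (inf_le_right : V a ⊓ V b ≤ V b) (s b)) :
    ∃! t : VF O (iSup V), ∀ a, res (le_iSup V a) t = s a := by
  have compat : ∀ (V' : Opens X) (a b : ι) (k : V' ≤ V a) (l : V' ≤ V b),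
      (s a).on k = (s b).on l := fun V' a b k l =>
    congrArg (fun ξ : VF O (V a ⊓ V b) => ξ.on (le_inf k l)) (hs a b)
  have key : ∀ (W : Opens X) (h : W ≤ iSup V) (f : Fn O W), ∃ t : Fn O W,
      ∀ (V' : Opens X) (i : V' ≤ W) (a : ι) (k : V' ≤ V a),
        resFn O i t = (s a).on k (resFn O i f) := fun W h f =>
    Fn.exists_of_cover O h (fun V' i a k => (s a).on k (resFn O i f))
      (fun V' i a k V'' j => by rw [res_on, resFn_resFn])
      (fun V' i a b k l => by rw [compat V' a b k l])
  choose D hD using key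
  refine ⟨mk (fun W h => Derivation.mk'
      { toFun := D W h
        map_add' := fun f g => Fn.eq_of_cover O h fun V' i a k => by
          simp only [map_add, hD W h _ V' i a k]
        map_smul' := fun c f => Fn.eq_of_cover O h fun V' i a k => by
          simp only [map_smul, hD W h _ V' i a k, RingHom.id_apply, Derivation.map_smul] }
      (fun f g => Fn.eq_of_cover O h fun V' i a k => by
        simp [hD W h _ V' i a k])) ?_, fun a => ?_, fun t ht => ?_⟩
  · intro W h W' i f
    refine Fn.eq_of_cover O (i.trans h) fun V' j a k => ?_
    change resFn O j (resFn O i (D W h f)) = resFn O j (D W' _ _)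
    rw [resFn_resFn, hD W h f V' (j.trans i) a k, hD W' (i.trans h) _ V' j a k, resFn_resFn]
  · refine ext' fun W h f => ?_
    change D W _ f = _
    have := hD W (h.trans (le_iSup V a)) f W le_rfl a h
    rwa [resFn_self, resFn_self] at this
  · refine ext' fun W h f => Fn.eq_of_cover O h fun V' i a k => ?_
    change _ = resFn O i (D W h f)
    rw [hD W h f V' i a k, res_on, ← ht a]
    rfl

end VF

/-- The tangent sheaf as a sheaf of vector spaces on `U`. -/
def vfSheaf (O : StructureSheaf X) (U : Opens X) : SheafOn U where
  sec W _ := VF O W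
  res _ i := VF.res i
  res_self _ _ := rfl
  res_res _ _ _ _ := rfl
  existsUnique_gluing V _ s hs := VF.existsUnique_gluing V s hs

theorem VF.eq_of_local {O : StructureSheaf X} {W : Opens X} {f g : VF O W}
    (H : ∀ p ∈ W, ∃ (V : Opens X) (i : V ≤ W) (_ : p ∈ V), VF.res i f = VF.res i g) : f = g :=
  (vfSheaf O W).eq_of_local le_rfl H

namespace Form

variable {O : StructureSheaf X} {p : ℕ}

theorem ext' {W : Opens X} {α β : Form O p W}
    (h : ∀ (V : Opens X) (hV : V ≤ W) (ξ : Fin p → VF O V), α.on hV ξ = β.on hV ξ) : α = β :=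
  Subtype.ext (funext fun V => AlternatingMap.ext (h V.1 V.2))

theorem existsUnique_gluing {ι : Type u} (V : ι → Opens X) (s : ∀ a, Form O p (V a))
    (hs : ∀ a b, res (inf_le_left : V a ⊓ V b ≤ V a) (s a)
      = res (inf_le_right : V a ⊓ V b ≤ V b) (s b)) :
    ∃! t : Form O p (iSup V), ∀ a, res (le_iSup V a) t = s a := by
  have compat : ∀ (V' : Opens X) (a b : ι) (k : V' ≤ V a) (l : V' ≤ V b),
      (s a).on k = (s b).on l := fun V' a b k l =>
    congrArg (fun ξ : Form O p (V a ⊓ V b) => ξ.on (le_inf k l)) (hs a b)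
  have key : ∀ (W : Opens X) (h : W ≤ iSup V) (f : Fin p → VF O W), ∃ t : Fn O W,
      ∀ (V' : Opens X) (i : V' ≤ W) (a : ι) (k : V' ≤ V a),
        resFn O i t = (s a).on k (fun j => VF.res i (f j)) := fun W h f =>
    Fn.exists_of_cover O h (fun V' i a k => (s a).on k (fun j => VF.res i (f j)))
      (fun V' i a k V'' j => by rw [res_on]; rfl)
      (fun V' i a b k l => by rw [compat V' a b k l])
  choose D hD using key
  have upd : ∀ {W V' : Opens X} (i : V' ≤ W) [DecidableEq (Fin p)] (f : Fin p → VF O W)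
      (j : Fin p) (ξ : VF O W), (fun k => VF.res i (Function.update f j ξ k))
        = Function.update (fun k => VF.res i (f k)) j (VF.res i ξ) := by
    intro W V' i _ f j ξ
    funext k
    by_cases hk : k = j
    · subst hk; simp
    · simp [hk]
  refine ⟨mk (fun W h =>
    { toFun := D W h
      map_update_add' := fun f j ξ η => Fn.eq_of_cover O h fun V' i a k => by
        simp only [map_add, hD W h _ V' i a k, upd, AlternatingMap.map_update_add]
      map_update_smul' := fun f j c ξ => Fn.eq_of_cover O h fun V' i a k => by
        simp only [hD W h _ V' i a k, upd, smul_eq_mul, map_mul]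
        rw [← smul_eq_mul, ← AlternatingMap.map_update_smul, VF.res_smul]
      map_eq_zero_of_eq' := fun f j k e hjk => Fn.eq_of_cover O h fun V' i a l => by
        rw [hD W h _ V' i a l, map_zero]
        exact AlternatingMap.map_eq_zero_of_eq _ _ (by rw [e]) hjk }) ?_, fun a => ?_, fun t ht => ?_⟩
  · intro W h W' i f
    refine Fn.eq_of_cover O (i.trans h) fun V' j a k => ?_
    change resFn O j (resFn O i (D W h f)) = resFn O j (D W' _ _)
    rw [resFn_resFn, hD W h f V' (j.trans i) a k, hD W' (i.trans h) _ V' j a k]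
    rfl
  · refine ext' fun W h f => ?_
    change D W _ f = _
    have := hD W (h.trans (le_iSup V a)) f W le_rfl a h
    rwa [resFn_self] at this
  · refine ext' fun W h f => Fn.eq_of_cover O h fun V' i a k => ?_
    change _ = resFn O i (D W h f)
    rw [hD W h f V' i a k, res_on, ← ht a]
    rfl

end Form

/-- The sheaf of `p`-forms as a sheaf of vector spaces on `U`. -/
def formSheaf (O : StructureSheaf X) (p : ℕ) (U : Opens X) : SheafOn U where
  sec W _ := Form O p W
  res _ i := Form.res i
  res_self _ _ := rfl
  res_res _ _ _ _ := rfl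
  existsUnique_gluing V _ s hs := Form.existsUnique_gluing V s hs

theorem Form.exists_of_local {O : StructureSheaf X} {p : ℕ} {W : Opens X}
    (R : ∀ (V : Opens X) (_ : V ≤ W), Form O p V → Prop)
    (Rres : ∀ (V : Opens X) (i : V ≤ W) (y : Form O p V), R V i y →
      ∀ (V' : Opens X) (j : V' ≤ V), R V' (j.trans i) (Form.res j y))
    (Runiq : ∀ (V : Opens X) (i : V ≤ W) (y y' : Form O p V), R V i y → R V i y' → y = y')
    (Rex : ∀ x ∈ W, ∃ (V : Opens X) (i : V ≤ W) (_ : x ∈ V) (y : Form O p V), R V i y) :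
    ∃ t : Form O p W, ∀ (V : Opens X) (i : V ≤ W) (y : Form O p V), R V i y →
      Form.res i t = y :=
  (formSheaf O p W).exists_of_local le_rfl R Rres Runiq Rex

/-! ### Locally surjective maps of sheaves -/

namespace SheafOn

variable {U : Opens X}

/-- A locally surjective map of sheaves `F → Q`. -/
structure LocSurj (F Q : SheafOn U) where
  map : ∀ {W : Opens X} (h : W ≤ U), F.sec W h →ₗ[ℂ] Q.sec W h
  map_res : ∀ {W V : Opens X} (h : W ≤ U) (i : V ≤ W) (a : F.sec W h),
    map (i.trans h) (F.res h i a) = Q.res h i (map h a)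
  surj : ∀ {W : Opens X} (h : W ≤ U) (q : Q.sec W h), ∀ p ∈ W,
    ∃ (V : Opens X) (i : V ≤ W) (_ : p ∈ V) (a : F.sec V (i.trans h)),
      map (i.trans h) a = Q.res h i q

/-- The identity as a locally surjective map. -/
def LocSurj.refl (F : SheafOn U) : LocSurj F F where
  map _ := LinearMap.id
  map_res _ _ _ := rfl
  surj {W} h q _ hp := ⟨W, le_rfl, hp, q, (F.res_self h q).symm⟩

/-- A linear relation between two sheaves which is locally total and has unique values. -/
structure LinRel (F G : SheafOn U) where
  rel : ∀ {W : Opens X} (h : W ≤ U), F.sec W h → G.sec W h → Prop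
  res : ∀ {W V : Opens X} (h : W ≤ U) (i : V ≤ W) {x : F.sec W h} {y : G.sec W h},
    rel h x y → rel (i.trans h) (F.res h i x) (G.res h i y)
  add : ∀ {W : Opens X} (h : W ≤ U) {x x' : F.sec W h} {y y' : G.sec W h},
    rel h x y → rel h x' y' → rel h (x + x') (y + y')
  smul : ∀ {W : Opens X} (h : W ≤ U) (c : ℂ) {x : F.sec W h} {y : G.sec W h},
    rel h x y → rel h (c • x) (c • y)
  uniq : ∀ {W : Opens X} (h : W ≤ U) {y : G.sec W h}, rel h 0 y → y = 0
  total : ∀ {W : Opens X} (h : W ≤ U) (x : F.sec W h), ∀ p ∈ W,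
    ∃ (V : Opens X) (i : V ≤ W) (_ : p ∈ V) (y : G.sec V (i.trans h)),
      rel (i.trans h) (F.res h i x) y

namespace LinRel

variable {F G : SheafOn U} (R : LinRel F G)

theorem unique {W : Opens X} (h : W ≤ U) {x : F.sec W h} {y y' : G.sec W h}
    (r : R.rel h x y) (r' : R.rel h x y') : y = y' := by
  have := R.add h r (R.smul h (-1) r')
  rw [neg_one_smul, neg_one_smul, add_neg_cancel] at this
  exact add_neg_eq_zero.1 (R.uniq h this)

theorem exists_apply {W : Opens X} (h : W ≤ U) (x : F.sec W h) :
    ∃ t : G.sec W h, ∀ (V : Opens X) (i : V ≤ W) (y : G.sec V (i.trans h)),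
      R.rel (i.trans h) (F.res h i x) y → G.res h i t = y :=
  G.exists_of_local h (fun V i y => R.rel (i.trans h) (F.res h i x) y)
    (fun V i y r V' j => by
      have := R.res _ j r
      rwa [F.res_res] at this)
    (fun V i y y' r r' => R.unique _ r r') (R.total h x)

/-- To check an equation between the values of locally total relations, one may choose
values locally. -/
theorem apply_eq_of_rel {W : Opens X} (h : W ≤ U) {x : F.sec W h} {t y : G.sec W h}
    (ht : ∀ (V : Opens X) (i : V ≤ W) (y : G.sec V (i.trans h)),
      R.rel (i.trans h) (F.res h i x) y → G.res h i t = y) (r : R.rel h x y) : t = y := by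
  have := ht W le_rfl y (by rwa [F.res_self])
  rwa [G.res_self] at this

/-- The map of sheaves whose graph is locally the given relation. -/
def toFun {W : Opens X} (h : W ≤ U) : F.sec W h →ₗ[ℂ] G.sec W h where
  toFun x := (R.exists_apply h x).choose
  map_add' x x' := by
    refine G.eq_of_local h fun p hp => ?_
    obtain ⟨V, i, hpV, y, r⟩ := R.total h x p hp
    obtain ⟨V', j, hpV', y', r'⟩ := R.total (i.trans h) (F.res h i x') p hpV
    rw [F.res_res] at r'
    have r₁ := R.res _ j r
    rw [F.res_res] at r₁
    refine ⟨V', j.trans i, hpV', ?_⟩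
    have r₂ := R.add _ r₁ r'
    rw [← map_add] at r₂
    rw [map_add, (R.exists_apply h x).choose_spec _ _ _ r₁,
      (R.exists_apply h x').choose_spec _ _ _ r', (R.exists_apply h _).choose_spec _ _ _ r₂]
  map_smul' c x := by
    refine G.eq_of_local h fun p hp => ?_
    obtain ⟨V, i, hpV, y, r⟩ := R.total h x p hp
    refine ⟨V, i, hpV, ?_⟩
    have r₂ := R.smul _ c r
    rw [← map_smul] at r₂
    rw [RingHom.id_apply, map_smul, (R.exists_apply h x).choose_spec _ _ _ r,
      (R.exists_apply h _).choose_spec _ _ _ r₂]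

theorem toFun_eq {W : Opens X} (h : W ≤ U) {x : F.sec W h} {y : G.sec W h} (r : R.rel h x y) :
    R.toFun h x = y :=
  R.apply_eq_of_rel h (R.exists_apply h x).choose_spec r

theorem toFun_res {W V : Opens X} (h : W ≤ U) (i : V ≤ W) (x : F.sec W h) :
    R.toFun (i.trans h) (F.res h i x) = G.res h i (R.toFun h x) := by
  refine G.eq_of_local _ fun p hp => ?_
  obtain ⟨V', j, hpV, y, r⟩ := R.total (i.trans h) (F.res h i x) p hp
  refine ⟨V', j, hpV, ?_⟩
  have e := (R.exists_apply (i.trans h) (F.res h i x)).choose_spec _ _ _ r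
  rw [F.res_res] at r
  exact e.trans ((G.res_res _ _ _ _).trans ((R.exists_apply h x).choose_spec _ _ _ r)).symm

end LinRel

section lift

variable {F F' Q Q' G : SheafOn U}

/-- The relation which extends a map on `F` to a quotient `Q` of `F`. -/
def LocSurj.liftRel (π : LocSurj F Q) (f : ∀ {W : Opens X} (h : W ≤ U), F.sec W h →ₗ[ℂ] G.sec W h)
    (f_res : ∀ {W V : Opens X} (h : W ≤ U) (i : V ≤ W) (a : F.sec W h),
      f (i.trans h) (F.res h i a) = G.res h i (f h a))
    (f_ker : ∀ {W : Opens X} (h : W ≤ U) (a : F.sec W h), π.map h a = 0 → f h a = 0) :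
    LinRel Q G where
  rel h q g := ∃ a, π.map h a = q ∧ f h a = g
  res := by
    rintro W V h i _ _ ⟨a, rfl, rfl⟩
    exact ⟨F.res h i a, π.map_res h i a, f_res h i a⟩
  add := by
    rintro W h _ _ _ _ ⟨a, rfl, rfl⟩ ⟨b, rfl, rfl⟩
    exact ⟨a + b, map_add _ _ _, map_add _ _ _⟩
  smul := by
    rintro W h c _ _ ⟨a, rfl, rfl⟩
    exact ⟨c • a, map_smul _ _ _, map_smul _ _ _⟩
  uniq := by
    rintro W h _ ⟨a, h0, rfl⟩
    exact f_ker h a h0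
  total h q p hp := by
    obtain ⟨V, i, hpV, a, ha⟩ := π.surj h q p hp
    exact ⟨V, i, hpV, _, a, ha, rfl⟩

/-- The bilinear map `Q × Q' → G` induced by a bilinear map `F × F' → G`. -/
theorem LocSurj.exists_liftBil (π : LocSurj F Q) (π' : LocSurj F' Q')
    (f : ∀ {W : Opens X} (h : W ≤ U), F.sec W h →ₗ[ℂ] F'.sec W h →ₗ[ℂ] G.sec W h)
    (f_res : ∀ {W V : Opens X} (h : W ≤ U) (i : V ≤ W) (a : F.sec W h) (b : F'.sec W h),
      f (i.trans h) (F.res h i a) (F'.res h i b) = G.res h i (f h a b))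
    (f_ker : ∀ {W : Opens X} (h : W ≤ U) (a : F.sec W h) (b : F'.sec W h),
      π.map h a = 0 → f h a b = 0)
    (f_ker' : ∀ {W : Opens X} (h : W ≤ U) (a : F.sec W h) (b : F'.sec W h),
      π'.map h b = 0 → f h a b = 0) :
    ∃ g : ∀ {W : Opens X} (h : W ≤ U), Q.sec W h →ₗ[ℂ] Q'.sec W h →ₗ[ℂ] G.sec W h,
      (∀ {W V : Opens X} (h : W ≤ U) (i : V ≤ W) (a : Q.sec W h) (b : Q'.sec W h),
        G.res h i (g h a b) = g (i.trans h) (Q.res h i a) (Q'.res h i b)) ∧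
      ∀ {W : Opens X} (h : W ≤ U) (a : F.sec W h) (b : F'.sec W h),
        g h (π.map h a) (π'.map h b) = f h a b := by
  have ind : ∀ {W : Opens X} (h : W ≤ U) (a a' : F.sec W h) (b b' : F'.sec W h),
      π.map h a = π.map h a' → π'.map h b = π'.map h b' → f h a b = f h a' b' := by
    intro W h a a' b b' e e'
    have h₁ := f_ker h (a - a') b (by rw [map_sub, e, sub_self])
    have h₂ := f_ker' h a' (b - b') (by rw [map_sub, e', sub_self])
    rw [map_sub, LinearMap.sub_apply, sub_eq_zero] at h₁
    rw [map_sub, sub_eq_zero] at h₂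
    exact h₁.trans h₂
  have surj₂ : ∀ {W : Opens X} (h : W ≤ U) (q : Q.sec W h) (q' : Q'.sec W h), ∀ p ∈ W,
      ∃ (V : Opens X) (i : V ≤ W) (_ : p ∈ V) (a : F.sec V (i.trans h))
        (b : F'.sec V (i.trans h)), π.map _ a = Q.res h i q ∧ π'.map _ b = Q'.res h i q' := by
    intro W h q q' p hp
    obtain ⟨V, i, hpV, a, ha⟩ := π.surj h q p hp
    obtain ⟨V', j, hpV', b, hb⟩ := π'.surj (i.trans h) (Q'.res h i q') p hpV
    refine ⟨V', j.trans i, hpV', F.res _ j a, b, ?_, ?_⟩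
    · rw [← Q.res_res h i j, ← ha]
      exact π.map_res _ j a
    · rw [hb, Q'.res_res]
  have key : ∀ {W : Opens X} (h : W ≤ U) (q : Q.sec W h) (q' : Q'.sec W h),
      ∃ t : G.sec W h, ∀ (V : Opens X) (i : V ≤ W) (y : G.sec V (i.trans h)),
        (∃ a b, π.map (i.trans h) a = Q.res h i q ∧ π'.map (i.trans h) b = Q'.res h i q' ∧
          f (i.trans h) a b = y) → G.res h i t = y := by
    intro W h q q'
    refine G.exists_of_local h _ ?_ ?_ ?_
    · rintro V i _ ⟨a, b, ha, hb, rfl⟩ V' j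
      refine ⟨F.res _ j a, F'.res _ j b, ?_, ?_, f_res _ j a b⟩
      · rw [← Q.res_res h i j, ← ha]; exact π.map_res _ j a
      · rw [← Q'.res_res h i j, ← hb]; exact π'.map_res _ j b
    · rintro V i _ _ ⟨a, b, ha, hb, rfl⟩ ⟨a', b', ha', hb', rfl⟩
      exact ind _ _ _ _ _ (ha.trans ha'.symm) (hb.trans hb'.symm)
    · intro p hp
      obtain ⟨V, i, hpV, a, b, ha, hb⟩ := surj₂ h q q' p hp
      exact ⟨V, i, hpV, _, a, b, ha, hb, rfl⟩
  choose g hg using @key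
  have hgπ : ∀ {W : Opens X} (h : W ≤ U) (a : F.sec W h) (b : F'.sec W h),
      g h (π.map h a) (π'.map h b) = f h a b := by
    intro W h a b
    have := hg h (π.map h a) (π'.map h b) W le_rfl (f h a b)
      ⟨a, b, (Q.res_self _ _).symm, (Q'.res_self _ _).symm, rfl⟩
    rwa [G.res_self] at this
  have hgres : ∀ {W V : Opens X} (h : W ≤ U) (i : V ≤ W) (q : Q.sec W h) (q' : Q'.sec W h),
      G.res h i (g h q q') = g (i.trans h) (Q.res h i q) (Q'.res h i q') := by
    intro W V h i q q'
    refine G.eq_of_local _ fun p hp => ?_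
    obtain ⟨V', j, hpV, a, b, ha, hb⟩ := surj₂ (i.trans h) (Q.res h i q) (Q'.res h i q') p hp
    refine ⟨V', j, hpV, ?_⟩
    rw [G.res_res, hg _ _ _ V' j _ ⟨a, b, ha, hb, rfl⟩]
    rw [Q.res_res] at ha
    rw [Q'.res_res] at hb
    rw [hg _ _ _ V' (j.trans i) _ ⟨a, b, ha, hb, rfl⟩]
  -- bilinearity is checked locally, on representatives
  have hgl : ∀ {W : Opens X} (h : W ≤ U) (c : ℂ) (q₁ q₂ : Q.sec W h) (q' : Q'.sec W h),
      g h (c • q₁ + q₂) q' = c • g h q₁ q' + g h q₂ q' := by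
    intro W h c q₁ q₂ q'
    refine G.eq_of_local _ fun p hp => ?_
    obtain ⟨V, i, hpV, a, b, ha, hb⟩ := surj₂ h q₁ q' p hp
    obtain ⟨V', j, hpV', a', ha'⟩ := π.surj (i.trans h) (Q.res h i q₂) p hpV
    refine ⟨V', j.trans i, hpV', ?_⟩
    have e₁ : Q.res h (j.trans i) q₁ = π.map _ (F.res _ j a) := by
      rw [← Q.res_res h i j, ← ha]; exact (π.map_res _ j a).symm
    have e₂ : Q.res h (j.trans i) q₂ = π.map _ a' := by rw [ha', Q.res_res]
    have e₃ : Q'.res h (j.trans i) q' = π'.map _ (F'.res _ j b) := by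
      rw [← Q'.res_res h i j, ← hb]; exact (π'.map_res _ j b).symm
    rw [map_add, map_smul, hgres, hgres, hgres, map_add, map_smul, e₁, e₂, e₃, ← map_smul,
      ← map_add, hgπ, hgπ, hgπ]
    simp
  have hgr : ∀ {W : Opens X} (h : W ≤ U) (c : ℂ) (q : Q.sec W h) (q₁ q₂ : Q'.sec W h),
      g h q (c • q₁ + q₂) = c • g h q q₁ + g h q q₂ := by
    intro W h c q q₁ q₂
    refine G.eq_of_local _ fun p hp => ?_
    obtain ⟨V, i, hpV, a, b, ha, hb⟩ := surj₂ h q q₁ p hp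
    obtain ⟨V', j, hpV', a', ha'⟩ := π'.surj (i.trans h) (Q'.res h i q₂) p hpV
    refine ⟨V', j.trans i, hpV', ?_⟩
    have e₁ : Q'.res h (j.trans i) q₁ = π'.map _ (F'.res _ j b) := by
      rw [← Q'.res_res h i j, ← hb]; exact (π'.map_res _ j b).symm
    have e₂ : Q'.res h (j.trans i) q₂ = π'.map _ a' := by rw [ha', Q'.res_res]
    have e₃ : Q.res h (j.trans i) q = π.map _ (F.res _ j a) := by
      rw [← Q.res_res h i j, ← ha]; exact (π.map_res _ j a).symm
    rw [map_add, map_smul, hgres, hgres, hgres, map_add, map_smul, e₁, e₂, e₃, ← map_smul,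
      ← map_add, hgπ, hgπ, hgπ]
    simp
  have hz : ∀ {W : Opens X} (h : W ≤ U) (q : Q.sec W h) (q' : Q'.sec W h),
      g h 0 q' = 0 ∧ g h q 0 = 0 := by
    intro W h q q'
    have h₁ := hgl h 1 0 0 q'
    have h₂ := hgr h 1 q 0 0
    rw [one_smul, one_smul, add_zero] at h₁ h₂
    exact ⟨left_eq_add.1 h₁, left_eq_add.1 h₂⟩
  refine ⟨fun h => LinearMap.mk₂ ℂ (g h) (fun q₁ q₂ q' => ?_) (fun c q q' => ?_)
    (fun q q₁ q₂ => ?_) (fun c q q' => ?_), fun h i a b => hgres h i a b, fun h a b => hgπ h a b⟩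
  · simpa using hgl h 1 q₁ q₂ q'
  · simpa [(hz h q q').1] using hgl h c q 0 q'
  · simpa using hgr h 1 q q₁ q₂
  · simpa [(hz h q q').2] using hgr h c q q' 0

end lift

end SheafOn

end

section

/-! ### Calculus of vector fields and forms -/

variable {O : StructureSheaf X}

namespace VF

variable {W V : Opens X}

theorem add_on (ξ η : VF O W) (h : V ≤ W) (g : Fn O V) :
    (ξ + η).on h g = ξ.on h g + η.on h g := rfl

theorem csmul_on (c : ℂ) (ξ : VF O W) (h : V ≤ W) (g : Fn O V) :
    (c • ξ).on h g = c • ξ.on h g := rfl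

theorem bracket_on (ξ η : VF O W) (h : V ≤ W) (g : Fn O V) :
    ⁅ξ, η⁆.on h g = ξ.on h (η.on h g) - η.on h (ξ.on h g) :=
  Derivation.commutator_apply (D1 := ξ.on h) (D2 := η.on h) g

theorem bracket_app (ξ η : VF O W) (g : Fn O W) :
    ⁅ξ, η⁆.app g = ξ.app (η.app g) - η.app (ξ.app g) := bracket_on ξ η le_rfl g

@[simp] theorem add_app (ξ η : VF O W) (g : Fn O W) : (ξ + η).app g = ξ.app g + η.app g := rfl

@[simp] theorem neg_app (ξ : VF O W) (g : Fn O W) : (-ξ).app g = -ξ.app g := rfl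

@[simp] theorem zero_app (g : Fn O W) : (0 : VF O W).app g = 0 := rfl

@[simp] theorem smul_app (f : Fn O W) (ξ : VF O W) (g : Fn O W) :
    (f • ξ).app g = f * ξ.app g := by
  change resFn O le_rfl f * _ = _
  rw [resFn_self]
  rfl

theorem app_mul (ξ : VF O W) (f g : Fn O W) : ξ.app (f * g) = f * ξ.app g + g * ξ.app f := by
  rw [Derivation.leibniz]; rfl

theorem res_app (ξ : VF O W) (i : V ≤ W) (f : Fn O W) :
    resFn O i (ξ.app f) = (res i ξ).app (resFn O i f) := ξ.res_on le_rfl i f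

theorem ext_app {ξ η : VF O W}
    (h : ∀ (V : Opens X) (i : V ≤ W) (f : Fn O V), (res i ξ).app f = (res i η).app f) : ξ = η :=
  ext' h

theorem res_res {V' : Opens X} (i : V ≤ W) (j : V' ≤ V) (ξ : VF O W) :
    res j (res i ξ) = res (j.trans i) ξ := rfl

theorem res_bracket (i : V ≤ W) (ξ η : VF O W) : res i ⁅ξ, η⁆ = ⁅res i ξ, res i η⁆ := rfl

theorem bracket_skew (ξ η : VF O W) : ⁅η, ξ⁆ = -⁅ξ, η⁆ := ext_app fun V i f => by
  rw [map_neg, neg_app, res_bracket, res_bracket, bracket_app, bracket_app, neg_sub]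

@[simp] theorem bracket_add (ξ η ζ : VF O W) : ⁅ξ, η + ζ⁆ = ⁅ξ, η⁆ + ⁅ξ, ζ⁆ :=
  ext_app fun V i f => by
    simp only [map_add, add_app, res_bracket, bracket_app]
    ring

@[simp] theorem add_bracket (ξ η ζ : VF O W) : ⁅ξ + η, ζ⁆ = ⁅ξ, ζ⁆ + ⁅η, ζ⁆ :=
  ext_app fun V i f => by
    simp only [map_add, add_app, res_bracket, bracket_app]
    ring

theorem bracket_csmul (c : ℂ) (ξ η : VF O W) : ⁅ξ, c • η⁆ = c • ⁅ξ, η⁆ :=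
  ext' fun V h f => by
    simp only [bracket_on, csmul_on, Derivation.map_smul, smul_sub]

theorem csmul_bracket (c : ℂ) (ξ η : VF O W) : ⁅c • ξ, η⁆ = c • ⁅ξ, η⁆ := by
  rw [bracket_skew, bracket_csmul, bracket_skew, smul_neg, neg_neg]

@[simp] theorem bracket_zero (ξ : VF O W) : ⁅ξ, (0 : VF O W)⁆ = 0 := by
  simpa using bracket_csmul 0 ξ 0

@[simp] theorem zero_bracket (ξ : VF O W) : ⁅(0 : VF O W), ξ⁆ = 0 := by
  rw [bracket_skew, bracket_zero, neg_zero]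

theorem bracket_smul (ξ η : VF O W) (f : Fn O W) :
    ⁅ξ, f • η⁆ = ξ.app f • η + f • ⁅ξ, η⁆ := ext_app fun V i g => by
  simp only [map_add, add_app, res_bracket, bracket_app, res_smul, smul_app, app_mul, res_app]
  ring

theorem smul_bracket (ξ η : VF O W) (f : Fn O W) :
    ⁅f • ξ, η⁆ = f • ⁅ξ, η⁆ - η.app f • ξ := by
  rw [bracket_skew, bracket_smul, bracket_skew ξ η]
  module

theorem jacobi (ξ η ζ : VF O W) : ⁅ξ, ⁅η, ζ⁆⁆ = ⁅⁅ξ, η⁆, ζ⁆ + ⁅η, ⁅ξ, ζ⁆⁆ :=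
  ext_app fun V i g => by
    simp only [map_add, add_app, res_bracket, bracket_app, map_sub]
    ring

theorem bracket_self (ξ : VF O W) : ⁅ξ, ξ⁆ = 0 := ext_app fun V i f => by
  rw [res_bracket, bracket_app, sub_self]
  rfl

instance : IsScalarTower ℂ (Fn O W) (VF O W) where
  smul_assoc c f ξ := ext' fun V h g => by
    simp [smul_on, csmul_on, map_smul]

end VF

namespace Form

variable {W V : Opens X} {p : ℕ}

instance : Module (Fn O W) (Form O p W) where
  one_smul α := ext' fun V h ξ => by
    change resFn O h 1 * α.on h ξ = _
    simp
  mul_smul f g α := ext' fun V h ξ => by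
    change resFn O h (f * g) * α.on h ξ = resFn O h f * (resFn O h g * α.on h ξ)
    simp [mul_assoc]
  smul_zero f := ext' fun V h ξ => by
    change resFn O h f * 0 = 0
    simp
  smul_add f α β := ext' fun V h ξ => by
    change resFn O h f * (α.on h ξ + β.on h ξ) = resFn O h f * α.on h ξ + resFn O h f * β.on h ξ
    ring
  add_smul f g α := ext' fun V h ξ => by
    change resFn O h (f + g) * α.on h ξ = resFn O h f * α.on h ξ + resFn O h g * α.on h ξ
    rw [map_add]
    ring
  zero_smul α := ext' fun V h ξ => by
    change resFn O h 0 * α.on h ξ = 0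
    simp

theorem res_smul (i : V ≤ W) (f : Fn O W) (α : Form O p W) :
    res i (f • α) = resFn O i f • res i α := ext' fun V' h ξ => by
  change resFn O _ f * α.on _ ξ = resFn O h (resFn O i f) * α.on _ ξ
  rw [resFn_resFn]

instance : IsScalarTower ℂ (Fn O W) (Form O p W) where
  smul_assoc c f α := ext' fun V h ξ => by
    change resFn O h (c • f) * α.on h ξ = c • (resFn O h f * α.on h ξ)
    simp

theorem res_res {V' : Opens X} (i : V ≤ W) (j : V' ≤ V) (α : Form O p W) :
    res j (res i α) = res (j.trans i) α := rfl

/-! #### Forms of degree one -/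

/-- The value of a 1-form on a vector field. -/
def ev (α : Form O 1 W) (ξ : VF O W) : Fn O W := α.on le_rfl (fun _ => ξ)

theorem res_ev (i : V ≤ W) (α : Form O 1 W) (ξ : VF O W) :
    resFn O i (ev α ξ) = ev (res i α) (VF.res i ξ) := α.res_on le_rfl i _

theorem ext₁ {α β : Form O 1 W}
    (h : ∀ (V : Opens X) (i : V ≤ W) (ξ : VF O V), ev (res i α) ξ = ev (res i β) ξ) : α = β :=
  ext' fun V i ξ => by
    have : ξ = fun _ => ξ 0 := by
      funext k
      rw [Subsingleton.elim k 0]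
    rw [this]
    exact h V i (ξ 0)

@[simp] theorem ev_add (α : Form O 1 W) (ξ η : VF O W) : ev α (ξ + η) = ev α ξ + ev α η := by
  have := (α.on le_rfl).map_update_add (fun _ => ξ) 0 ξ η
  have e : ∀ ζ : VF O W, Function.update (fun _ : Fin 1 => ξ) 0 ζ = fun _ => ζ := by
    intro ζ; funext k; rw [Subsingleton.elim k 0]; simp
  rwa [e, e, e] at this

@[simp] theorem ev_smul (α : Form O 1 W) (f : Fn O W) (ξ : VF O W) :
    ev α (f • ξ) = f * ev α ξ := by
  have := (α.on le_rfl).map_update_smul (fun _ => ξ) 0 f ξ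
  have e : ∀ ζ : VF O W, Function.update (fun _ : Fin 1 => ξ) 0 ζ = fun _ => ζ := by
    intro ζ; funext k; rw [Subsingleton.elim k 0]; simp
  rwa [e, e] at this

@[simp] theorem ev_zero (α : Form O 1 W) : ev α 0 = 0 := by
  simpa using ev_smul α 0 0

@[simp] theorem ev_neg (α : Form O 1 W) (ξ : VF O W) : ev α (-ξ) = -ev α ξ := by
  simpa using ev_smul α (-1) ξ

@[simp] theorem ev_sub (α : Form O 1 W) (ξ η : VF O W) : ev α (ξ - η) = ev α ξ - ev α η := by
  rw [sub_eq_add_neg, ev_add, ev_neg, sub_eq_add_neg]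

@[simp] theorem ev_sum {ι : Type*} (s : Finset ι) (α : Form O 1 W) (ξ : ι → VF O W) :
    ev α (∑ k ∈ s, ξ k) = ∑ k ∈ s, ev α (ξ k) :=
  map_sum (AddMonoidHom.mk' (ev α) (ev_add α)) ξ s

@[simp] theorem add_ev (α β : Form O 1 W) (ξ : VF O W) : ev (α + β) ξ = ev α ξ + ev β ξ := rfl

@[simp] theorem neg_ev (α : Form O 1 W) (ξ : VF O W) : ev (-α) ξ = -ev α ξ := rfl

@[simp] theorem sub_ev (α β : Form O 1 W) (ξ : VF O W) : ev (α - β) ξ = ev α ξ - ev β ξ := rfl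

@[simp] theorem zero_ev (ξ : VF O W) : ev (0 : Form O 1 W) ξ = 0 := rfl

theorem csmul_ev (c : ℂ) (α : Form O 1 W) (ξ : VF O W) : ev (c • α) ξ = c • ev α ξ := rfl

@[simp] theorem sum_ev {ι : Type*} (s : Finset ι) (α : ι → Form O 1 W) (ξ : VF O W) :
    ev (∑ k ∈ s, α k) ξ = ∑ k ∈ s, ev (α k) ξ :=
  map_sum (AddMonoidHom.mk' (fun α => ev α ξ) fun α β => add_ev α β ξ) α s

@[simp] theorem smul_ev (f : Fn O W) (α : Form O 1 W) (ξ : VF O W) :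
    ev (f • α) ξ = f * ev α ξ := by
  change resFn O le_rfl f * _ = _
  rw [resFn_self]
  rfl

/-- A 1-form from a compatible family of linear maps. -/
def mk₁ (φ : ∀ V : Opens X, V ≤ W → VF O V →ₗ[Fn O V] Fn O V)
    (hφ : ∀ (V : Opens X) (h : V ≤ W) (V' : Opens X) (i : V' ≤ V) (ξ : VF O V),
      resFn O i (φ V h ξ) = φ V' (i.trans h) (VF.res i ξ)) : Form O 1 W :=
  mk (fun V h => AlternatingMap.ofSubsingleton (Fn O V) (VF O V) (Fn O V) (0 : Fin 1) (φ V h))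
    (fun V h V' i ξ => hφ V h V' i (ξ 0))

@[simp] theorem ev_d (f : Fn O W) (ξ : VF O W) : ev (d f) ξ = ξ.app f := by
  change ξ.app (resFn O le_rfl f) = _
  rw [resFn_self]

theorem res_d (i : V ≤ W) (f : Fn O W) : res i (d f) = d (resFn O i f) := ext₁ fun V' j ξ => by
  change ξ.app (resFn O _ f) = ξ.app (resFn O j (resFn O i f))
  rw [resFn_resFn]

theorem d_add (f g : Fn O W) : d (f + g) = d f + d g := ext₁ fun V i ξ => by
  simp [res_d]

theorem d_csmul (c : ℂ) (f : Fn O W) : d (c • f) = c • d f := ext₁ fun V i ξ => by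
  simp [res_d, csmul_ev]

/-- The de Rham differential of functions as a linear map. -/
def dₗ : Fn O W →ₗ[ℂ] Form O 1 W where
  toFun := d
  map_add' := d_add
  map_smul' := d_csmul

@[simp] theorem d_sub (f g : Fn O W) : d (f - g) = d f - d g := map_sub (dₗ (O := O) (W := W)) f g

@[simp] theorem d_sum {ι : Type*} (s : Finset ι) (f : ι → Fn O W) :
    d (∑ k ∈ s, f k) = ∑ k ∈ s, d (f k) := map_sum (dₗ (O := O) (W := W)) f s

theorem d_mul (f g : Fn O W) : d (f * g) = f • d g + g • d f := ext₁ fun V i ξ => by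
  simp [res_d, res_smul]

/-- The Lie derivative of 1-forms. -/
def lie (ξ : VF O W) (α : Form O 1 W) : Form O 1 W :=
  mk₁ (fun V h =>
    { toFun := fun η => (VF.res h ξ).app (ev (res h α) η) - ev (res h α) ⁅VF.res h ξ, η⁆
      map_add' := fun η ζ => by
        simp only [ev_add, map_add, VF.bracket_add]
        ring
      map_smul' := fun f η => by
        simp only [ev_smul, VF.bracket_smul, ev_add, VF.app_mul, RingHom.id_apply, smul_eq_mul]
        ring })
    (fun V h V' i η => by
      change resFn O i (_ - _) = _ - _
      rw [map_sub, VF.res_app, res_ev, res_ev]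
      rfl)

@[simp] theorem ev_lie (ξ : VF O W) (α : Form O 1 W) (η : VF O W) :
    ev (lie ξ α) η = ξ.app (ev α η) - ev α ⁅ξ, η⁆ := rfl

theorem res_lie (i : V ≤ W) (ξ : VF O W) (α : Form O 1 W) :
    res i (lie ξ α) = lie (VF.res i ξ) (res i α) := rfl

theorem lie_add (ξ : VF O W) (α β : Form O 1 W) : lie ξ (α + β) = lie ξ α + lie ξ β :=
  ext₁ fun V i η => by
    simp only [map_add, res_lie, add_ev, ev_lie]
    ring

theorem add_lie (ξ η : VF O W) (α : Form O 1 W) : lie (ξ + η) α = lie ξ α + lie η α :=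
  ext₁ fun V i ζ => by
    simp only [map_add, res_lie, add_ev, ev_lie, VF.add_app, VF.add_bracket, ev_add]
    ring

theorem lie_csmul (c : ℂ) (ξ : VF O W) (α : Form O 1 W) : lie ξ (c • α) = c • lie ξ α :=
  ext₁ fun V i η => by
    simp only [map_smul, res_lie, csmul_ev, ev_lie, Derivation.map_smul, smul_sub]

theorem ev_csmul (c : ℂ) (α : Form O 1 W) (ξ : VF O W) : ev α (c • ξ) = c • ev α ξ := by
  rw [← smul_one_smul (Fn O W) c ξ, ev_smul, smul_mul_assoc, one_mul]

theorem csmul_lie (c : ℂ) (ξ : VF O W) (α : Form O 1 W) : lie (c • ξ) α = c • lie ξ α :=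
  ext₁ fun V i η => by
    rw [map_smul, res_lie, res_lie, csmul_ev, ev_lie, ev_lie, map_smul, VF.csmul_bracket,
      ev_csmul, smul_sub]
    rfl

@[simp] theorem lie_d (ξ : VF O W) (f : Fn O W) : lie ξ (d f) = d (ξ.app f) :=
  ext₁ fun V i η => by
    simp only [res_lie, res_d, ev_lie, ev_d, VF.bracket_app, VF.res_app]
    ring

theorem lie_smul (ξ : VF O W) (f : Fn O W) (α : Form O 1 W) :
    lie ξ (f • α) = ξ.app f • α + f • lie ξ α := ext₁ fun V i η => by
  simp only [map_add, res_lie, res_smul, ev_lie, smul_ev, add_ev, VF.app_mul, VF.res_app]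
  ring

theorem smul_lie (ξ : VF O W) (f : Fn O W) (α : Form O 1 W) :
    lie (f • ξ) α = f • lie ξ α + ev α ξ • d f := ext₁ fun V i η => by
  simp only [map_add, res_lie, res_smul, ev_lie, smul_ev, add_ev, VF.smul_app, VF.res_smul,
    VF.smul_bracket, ev_sub, ev_smul, res_d, ev_d, res_ev]
  ring

theorem lie_lie (ξ η : VF O W) (α : Form O 1 W) :
    lie ξ (lie η α) = lie ⁅ξ, η⁆ α + lie η (lie ξ α) := ext₁ fun V i ζ => by
  simp only [map_add, res_lie, add_ev, ev_lie, VF.res_bracket, VF.bracket_app, map_sub,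
    VF.jacobi (VF.res i ξ) (VF.res i η), ev_add]
  ring

/-! #### Forms of degree two and three -/

section alternating

variable {R M : Type*} [CommRing R] [Algebra ℂ R] [AddCommGroup M] [Module R M]

theorem eq_zero_of_eq_neg {r : R} (h : r = -r) : r = 0 := by
  have e : (2 : ℂ) • r = 0 := by
    rw [two_smul]
    nth_rewrite 1 [h]
    exact neg_add_cancel r
  rw [← inv_smul_smul₀ (two_ne_zero (α := ℂ)) r, e, smul_zero]

/-- A skew-symmetric bilinear map as an alternating map. -/
def alt₂ (f : M → M → R) (add : ∀ x x' y, f (x + x') y = f x y + f x' y)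
    (smul : ∀ (r : R) x y, f (r • x) y = r * f x y) (skew : ∀ x y, f x y = -f y x) :
    M [⋀^Fin 2]→ₗ[R] R where
  toFun m := f (m 0) (m 1)
  map_update_add' m i x y := by
    fin_cases i
    · simp [add]
    · simp [skew (m 0), add]
      ring
  map_update_smul' m i c x := by
    fin_cases i
    · simp [smul]
    · simp [skew (m 0), smul]
  map_eq_zero_of_eq' m i j e hij := by
    have alt : m 0 = m 1 → f (m 0) (m 1) = 0 := fun e => eq_zero_of_eq_neg (by
      nth_rewrite 1 [skew]
      rw [e])
    fin_cases i <;> fin_cases j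
    · exact absurd rfl hij
    · exact alt e
    · exact alt e.symm
    · exact absurd rfl hij

/-- A skew-symmetric trilinear map as an alternating map. -/
def alt₃ (f : M → M → M → R) (add : ∀ x x' y z, f (x + x') y z = f x y z + f x' y z)
    (smul : ∀ (r : R) x y z, f (r • x) y z = r * f x y z)
    (skew : ∀ x y z, f x y z = -f y x z) (skew' : ∀ x y z, f x y z = -f x z y) :
    M [⋀^Fin 3]→ₗ[R] R where
  toFun m := f (m 0) (m 1) (m 2)
  map_update_add' := @fun inst m i x y => by
    obtain rfl : inst = instDecidableEqFin 3 := Subsingleton.elim _ _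
    have rot : ∀ x y z, f x y z = f z x y := fun x y z => by rw [skew' x, skew x, neg_neg]
    fin_cases i
    · simp [add]
    · simp [skew (m 0), add]
      ring
    · simp [rot (m 0), add]
  map_update_smul' := @fun inst m i c x => by
    obtain rfl : inst = instDecidableEqFin 3 := Subsingleton.elim _ _
    have rot : ∀ x y z, f x y z = f z x y := fun x y z => by rw [skew' x, skew x, neg_neg]
    fin_cases i
    · simp [smul]
    · simp [skew (m 0), smul]
    · simp [rot (m 0), smul]
  map_eq_zero_of_eq' m i j e hij := by
    have a₁ : ∀ x z, f x x z = 0 := fun x z => eq_zero_of_eq_neg (skew x x z)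
    have a₂ : ∀ x y, f x y y = 0 := fun x y => eq_zero_of_eq_neg (skew' x y y)
    have a₃ : ∀ x y, f x y x = 0 := fun x y => by rw [skew, a₂, neg_zero]
    fin_cases i <;> fin_cases j <;> first
      | exact absurd rfl hij
      | (simp only [Fin.zero_eta, Fin.mk_one, Fin.reduceFinMk] at e
         simp [e, a₁, a₂, a₃])

end alternating

/-- The value of a 2-form on two vector fields. -/
def ev₂ (B : Form O 2 W) (ξ η : VF O W) : Fn O W := B.on le_rfl ![ξ, η]

/-- The value of a 3-form on three vector fields. -/
def ev₃ (H : Form O 3 W) (ξ η ζ : VF O W) : Fn O W := H.on le_rfl ![ξ, η, ζ]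

theorem vec₂_eta {M : Type*} (m : Fin 2 → M) : m = ![m 0, m 1] := by
  funext k; fin_cases k <;> rfl

theorem vec₃_eta {M : Type*} (m : Fin 3 → M) : m = ![m 0, m 1, m 2] := by
  funext k; fin_cases k <;> rfl

theorem on_eq_ev₂ (B : Form O 2 W) (h : V ≤ W) (ξ η : VF O V) :
    B.on h ![ξ, η] = ev₂ (res h B) ξ η := rfl

theorem on_eq_ev₃ (H : Form O 3 W) (h : V ≤ W) (ξ η ζ : VF O V) :
    H.on h ![ξ, η, ζ] = ev₃ (res h H) ξ η ζ := rfl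

theorem on_eq_ev₂' (B : Form O 2 W) (h : V ≤ W) (ξ : Fin 2 → VF O V) :
    B.on h ξ = ev₂ (res h B) (ξ 0) (ξ 1) := by
  nth_rewrite 1 [vec₂_eta ξ]
  rfl

theorem ext₂ {B B' : Form O 2 W}
    (h : ∀ (V : Opens X) (i : V ≤ W) (ξ η : VF O V), ev₂ (res i B) ξ η = ev₂ (res i B') ξ η) :
    B = B' := ext' fun V i ξ => by
  rw [vec₂_eta ξ]
  exact h V i _ _

theorem res_ev₂ (i : V ≤ W) (B : Form O 2 W) (ξ η : VF O W) :
    resFn O i (ev₂ B ξ η) = ev₂ (res i B) (VF.res i ξ) (VF.res i η) := by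
  refine (B.res_on le_rfl i _).trans ?_
  rw [on_eq_ev₂']
  rfl

theorem res_ev₃ (i : V ≤ W) (H : Form O 3 W) (ξ η ζ : VF O W) :
    resFn O i (ev₃ H ξ η ζ) = ev₃ (res i H) (VF.res i ξ) (VF.res i η) (VF.res i ζ) := by
  refine (H.res_on le_rfl i _).trans ?_
  rw [vec₃_eta (fun k => _)]
  rfl

theorem res_contract (i : V ≤ W) (ξ : VF O W) (ω : Form O (p + 1) W) :
    res i (contract ξ ω) = contract (VF.res i ξ) (res i ω) := rfl

@[simp] theorem ev_contract (B : Form O 2 W) (ξ η : VF O W) :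
    ev (contract ξ B) η = ev₂ B ξ η := by
  change B.on le_rfl (Matrix.vecCons (VF.res le_rfl ξ) fun _ => η) = _
  rw [vec₂_eta (Matrix.vecCons _ _)]
  rfl

@[simp] theorem ev_contract_contract (H : Form O 3 W) (ξ η ζ : VF O W) :
    ev (contract η (contract ξ H)) ζ = ev₃ H ξ η ζ := by
  change H.on le_rfl (Matrix.vecCons (VF.res le_rfl ξ)
    (Matrix.vecCons (VF.res le_rfl η) fun _ => ζ)) = _
  rw [vec₃_eta (Matrix.vecCons _ _)]
  rfl

theorem ev₂_skew (B : Form O 2 W) (ξ η : VF O W) : ev₂ B ξ η = -ev₂ B η ξ := by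
  have := (B.on le_rfl).map_swap ![η, ξ] (i := 0) (j := 1) (by decide)
  rw [← ev₂, vec₂_eta (_ ∘ _)] at this
  exact this

theorem ev₃_skew (H : Form O 3 W) (ξ η ζ : VF O W) : ev₃ H ξ η ζ = -ev₃ H η ξ ζ := by
  have := (H.on le_rfl).map_swap ![η, ξ, ζ] (i := 0) (j := 1) (by decide)
  rw [← ev₃, vec₃_eta (_ ∘ _)] at this
  exact this

theorem ev₃_skew' (H : Form O 3 W) (ξ η ζ : VF O W) : ev₃ H ξ η ζ = -ev₃ H ξ ζ η := by
  have := (H.on le_rfl).map_swap ![ξ, ζ, η] (i := 1) (j := 2) (by decide)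
  rw [← ev₃, vec₃_eta (_ ∘ _)] at this
  exact this

@[simp] theorem ev₃_add_right (H : Form O 3 W) (ξ η ζ ζ' : VF O W) :
    ev₃ H ξ η (ζ + ζ') = ev₃ H ξ η ζ + ev₃ H ξ η ζ' := by
  simp only [← ev_contract_contract, ev_add]

@[simp] theorem ev₃_smul_right (H : Form O 3 W) (f : Fn O W) (ξ η ζ : VF O W) :
    ev₃ H ξ η (f • ζ) = f * ev₃ H ξ η ζ := by
  simp only [← ev_contract_contract, ev_smul]

@[simp] theorem ev₃_add_mid (H : Form O 3 W) (ξ η η' ζ : VF O W) :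
    ev₃ H ξ (η + η') ζ = ev₃ H ξ η ζ + ev₃ H ξ η' ζ := by
  rw [ev₃_skew', ev₃_add_right, ev₃_skew' H ξ η, ev₃_skew' H ξ η']
  ring

@[simp] theorem ev₃_smul_mid (H : Form O 3 W) (f : Fn O W) (ξ η ζ : VF O W) :
    ev₃ H ξ (f • η) ζ = f * ev₃ H ξ η ζ := by
  rw [ev₃_skew', ev₃_smul_right, ev₃_skew' H ξ η]
  ring

@[simp] theorem ev₃_add_left (H : Form O 3 W) (ξ ξ' η ζ : VF O W) :
    ev₃ H (ξ + ξ') η ζ = ev₃ H ξ η ζ + ev₃ H ξ' η ζ := by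
  rw [ev₃_skew, ev₃_add_mid, ev₃_skew H ξ η, ev₃_skew H ξ' η]
  ring

@[simp] theorem ev₃_smul_left (H : Form O 3 W) (f : Fn O W) (ξ η ζ : VF O W) :
    ev₃ H (f • ξ) η ζ = f * ev₃ H ξ η ζ := by
  rw [ev₃_skew, ev₃_smul_mid, ev₃_skew H ξ η]
  ring

/-- A 2-form from a compatible family of skew-symmetric bilinear maps. -/
def mk₂ (φ : ∀ V : Opens X, V ≤ W → VF O V → VF O V → Fn O V)
    (add : ∀ V h x x' y, φ V h (x + x') y = φ V h x y + φ V h x' y)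
    (smul : ∀ V h (f : Fn O V) x y, φ V h (f • x) y = f * φ V h x y)
    (skew : ∀ V h x y, φ V h x y = -φ V h y x)
    (hφ : ∀ (V : Opens X) (h : V ≤ W) (V' : Opens X) (i : V' ≤ V) (ξ η : VF O V),
      resFn O i (φ V h ξ η) = φ V' (i.trans h) (VF.res i ξ) (VF.res i η)) : Form O 2 W :=
  mk (fun V h => alt₂ (φ V h) (add V h) (smul V h) (skew V h))
    (fun V h V' i ξ => hφ V h V' i (ξ 0) (ξ 1))

theorem ev₂_res_mk₂ {φ : ∀ V : Opens X, V ≤ W → VF O V → VF O V → Fn O V} {add smul skew hφ}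
    (h : V ≤ W) (ξ η : VF O V) : ev₂ (res h (mk₂ φ add smul skew hφ)) ξ η = φ V h ξ η := rfl

/-- A 3-form from a compatible family of skew-symmetric trilinear maps. -/
def mk₃ (φ : ∀ V : Opens X, V ≤ W → VF O V → VF O V → VF O V → Fn O V)
    (add : ∀ V h x x' y z, φ V h (x + x') y z = φ V h x y z + φ V h x' y z)
    (smul : ∀ V h (f : Fn O V) x y z, φ V h (f • x) y z = f * φ V h x y z)
    (skew : ∀ V h x y z, φ V h x y z = -φ V h y x z)
    (skew' : ∀ V h x y z, φ V h x y z = -φ V h x z y)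
    (hφ : ∀ (V : Opens X) (h : V ≤ W) (V' : Opens X) (i : V' ≤ V) (ξ η ζ : VF O V),
      resFn O i (φ V h ξ η ζ) = φ V' (i.trans h) (VF.res i ξ) (VF.res i η) (VF.res i ζ)) :
    Form O 3 W :=
  mk (fun V h => alt₃ (φ V h) (add V h) (smul V h) (skew V h) (skew' V h))
    (fun V h V' i ξ => hφ V h V' i (ξ 0) (ξ 1) (ξ 2))

theorem ev₃_res_mk₃ {φ : ∀ V : Opens X, V ≤ W → VF O V → VF O V → VF O V → Fn O V}
    {add smul skew skew' hφ} (h : V ≤ W) (ξ η ζ : VF O V) :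
    ev₃ (res h (mk₃ φ add smul skew skew' hφ)) ξ η ζ = φ V h ξ η ζ := rfl

end Form

/-! #### Coordinates -/

/-- A coordinate system on `U`. -/
structure Coordinates (O : StructureSheaf X) (U : Opens X) where
  n : ℕ
  x : Fin n → Fn O U
  D : Fin n → VF O U
  app_D : ∀ i j, (D i).app (x j) = if i = j then 1 else 0
  expand : ∀ (W : Opens X) (h : W ≤ U) (ξ : VF O W),
    ξ = ∑ i, ξ.app (resFn O h (x i)) • VF.res h (D i)

namespace Coordinates

variable {U : Opens X}

/-- Restriction of a coordinate system. -/
def restrict (C : Coordinates O U) {U' : Opens X} (i : U' ≤ U) : Coordinates O U' where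
  n := C.n
  x k := resFn O i (C.x k)
  D k := VF.res i (C.D k)
  app_D k l := by
    rw [← VF.res_app, C.app_D]
    split_ifs <;> simp
  expand W h ξ := by
    simp only [resFn_resFn, VF.res_res]
    exact C.expand W (h.trans i) ξ

theorem form_eq (C : Coordinates O U) (α : Form O 1 U) :
    α = ∑ k, Form.ev α (C.D k) • Form.d (C.x k) := Form.ext₁ fun V i ξ => by
  conv_lhs => rw [C.expand V i ξ]
  simp only [Form.ev_sum, Form.ev_smul, map_sum, Form.sum_ev, Form.res_smul, Form.smul_ev,
    Form.res_d, Form.ev_d, ← Form.res_ev]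
  exact Finset.sum_congr rfl fun k _ => mul_comm _ _

end Coordinates

theorem IsSmooth.exists_coordinates (hO : IsSmooth O) (p : X) :
    ∃ (U : Opens X) (_ : p ∈ U), Nonempty (Coordinates O U) := by
  obtain ⟨U, hp, n, x, D, h₁, h₂⟩ := hO p
  exact ⟨U, hp, ⟨⟨n, x, D, h₁, h₂⟩⟩⟩

/-- Coordinates on a neighbourhood of `p` in `W`. -/
theorem IsSmooth.exists_coordinates_le (hO : IsSmooth O) {W : Opens X} {p : X} (hp : p ∈ W) :
    ∃ (U : Opens X) (_ : U ≤ W) (_ : p ∈ U), Nonempty (Coordinates O U) := by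
  obtain ⟨U, hU, ⟨C⟩⟩ := hO.exists_coordinates p
  exact ⟨W ⊓ U, inf_le_left, ⟨hp, hU⟩, ⟨C.restrict inf_le_right⟩⟩

/-- Multiplication of vector fields by functions, as a bilinear map. -/
def VF.actₗ (W : Opens X) : Fn O W →ₗ[ℂ] VF O W →ₗ[ℂ] VF O W :=
  LinearMap.mk₂ ℂ (fun f ξ => f • ξ) (fun f g ξ => add_smul f g ξ)
    (fun c f ξ => smul_assoc c f ξ) (fun f ξ η => smul_add f ξ η)
    (fun c f ξ => smul_algebra_smul_comm c f ξ)

/-- The commutator of vector fields, as a bilinear map. -/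
def VF.bracketₗ (W : Opens X) : VF O W →ₗ[ℂ] VF O W →ₗ[ℂ] VF O W :=
  LinearMap.mk₂ ℂ (fun ξ η => ⁅ξ, η⁆) VF.add_bracket VF.csmul_bracket VF.bracket_add
    VF.bracket_csmul

variable (O) in
/-- The tangent sheaf as a Lie algebroid. -/
def tangent : LieAlgebroid O where
  toSheafOn := vfSheaf O ⊤
  act := VF.actₗ
  bracket := VF.bracketₗ
  anchor _ := LinearMap.id
  res_act i f ξ := VF.res_smul i f ξ
  res_bracket i ξ η := VF.res_bracket i ξ η
  res_anchor _ _ := rfl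
  one_act ξ := one_smul (Fn O _) (show VF O _ from ξ)
  act_act f g ξ := (mul_smul f g (show VF O _ from ξ)).symm
  bracket_self ξ := VF.bracket_self ξ
  jacobi ξ η ζ := VF.jacobi ξ η ζ
  anchor_act _ _ := rfl
  anchor_bracket _ _ := rfl
  bracket_act ξ η f := VF.bracket_smul ξ η f

theorem tangent_isTransitive : (tangent O).IsTransitive :=
  fun _ ξ _ hp => ⟨_, le_rfl, hp, show VF O _ from ξ, rfl⟩

end

section

/-! ### Algebroids of level `k` -/

variable {O : StructureSheaf X}

/-- To prove a local and additive property of 1-forms it suffices to prove it for `f dg`. -/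
theorem IsSmooth.form_induction (hO : IsSmooth O) {U : Opens X}
    {P : ∀ {W : Opens X} (_ : W ≤ U), Form O 1 W → Prop}
    (loc : ∀ {W : Opens X} (h : W ≤ U) (α : Form O 1 W),
      (∀ p ∈ W, ∃ (V : Opens X) (i : V ≤ W) (_ : p ∈ V), P (i.trans h) (Form.res i α)) → P h α)
    (zero : ∀ {W : Opens X} (h : W ≤ U), P h (0 : Form O 1 W))
    (add : ∀ {W : Opens X} (h : W ≤ U) (α β : Form O 1 W), P h α → P h β → P h (α + β))
    (smul_d : ∀ {W : Opens X} (h : W ≤ U) (f g : Fn O W), P h (f • Form.d g))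
    {W : Opens X} (h : W ≤ U) (α : Form O 1 W) : P h α := by
  refine loc h α fun p hp => ?_
  obtain ⟨V, i, hpV, ⟨C⟩⟩ := hO.exists_coordinates_le hp
  refine ⟨V, i, hpV, ?_⟩
  rw [C.form_eq (Form.res i α)]
  have : ∀ s : Finset (Fin C.n),
      P (i.trans h) (∑ k ∈ s, Form.ev (Form.res i α) (C.D k) • Form.d (C.x k)) := by
    classical
    intro s
    induction s using Finset.induction_on with
    | empty => simpa using zero _
    | insert a s has ih => rw [Finset.sum_insert has]; exact add _ _ _ (smul_d _ _ _) ih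
  exact this _

namespace Algebroid

variable {U : Opens X}

/-- The identities of a Courant algebroid (`k = 0`) or of a vertex algebroid (`k = 1`), where
equations between sections hold up to the relation `r`.  The level `k` measures the failure of
associativity of the action and of linearity of the pairing; levels add up under sums. -/
structure IsLevel (k : ℤ) (E : Algebroid O U)
    (r : ∀ {W : Opens X} (h : W ≤ U), E.sec W h → E.sec W h → Prop) : Prop where
  one_act : ∀ {W : Opens X} (h : W ≤ U) (v : E.sec W h), r h (E.act h 1 v) v
  act_act : ∀ {W : Opens X} (h : W ≤ U) (f g : Fn O W) (v : E.sec W h),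
    r h (E.act h f (E.act h g v)) (E.act h (f * g) v
      + k • (E.act h ((E.anchor h v).app f) (E.der h g)
        + E.act h ((E.anchor h v).app g) (E.der h f)))
  jacobi : ∀ {W : Opens X} (h : W ≤ U) (a b c : E.sec W h),
    r h (E.bracket h a (E.bracket h b c))
      (E.bracket h (E.bracket h a b) c + E.bracket h b (E.bracket h a c))
  anchor_bracket : ∀ {W : Opens X} (h : W ≤ U) (v v' : E.sec W h),
    E.anchor h (E.bracket h v v') = ⁅E.anchor h v, E.anchor h v'⁆
  pairing_symm : ∀ {W : Opens X} (h : W ≤ U) (v v' : E.sec W h),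
    E.pairing h v v' = E.pairing h v' v
  anchor_der : ∀ {W : Opens X} (h : W ≤ U) (f : Fn O W), E.anchor h (E.der h f) = 0
  bracket_act : ∀ {W : Opens X} (h : W ≤ U) (v v' : E.sec W h) (f : Fn O W),
    r h (E.bracket h v (E.act h f v'))
      (E.act h ((E.anchor h v).app f) v' + E.act h f (E.bracket h v v'))
  bracket_symm : ∀ {W : Opens X} (h : W ≤ U) (v v' : E.sec W h),
    r h (E.bracket h v v' + E.bracket h v' v) (E.der h (E.pairing h v v'))
  anchor_act : ∀ {W : Opens X} (h : W ≤ U) (f : Fn O W) (v : E.sec W h),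
    E.anchor h (E.act h f v) = f • E.anchor h v
  pairing_act : ∀ {W : Opens X} (h : W ≤ U) (f : Fn O W) (v v' : E.sec W h),
    E.pairing h (E.act h f v) v'
      = f * E.pairing h v v' - k • (E.anchor h v).app ((E.anchor h v').app f)
  pairing_invariant : ∀ {W : Opens X} (h : W ≤ U) (v v₁ v₂ : E.sec W h),
    (E.anchor h v).app (E.pairing h v₁ v₂)
      = E.pairing h (E.bracket h v v₁) v₂ + E.pairing h v₁ (E.bracket h v v₂)
  der_mul : ∀ {W : Opens X} (h : W ≤ U) (f g : Fn O W),
    r h (E.der h (f * g)) (E.act h f (E.der h g) + E.act h g (E.der h f))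
  bracket_der : ∀ {W : Opens X} (h : W ≤ U) (v : E.sec W h) (f : Fn O W),
    r h (E.bracket h v (E.der h f)) (E.der h ((E.anchor h v).app f))
  pairing_der : ∀ {W : Opens X} (h : W ≤ U) (v : E.sec W h) (f : Fn O W),
    E.pairing h v (E.der h f) = (E.anchor h v).app f
  inc_act : ∀ {W : Opens X} (h : W ≤ U) (f : Fn O W) (α : Form O 1 W),
    r h (E.inc h (f • α)) (E.act h f (E.inc h α))
  inc_d : ∀ {W : Opens X} (h : W ≤ U) (f : Fn O W), r h (E.inc h (Form.d f)) (E.der h f)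

/-- `E` is an algebroid of level `k`: a Courant algebroid for `k = 0` and a vertex algebroid for
`k = 1`. -/
abbrev IsAlg (k : ℤ) (E : Algebroid O U) : Prop := IsLevel k E fun _ a b => a = b

theorem IsCourant.isAlg {E : Algebroid O U} (hE : E.IsCourant) : E.IsAlg 0 where
  one_act := hE.one_act
  act_act h f g v := by rw [hE.act_act, zero_smul, add_zero]
  jacobi := hE.jacobi
  anchor_bracket := hE.anchor_bracket
  pairing_symm := hE.pairing_symm
  anchor_der := hE.anchor_der
  bracket_act h v v' f := by rw [hE.bracket_act, add_comm]
  bracket_symm := hE.bracket_symm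
  anchor_act := hE.anchor_act
  pairing_act h f v v' := by rw [hE.pairing_act, zero_smul, sub_zero]
  pairing_invariant h v v₁ v₂ := (hE.pairing_invariant h v v₁ v₂).symm
  der_mul := hE.der_mul
  bracket_der := hE.bracket_der
  pairing_der := hE.pairing_der
  inc_act := hE.inc_act
  inc_d := hE.inc_d

theorem IsAlg.isCourant {E : Algebroid O U} (hE : E.IsAlg 0) : E.IsCourant where
  one_act := hE.one_act
  act_act h f g v := by rw [hE.act_act, zero_smul, add_zero]
  jacobi := hE.jacobi
  anchor_bracket := hE.anchor_bracket
  pairing_symm := hE.pairing_symm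
  anchor_der := hE.anchor_der
  bracket_act h v v' f := by rw [hE.bracket_act, add_comm]
  bracket_symm := hE.bracket_symm
  anchor_act := hE.anchor_act
  pairing_act h f v v' := by rw [hE.pairing_act, zero_smul, sub_zero]
  pairing_invariant h v v₁ v₂ := (hE.pairing_invariant h v v₁ v₂).symm
  der_mul := hE.der_mul
  bracket_der := hE.bracket_der
  pairing_der := hE.pairing_der
  inc_act := hE.inc_act
  inc_d := hE.inc_d

theorem IsVertex.isAlg {E : Algebroid O U} (hE : E.IsVertex) : E.IsAlg 1 where
  one_act := hE.one_act
  act_act h f g v := by rw [one_smul, ← hE.act_act, add_sub_cancel]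
  jacobi := hE.jacobi
  anchor_bracket := hE.anchor_bracket
  pairing_symm := hE.pairing_symm
  anchor_der := hE.anchor_der
  bracket_act := hE.bracket_act
  bracket_symm := hE.bracket_symm
  anchor_act := hE.anchor_act
  pairing_act h f v v' := by rw [hE.pairing_act, one_smul]
  pairing_invariant := hE.pairing_invariant
  der_mul := hE.der_mul
  bracket_der := hE.bracket_der
  pairing_der := hE.pairing_der
  inc_act := hE.inc_act
  inc_d := hE.inc_d

theorem IsAlg.isVertex {E : Algebroid O U} (hE : E.IsAlg 1) : E.IsVertex where
  one_act := hE.one_act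
  act_act h f g v := by rw [hE.act_act, one_smul, add_sub_cancel_left]
  jacobi := hE.jacobi
  anchor_bracket := hE.anchor_bracket
  pairing_symm := hE.pairing_symm
  anchor_der := hE.anchor_der
  bracket_act := hE.bracket_act
  bracket_symm := hE.bracket_symm
  anchor_act := hE.anchor_act
  pairing_act h f v v' := by rw [hE.pairing_act, one_smul]
  pairing_invariant := hE.pairing_invariant
  der_mul := hE.der_mul
  bracket_der := hE.bracket_der
  pairing_der := hE.pairing_der
  inc_act := hE.inc_act
  inc_d := hE.inc_d

theorem IsAlg.restrict {k : ℤ} {E : Algebroid O U} (hE : E.IsAlg k) {U' : Opens X} (i : U' ≤ U) :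
    (E.restrict i).IsAlg k where
  one_act h := hE.one_act (h.trans i)
  act_act h := hE.act_act (h.trans i)
  jacobi h := hE.jacobi (h.trans i)
  anchor_bracket h := hE.anchor_bracket (h.trans i)
  pairing_symm h := hE.pairing_symm (h.trans i)
  anchor_der h := hE.anchor_der (h.trans i)
  bracket_act h := hE.bracket_act (h.trans i)
  bracket_symm h := hE.bracket_symm (h.trans i)
  anchor_act h := hE.anchor_act (h.trans i)
  pairing_act h := hE.pairing_act (h.trans i)
  pairing_invariant h := hE.pairing_invariant (h.trans i)
  der_mul h := hE.der_mul (h.trans i)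
  bracket_der h := hE.bracket_der (h.trans i)
  pairing_der h := hE.pairing_der (h.trans i)
  inc_act h := hE.inc_act (h.trans i)
  inc_d h := hE.inc_d (h.trans i)

/-- The anchor map is a surjective map of sheaves. -/
def AnchorSurj (E : Algebroid O U) : Prop :=
  ∀ {W : Opens X} (h : W ≤ U) (ξ : VF O W), ∀ p ∈ W,
    ∃ (V : Opens X) (i : V ≤ W) (_ : p ∈ V) (e : E.sec V (i.trans h)),
      E.anchor (i.trans h) e = VF.res i ξ

theorem IsExact.anchorSurj {E : Algebroid O U} (hE : E.IsExact) : E.AnchorSurj := by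
  intro W h ξ p hp
  obtain ⟨V, i, hV, hpV, e, he⟩ := hE.surj h ξ p hp
  exact ⟨V, i, hpV, e, he⟩

theorem AnchorSurj.restrict {E : Algebroid O U} (hE : E.AnchorSurj) {U' : Opens X} (i : U' ≤ U) :
    (E.restrict i).AnchorSurj := fun h => hE (h.trans i)

theorem _root_.Algebroids.Projection.anchorSurj {A : LieAlgebroid O} (hA : A.IsTransitive)
    {E : Algebroid O U} (π : Projection A E) : E.AnchorSurj := by
  intro W h ξ p hp
  obtain ⟨V, i, hpV, a, ha⟩ := hA W ξ p hp
  obtain ⟨V', j, hV', hpV', e, he⟩ := π.surj (i.trans h) a p hpV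
  refine ⟨V', j.trans i, hpV', e, ?_⟩
  rw [← π.anchor_app, he, ← A.res_anchor, ha, VF.res_res]

section inc

variable {k : ℤ} {E : Algebroid O U} (hO : IsSmooth O) (hE : E.IsAlg k)
include hE

theorem IsLevel.act_der {W : Opens X} (h : W ≤ U) (f g : Fn O W) :
    E.act h f (E.der h g) = E.inc h (f • Form.d g) := by
  rw [hE.inc_act, hE.inc_d]

theorem IsLevel.act_inc {W : Opens X} (h : W ≤ U) (f : Fn O W) (α : Form O 1 W) :
    E.act h f (E.inc h α) = E.inc h (f • α) := (hE.inc_act h f α).symm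

theorem IsLevel.act_act' {W : Opens X} (h : W ≤ U) (f g : Fn O W) (v : E.sec W h) :
    E.act h f (E.act h g v) = E.act h (f * g) v
      + E.inc h (k • ((E.anchor h v).app f • Form.d g + (E.anchor h v).app g • Form.d f)) := by
  rw [hE.act_act, hE.act_der, hE.act_der, ← map_add, ← map_zsmul]

theorem IsLevel.pairing_act_right {W : Opens X} (h : W ≤ U) (f : Fn O W) (v v' : E.sec W h) :
    E.pairing h v (E.act h f v')
      = f * E.pairing h v v' - k • (E.anchor h v').app ((E.anchor h v).app f) := by
  rw [hE.pairing_symm, hE.pairing_act, hE.pairing_symm h v']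

include hO

theorem IsLevel.anchor_inc {W : Opens X} (h : W ≤ U) (α : Form O 1 W) :
    E.anchor h (E.inc h α) = 0 := by
  refine hO.form_induction (U := U) (P := fun h α => E.anchor h (E.inc h α) = 0)
    (fun h α H => VF.eq_of_local fun p hp => ?_) (fun h => by simp)
    (fun h α β a b => by rw [map_add, map_add, a, b, add_zero])
    (fun h f g => by rw [hE.inc_act, hE.inc_d, hE.anchor_act, hE.anchor_der, smul_zero]) h α
  obtain ⟨V, i, hpV, e⟩ := H p hp
  exact ⟨V, i, hpV, by rw [E.res_anchor, E.res_inc, e, map_zero]⟩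

theorem IsLevel.pairing_inc {W : Opens X} (h : W ≤ U) (v : E.sec W h) (α : Form O 1 W) :
    E.pairing h v (E.inc h α) = Form.ev α (E.anchor h v) := by
  revert v
  refine hO.form_induction (U := U)
    (P := fun h α => ∀ v, E.pairing h v (E.inc h α) = Form.ev α (E.anchor h v))
    (fun h α H v => Fn.eq_of_local O fun p hp => ?_) (fun h v => by simp)
    (fun h α β a b v => by rw [map_add, map_add, a, b, Form.add_ev])
    (fun h f g v => ?_) h α
  · obtain ⟨V, i, hpV, e⟩ := H p hp
    exact ⟨V, i, hpV, by rw [E.res_pairing, E.res_inc, e, Form.res_ev, E.res_anchor]⟩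
  · rw [hE.inc_act, hE.inc_d, hE.pairing_act_right, hE.pairing_der, hE.anchor_der]
    simp

theorem IsLevel.inc_pairing {W : Opens X} (h : W ≤ U) (α : Form O 1 W) (v : E.sec W h) :
    E.pairing h (E.inc h α) v = Form.ev α (E.anchor h v) := by
  rw [hE.pairing_symm, hE.pairing_inc hO]

theorem IsLevel.bracket_inc {W : Opens X} (h : W ≤ U) (v : E.sec W h) (α : Form O 1 W) :
    E.bracket h v (E.inc h α) = E.inc h (Form.lie (E.anchor h v) α) := by
  revert v
  refine hO.form_induction (U := U)
    (P := fun h α => ∀ v, E.bracket h v (E.inc h α) = E.inc h (Form.lie (E.anchor h v) α))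
    (fun h α H v => E.eq_of_local h fun p hp => ?_)
    (fun h v => by rw [← zero_smul ℂ (0 : Form O 1 _), Form.lie_csmul]; simp)
    (fun h α β a b v => by rw [map_add, map_add, a, b, Form.lie_add, map_add])
    (fun h f g v => ?_) h α
  · obtain ⟨V, i, hpV, e⟩ := H p hp
    exact ⟨V, i, hpV, by rw [E.res_bracket, E.res_inc, e, E.res_inc, Form.res_lie, E.res_anchor]⟩
  · rw [Form.lie_smul, Form.lie_d, map_add, hE.inc_act, hE.inc_act, hE.inc_act, hE.inc_d, hE.inc_d,
      hE.bracket_act, hE.bracket_der]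

theorem IsLevel.inc_bracket {W : Opens X} (h : W ≤ U) (α : Form O 1 W) (v : E.sec W h) :
    E.bracket h (E.inc h α) v
      = E.inc h (Form.d (Form.ev α (E.anchor h v)) - Form.lie (E.anchor h v) α) := by
  rw [map_sub, hE.inc_d, ← hE.bracket_inc hO, eq_sub_iff_add_eq, hE.bracket_symm,
    hE.inc_pairing hO]

theorem IsLevel.isOmega_inc {W : Opens X} (h : W ≤ U) (α : Form O 1 W) :
    E.IsOmega h (E.inc h α) := by
  refine hO.form_induction (U := U) (P := fun h α => E.IsOmega h (E.inc h α))
    (fun h α H p hp => ?_) (fun {W} h p hp => ⟨W, le_rfl, hp, ?_⟩)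
    (fun h α β a b p hp => ?_) (fun {W} h f g p hp => ⟨W, le_rfl, hp, ?_⟩) h α
  · obtain ⟨V, i, hpV, e⟩ := H p hp
    obtain ⟨V', j, hpV', e'⟩ := e p hpV
    refine ⟨V', j.trans i, hpV', ?_⟩
    rwa [← E.res_inc h, E.res_res] at e'
  · rw [map_zero, map_zero]
    exact zero_mem _
  · obtain ⟨V, i, hpV, e⟩ := a p hp
    obtain ⟨V', j, hpV', e'⟩ := b p hp
    have hres : ∀ {V V' : Opens X} (i : V ≤ _) (j : V' ≤ V) (x : E.sec _ h),
        E.res h i x ∈ AddSubgroup.closure (Set.range fun fg : Fn O V × Fn O V =>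
          E.act (i.trans h) fg.1 (E.der (i.trans h) fg.2)) →
        E.res h (j.trans i) x ∈ AddSubgroup.closure (Set.range fun fg : Fn O V' × Fn O V' =>
          E.act ((j.trans i).trans h) fg.1 (E.der ((j.trans i).trans h) fg.2)) := by
      intro V V' i j x hx
      have := AddSubgroup.mem_map_of_mem (E.res (i.trans h) j).toAddMonoidHom hx
      rw [AddMonoidHom.map_closure] at this
      rw [← E.res_res h i j]
      refine AddSubgroup.closure_mono ?_ this
      rintro _ ⟨_, ⟨⟨f, g⟩, rfl⟩, rfl⟩
      refine ⟨(resFn O j f, resFn O j g), ?_⟩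
      change _ = E.res (i.trans h) j _
      rw [E.res_act, E.res_der]
    refine ⟨V ⊓ V', inf_le_left.trans i, ⟨hpV, hpV'⟩, ?_⟩
    rw [map_add, map_add]
    exact add_mem (hres i inf_le_left _ e) (hres j inf_le_right _ e')
  · rw [E.res_self, hE.inc_act, hE.inc_d]
    exact AddSubgroup.subset_closure ⟨(f, g), rfl⟩

/-- `i : Ω¹ → E` is injective, because `⟨e, i(α)⟩ = α(π(e))` and `π` is surjective. -/
theorem IsLevel.inc_injective (hs : E.AnchorSurj) {W : Opens X} (h : W ≤ U) :
    Function.Injective (E.inc h) := by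
  refine (injective_iff_map_eq_zero _).2 fun α hα => Form.ext₁ fun V i ξ => ?_
  refine Fn.eq_of_local O fun p hp => ?_
  obtain ⟨V', j, hpV', e, he⟩ := hs (i.trans h) ξ p hp
  refine ⟨V', j, hpV', ?_⟩
  rw [Form.res_ev, Form.res_ev, ← he, ← hE.pairing_inc hO, Form.res_res, ← E.res_inc h, hα]
  simp

theorem IsLevel.isOmega_iff (hs : E.AnchorSurj) {W : Opens X} (h : W ≤ U) (e : E.sec W h) :
    E.IsOmega h e ↔ ∃ α : Form O 1 W, e = E.inc h α := by
  refine ⟨fun H => ?_, ?_⟩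
  · have loc : ∀ p ∈ W, ∃ (V : Opens X) (i : V ≤ W) (_ : p ∈ V) (α : Form O 1 V),
        E.res h i e = E.inc (i.trans h) α := by
      intro p hp
      obtain ⟨V, i, hpV, hm⟩ := H p hp
      have : AddSubgroup.closure (Set.range fun fg : Fn O V × Fn O V =>
          E.act (i.trans h) fg.1 (E.der (i.trans h) fg.2))
            ≤ (E.inc (i.trans h)).toAddMonoidHom.range := by
        rw [AddSubgroup.closure_le]
        rintro _ ⟨⟨f, g⟩, rfl⟩
        exact ⟨f • Form.d g, (hE.act_der _ f g).symm⟩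
      obtain ⟨α, hα⟩ := this hm
      exact ⟨V, i, hpV, α, hα.symm⟩
    obtain ⟨α, hα⟩ := Form.exists_of_local
      (fun V i α => E.res h i e = E.inc (i.trans h) α)
      (fun V i α hα V' j => by rw [← E.res_res h i j, hα, E.res_inc])
      (fun V i α β a b => hE.inc_injective hO hs _ (a.symm.trans b)) loc
    refine ⟨α, E.eq_of_local h fun p hp => ?_⟩
    obtain ⟨V, i, hpV, β, hβ⟩ := loc p hp
    exact ⟨V, i, hpV, by rw [E.res_inc, hα V i β hβ, hβ]⟩
  · rintro ⟨α, rfl⟩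
    exact hE.isOmega_inc hO h α

end inc

end Algebroid

end

section

/-! ### Quotients of sheaves -/

namespace SheafOn

variable {U : Opens X} {F : SheafOn U}

variable (F) in
/-- A subsheaf of vector spaces of `F`. -/
structure Sub where
  mem : ∀ {W : Opens X} (h : W ≤ U), Submodule ℂ (F.sec W h)
  res_mem : ∀ {W V : Opens X} (h : W ≤ U) (i : V ≤ W) {a : F.sec W h},
    a ∈ mem h → F.res h i a ∈ mem (i.trans h)
  local_mem : ∀ {W : Opens X} (h : W ≤ U) {a : F.sec W h},
    (∀ p ∈ W, ∃ (V : Opens X) (i : V ≤ W) (_ : p ∈ V), F.res h i a ∈ mem (i.trans h)) → a ∈ mem h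

namespace Sub

variable (K : F.Sub)

/-- The open neighbourhoods of `p` in `U`. -/
abbrev Nbhd (U : Opens X) (p : X) : Type u := {V : Opens X // V ≤ U ∧ p ∈ V}

/-- Families of sections of `F` on the neighbourhoods of `p` which belong to `K` on all sufficiently
small neighbourhoods. -/
def negligible (p : X) : Submodule ℂ (∀ V : Nbhd U p, F.sec V.1 V.2.1) where
  carrier := {s | ∃ V₀ : Opens X, p ∈ V₀ ∧ ∀ V : Nbhd U p, V.1 ≤ V₀ → s V ∈ K.mem V.2.1}
  add_mem' := by
    rintro s t ⟨V, hp, hV⟩ ⟨V', hp', hV'⟩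
    exact ⟨V ⊓ V', ⟨hp, hp'⟩, fun V₁ h =>
      add_mem (hV V₁ (h.trans inf_le_left)) (hV' V₁ (h.trans inf_le_right))⟩
  zero_mem' := ⟨⊤, trivial, fun V _ => zero_mem _⟩
  smul_mem' := by
    rintro c s ⟨V, hp, hV⟩
    exact ⟨V, hp, fun V₁ h => Submodule.smul_mem _ c (hV V₁ h)⟩

/-- A vector space which contains the stalk of `F / K` at `p`: families of sections of `F` on the
neighbourhoods of `p`, modulo negligible families. -/
abbrev Stalk (p : X) : Type u := (∀ V : Nbhd U p, F.sec V.1 V.2.1) ⧸ K.negligible p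

open Classical in
/-- The germ at `p` of the class modulo `K` of a section of `F`, represented by the family of its
restrictions to smaller neighbourhoods. -/
def germ {V : Opens X} (h : V ≤ U) (p : X) : F.sec V h →ₗ[ℂ] K.Stalk p :=
  (K.negligible p).mkQ.comp
    (LinearMap.pi fun V' => if k : V'.1 ≤ V then F.res h k else 0)

theorem germ_res {V V' : Opens X} (h : V ≤ U) (i : V' ≤ V) (p : X) (hp : p ∈ V')
    (a : F.sec V h) : K.germ (i.trans h) p (F.res h i a) = K.germ h p a := by
  refine (Submodule.Quotient.eq _).2 ⟨V', hp, fun V₁ hV₁ => ?_⟩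
  simp only [Pi.sub_apply, LinearMap.pi_apply, dif_pos hV₁, dif_pos (hV₁.trans i), F.res_res,
    sub_self, zero_mem]

theorem germ_eq_zero {V : Opens X} (h : V ≤ U) (p : X) (hp : p ∈ V) (a : F.sec V h) :
    K.germ h p a = 0 ↔ ∃ (V' : Opens X) (i : V' ≤ V) (_ : p ∈ V'),
      F.res h i a ∈ K.mem (i.trans h) := by
  refine (Submodule.Quotient.mk_eq_zero _).trans ⟨?_, ?_⟩
  · rintro ⟨V₀, hp₀, H⟩
    have := H ⟨V ⊓ V₀, inf_le_left.trans h, hp, hp₀⟩ inf_le_right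
    rw [LinearMap.pi_apply, dif_pos inf_le_left] at this
    exact ⟨_, inf_le_left, ⟨hp, hp₀⟩, this⟩
  · rintro ⟨V', i, hp', H⟩
    refine ⟨V', hp', fun V₁ hV₁ => ?_⟩
    rw [LinearMap.pi_apply, dif_pos (hV₁.trans i), ← F.res_res h i hV₁]
    exact K.res_mem _ _ H

/-- The sections of `F / K` over `W`: families of germs which come locally from sections of `F`. -/
def quotSec {W : Opens X} (hW : W ≤ U) : Submodule ℂ (∀ p : W, K.Stalk p.1) where
  carrier := {s | ∀ p ∈ W, ∃ (V : Opens X) (h : V ≤ U) (i : V ≤ W) (_ : p ∈ V) (a : F.sec V h),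
    ∀ q (hq : q ∈ V), s ⟨q, i hq⟩ = K.germ h q a}
  add_mem' := by
    intro s t hs ht p hp
    obtain ⟨V, h, i, hV, a, ha⟩ := hs p hp
    obtain ⟨V', h', i', hV', a', ha'⟩ := ht p hp
    refine ⟨V ⊓ V', inf_le_left.trans h, inf_le_left.trans i, ⟨hV, hV'⟩,
      F.res h inf_le_left a + F.res h' inf_le_right a', fun q hq => ?_⟩
    rw [map_add, K.germ_res h _ q hq, K.germ_res h' _ q hq, ← ha q hq.1, ← ha' q hq.2]
    rfl
  zero_mem' := by
    intro p hp
    exact ⟨W, hW, le_rfl, hp, 0, fun q hq => by simp⟩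
  smul_mem' := by
    intro c s hs p hp
    obtain ⟨V, h, i, hV, a, ha⟩ := hs p hp
    refine ⟨V, h, i, hV, c • a, fun q hq => ?_⟩
    rw [map_smul, ← ha q hq]
    rfl

variable (F) in
/-- The quotient sheaf `F / K`. -/
def _root_.Algebroids.SheafOn.quot (K : F.Sub) : SheafOn U where
  sec _ h := K.quotSec h
  res {W V} h i :=
    { toFun := fun s => ⟨fun p => s.1 ⟨p.1, i p.2⟩, fun p hp => by
        obtain ⟨V', h', i', hV', a, ha⟩ := s.2 p (i hp)
        refine ⟨V ⊓ V', inf_le_right.trans h', inf_le_left, ⟨hp, hV'⟩,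
          F.res h' inf_le_right a, fun q hq => ?_⟩
        rw [K.germ_res h' _ q hq, ← ha q hq.2]⟩
      map_add' := fun _ _ => rfl
      map_smul' := fun _ _ => rfl }
  res_self _ _ := rfl
  res_res _ _ _ _ := rfl
  existsUnique_gluing {ι} V h s hs := by
    have compat : ∀ (a b : ι) (p : X) (ha : p ∈ V a) (hb : p ∈ V b),
        (s a).1 ⟨p, ha⟩ = (s b).1 ⟨p, hb⟩ := fun a b p ha hb =>
      congrFun (congrArg Subtype.val (hs a b)) ⟨p, ha, hb⟩
    have cov : ∀ p : (iSup V : Opens X), ∃ a, p.1 ∈ V a := fun p => Opens.mem_iSup.1 p.2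
    choose c hc using cov
    refine ⟨⟨fun p => (s (c p)).1 ⟨p.1, hc p⟩, fun p hp => ?_⟩, fun a => ?_, fun t ht => ?_⟩
    · obtain ⟨V', h', i', hV', a, ha⟩ := (s (c ⟨p, hp⟩)).2 p (hc ⟨p, hp⟩)
      refine ⟨V', h', i'.trans (le_iSup V _), hV', a, fun q hq => ?_⟩
      rw [← ha q hq]
      exact compat _ _ _ _ _
    · exact Subtype.ext (funext fun p => compat _ _ _ _ _)
    · refine Subtype.ext (funext fun p => ?_)
      exact congrFun (congrArg Subtype.val (ht (c p))) ⟨p.1, hc p⟩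

/-- The quotient map `F → F / K`. -/
def quotMk : LocSurj F (F.quot K) where
  map {W} h :=
    { toFun := fun a => ⟨fun p => K.germ h p.1 a,
        fun p hp => ⟨W, h, le_rfl, hp, a, fun _ _ => rfl⟩⟩
      map_add' := fun a b => Subtype.ext (funext fun p => map_add _ a b)
      map_smul' := fun c a => Subtype.ext (funext fun p => map_smul _ c a) }
  map_res h i a := Subtype.ext (funext fun p => K.germ_res h i p.1 p.2 a)
  surj {W} h q p hp := by
    obtain ⟨V, h', i, hV, a, ha⟩ := q.2 p hp
    exact ⟨V, i, hV, a, Subtype.ext (funext fun x => (ha x.1 x.2).symm)⟩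

theorem quotMk_eq_zero {W : Opens X} (h : W ≤ U) (a : F.sec W h) :
    K.quotMk.map h a = 0 ↔ a ∈ K.mem h := by
  refine ⟨fun H => K.local_mem h fun p hp => ?_, fun H => ?_⟩
  · have : K.germ h p a = 0 := congrFun (congrArg Subtype.val H) ⟨p, hp⟩
    obtain ⟨V, i, hpV, hm⟩ := (K.germ_eq_zero h p hp a).1 this
    exact ⟨V, i, hpV, hm⟩
  · refine Subtype.ext (funext fun p => ?_)
    exact (K.germ_eq_zero h p.1 p.2 a).2 ⟨W, le_rfl, p.2, by rwa [F.res_self]⟩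

theorem quotMk_eq_quotMk {W : Opens X} (h : W ≤ U) (a b : F.sec W h) :
    K.quotMk.map h a = K.quotMk.map h b ↔ a - b ∈ K.mem h := by
  rw [← K.quotMk_eq_zero, map_sub, sub_eq_zero]

end Sub
end SheafOn

namespace Algebroid

variable {O : StructureSheaf X} {U : Opens X}

/-- An ideal of `F`: a subsheaf which is stable under all operations, is contained in the kernel
of the anchor map, and pairs to zero with `F`. -/
structure Ideal (F : Algebroid O U) extends F.toSheafOn.Sub where
  act_mem : ∀ {W : Opens X} (h : W ≤ U) (f : Fn O W) {a : F.sec W h},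
    a ∈ mem h → F.act h f a ∈ mem h
  bracket_mem : ∀ {W : Opens X} (h : W ≤ U) (b : F.sec W h) {a : F.sec W h},
    a ∈ mem h → F.bracket h b a ∈ mem h
  mem_bracket : ∀ {W : Opens X} (h : W ≤ U) (b : F.sec W h) {a : F.sec W h},
    a ∈ mem h → F.bracket h a b ∈ mem h
  anchor_eq_zero : ∀ {W : Opens X} (h : W ≤ U) {a : F.sec W h}, a ∈ mem h → F.anchor h a = 0
  pairing_eq_zero : ∀ {W : Opens X} (h : W ≤ U) (b : F.sec W h) {a : F.sec W h},
    a ∈ mem h → F.pairing h b a = 0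
  eq_zero_pairing : ∀ {W : Opens X} (h : W ≤ U) (b : F.sec W h) {a : F.sec W h},
    a ∈ mem h → F.pairing h a b = 0

namespace Ideal

variable {F : Algebroid O U} (K : F.Ideal)

/-- The sheaf `F / K`. -/
abbrev quotSheaf : SheafOn U := F.toSheafOn.quot K.toSub

theorem exists_quotAct :
    ∃ g : ∀ {W : Opens X} (h : W ≤ U), Fn O W →ₗ[ℂ] K.quotSheaf.sec W h →ₗ[ℂ] K.quotSheaf.sec W h,
      (∀ {W V : Opens X} (h : W ≤ U) (i : V ≤ W) (f : Fn O W) (a : K.quotSheaf.sec W h),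
        K.quotSheaf.res h i (g h f a) = g (i.trans h) (resFn O i f) (K.quotSheaf.res h i a)) ∧
      ∀ {W : Opens X} (h : W ≤ U) (f : Fn O W) (a : F.sec W h),
        g h f (K.quotMk.map h a) = K.quotMk.map h (F.act h f a) :=
  SheafOn.LocSurj.exists_liftBil
    (SheafOn.LocSurj.refl (fnSheaf O U)) K.toSub.quotMk (G := K.quotSheaf)
    (fun h => (F.act h).compr₂ (K.quotMk.map h))
    (fun h i f a => (congrArg _ (F.res_act h i f a).symm).trans (K.quotMk.map_res h i _))
    (fun h f a hf => by
      have hf : f = 0 := hf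
      subst hf
      change K.quotMk.map h (F.act h 0 a) = 0
      rw [map_zero, LinearMap.zero_apply, map_zero])
    (fun h f a ha => (K.quotMk_eq_zero h _).2 (K.act_mem h f ((K.quotMk_eq_zero h _).1 ha)))

theorem exists_quotBracket :
    ∃ g : ∀ {W : Opens X} (h : W ≤ U),
        K.quotSheaf.sec W h →ₗ[ℂ] K.quotSheaf.sec W h →ₗ[ℂ] K.quotSheaf.sec W h,
      (∀ {W V : Opens X} (h : W ≤ U) (i : V ≤ W) (a b : K.quotSheaf.sec W h),
        K.quotSheaf.res h i (g h a b)
          = g (i.trans h) (K.quotSheaf.res h i a) (K.quotSheaf.res h i b)) ∧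
      ∀ {W : Opens X} (h : W ≤ U) (a b : F.sec W h),
        g h (K.quotMk.map h a) (K.quotMk.map h b) = K.quotMk.map h (F.bracket h a b) :=
  SheafOn.LocSurj.exists_liftBil K.toSub.quotMk K.toSub.quotMk (G := K.quotSheaf)
    (fun h => (F.bracket h).compr₂ (K.quotMk.map h))
    (fun h i f a => (congrArg _ (F.res_bracket h i f a).symm).trans (K.quotMk.map_res h i _))
    (fun h _ b ha => (K.quotMk_eq_zero h _).2 (K.mem_bracket h b ((K.quotMk_eq_zero h _).1 ha)))
    (fun h a _ hb => (K.quotMk_eq_zero h _).2 (K.bracket_mem h a ((K.quotMk_eq_zero h _).1 hb)))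

theorem exists_quotPairing :
    ∃ g : ∀ {W : Opens X} (h : W ≤ U),
        K.quotSheaf.sec W h →ₗ[ℂ] K.quotSheaf.sec W h →ₗ[ℂ] Fn O W,
      (∀ {W V : Opens X} (h : W ≤ U) (i : V ≤ W) (a b : K.quotSheaf.sec W h),
        resFn O i (g h a b)
          = g (i.trans h) (K.quotSheaf.res h i a) (K.quotSheaf.res h i b)) ∧
      ∀ {W : Opens X} (h : W ≤ U) (a b : F.sec W h),
        g h (K.quotMk.map h a) (K.quotMk.map h b) = F.pairing h a b :=
  SheafOn.LocSurj.exists_liftBil K.toSub.quotMk K.toSub.quotMk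
    (G := fnSheaf O U) (fun h => F.pairing h)
    (fun h i f a => (F.res_pairing h i f a).symm)
    (fun h _ b ha => K.eq_zero_pairing h b ((K.quotMk_eq_zero h _).1 ha))
    (fun h a _ hb => K.pairing_eq_zero h a ((K.quotMk_eq_zero h _).1 hb))

/-- The relation which defines the anchor map of the quotient. -/
def quotAnchor : SheafOn.LinRel K.quotSheaf (vfSheaf O U) := K.toSub.quotMk.liftRel (G := vfSheaf O U) (fun h => F.anchor h)
  (fun h i a => (F.res_anchor h i a).symm)
  (fun h _ ha => K.anchor_eq_zero h ((K.quotMk_eq_zero h _).1 ha))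

variable (F) in
/-- The quotient of an algebroid by an ideal. -/
def _root_.Algebroids.Algebroid.quot (K : F.Ideal) : Algebroid O U where
  toSheafOn := K.quotSheaf
  act := K.exists_quotAct.choose
  bracket := K.exists_quotBracket.choose
  anchor := K.quotAnchor.toFun
  pairing := K.exists_quotPairing.choose
  der h := (K.quotMk.map h).comp (F.der h)
  inc h := (K.quotMk.map h).comp (F.inc h)
  res_act := K.exists_quotAct.choose_spec.1
  res_bracket := K.exists_quotBracket.choose_spec.1
  res_anchor h i e := (K.quotAnchor.toFun_res h i e).symm
  res_pairing := K.exists_quotPairing.choose_spec.1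
  res_der h i f := (K.quotMk.map_res h i _).symm.trans (congrArg _ (F.res_der h i f))
  res_inc h i f := (K.quotMk.map_res h i _).symm.trans (congrArg _ (F.res_inc h i f))

/-- The quotient map. -/
def proj {W : Opens X} (h : W ≤ U) : F.sec W h →ₗ[ℂ] (F.quot K).sec W h := K.quotMk.map h

theorem proj_res {W V : Opens X} (h : W ≤ U) (i : V ≤ W) (a : F.sec W h) :
    (F.quot K).res h i (K.proj h a) = K.proj (i.trans h) (F.res h i a) := (K.quotMk.map_res h i a).symm

theorem proj_surj {W : Opens X} (h : W ≤ U) (q : (F.quot K).sec W h) (p : X) (hp : p ∈ W) :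
    ∃ (V : Opens X) (i : V ≤ W) (_ : p ∈ V) (a : F.sec V (i.trans h)),
      K.proj (i.trans h) a = (F.quot K).res h i q := K.quotMk.surj h q p hp

theorem proj_eq_zero {W : Opens X} (h : W ≤ U) (a : F.sec W h) :
    K.proj h a = 0 ↔ a ∈ K.mem h := K.quotMk_eq_zero h a

theorem proj_eq_proj {W : Opens X} (h : W ≤ U) (a b : F.sec W h) :
    K.proj h a = K.proj h b ↔ a - b ∈ K.mem h := K.quotMk_eq_quotMk h a b

theorem act_proj {W : Opens X} (h : W ≤ U) (f : Fn O W) (a : F.sec W h) :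
    (F.quot K).act h f (K.proj h a) = K.proj h (F.act h f a) :=
  K.exists_quotAct.choose_spec.2 h f a

theorem bracket_proj {W : Opens X} (h : W ≤ U) (a b : F.sec W h) :
    (F.quot K).bracket h (K.proj h a) (K.proj h b) = K.proj h (F.bracket h a b) :=
  K.exists_quotBracket.choose_spec.2 h a b

theorem anchor_proj {W : Opens X} (h : W ≤ U) (a : F.sec W h) :
    (F.quot K).anchor h (K.proj h a) = F.anchor h a :=
  K.quotAnchor.toFun_eq h ⟨a, rfl, rfl⟩

theorem pairing_proj {W : Opens X} (h : W ≤ U) (a b : F.sec W h) :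
    (F.quot K).pairing h (K.proj h a) (K.proj h b) = F.pairing h a b :=
  K.exists_quotPairing.choose_spec.2 h a b

theorem der_eq_proj {W : Opens X} (h : W ≤ U) (f : Fn O W) :
    (F.quot K).der h f = K.proj h (F.der h f) := rfl

theorem inc_eq_proj {W : Opens X} (h : W ≤ U) (α : Form O 1 W) :
    (F.quot K).inc h α = K.proj h (F.inc h α) := rfl

/-- Finitely many sections of the quotient have, locally, representatives. -/
theorem exists_rep {ι : Type} [Finite ι] {W : Opens X} (h : W ≤ U) (q : ι → (F.quot K).sec W h)
    (p : X) (hp : p ∈ W) : ∃ (V : Opens X) (i : V ≤ W) (_ : p ∈ V)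
      (a : ι → F.sec V (i.trans h)), ∀ k, (F.quot K).res h i (q k) = K.proj (i.trans h) (a k) := by
  classical
  choose V i hpV a ha using fun k => K.proj_surj h (q k) p hp
  have hfin : ∃ V' : Opens X, p ∈ V' ∧ V' ≤ W ∧ ∀ k, V' ≤ V k := by
    have := Fintype.ofFinite ι
    have main : ∀ s : Finset ι, ∃ V' : Opens X, p ∈ V' ∧ V' ≤ W ∧ ∀ k ∈ s, V' ≤ V k := by
      intro s
      induction s using Finset.induction_on with
      | empty => exact ⟨W, hp, le_rfl, by simp⟩
      | insert k s _ ih =>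
        obtain ⟨V', h₁, h₂, h₃⟩ := ih
        refine ⟨V' ⊓ V k, ⟨h₁, hpV k⟩, inf_le_left.trans h₂, fun l hl => ?_⟩
        rcases Finset.mem_insert.1 hl with rfl | hl
        · exact inf_le_right
        · exact inf_le_left.trans (h₃ l hl)
    obtain ⟨V', h₁, h₂, h₃⟩ := main Finset.univ
    exact ⟨V', h₁, h₂, fun k => h₃ k (Finset.mem_univ k)⟩
  obtain ⟨V', hp', j, hj⟩ := hfin
  refine ⟨V', j, hp', fun k => F.res _ (hj k) (a k), fun k => ?_⟩
  rw [← K.proj_res, ha, SheafOn.res_res]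

theorem exists_rep₁ {W : Opens X} (h : W ≤ U) (q : (F.quot K).sec W h) (p : X) (hp : p ∈ W) :
    ∃ (V : Opens X) (i : V ≤ W) (_ : p ∈ V) (a : F.sec V (i.trans h)),
      (F.quot K).res h i q = K.proj (i.trans h) a := by
  obtain ⟨V, i, hpV, a, ha⟩ := K.exists_rep h (fun _ : Unit => q) p hp
  exact ⟨V, i, hpV, a (), ha ()⟩

theorem exists_rep₂ {W : Opens X} (h : W ≤ U) (q q' : (F.quot K).sec W h) (p : X) (hp : p ∈ W) :
    ∃ (V : Opens X) (i : V ≤ W) (_ : p ∈ V) (a b : F.sec V (i.trans h)),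
      (F.quot K).res h i q = K.proj (i.trans h) a ∧
      (F.quot K).res h i q' = K.proj (i.trans h) b := by
  obtain ⟨V, i, hpV, a, ha⟩ := K.exists_rep h ![q, q'] p hp
  exact ⟨V, i, hpV, a 0, a 1, ha 0, ha 1⟩

theorem exists_rep₃ {W : Opens X} (h : W ≤ U) (q q' q'' : (F.quot K).sec W h) (p : X)
    (hp : p ∈ W) : ∃ (V : Opens X) (i : V ≤ W) (_ : p ∈ V) (a b c : F.sec V (i.trans h)),
      (F.quot K).res h i q = K.proj (i.trans h) a ∧
      (F.quot K).res h i q' = K.proj (i.trans h) b ∧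
      (F.quot K).res h i q'' = K.proj (i.trans h) c := by
  obtain ⟨V, i, hpV, a, ha⟩ := K.exists_rep h ![q, q', q''] p hp
  exact ⟨V, i, hpV, a 0, a 1, a 2, ha 0, ha 1, ha 2⟩

set_option linter.unusedSimpArgs false in
/-- The quotient satisfies the identities which hold in `F` modulo the ideal. -/
theorem quot_isAlg {k : ℤ} (hF : IsLevel k F fun h a b => a - b ∈ K.mem h) :
    (F.quot K).IsAlg k where
  one_act h v := by
    refine (F.quot K).eq_of_local h fun p hp => ?_
    obtain ⟨V, i, hpV, a, ea⟩ := K.exists_rep₁ h v p hp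
    refine ⟨V, i, hpV, ?_⟩
    simp only [res_act, res_bracket, res_anchor, res_pairing, res_der, VF.res_bracket, VF.res_app,
      VF.res_smul, map_add, map_sub, map_zsmul, map_mul, map_one]
    simp only [ea, K.act_proj, K.bracket_proj, K.anchor_proj, K.pairing_proj,
      K.der_eq_proj, ← map_add, ← map_zsmul]
    exact (K.proj_eq_proj _ _ _).2 (hF.one_act _ a)
  act_act h f g v := by
    refine (F.quot K).eq_of_local h fun p hp => ?_
    obtain ⟨V, i, hpV, a, ea⟩ := K.exists_rep₁ h v p hp
    refine ⟨V, i, hpV, ?_⟩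
    simp only [res_act, res_bracket, res_anchor, res_pairing, res_der, VF.res_bracket, VF.res_app,
      VF.res_smul, map_add, map_sub, map_zsmul, map_mul, map_one]
    simp only [ea, K.act_proj, K.bracket_proj, K.anchor_proj, K.pairing_proj,
      K.der_eq_proj, ← map_add, ← map_zsmul]
    exact (K.proj_eq_proj _ _ _).2 (hF.act_act _ _ _ a)
  jacobi h v v' v'' := by
    refine (F.quot K).eq_of_local h fun p hp => ?_
    obtain ⟨V, i, hpV, a, b, c, ea, eb, ec⟩ := K.exists_rep₃ h v v' v'' p hp
    refine ⟨V, i, hpV, ?_⟩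
    simp only [res_act, res_bracket, res_anchor, res_pairing, res_der, VF.res_bracket, VF.res_app,
      VF.res_smul, map_add, map_sub, map_zsmul, map_mul, map_one]
    simp only [ea, eb, ec, K.act_proj, K.bracket_proj, K.anchor_proj, K.pairing_proj,
      K.der_eq_proj, ← map_add, ← map_zsmul]
    exact (K.proj_eq_proj _ _ _).2 (hF.jacobi _ a b c)
  anchor_bracket h v v' := by
    refine VF.eq_of_local fun p hp => ?_
    obtain ⟨V, i, hpV, a, b, ea, eb⟩ := K.exists_rep₂ h v v' p hp
    refine ⟨V, i, hpV, ?_⟩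
    simp only [res_act, res_bracket, res_anchor, res_pairing, res_der, VF.res_bracket, VF.res_app,
      VF.res_smul, map_add, map_sub, map_zsmul, map_mul, map_one]
    simp only [ea, eb, K.act_proj, K.bracket_proj, K.anchor_proj, K.pairing_proj,
      K.der_eq_proj, ← map_add, ← map_zsmul]
    exact hF.anchor_bracket _ a b
  pairing_symm h v v' := by
    refine Fn.eq_of_local O fun p hp => ?_
    obtain ⟨V, i, hpV, a, b, ea, eb⟩ := K.exists_rep₂ h v v' p hp
    refine ⟨V, i, hpV, ?_⟩
    simp only [res_act, res_bracket, res_anchor, res_pairing, res_der, VF.res_bracket, VF.res_app,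
      VF.res_smul, map_add, map_sub, map_zsmul, map_mul, map_one]
    simp only [ea, eb, K.act_proj, K.bracket_proj, K.anchor_proj, K.pairing_proj,
      K.der_eq_proj, ← map_add, ← map_zsmul]
    exact hF.pairing_symm _ a b
  anchor_der h f := (K.anchor_proj h _).trans (hF.anchor_der h f)
  bracket_act h v v' f := by
    refine (F.quot K).eq_of_local h fun p hp => ?_
    obtain ⟨V, i, hpV, a, b, ea, eb⟩ := K.exists_rep₂ h v v' p hp
    refine ⟨V, i, hpV, ?_⟩
    simp only [res_act, res_bracket, res_anchor, res_pairing, res_der, VF.res_bracket, VF.res_app,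
      VF.res_smul, map_add, map_sub, map_zsmul, map_mul, map_one]
    simp only [ea, eb, K.act_proj, K.bracket_proj, K.anchor_proj, K.pairing_proj,
      K.der_eq_proj, ← map_add, ← map_zsmul]
    exact (K.proj_eq_proj _ _ _).2 (hF.bracket_act _ a b _)
  bracket_symm h v v' := by
    refine (F.quot K).eq_of_local h fun p hp => ?_
    obtain ⟨V, i, hpV, a, b, ea, eb⟩ := K.exists_rep₂ h v v' p hp
    refine ⟨V, i, hpV, ?_⟩
    simp only [res_act, res_bracket, res_anchor, res_pairing, res_der, VF.res_bracket, VF.res_app,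
      VF.res_smul, map_add, map_sub, map_zsmul, map_mul, map_one]
    simp only [ea, eb, K.act_proj, K.bracket_proj, K.anchor_proj, K.pairing_proj,
      K.der_eq_proj, ← map_add, ← map_zsmul]
    exact (K.proj_eq_proj _ _ _).2 (hF.bracket_symm _ a b)
  anchor_act h f v := by
    refine VF.eq_of_local fun p hp => ?_
    obtain ⟨V, i, hpV, a, ea⟩ := K.exists_rep₁ h v p hp
    refine ⟨V, i, hpV, ?_⟩
    simp only [res_act, res_bracket, res_anchor, res_pairing, res_der, VF.res_bracket, VF.res_app,
      VF.res_smul, map_add, map_sub, map_zsmul, map_mul, map_one]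
    simp only [ea, K.act_proj, K.bracket_proj, K.anchor_proj, K.pairing_proj,
      K.der_eq_proj, ← map_add, ← map_zsmul]
    exact hF.anchor_act _ _ a
  pairing_act h f v v' := by
    refine Fn.eq_of_local O fun p hp => ?_
    obtain ⟨V, i, hpV, a, b, ea, eb⟩ := K.exists_rep₂ h v v' p hp
    refine ⟨V, i, hpV, ?_⟩
    simp only [res_act, res_bracket, res_anchor, res_pairing, res_der, VF.res_bracket, VF.res_app,
      VF.res_smul, map_add, map_sub, map_zsmul, map_mul, map_one]
    simp only [ea, eb, K.act_proj, K.bracket_proj, K.anchor_proj, K.pairing_proj,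
      K.der_eq_proj]
    exact hF.pairing_act _ _ a b
  pairing_invariant h v v₁ v₂ := by
    refine Fn.eq_of_local O fun p hp => ?_
    obtain ⟨V, i, hpV, a, b, c, ea, eb, ec⟩ := K.exists_rep₃ h v v₁ v₂ p hp
    refine ⟨V, i, hpV, ?_⟩
    simp only [res_act, res_bracket, res_anchor, res_pairing, res_der, VF.res_bracket, VF.res_app,
      VF.res_smul, map_add, map_sub, map_zsmul, map_mul, map_one]
    simp only [ea, eb, ec, K.act_proj, K.bracket_proj, K.anchor_proj, K.pairing_proj,
      K.der_eq_proj, ← map_add, ← map_zsmul]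
    exact hF.pairing_invariant _ a b c
  der_mul h f g := by
    simp only [K.der_eq_proj, K.act_proj, ← map_add]
    exact (K.proj_eq_proj h _ _).2 (hF.der_mul h f g)
  bracket_der h v f := by
    refine (F.quot K).eq_of_local h fun p hp => ?_
    obtain ⟨V, i, hpV, a, ea⟩ := K.exists_rep₁ h v p hp
    refine ⟨V, i, hpV, ?_⟩
    simp only [res_act, res_bracket, res_anchor, res_pairing, res_der, VF.res_bracket, VF.res_app,
      VF.res_smul, map_add, map_sub, map_zsmul, map_mul, map_one]
    simp only [ea, K.act_proj, K.bracket_proj, K.anchor_proj, K.pairing_proj,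
      K.der_eq_proj, ← map_add, ← map_zsmul]
    exact (K.proj_eq_proj _ _ _).2 (hF.bracket_der _ a _)
  pairing_der h v f := by
    refine Fn.eq_of_local O fun p hp => ?_
    obtain ⟨V, i, hpV, a, ea⟩ := K.exists_rep₁ h v p hp
    refine ⟨V, i, hpV, ?_⟩
    simp only [res_act, res_bracket, res_anchor, res_pairing, res_der, VF.res_bracket, VF.res_app,
      VF.res_smul, map_add, map_sub, map_zsmul, map_mul, map_one]
    simp only [ea, K.act_proj, K.bracket_proj, K.anchor_proj, K.pairing_proj,
      K.der_eq_proj, ← map_add, ← map_zsmul]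
    exact hF.pairing_der _ a _
  inc_act h f α := by
    simp only [K.inc_eq_proj, K.act_proj]
    exact (K.proj_eq_proj h _ _).2 (hF.inc_act h f α)
  inc_d h f := (K.proj_eq_proj h _ _).2 (hF.inc_d h f)

end Ideal

end Algebroid

end

section

/-! ### Fiber products of algebroids over a Lie algebroid -/

namespace Algebroid

variable {O : StructureSheaf X} {U : Opens X} {A : LieAlgebroid O}

/-- A map from `E` to the Lie algebroid `A` which is compatible with all operations. -/
structure MapTo (A : LieAlgebroid O) (E : Algebroid O U) where
  app : ∀ {W : Opens X} (h : W ≤ U), E.sec W h →ₗ[ℂ] A.Sec W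
  app_res : ∀ {W V : Opens X} (h : W ≤ U) (i : V ≤ W) (e : E.sec W h),
    app (i.trans h) (E.res h i e) = A.res le_top i (app h e)
  app_act : ∀ {W : Opens X} (h : W ≤ U) (f : Fn O W) (e : E.sec W h),
    app h (E.act h f e) = A.act W f (app h e)
  app_bracket : ∀ {W : Opens X} (h : W ≤ U) (a b : E.sec W h),
    app h (E.bracket h a b) = A.bracket W (app h a) (app h b)
  anchor_app : ∀ {W : Opens X} (h : W ≤ U) (e : E.sec W h),
    A.anchor W (app h e) = E.anchor h e
  app_der : ∀ {W : Opens X} (h : W ≤ U) (f : Fn O W), app h (E.der h f) = 0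
  app_inc : ∀ {W : Opens X} (h : W ≤ U) (α : Form O 1 W), app h (E.inc h α) = 0

/-- The projection of an extension of `A`. -/
def _root_.Algebroids.Projection.toMapTo (hO : IsSmooth O) {k : ℤ} {E : Algebroid O U}
    (hE : E.IsAlg k) (π : Projection A E) : MapTo A E where
  app := π.app
  app_res := π.app_res
  app_act := π.app_act
  app_bracket := π.app_bracket
  anchor_app := π.anchor_app
  app_der h f := (π.ker h _).2 (hE.inc_d h f ▸ hE.isOmega_inc hO h _)
  app_inc h α := (π.ker h _).2 (hE.isOmega_inc hO h α)

/-- The anchor map as a map to the tangent Lie algebroid. -/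
def anchorMap (hO : IsSmooth O) {k : ℤ} {E : Algebroid O U} (hE : E.IsAlg k) :
    MapTo (tangent O) E where
  app := E.anchor
  app_res h i e := (E.res_anchor h i e).symm
  app_act := hE.anchor_act
  app_bracket := hE.anchor_bracket
  anchor_app _ _ := rfl
  app_der := hE.anchor_der
  app_inc := hE.anchor_inc hO

section fiberProduct

variable {E₁ E₂ : Algebroid O U} (p₁ : MapTo A E₁) (p₂ : MapTo A E₂)

/-- The sections of the fiber product. -/
abbrev fiberSec {W : Opens X} (h : W ≤ U) : Submodule ℂ (E₁.sec W h × E₂.sec W h) :=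
  LinearMap.eqLocus ((p₁.app h).comp (LinearMap.fst ℂ _ _)) ((p₂.app h).comp (LinearMap.snd ℂ _ _))

/-- The underlying sheaf of the fiber product. -/
def fiberSheaf : SheafOn U where
  sec _ h := fiberSec p₁ p₂ h
  res h i :=
    { toFun := fun x => ⟨(E₁.res h i x.1.1, E₂.res h i x.1.2), by
        have hx : p₁.app h x.1.1 = p₂.app h x.1.2 := x.2
        change p₁.app (i.trans h) (E₁.res h i x.1.1) = p₂.app (i.trans h) (E₂.res h i x.1.2)
        rw [p₁.app_res, p₂.app_res, hx]⟩
      map_add' := fun x y => Subtype.ext (Prod.ext (map_add _ _ _) (map_add _ _ _))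
      map_smul' := fun c x => Subtype.ext (Prod.ext (map_smul _ _ _) (map_smul _ _ _)) }
  res_self h x := Subtype.ext (Prod.ext (E₁.res_self h _) (E₂.res_self h _))
  res_res h i j x := Subtype.ext (Prod.ext (E₁.res_res h i j _) (E₂.res_res h i j _))
  existsUnique_gluing V h s hs := by
    obtain ⟨a, ha, hau⟩ := E₁.existsUnique_gluing V h (fun k => (s k).1.1)
      (fun k l => congrArg (fun x => x.1.1) (hs k l))
    obtain ⟨b, hb, hbu⟩ := E₂.existsUnique_gluing V h (fun k => (s k).1.2)
      (fun k l => congrArg (fun x => x.1.2) (hs k l))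
    refine ⟨⟨(a, b), ?_⟩, fun k => Subtype.ext (Prod.ext (ha k) (hb k)), fun t ht =>
      Subtype.ext (Prod.ext (hau _ fun k => congrArg (fun x => x.1.1) (ht k))
        (hbu _ fun k => congrArg (fun x => x.1.2) (ht k)))⟩
    change p₁.app h a = p₂.app h b
    refine A.eq_of_local _ fun p hp => ?_
    obtain ⟨k, hk⟩ := Opens.mem_iSup.1 hp
    refine ⟨V k, le_iSup V k, hk, ?_⟩
    rw [← p₁.app_res, ← p₂.app_res, ha k, hb k]
    exact (s k).2

theorem fiberSec_anchor {W : Opens X} (h : W ≤ U) (x : fiberSec p₁ p₂ h) :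
    E₁.anchor h x.1.1 = E₂.anchor h x.1.2 := by
  have hx : p₁.app h x.1.1 = p₂.app h x.1.2 := x.2
  rw [← p₁.anchor_app, hx, p₂.anchor_app]

/-- The componentwise action of functions on the fiber product. -/
def fiberAct {W : Opens X} (h : W ≤ U) : Fn O W →ₗ[ℂ] fiberSec p₁ p₂ h →ₗ[ℂ] fiberSec p₁ p₂ h :=
  LinearMap.mk₂ ℂ
    (fun (f : Fn O W) (x : fiberSec p₁ p₂ h) =>
      (⟨(E₁.act h f x.1.1, E₂.act h f x.1.2), by
        have hx : p₁.app h x.1.1 = p₂.app h x.1.2 := x.2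
        change p₁.app h (E₁.act h f x.1.1) = p₂.app h (E₂.act h f x.1.2)
        rw [p₁.app_act, p₂.app_act, hx]⟩ : fiberSec p₁ p₂ h))
    (fun f g x => Subtype.ext (Prod.ext (LinearMap.map_add₂ _ f g _) (LinearMap.map_add₂ _ f g _)))
    (fun c f x => Subtype.ext (Prod.ext (LinearMap.map_smul₂ _ c f _)
      (LinearMap.map_smul₂ _ c f _)))
    (fun f x y => Subtype.ext (Prod.ext (map_add _ _ _) (map_add _ _ _)))
    (fun c f x => Subtype.ext (Prod.ext (map_smul _ _ _) (map_smul _ _ _)))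

/-- The componentwise bracket on the fiber product. -/
def fiberBracket {W : Opens X} (h : W ≤ U) :
    fiberSec p₁ p₂ h →ₗ[ℂ] fiberSec p₁ p₂ h →ₗ[ℂ] fiberSec p₁ p₂ h :=
  LinearMap.mk₂ ℂ
    (fun (x y : fiberSec p₁ p₂ h) =>
      (⟨(E₁.bracket h x.1.1 y.1.1, E₂.bracket h x.1.2 y.1.2), by
        have hx : p₁.app h x.1.1 = p₂.app h x.1.2 := x.2
        have hy : p₁.app h y.1.1 = p₂.app h y.1.2 := y.2
        change p₁.app h (E₁.bracket h x.1.1 y.1.1) = p₂.app h (E₂.bracket h x.1.2 y.1.2)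
        rw [p₁.app_bracket, p₂.app_bracket, hx, hy]⟩ : fiberSec p₁ p₂ h))
    (fun x y z => Subtype.ext (Prod.ext (LinearMap.map_add₂ _ x.1.1 y.1.1 _)
      (LinearMap.map_add₂ _ x.1.2 y.1.2 _)))
    (fun c x y => Subtype.ext (Prod.ext (LinearMap.map_smul₂ _ c x.1.1 _)
      (LinearMap.map_smul₂ _ c x.1.2 _)))
    (fun f x y => Subtype.ext (Prod.ext (map_add _ _ _) (map_add _ _ _)))
    (fun c f x => Subtype.ext (Prod.ext (map_smul _ _ _) (map_smul _ _ _)))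

variable (ε : ℤ)

/-- The pairing `⟨ , ⟩₁ + ε ⟨ , ⟩₂` on the fiber product. -/
def fiberPairing {W : Opens X} (h : W ≤ U) :
    fiberSec p₁ p₂ h →ₗ[ℂ] fiberSec p₁ p₂ h →ₗ[ℂ] Fn O W :=
  LinearMap.mk₂ ℂ
    (fun (x y : fiberSec p₁ p₂ h) =>
      E₁.pairing h x.1.1 y.1.1 + ε • E₂.pairing h x.1.2 y.1.2)
    (fun x y z => by
      change E₁.pairing h (x.1.1 + y.1.1) _ + ε • E₂.pairing h (x.1.2 + y.1.2) _ = _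
      rw [LinearMap.map_add₂, LinearMap.map_add₂, smul_add]; abel)
    (fun c x y => by
      change E₁.pairing h (c • x.1.1) _ + ε • E₂.pairing h (c • x.1.2) _ = _
      rw [LinearMap.map_smul₂, LinearMap.map_smul₂, smul_add, smul_comm ε c])
    (fun x y z => by
      change E₁.pairing h _ (y.1.1 + z.1.1) + ε • E₂.pairing h _ (y.1.2 + z.1.2) = _
      rw [map_add, map_add, smul_add]; abel)
    (fun c x y => by
      change E₁.pairing h _ (c • y.1.1) + ε • E₂.pairing h _ (c • y.1.2) = _
      rw [map_smul, map_smul, smul_add, smul_comm ε c])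

/-- The fiber product `E₁ ×_A E₂` with the pairing `⟨ , ⟩₁ + ε ⟨ , ⟩₂`.  The maps `∂` and `i` are
those of `E₁`; in the quotients of interest, `(α, -ε α)` vanishes for all 1-forms `α`. -/
def fiberProduct : Algebroid O U where
  toSheafOn := fiberSheaf p₁ p₂
  act h := fiberAct p₁ p₂ h
  bracket h := fiberBracket p₁ p₂ h
  anchor h := (E₁.anchor h).comp ((LinearMap.fst ℂ _ _).comp (fiberSec p₁ p₂ h).subtype)
  pairing h := fiberPairing p₁ p₂ ε h
  der h :=
    { toFun := fun f => (⟨(E₁.der h f, 0), by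
        change p₁.app h (E₁.der h f) = p₂.app h 0
        rw [p₁.app_der, map_zero]⟩ : fiberSec p₁ p₂ h)
      map_add' := fun f g => Subtype.ext (Prod.ext (map_add _ _ _) (add_zero _).symm)
      map_smul' := fun c f => Subtype.ext (Prod.ext (map_smul _ _ _) (smul_zero _).symm) }
  inc h :=
    { toFun := fun f => (⟨(E₁.inc h f, 0), by
        change p₁.app h (E₁.inc h f) = p₂.app h 0
        rw [p₁.app_inc, map_zero]⟩ : fiberSec p₁ p₂ h)
      map_add' := fun f g => Subtype.ext (Prod.ext (map_add _ _ _) (add_zero _).symm)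
      map_smul' := fun c f => Subtype.ext (Prod.ext (map_smul _ _ _) (smul_zero _).symm) }
  res_act h i f x := Subtype.ext (Prod.ext (E₁.res_act h i f _) (E₂.res_act h i f _))
  res_bracket h i x y := Subtype.ext (Prod.ext (E₁.res_bracket h i _ _) (E₂.res_bracket h i _ _))
  res_anchor h i x := E₁.res_anchor h i _
  res_pairing {W V} h i x y := by
    obtain ⟨⟨a, b⟩, w⟩ := x
    obtain ⟨⟨a', b'⟩, w'⟩ := y
    change resFn O i (E₁.pairing h a a' + ε • E₂.pairing h b b')
      = E₁.pairing (i.trans h) (E₁.res h i a) (E₁.res h i a')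
        + ε • E₂.pairing (i.trans h) (E₂.res h i b) (E₂.res h i b')
    rw [map_add, map_zsmul, E₁.res_pairing, E₂.res_pairing]
  res_der h i f := Subtype.ext (Prod.ext (E₁.res_der h i f) (map_zero _))
  res_inc h i f := Subtype.ext (Prod.ext (E₁.res_inc h i f) (map_zero _))

variable {p₁ p₂ ε}

/-- The section `(a, b)` of the fiber product. -/
def pair {W : Opens X} {h : W ≤ U} (a : E₁.sec W h) (b : E₂.sec W h)
    (w : p₁.app h a = p₂.app h b) : (fiberProduct p₁ p₂ ε).sec W h :=
  (⟨(a, b), w⟩ : fiberSec p₁ p₂ h)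

/-- The first component of a section of the fiber product. -/
def fst {W : Opens X} {h : W ≤ U} (x : (fiberProduct p₁ p₂ ε).sec W h) : E₁.sec W h :=
  (show fiberSec p₁ p₂ h from x).1.1

/-- The second component of a section of the fiber product. -/
def snd {W : Opens X} {h : W ≤ U} (x : (fiberProduct p₁ p₂ ε).sec W h) : E₂.sec W h :=
  (show fiberSec p₁ p₂ h from x).1.2

section

variable {W V : Opens X} {h : W ≤ U} (x y : (fiberProduct p₁ p₂ ε).sec W h)

theorem app_fst : p₁.app h (fst x) = p₂.app h (snd x) :=
  (show fiberSec p₁ p₂ h from x).2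

theorem fiber_ext {x y : (fiberProduct p₁ p₂ ε).sec W h} (a : fst x = fst y) (b : snd x = snd y) :
    x = y := Subtype.ext (Prod.ext a b)

theorem anchor_fst : E₁.anchor h (fst x) = E₂.anchor h (snd x) := fiberSec_anchor p₁ p₂ h x

@[simp] theorem fst_pair (a : E₁.sec W h) (b : E₂.sec W h) (w) :
    fst (pair a b w : (fiberProduct p₁ p₂ ε).sec W h) = a := rfl

@[simp] theorem snd_pair (a : E₁.sec W h) (b : E₂.sec W h) (w) :
    snd (pair a b w : (fiberProduct p₁ p₂ ε).sec W h) = b := rfl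

@[simp] theorem fst_add : fst (x + y) = fst x + fst y := rfl
@[simp] theorem snd_add : snd (x + y) = snd x + snd y := rfl
@[simp] theorem fst_sub : fst (x - y) = fst x - fst y := rfl
@[simp] theorem snd_sub : snd (x - y) = snd x - snd y := rfl
@[simp] theorem fst_csmul (c : ℂ) : fst (c • x) = c • fst x := rfl
@[simp] theorem snd_csmul (c : ℂ) : snd (c • x) = c • snd x := rfl
@[simp] theorem fst_zsmul (c : ℤ) : fst (c • x) = c • fst x := rfl
@[simp] theorem snd_zsmul (c : ℤ) : snd (c • x) = c • snd x := rfl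
@[simp] theorem fst_zero : fst (0 : (fiberProduct p₁ p₂ ε).sec W h) = 0 := rfl
@[simp] theorem snd_zero : snd (0 : (fiberProduct p₁ p₂ ε).sec W h) = 0 := rfl
@[simp] theorem fst_res (i : V ≤ W) : fst ((fiberProduct p₁ p₂ ε).res h i x) = E₁.res h i (fst x) :=
  rfl
@[simp] theorem snd_res (i : V ≤ W) : snd ((fiberProduct p₁ p₂ ε).res h i x) = E₂.res h i (snd x) :=
  rfl
@[simp] theorem fst_act (f : Fn O W) :
    fst ((fiberProduct p₁ p₂ ε).act h f x) = E₁.act h f (fst x) := rfl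
@[simp] theorem snd_act (f : Fn O W) :
    snd ((fiberProduct p₁ p₂ ε).act h f x) = E₂.act h f (snd x) := rfl
@[simp] theorem fst_bracket :
    fst ((fiberProduct p₁ p₂ ε).bracket h x y) = E₁.bracket h (fst x) (fst y) := rfl
@[simp] theorem snd_bracket :
    snd ((fiberProduct p₁ p₂ ε).bracket h x y) = E₂.bracket h (snd x) (snd y) := rfl
@[simp] theorem anchor_eq : (fiberProduct p₁ p₂ ε).anchor h x = E₁.anchor h (fst x) := rfl
@[simp] theorem pairing_eq : (fiberProduct p₁ p₂ ε).pairing h x y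
    = E₁.pairing h (fst x) (fst y) + ε • E₂.pairing h (snd x) (snd y) := rfl
@[simp] theorem fst_der (f : Fn O W) : fst ((fiberProduct p₁ p₂ ε).der h f) = E₁.der h f := rfl
@[simp] theorem snd_der (f : Fn O W) : snd ((fiberProduct p₁ p₂ ε).der h f) = 0 := rfl
@[simp] theorem fst_inc (α : Form O 1 W) : fst ((fiberProduct p₁ p₂ ε).inc h α) = E₁.inc h α := rfl
@[simp] theorem snd_inc (α : Form O 1 W) : snd ((fiberProduct p₁ p₂ ε).inc h α) = 0 := rfl

end

/-- Levels add up: modulo the sections `(α, -ε α)`, the fiber product of algebroids of levels `k₁`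
and `k₂` has level `k₁ + ε k₂`. -/
theorem fiberProduct_isLevel {k₁ k₂ : ℤ} (hE₁ : E₁.IsAlg k₁) (hE₂ : E₂.IsAlg k₂)
    (hε : ε * ε = 1) (K : (fiberProduct p₁ p₂ ε).Ideal)
    (hK : ∀ {W : Opens X} (h : W ≤ U) (α : Form O 1 W) (x : (fiberProduct p₁ p₂ ε).sec W h),
      fst x = E₁.inc h α → snd x = -(ε • E₂.inc h α) → x ∈ K.mem h) :
    IsLevel (k₁ + ε * k₂) (fiberProduct p₁ p₂ ε) fun h a b => a - b ∈ K.mem h := by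
  have triv : ∀ {W : Opens X} (h : W ≤ U) {x y : (fiberProduct p₁ p₂ ε).sec W h},
      fst x = fst y → snd x = snd y → x - y ∈ K.mem h := by
    intro W h x y a b
    rw [fiber_ext a b, sub_self]
    exact zero_mem _
  have hεε : ∀ {W : Opens X} (h : W ≤ U) (e : E₂.sec W h), ε • ε • e = e := by
    intro W h e
    rw [smul_smul, hε, one_smul]
  exact
  { one_act := fun h v => triv h (hE₁.one_act h _) (hE₂.one_act h _)
    act_act := fun h f g v => by
      set ω := (E₁.anchor h (fst v)).app f • Form.d g + (E₁.anchor h (fst v)).app g • Form.d f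
        with hω
      refine hK h (-(ε * k₂) • ω) _ ?_ ?_
      · simp only [fst_sub, fst_act, fst_add, fst_zsmul, anchor_eq, fst_der]
        rw [hE₁.act_act', hE₁.act_der, hE₁.act_der, ← map_add, ← hω, add_smul, map_zsmul, map_zsmul]
        module
      · simp only [snd_sub, snd_act, snd_add, snd_zsmul, anchor_eq, snd_der, map_zero, add_zero,
          smul_zero]
        rw [hE₂.act_act', ← anchor_fst, ← hω, map_zsmul, map_zsmul]
        simp only [neg_smul, mul_smul, smul_neg, neg_neg]
        rw [hεε, add_sub_cancel_left]
    jacobi := fun h a b c => triv h (hE₁.jacobi h _ _ _) (hE₂.jacobi h _ _ _)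
    anchor_bracket := fun h _ _ => hE₁.anchor_bracket h _ _
    pairing_symm := fun h v v' => by
      simp only [pairing_eq]
      rw [hE₁.pairing_symm, hE₂.pairing_symm]
    anchor_der := fun h f => hE₁.anchor_der h f
    bracket_act := fun h v v' f => triv h (hE₁.bracket_act h _ _ f) (by
      simp only [snd_bracket, snd_act, snd_add, anchor_eq]
      rw [hE₂.bracket_act, anchor_fst])
    bracket_symm := fun h v v' => by
      refine hK h (-(ε • Form.d (E₂.pairing h (snd v) (snd v')))) _ ?_ ?_
      · simp only [fst_sub, fst_bracket, fst_add, fst_der, pairing_eq]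
        rw [hE₁.bracket_symm, map_add, map_neg, map_zsmul, map_zsmul, hE₁.inc_d]
        abel
      · simp only [snd_sub, snd_bracket, snd_add, snd_der, sub_zero]
        rw [hE₂.bracket_symm, map_neg, map_zsmul, hE₂.inc_d, smul_neg, neg_neg, hεε]
    anchor_act := fun h f v => hE₁.anchor_act h f _
    pairing_act := fun h f v v' => by
      simp only [pairing_eq, fst_act, snd_act, anchor_eq]
      rw [hE₁.pairing_act, hE₂.pairing_act, ← anchor_fst, ← anchor_fst]
      simp only [smul_sub, add_smul, mul_smul, mul_add, mul_smul_comm]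
      abel
    pairing_invariant := fun h v v₁ v₂ => by
      simp only [pairing_eq, fst_bracket, snd_bracket, anchor_eq]
      rw [map_add, hE₁.pairing_invariant, anchor_fst, map_zsmul, hE₂.pairing_invariant, smul_add]
      abel
    der_mul := fun h f g => triv h (hE₁.der_mul h f g) (by simp)
    bracket_der := fun h v f => triv h (hE₁.bracket_der h _ f) (by simp)
    pairing_der := fun h v f => by
      simp only [pairing_eq, fst_der, snd_der, map_zero, smul_zero, add_zero]
      exact hE₁.pairing_der h _ f
    inc_act := fun h f α => triv h (hE₁.inc_act h f α) (by simp)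
    inc_d := fun h f => triv h (hE₁.inc_d h f) rfl }

end fiberProduct

end Algebroid

end

section

/-! ### Homomorphisms defined by relations -/

namespace SheafOn.LinRel

variable {U : Opens X} {F G : SheafOn U} (R : LinRel F G)

theorem exists_rel {W : Opens X} (h : W ≤ U) (x : F.sec W h) (p : X) (hp : p ∈ W) :
    ∃ (V : Opens X) (i : V ≤ W) (_ : p ∈ V),
      R.rel (i.trans h) (F.res h i x) (G.res h i (R.toFun h x)) := by
  obtain ⟨V, i, hpV, y, r⟩ := R.total h x p hp
  refine ⟨V, i, hpV, ?_⟩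
  rw [← R.toFun_res, R.toFun_eq _ r]
  exact r

theorem exists_rel₂ {W : Opens X} (h : W ≤ U) (x y : F.sec W h) (p : X) (hp : p ∈ W) :
    ∃ (V : Opens X) (i : V ≤ W) (_ : p ∈ V),
      R.rel (i.trans h) (F.res h i x) (G.res h i (R.toFun h x)) ∧
      R.rel (i.trans h) (F.res h i y) (G.res h i (R.toFun h y)) := by
  obtain ⟨V, i, hpV, r⟩ := R.exists_rel h x p hp
  obtain ⟨V', i', hpV', r'⟩ := R.exists_rel h y p hp
  have s := R.res _ (inf_le_left : V ⊓ V' ≤ V) r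
  have s' := R.res _ (inf_le_right : V ⊓ V' ≤ V') r'
  rw [F.res_res, G.res_res] at s s'
  exact ⟨V ⊓ V', inf_le_left.trans i, ⟨hpV, hpV'⟩, s, s'⟩

end SheafOn.LinRel

namespace Algebroid

variable {O : StructureSheaf X} {U : Opens X}

/-- A relation between the sections of two algebroids which is compatible with all operations,
functional, and locally everywhere defined: the local form of a homomorphism. -/
structure HomRel (E E' : Algebroid O U) extends SheafOn.LinRel E.toSheafOn E'.toSheafOn where
  act : ∀ {W : Opens X} (h : W ≤ U) (f : Fn O W) {e : E.sec W h} {e' : E'.sec W h},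
    rel h e e' → rel h (E.act h f e) (E'.act h f e')
  bracket : ∀ {W : Opens X} (h : W ≤ U) {a b : E.sec W h} {a' b' : E'.sec W h},
    rel h a a' → rel h b b' → rel h (E.bracket h a b) (E'.bracket h a' b')
  anchor : ∀ {W : Opens X} (h : W ≤ U) {e : E.sec W h} {e' : E'.sec W h},
    rel h e e' → E'.anchor h e' = E.anchor h e
  pairing : ∀ {W : Opens X} (h : W ≤ U) {a b : E.sec W h} {a' b' : E'.sec W h},
    rel h a a' → rel h b b' → E'.pairing h a' b' = E.pairing h a b
  der : ∀ {W : Opens X} (h : W ≤ U) (f : Fn O W), rel h (E.der h f) (E'.der h f)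

namespace HomRel

variable {E E' : Algebroid O U} (R : HomRel E E')

/-- The homomorphism given by a relation. -/
def toHom : Hom E E' where
  app := R.toFun
  app_res := R.toFun_res
  app_act h f e := by
    refine E'.eq_of_local h fun p hp => ?_
    obtain ⟨V, i, hpV, r⟩ := R.exists_rel h e p hp
    refine ⟨V, i, hpV, ?_⟩
    rw [← R.toFun_res, E.res_act, E'.res_act]
    exact R.toFun_eq _ (R.act _ _ r)
  app_bracket h a b := by
    refine E'.eq_of_local h fun p hp => ?_
    obtain ⟨V, i, hpV, r, r'⟩ := R.exists_rel₂ h a b p hp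
    refine ⟨V, i, hpV, ?_⟩
    rw [← R.toFun_res, E.res_bracket, E'.res_bracket]
    exact R.toFun_eq _ (R.bracket _ r r')
  anchor_app h e := by
    refine VF.eq_of_local fun p hp => ?_
    obtain ⟨V, i, hpV, r⟩ := R.exists_rel h e p hp
    refine ⟨V, i, hpV, ?_⟩
    rw [E.res_anchor, E'.res_anchor]
    exact R.anchor _ r
  pairing_app h a b := by
    refine Fn.eq_of_local O fun p hp => ?_
    obtain ⟨V, i, hpV, r, r'⟩ := R.exists_rel₂ h a b p hp
    refine ⟨V, i, hpV, ?_⟩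
    rw [E.res_pairing, E'.res_pairing]
    exact R.pairing _ r r'
  app_der h f := R.toFun_eq h (R.der h f)

theorem toHom_eq {W : Opens X} (h : W ≤ U) {e : E.sec W h} {e' : E'.sec W h} (r : R.rel h e e') :
    R.toHom.app h e = e' := R.toFun_eq h r

end HomRel

namespace Hom

variable {E E' : Algebroid O U}

theorem ext_app {φ ψ : Hom E E'}
    (H : ∀ {W : Opens X} (h : W ≤ U) (e : E.sec W h), φ.app h e = ψ.app h e) : φ = ψ := by
  ext W h e
  exact H h e

theorem app_inc (hO : IsSmooth O) {k k' : ℤ} (hE : E.IsAlg k) (hE' : E'.IsAlg k') (φ : Hom E E')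
    {W : Opens X} (h : W ≤ U) (α : Form O 1 W) : φ.app h (E.inc h α) = E'.inc h α := by
  refine hO.form_induction (U := U) (P := fun h α => φ.app h (E.inc h α) = E'.inc h α)
    (fun h α H => E'.eq_of_local h fun p hp => ?_) (fun h => by simp)
    (fun h α β a b => by simp only [map_add, a, b])
    (fun h f g => by rw [hE.inc_act, hE'.inc_act, φ.app_act, hE.inc_d, hE'.inc_d, φ.app_der]) h α
  obtain ⟨V, i, hpV, e⟩ := H p hp
  exact ⟨V, i, hpV, by rw [← φ.app_res, E.res_inc, E'.res_inc, e]⟩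

/-- A homomorphism is injective if it is compatible with maps to `A` whose kernels are `Ω¹`. -/
theorem injective_of_mapTo (hO : IsSmooth O) {k k' : ℤ} (hE : E.IsAlg k) (hE' : E'.IsAlg k')
    (hs' : E'.AnchorSurj) {A : LieAlgebroid O} (φ : Hom E E') (p : MapTo A E) (p' : MapTo A E')
    (hp : ∀ {W : Opens X} (h : W ≤ U) (e : E.sec W h), p'.app h (φ.app h e) = p.app h e)
    (hker : ∀ {W : Opens X} (h : W ≤ U) (e : E.sec W h), p.app h e = 0 → ∃ α, e = E.inc h α)
    {W : Opens X} (h : W ≤ U) : Function.Injective (φ.app h) := by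
  refine (injective_iff_map_eq_zero _).2 fun e he => ?_
  obtain ⟨α, rfl⟩ := hker h e (by rw [← hp, he, map_zero])
  rw [φ.app_inc hO hE hE'] at he
  rw [(map_eq_zero_iff _ (hE'.inc_injective hO hs' h)).1 he, map_zero]

theorem surj_of_mapTo (hO : IsSmooth O) {k k' : ℤ} (hE : E.IsAlg k) (hE' : E'.IsAlg k')
    {A : LieAlgebroid O} (φ : Hom E E') (p : MapTo A E) (p' : MapTo A E')
    (hp : ∀ {W : Opens X} (h : W ≤ U) (e : E.sec W h), p'.app h (φ.app h e) = p.app h e)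
    (hker' : ∀ {W : Opens X} (h : W ≤ U) (e : E'.sec W h), p'.app h e = 0 → ∃ α, e = E'.inc h α)
    (hs : ∀ {W : Opens X} (h : W ≤ U) (a : A.Sec W), ∀ x ∈ W,
      ∃ (V : Opens X) (i : V ≤ W) (_ : x ∈ V) (e : E.sec V (i.trans h)),
        p.app (i.trans h) e = A.res le_top i a)
    {W : Opens X} (h : W ≤ U) (e' : E'.sec W h) (x : X) (hx : x ∈ W) :
    ∃ (V : Opens X) (i : V ≤ W) (_ : x ∈ V) (e : E.sec V (i.trans h)),
      φ.app (i.trans h) e = E'.res h i e' := by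
  obtain ⟨V, i, hxV, e, he⟩ := hs h (p'.app h e') x hx
  obtain ⟨α, hα⟩ := hker' (i.trans h) (E'.res h i e' - φ.app (i.trans h) e) (by
    rw [map_sub, p'.app_res, hp, he, sub_self])
  refine ⟨V, i, hxV, e + E.inc _ α, ?_⟩
  rw [map_add, φ.app_inc hO hE hE', ← hα, add_sub_cancel]

/-- A bijective homomorphism is an isomorphism. -/
theorem exists_inverse (φ : Hom E E')
    (hinj : ∀ {W : Opens X} (h : W ≤ U), Function.Injective (φ.app h))
    (hsurj : ∀ {W : Opens X} (h : W ≤ U) (e' : E'.sec W h), ∀ x ∈ W,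
      ∃ (V : Opens X) (i : V ≤ W) (_ : x ∈ V) (e : E.sec V (i.trans h)),
        φ.app (i.trans h) e = E'.res h i e') :
    ∃ ψ : Hom E' E, φ.comp ψ = Hom.id E ∧ ψ.comp φ = Hom.id E' := by
  let R : HomRel E' E :=
    { rel := fun h e' e => φ.app h e = e'
      res := fun h i e' e r => by rw [φ.app_res, r]
      add := fun h a b a' b' r s => by rw [map_add, r, s]
      smul := fun h c a b r => by rw [map_smul, r]
      uniq := fun h e r => hinj h (by rw [r, map_zero])
      total := fun h e' x hx => by
        obtain ⟨V, i, hxV, e, he⟩ := hsurj h e' x hx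
        exact ⟨V, i, hxV, e, he⟩
      act := fun h f e e' r => by rw [φ.app_act, r]
      bracket := fun h a b a' b' r s => by rw [φ.app_bracket, r, s]
      anchor := fun h e e' r => by rw [← r, φ.anchor_app]
      pairing := fun h a b a' b' r s => by rw [← r, ← s, φ.pairing_app]
      der := fun h f => φ.app_der h f }
  have key : ∀ {W : Opens X} (h : W ≤ U) (e : E.sec W h), R.toHom.app h (φ.app h e) = e :=
    fun h e => R.toHom_eq h rfl
  refine ⟨R.toHom, ext_app fun h e => key h e, ext_app fun h e' => ?_⟩
  refine E'.eq_of_local h fun x hx => ?_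
  obtain ⟨V, i, hxV, e, he⟩ := hsurj h e' x hx
  refine ⟨V, i, hxV, ?_⟩
  rw [← app_res]
  exact (congrArg (fun y => φ.app (i.trans h) (R.toHom.app (i.trans h) y)) he.symm).trans
    ((congrArg (φ.app (i.trans h)) (key _ e)).trans he)

end Hom

/-! ### Combinations -/

namespace Combination

variable {ε : ℤ} {E₁ E₂ E E₁' E₂' E' : Algebroid O U} (κ : Combination ε E₁ E₂ E)

theorem congr {W : Opens X} {h : W ≤ U} {a a' : E₁.sec W h} {b b' : E₂.sec W h}
    (ha : a = a') (hb : b = b') (w : E₁.anchor h a = E₂.anchor h b)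
    (w' : E₁.anchor h a' = E₂.anchor h b') : κ.map h a b w = κ.map h a' b' w' := by
  subst ha hb
  rfl

theorem map_zero {W : Opens X} (h : W ≤ U) (w : E₁.anchor h 0 = E₂.anchor h 0) :
    κ.map h 0 0 w = 0 := by
  have := κ.map_add h 0 0 0 0 w w (by simp)
  rw [κ.congr (add_zero 0) (add_zero 0) _ w] at this
  exact left_eq_add.1 this

theorem map_sub {W : Opens X} (h : W ≤ U) (a a' : E₁.sec W h) (b b' : E₂.sec W h)
    (w : E₁.anchor h a = E₂.anchor h b) (w' : E₁.anchor h a' = E₂.anchor h b')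
    (w'' : E₁.anchor h (a - a') = E₂.anchor h (b - b')) :
    κ.map h (a - a') (b - b') w'' = κ.map h a b w - κ.map h a' b' w' := by
  rw [eq_sub_iff_add_eq, ← κ.map_add h _ _ _ _ w'' w' (by simpa using w)]
  exact κ.congr (by abel) (by abel) _ _

theorem eq_of_map_eq {W : Opens X} (h : W ≤ U) {a a' : E₁.sec W h} {b b' : E₂.sec W h}
    {w : E₁.anchor h a = E₂.anchor h b} {w' : E₁.anchor h a' = E₂.anchor h b'}
    (H : κ.map h a b w = κ.map h a' b' w') :
    ∃ α : Form O 1 W, a - a' = E₁.inc h α ∧ b - b' = -(ε • E₂.inc h α) := by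
  rw [← κ.ker h (a - a') (b - b') (by rw [_root_.map_sub, _root_.map_sub, w, w']),
    κ.map_sub h _ _ _ _ w w', H, sub_self]

section inc

variable {k₁ k₂ k : ℤ} (hO : IsSmooth O) (hE₁ : E₁.IsAlg k₁) (hE₂ : E₂.IsAlg k₂) (hE : E.IsAlg k)
include hO hE₁ hE

/-- The class of `(α, 0)` is the 1-form `α`. -/
theorem map_inc_zero {W : Opens X} (h : W ≤ U) (α : Form O 1 W)
    (w : E₁.anchor h (E₁.inc h α) = E₂.anchor h 0) : κ.map h (E₁.inc h α) 0 w = E.inc h α := by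
  revert w
  refine hO.form_induction (U := U) (P := fun h α => ∀ w, κ.map h (E₁.inc h α) 0 w = E.inc h α)
    (fun h α H w => E.eq_of_local h fun p hp => ?_) (fun h w => ?_)
    (fun h α β a b w => ?_) (fun h f g w => ?_) h α
  · obtain ⟨V, i, hpV, e⟩ := H p hp
    refine ⟨V, i, hpV, ?_⟩
    have w' : E₁.anchor (i.trans h) (E₁.inc _ (Form.res i α)) = E₂.anchor (i.trans h) 0 := by
      rw [hE₁.anchor_inc hO, _root_.map_zero]
    rw [E.res_inc, ← e w', ← κ.map_res h i _ _ w (by rw [E₁.res_inc, _root_.map_zero, w'])]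
    exact κ.congr (E₁.res_inc _ _ _) (_root_.map_zero _) _ _
  · rw [_root_.map_zero (E.inc h), ← κ.map_zero h (by simp)]
    exact κ.congr (_root_.map_zero _) rfl _ _
  · have wα : E₁.anchor h (E₁.inc h α) = E₂.anchor h 0 := by
      rw [hE₁.anchor_inc hO, _root_.map_zero]
    have wβ : E₁.anchor h (E₁.inc h β) = E₂.anchor h 0 := by
      rw [hE₁.anchor_inc hO, _root_.map_zero]
    rw [_root_.map_add (E.inc h), ← a wα, ← b wβ, ← κ.map_add h _ _ _ _ wα wβ (by simp [wα, wβ])]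
    exact κ.congr (_root_.map_add _ _ _) (add_zero _).symm _ _
  · have w' : E₁.anchor h (E₁.der h g) = E₂.anchor h (E₂.der h 0) := by
      rw [hE₁.anchor_der, _root_.map_zero, _root_.map_zero]
    have := κ.map_der h g 0 w'
    rw [_root_.map_zero (E.der h), smul_zero, add_zero] at this
    rw [hE.inc_act, hE.inc_d, ← this, ← κ.map_act h f _ _ w' (by
      rw [hE₁.anchor_act, hE₁.anchor_der, smul_zero]; simp)]
    exact κ.congr (by rw [hE₁.inc_act, hE₁.inc_d]) (by simp) _ _

theorem map_inc {W : Opens X} (h : W ≤ U) (α β : Form O 1 W)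
    (w : E₁.anchor h (E₁.inc h α) = E₂.anchor h (E₂.inc h β)) (hε : ε * ε = 1) :
    κ.map h (E₁.inc h α) (E₂.inc h β) w = E.inc h (α + ε • β) := by
  have w₁ : E₁.anchor h (E₁.inc h (α + ε • β)) = E₂.anchor h 0 := by
    rw [hE₁.anchor_inc hO, _root_.map_zero]
  rw [← κ.map_inc_zero hO hE₁ hE h (α + ε • β) w₁, ← sub_eq_zero, ← κ.map_sub h _ _ _ _ w w₁ (by
    rw [_root_.map_sub, _root_.map_sub, w, w₁]), κ.ker]
  refine ⟨-(ε • β), by rw [_root_.map_add, map_neg]; abel, ?_⟩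
  rw [map_neg, map_zsmul, smul_neg, neg_neg, smul_smul, hε, one_smul, sub_zero]

include hE₂ in
theorem map_add_inc {W : Opens X} (h : W ≤ U) (a : E₁.sec W h) (b : E₂.sec W h) (α β : Form O 1 W)
    (w : E₁.anchor h a = E₂.anchor h b)
    (w' : E₁.anchor h (a + E₁.inc h α) = E₂.anchor h (b + E₂.inc h β)) (hε : ε * ε = 1) :
    κ.map h (a + E₁.inc h α) (b + E₂.inc h β) w' = κ.map h a b w + E.inc h (α + ε • β) := by
  rw [κ.map_add h _ _ _ _ w (by rw [hE₁.anchor_inc hO, hE₂.anchor_inc hO]) w',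
    κ.map_inc hO hE₁ hE h _ _ _ hε]

end inc

theorem surj₂ {W : Opens X} (h : W ≤ U) (e e' : E.sec W h) (p : X) (hp : p ∈ W) :
    ∃ (V : Opens X) (i : V ≤ W) (_ : p ∈ V) (a a' : E₁.sec V (i.trans h))
      (b b' : E₂.sec V (i.trans h)) (w : E₁.anchor (i.trans h) a = E₂.anchor (i.trans h) b)
      (w' : E₁.anchor (i.trans h) a' = E₂.anchor (i.trans h) b'),
      κ.map (i.trans h) a b w = E.res h i e ∧ κ.map (i.trans h) a' b' w' = E.res h i e' := by
  obtain ⟨V, i, hpV, a, b, w, hab⟩ := κ.surj h e p hp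
  obtain ⟨V', j, hpV', a', b', w', hab'⟩ := κ.surj (i.trans h) (E.res h i e') p hpV
  have w₁ : E₁.anchor (j.trans (i.trans h)) (E₁.res _ j a)
      = E₂.anchor (j.trans (i.trans h)) (E₂.res _ j b) := by
    rw [← E₁.res_anchor, ← E₂.res_anchor, w]
  refine ⟨V', j.trans i, hpV', E₁.res _ j a, a', E₂.res _ j b, b', w₁, w', ?_, ?_⟩
  · rw [← E.res_res h i j, ← hab]
    exact κ.map_res _ j a b w w₁
  · rw [← E.res_res h i j]
    exact hab'

include κ in
theorem anchorSurj (h₁ : E₁.AnchorSurj) (h₂ : E₂.AnchorSurj) : E.AnchorSurj := by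
  intro W h ξ p hp
  obtain ⟨V, i, hpV, a, ha⟩ := h₁ h ξ p hp
  obtain ⟨V', j, hpV', b, hb⟩ := h₂ (i.trans h) (VF.res i ξ) p hpV
  have w : E₁.anchor (j.trans (i.trans h)) (E₁.res _ j a) = E₂.anchor (j.trans (i.trans h)) b := by
    rw [← E₁.res_anchor, ha, hb]
  refine ⟨V', j.trans i, hpV', κ.map _ _ b w, ?_⟩
  rw [κ.anchor_map, w]
  exact hb.trans (VF.res_res _ _ _)

theorem _root_.Algebroids.Algebroid.IsLevel.const_act {k : ℤ} (hE : E.IsAlg k) {W : Opens X}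
    (h : W ≤ U) (c : ℂ) (e : E.sec W h) : E.act h (c • 1) e = c • e := by
  rw [LinearMap.map_smul₂, hE.one_act]

theorem map_csmul {k₁ k₂ k : ℤ} (hE₁ : E₁.IsAlg k₁) (hE₂ : E₂.IsAlg k₂) (hE : E.IsAlg k)
    {W : Opens X} (h : W ≤ U) (c : ℂ) (a : E₁.sec W h) (b : E₂.sec W h)
    (w : E₁.anchor h a = E₂.anchor h b) (w' : E₁.anchor h (c • a) = E₂.anchor h (c • b)) :
    κ.map h (c • a) (c • b) w' = c • κ.map h a b w := by
  rw [← hE.const_act, ← κ.map_act h _ _ _ w (by rw [hE₁.anchor_act, hE₂.anchor_act, w])]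
  exact κ.congr (hE₁.const_act _ _ _).symm (hE₂.const_act _ _ _).symm _ _

theorem map_der_zero {k₁ : ℤ} (hE₁ : E₁.IsAlg k₁) {W : Opens X} (h : W ≤ U) (f : Fn O W)
    (w : E₁.anchor h (E₁.der h f) = E₂.anchor h 0) : κ.map h (E₁.der h f) 0 w = E.der h f := by
  have w' : E₁.anchor h (E₁.der h f) = E₂.anchor h (E₂.der h 0) := by
    rw [hE₁.anchor_der, _root_.map_zero, _root_.map_zero]
  have := κ.map_der h f 0 w'
  rw [_root_.map_zero (E.der h), smul_zero, add_zero] at this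
  rw [← this]
  exact κ.congr rfl (_root_.map_zero _).symm _ _

/-- A homomorphism from `E₁ + ε E₂` is determined by its values on the pairs. -/
theorem hom_ext {φ ψ : Hom E E'}
    (H : ∀ {W : Opens X} (h : W ≤ U) (a : E₁.sec W h) (b : E₂.sec W h) (w),
      φ.app h (κ.map h a b w) = ψ.app h (κ.map h a b w)) : φ = ψ := by
  refine Hom.ext_app fun h e => E'.eq_of_local h fun p hp => ?_
  obtain ⟨V, i, hpV, a, b, w, hab⟩ := κ.surj h e p hp
  exact ⟨V, i, hpV, by rw [← φ.app_res, ← ψ.app_res, ← hab, H]⟩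

/-- Restriction to a smaller open subset. -/
def restrict {U' : Opens X} (i : U' ≤ U) :
    Combination ε (E₁.restrict i) (E₂.restrict i) (E.restrict i) where
  map h := κ.map (h.trans i)
  map_res h := κ.map_res (h.trans i)
  map_add h := κ.map_add (h.trans i)
  map_act h := κ.map_act (h.trans i)
  map_bracket h := κ.map_bracket (h.trans i)
  anchor_map h := κ.anchor_map (h.trans i)
  pairing_map h := κ.pairing_map (h.trans i)
  map_der h := κ.map_der (h.trans i)
  surj h := κ.surj (h.trans i)
  ker h := κ.ker (h.trans i)

section functoriality

variable {k₁ k₂ k₁' k₂' k k' : ℤ} (hO : IsSmooth O) (hE₁ : E₁.IsAlg k₁) (hE₂ : E₂.IsAlg k₂)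
  (hE₁' : E₁'.IsAlg k₁') (hE₂' : E₂'.IsAlg k₂') (hE : E.IsAlg k) (hE' : E'.IsAlg k')
  (κ' : Combination ε E₁' E₂' E') (φ : Hom E₁ E₁') (ψ : Hom E₂ E₂')

/-- The relation `κ(a, b) ↦ κ'(φ(a), ψ(b))`. -/
def homRel : HomRel E E' where
  rel h e e' := ∃ a b w w', κ.map h a b w = e ∧ κ'.map h (φ.app h a) (ψ.app h b) w' = e'
  res := by
    rintro W V h i _ _ ⟨a, b, w, w', rfl, rfl⟩
    have w₁ : E₁.anchor (i.trans h) (E₁.res h i a) = E₂.anchor (i.trans h) (E₂.res h i b) := by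
      rw [← E₁.res_anchor, w, E₂.res_anchor]
    have w₂ : E₁'.anchor (i.trans h) (E₁'.res h i (φ.app h a))
        = E₂'.anchor (i.trans h) (E₂'.res h i (ψ.app h b)) := by
      rw [← E₁'.res_anchor, w', E₂'.res_anchor]
    refine ⟨_, _, w₁, by rw [φ.anchor_app, ψ.anchor_app, w₁], κ.map_res h i a b w w₁, ?_⟩
    rw [← κ'.map_res h i _ _ w' w₂]
    exact κ'.congr (φ.app_res h i a) (ψ.app_res h i b) _ _
  add := by
    rintro W h _ _ _ _ ⟨a, b, w, w', rfl, rfl⟩ ⟨a₁, b₁, w₁, w₁', rfl, rfl⟩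
    refine ⟨a + a₁, b + b₁, by rw [_root_.map_add, _root_.map_add, w, w₁],
      by rw [_root_.map_add, _root_.map_add, _root_.map_add, _root_.map_add, w', w₁'],
      κ.map_add _ _ _ _ _ _ _ _, ?_⟩
    rw [← κ'.map_add h _ _ _ _ w' w₁' (by rw [_root_.map_add, _root_.map_add, w', w₁'])]
    exact κ'.congr (_root_.map_add _ _ _) (_root_.map_add _ _ _) _ _
  smul := by
    rintro W h c _ _ ⟨a, b, w, w', rfl, rfl⟩
    refine ⟨c • a, c • b, by rw [map_smul, map_smul, w],
      by rw [map_smul, map_smul, map_smul, map_smul, w'], κ.map_csmul hE₁ hE₂ hE h c a b w _, ?_⟩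
    rw [← κ'.map_csmul hE₁' hE₂' hE' h c _ _ w' (by rw [map_smul, map_smul, w'])]
    exact κ'.congr (map_smul _ _ _) (map_smul _ _ _) _ _
  uniq := by
    rintro W h _ ⟨a, b, w, w', h0, rfl⟩
    obtain ⟨α, rfl, rfl⟩ := (κ.ker h a b w).1 h0
    refine (κ'.ker h _ _ _).2 ⟨α, φ.app_inc hO hE₁ hE₁' h α, ?_⟩
    rw [map_neg, map_zsmul, ψ.app_inc hO hE₂ hE₂']
  total h e p hp := by
    obtain ⟨V, i, hpV, a, b, w, hab⟩ := κ.surj h e p hp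
    exact ⟨V, i, hpV, _, a, b, w, by rw [φ.anchor_app, ψ.anchor_app, w], hab, rfl⟩
  act := by
    rintro W h f _ _ ⟨a, b, w, w', rfl, rfl⟩
    refine ⟨E₁.act h f a, E₂.act h f b, by rw [hE₁.anchor_act, hE₂.anchor_act, w], by
      rw [φ.app_act, ψ.app_act, hE₁'.anchor_act, hE₂'.anchor_act, w'], κ.map_act _ _ _ _ _ _, ?_⟩
    rw [← κ'.map_act h f _ _ w' (by rw [hE₁'.anchor_act, hE₂'.anchor_act, w'])]
    exact κ'.congr (φ.app_act _ _ _) (ψ.app_act _ _ _) _ _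
  bracket := by
    rintro W h _ _ _ _ ⟨a, b, w, w', rfl, rfl⟩ ⟨a₁, b₁, w₁, w₁', rfl, rfl⟩
    refine ⟨E₁.bracket h a a₁, E₂.bracket h b b₁,
      by rw [hE₁.anchor_bracket, hE₂.anchor_bracket, w, w₁], by
      rw [φ.app_bracket, ψ.app_bracket, hE₁'.anchor_bracket, hE₂'.anchor_bracket, w', w₁'],
      κ.map_bracket _ _ _ _ _ _ _ _, ?_⟩
    rw [← κ'.map_bracket h _ _ _ _ w' w₁' (by
      rw [hE₁'.anchor_bracket, hE₂'.anchor_bracket, w', w₁'])]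
    exact κ'.congr (φ.app_bracket _ _ _) (ψ.app_bracket _ _ _) _ _
  anchor := by
    rintro W h _ _ ⟨a, b, w, w', rfl, rfl⟩
    rw [κ'.anchor_map, κ.anchor_map, φ.anchor_app]
  pairing := by
    rintro W h _ _ _ _ ⟨a, b, w, w', rfl, rfl⟩ ⟨a₁, b₁, w₁, w₁', rfl, rfl⟩
    rw [κ'.pairing_map, κ.pairing_map, φ.pairing_app, ψ.pairing_app]
  der h f := by
    have w : E₁.anchor h (E₁.der h f) = E₂.anchor h 0 := by rw [hE₁.anchor_der, _root_.map_zero]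
    have w' : E₁'.anchor h (E₁'.der h f) = E₂'.anchor h 0 := by
      rw [hE₁'.anchor_der, _root_.map_zero]
    refine ⟨_, 0, w, by rw [φ.anchor_app, ψ.anchor_app, w], κ.map_der_zero hE₁ h f w, ?_⟩
    rw [← κ'.map_der_zero hE₁' h f w']
    exact κ'.congr (φ.app_der _ _) (_root_.map_zero _) _ _

/-- The homomorphism `κ(a, b) ↦ κ'(φ(a), ψ(b))`. -/
def mapHom : Hom E E' := (κ.homRel hO hE₁ hE₂ hE₁' hE₂' hE hE' κ' φ ψ).toHom

theorem mapHom_map {W : Opens X} (h : W ≤ U) (a : E₁.sec W h) (b : E₂.sec W h) (w) (w') :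
    (κ.mapHom hO hE₁ hE₂ hE₁' hE₂' hE hE' κ' φ ψ).app h (κ.map h a b w)
      = κ'.map h (φ.app h a) (ψ.app h b) w' :=
  HomRel.toHom_eq _ h ⟨a, b, w, w', rfl, rfl⟩

end functoriality

end Combination

end Algebroid

end

section

namespace Algebroid

variable {O : StructureSheaf X} {U : Opens X}

/-! ### Sums and differences over the tangent sheaf -/

theorem isOmega_of_local {E : Algebroid O U} {W : Opens X} (h : W ≤ U) (e : E.sec W h)
    (H : ∀ p ∈ W, ∃ (V : Opens X) (i : V ≤ W) (_ : p ∈ V), E.IsOmega (i.trans h) (E.res h i e)) :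
    E.IsOmega h e := by
  intro p hp
  obtain ⟨V, i, hpV, e'⟩ := H p hp
  obtain ⟨V', j, hpV', m⟩ := e' p hpV
  refine ⟨V', j.trans i, hpV', ?_⟩
  rwa [E.res_res] at m

section diag

variable {A : LieAlgebroid O} {E₁ E₂ : Algebroid O U} (p₁ : MapTo A E₁) (p₂ : MapTo A E₂) {ε : ℤ}
  {k₁ k₂ : ℤ} (hO : IsSmooth O) (hE₁ : E₁.IsAlg k₁) (hE₂ : E₂.IsAlg k₂) (hs : E₁.AnchorSurj)
  (hε : ε * ε = 1)

/-- The ideal of the sections `(α, -ε α)`, `α ∈ Ω¹`, of the fiber product. -/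
def diagIdeal : (fiberProduct p₁ p₂ ε).Ideal where
  mem {W} h :=
    { carrier := {x | ∃ α : Form O 1 W, fst x = E₁.inc h α ∧ snd x = -(ε • E₂.inc h α)}
      add_mem' := by
        rintro x y ⟨α, a, b⟩ ⟨β, a', b'⟩
        refine ⟨α + β, by rw [fst_add, a, a', map_add], ?_⟩
        rw [snd_add, b, b', map_add, smul_add, neg_add]
      zero_mem' := ⟨0, by simp, by simp⟩
      smul_mem' := by
        rintro c x ⟨α, a, b⟩
        refine ⟨c • α, by rw [fst_csmul, a, map_smul], ?_⟩
        rw [snd_csmul, b, map_smul, smul_neg, smul_comm] }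
  res_mem := by
    rintro W V h i x ⟨α, a, b⟩
    refine ⟨Form.res i α, by rw [fst_res, a, E₁.res_inc], ?_⟩
    rw [snd_res, b, map_neg, map_zsmul, E₂.res_inc]
  local_mem := by
    intro W h x H
    obtain ⟨α, hα⟩ := Form.exists_of_local
      (fun V i α => E₁.res h i (fst x) = E₁.inc (i.trans h) α
        ∧ E₂.res h i (snd x) = -(ε • E₂.inc (i.trans h) α))
      (fun V i α hα V' j => by
        rw [← E₁.res_res h i j, hα.1, E₁.res_inc, ← E₂.res_res h i j, hα.2, map_neg, map_zsmul,
          E₂.res_inc]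
        exact ⟨rfl, rfl⟩)
      (fun V i α β a b => hE₁.inc_injective hO hs _ (a.1.symm.trans b.1)) H
    refine ⟨α, E₁.eq_of_local h fun p hp => ?_, E₂.eq_of_local h fun p hp => ?_⟩
    · obtain ⟨V, i, hpV, β, hβ⟩ := H p hp
      exact ⟨V, i, hpV, by rw [E₁.res_inc, hα V i β hβ]; exact hβ.1⟩
    · obtain ⟨V, i, hpV, β, hβ⟩ := H p hp
      exact ⟨V, i, hpV, by rw [map_neg, map_zsmul, E₂.res_inc, hα V i β hβ]; exact hβ.2⟩
  act_mem := by
    rintro W h f x ⟨α, a, b⟩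
    refine ⟨f • α, by rw [fst_act, a, hE₁.act_inc], ?_⟩
    rw [snd_act, b, map_neg, map_zsmul, hE₂.act_inc]
  bracket_mem := by
    rintro W h y x ⟨α, a, b⟩
    refine ⟨Form.lie (E₁.anchor h (fst y)) α, by rw [fst_bracket, a, hE₁.bracket_inc hO], ?_⟩
    rw [snd_bracket, b, map_neg, map_zsmul, hE₂.bracket_inc hO, anchor_fst]
  mem_bracket := by
    rintro W h y x ⟨α, a, b⟩
    refine ⟨Form.d (Form.ev α (E₁.anchor h (fst y))) - Form.lie (E₁.anchor h (fst y)) α,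
      by rw [fst_bracket, a, hE₁.inc_bracket hO], ?_⟩
    rw [snd_bracket, b, LinearMap.map_neg₂, map_zsmul, LinearMap.smul_apply, hE₂.inc_bracket hO,
      anchor_fst]
  anchor_eq_zero := by
    rintro W h x ⟨α, a, b⟩
    rw [anchor_eq, a, hE₁.anchor_inc hO]
  pairing_eq_zero := by
    rintro W h y x ⟨α, a, b⟩
    rw [pairing_eq, a, b, map_neg, map_zsmul, hE₁.pairing_inc hO, hE₂.pairing_inc hO, anchor_fst,
      smul_neg, smul_smul, hε, one_smul, add_neg_cancel]
  eq_zero_pairing := by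
    rintro W h y x ⟨α, a, b⟩
    rw [pairing_eq, a, b, LinearMap.map_neg₂, map_zsmul, LinearMap.smul_apply, hE₁.inc_pairing hO,
      hE₂.inc_pairing hO, anchor_fst, smul_neg, smul_smul, hε, one_smul, add_neg_cancel]

end diag

section combine

variable {E₁ E₂ E : Algebroid O U} {ε : ℤ} {k₁ k₂ k : ℤ} (hO : IsSmooth O) (hE₁ : E₁.IsAlg k₁)
  (hE₂ : E₂.IsAlg k₂) (hs : E₁.AnchorSurj) (hε : ε * ε = 1)

/-- The ideal by which `E₁ ×_T E₂` is divided to obtain `E₁ + ε E₂`. -/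
abbrev combIdeal : (fiberProduct (anchorMap hO hE₁) (anchorMap hO hE₂) ε).Ideal :=
  diagIdeal _ _ hO hE₁ hE₂ hs hε

/-- The combination `E₁ + ε E₂`. -/
def combine : Algebroid O U := Algebroid.quot _ (combIdeal hO hE₁ hE₂ hs hε)

theorem combine_isAlg : (combine hO hE₁ hE₂ hs hε).IsAlg (k₁ + ε * k₂) :=
  Ideal.quot_isAlg _ (fiberProduct_isLevel hE₁ hE₂ hε _ fun _ α _ a b => ⟨α, a, b⟩)

/-- The canonical map `E₁ ×_T E₂ → E₁ + ε E₂`. -/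
def combination : Combination ε E₁ E₂ (combine hO hE₁ hE₂ hs hε) where
  map h a b w := (combIdeal hO hE₁ hE₂ hs hε).proj h (pair a b w)
  map_res h i a b w w' := ((combIdeal hO hE₁ hE₂ hs hε).proj_res h i (pair a b w)).symm
  map_add h a a' b b' w w' w'' := map_add ((combIdeal hO hE₁ hE₂ hs hε).proj h) (pair a b w) (pair a' b' w')
  map_act h f a b w w' := ((combIdeal hO hE₁ hE₂ hs hε).act_proj h f (pair a b w)).symm
  map_bracket h a a' b b' w w' w'' :=
    ((combIdeal hO hE₁ hE₂ hs hε).bracket_proj h (pair a b w) (pair a' b' w')).symm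
  anchor_map h a b w := (combIdeal hO hE₁ hE₂ hs hε).anchor_proj h (pair a b w)
  pairing_map h a a' b b' w w' :=
    (combIdeal hO hE₁ hE₂ hs hε).pairing_proj h (pair a b w) (pair a' b' w')
  map_der {W} h f g w := by
    change (combIdeal hO hE₁ hE₂ hs hε).proj h (pair _ _ w)
      = (combIdeal hO hE₁ hE₂ hs hε).proj h _ + ε • (combIdeal hO hE₁ hE₂ hs hε).proj h _
    rw [← map_zsmul, ← map_add, Ideal.proj_eq_proj]
    refine ⟨-(ε • Form.d g), ?_, ?_⟩
    · change E₁.der h f - (E₁.der h f + ε • E₁.der h g) = _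
      rw [map_neg, map_zsmul, hE₁.inc_d]
      abel
    · change E₂.der h g - (0 + ε • 0) = _
      rw [map_neg, map_zsmul, hE₂.inc_d, smul_neg, neg_neg, smul_smul, hε, one_smul]
      simp
  surj h e p hp := by
    obtain ⟨V, i, hpV, x, hx⟩ := (combIdeal hO hE₁ hE₂ hs hε).exists_rep₁ h e p hp
    exact ⟨V, i, hpV, fst x, snd x, app_fst x, hx.symm⟩
  ker h a b w := (combIdeal hO hE₁ hE₂ hs hε).proj_eq_zero h (pair a b w)

end combine

namespace Combination

variable {ε : ℤ} {E₁ E₂ E : Algebroid O U} (κ : Combination ε E₁ E₂ E) {k₁ k₂ k : ℤ}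
  (hO : IsSmooth O) (hE₁ : E₁.IsAlg k₁) (hE₂ : E₂.IsAlg k₂) (hE : E.IsAlg k)
  {A : LieAlgebroid O}

/-- The presentation of `E₁ + ε E₂` as a quotient of the fiber product. -/
def locSurj : SheafOn.LocSurj
    (fiberProduct (anchorMap hO hE₁) (anchorMap hO hE₂) ε).toSheafOn E.toSheafOn where
  map h :=
    { toFun := fun x => κ.map h (fst x) (snd x) (anchor_fst x)
      map_add' := fun x y => κ.map_add h _ _ _ _ _ _ _
      map_smul' := fun c x => κ.map_csmul hE₁ hE₂ hE h c _ _ _ _ }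
  map_res h i x := κ.map_res h i _ _ _ _
  surj h e p hp := by
    obtain ⟨V, i, hpV, a, b, w, hab⟩ := κ.surj h e p hp
    exact ⟨V, i, hpV, pair a b w, hab⟩

variable (q : MapTo A (fiberProduct (anchorMap hO hE₁) (anchorMap hO hE₂) ε))
  (hq : ∀ {W : Opens X} (h : W ≤ U) (α β : Form O 1 W) (w),
    q.app h (pair (E₁.inc h α) (E₂.inc h β) w) = 0)

/-- The map from the sections of `E₁ + ε E₂` to those of `A` induced by a map from the fiber
product. -/
def descend : SheafOn.LinRel E.toSheafOn (A.toSheafOn.restrict (le_top : U ≤ ⊤)) :=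
  (κ.locSurj hO hE₁ hE₂ hE).liftRel (G := A.toSheafOn.restrict (le_top : U ≤ ⊤))
    (fun h => q.app h) (fun h i x => q.app_res h i x) (fun h x hx => by
      obtain ⟨α, a, b⟩ := (κ.ker h _ _ _).1 hx
      have := hq h α (-(ε • α)) (by
        change E₁.anchor h _ = E₂.anchor h _
        rw [hE₁.anchor_inc hO, hE₂.anchor_inc hO])
      refine (congrArg (q.app h) (fiber_ext a (b.trans ?_))).trans this
      change _ = E₂.inc h (-(ε • α))
      rw [map_neg, map_zsmul])

/-- The map of `descend`. -/
def descendApp {W : Opens X} (h : W ≤ U) : E.sec W h →ₗ[ℂ] A.Sec W :=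
  (κ.descend hO hE₁ hE₂ hE q hq).toFun h

theorem descendApp_res {W V : Opens X} (h : W ≤ U) (i : V ≤ W) (e : E.sec W h) :
    κ.descendApp hO hE₁ hE₂ hE q hq (i.trans h) (E.res h i e)
      = A.res le_top i (κ.descendApp hO hE₁ hE₂ hE q hq h e) :=
  (κ.descend hO hE₁ hE₂ hE q hq).toFun_res h i e

theorem descendApp_map {W : Opens X} (h : W ≤ U) (a : E₁.sec W h) (b : E₂.sec W h) (w) :
    κ.descendApp hO hE₁ hE₂ hE q hq h (κ.map h a b w) = q.app h (pair a b w) :=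
  SheafOn.LinRel.toFun_eq _ h ⟨pair a b w, rfl, rfl⟩

/-- The projection from `E₁ + ε E₂` to `A` induced by a map from the fiber product, provided that
the kernel of the latter is `Ω¹ × Ω¹`. -/
def projection (hs : E.AnchorSurj) (hε : ε * ε = 1)
    (hsurj : ∀ {W : Opens X} (h : W ≤ U) (a : A.Sec W), ∀ p ∈ W,
      ∃ (V : Opens X) (i : V ≤ W) (_ : p ∈ V) (x : _), q.app (i.trans h) x = A.res le_top i a)
    (hker : ∀ {W : Opens X} (h : W ≤ U) (a : E₁.sec W h) (b : E₂.sec W h) (w),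
      q.app h (pair a b w) = 0 → ∃ α β, a = E₁.inc h α ∧ b = E₂.inc h β) :
    Projection A E where
  app h := κ.descendApp hO hE₁ hE₂ hE q hq h
  app_res h i e := κ.descendApp_res hO hE₁ hE₂ hE q hq h i e
  app_act h f e := by
    refine A.eq_of_local _ fun p hp => ?_
    obtain ⟨V, i, hpV, a, b, w, hab⟩ := κ.surj h e p hp
    refine ⟨V, i, hpV, ?_⟩
    rw [← descendApp_res, E.res_act, ← hab, ← κ.map_act _ _ _ _ w (by
      rw [hE₁.anchor_act, hE₂.anchor_act, w]), descendApp_map, A.res_act, ← descendApp_res, ← hab,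
      descendApp_map]
    exact q.app_act _ _ (pair a b w)
  app_bracket h e e' := by
    refine A.eq_of_local _ fun p hp => ?_
    obtain ⟨V, i, hpV, a, a', b, b', w, w', hab, hab'⟩ := κ.surj₂ h e e' p hp
    refine ⟨V, i, hpV, ?_⟩
    rw [← descendApp_res, E.res_bracket, ← hab, ← hab', ← κ.map_bracket _ _ _ _ _ w w' (by
      rw [hE₁.anchor_bracket, hE₂.anchor_bracket, w, w']), descendApp_map, A.res_bracket,
      ← descendApp_res, ← descendApp_res, ← hab, ← hab', descendApp_map, descendApp_map]
    exact q.app_bracket _ (pair a b w) (pair a' b' w')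
  anchor_app h e := by
    refine VF.eq_of_local fun p hp => ?_
    obtain ⟨V, i, hpV, a, b, w, hab⟩ := κ.surj h e p hp
    refine ⟨V, i, hpV, ?_⟩
    rw [A.res_anchor, E.res_anchor, ← descendApp_res, ← hab, κ.anchor_map, descendApp_map]
    exact q.anchor_app _ (pair a b w)
  surj h a p hp := by
    obtain ⟨V, i, hpV, x, hx⟩ := hsurj h a p hp
    refine ⟨V, i, i.trans h, hpV, κ.map _ (fst x) (snd x) (anchor_fst x), ?_⟩
    rw [descendApp_map]
    exact hx
  ker h e := by
    constructor
    · intro he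
      refine isOmega_of_local h e fun p hp => ?_
      obtain ⟨V, i, hpV, a, b, w, hab⟩ := κ.surj h e p hp
      have r := κ.descendApp_res hO hE₁ hE₂ hE q hq h i e
      rw [he, _root_.map_zero, ← hab, descendApp_map] at r
      obtain ⟨α, β, rfl, rfl⟩ := hker _ _ _ _ r
      refine ⟨V, i, hpV, ?_⟩
      rw [← hab, κ.map_inc hO hE₁ hE _ _ _ _ hε]
      exact hE.isOmega_inc hO _ _
    · intro he
      obtain ⟨α, rfl⟩ := (hE.isOmega_iff hO hs h e).1 he
      have w : E₁.anchor h (E₁.inc h α) = E₂.anchor h 0 := by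
        rw [hE₁.anchor_inc hO, _root_.map_zero]
      rw [← κ.map_inc_zero hO hE₁ hE h α w, descendApp_map]
      exact q.app_inc h α

end Combination

end Algebroid

end

section

namespace Algebroid

variable {O : StructureSheaf X} {U : Opens X}

theorem Combination.isExact {ε : ℤ} {E₁ E₂ E : Algebroid O U} (κ : Combination ε E₁ E₂ E)
    {k₁ k₂ k : ℤ} (hO : IsSmooth O) (hE₁ : E₁.IsAlg k₁) (hE₂ : E₂.IsAlg k₂) (hE : E.IsAlg k)
    (hε : ε * ε = 1) (h₁ : E₁.IsExact) (h₂ : E₂.IsExact) : E.IsExact where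
  surj {W} h ξ p hp := by
    obtain ⟨V, i, hpV, e, he⟩ := κ.anchorSurj h₁.anchorSurj h₂.anchorSurj h ξ p hp
    exact ⟨V, i, _, hpV, e, he⟩
  ker {W} h e := by
    constructor
    · intro he
      refine isOmega_of_local h e fun p hp => ?_
      obtain ⟨V, i, hpV, a, b, w, hab⟩ := κ.surj h e p hp
      have ha : E₁.anchor (i.trans h) a = 0 := by
        rw [← κ.anchor_map _ a b w, hab, ← E.res_anchor, he, _root_.map_zero]
      obtain ⟨α, rfl⟩ := (hE₁.isOmega_iff hO h₁.anchorSurj _ _).1 ((h₁.ker _ _).1 ha)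
      obtain ⟨β, rfl⟩ := (hE₂.isOmega_iff hO h₂.anchorSurj _ _).1 ((h₂.ker _ _).1 (w ▸ ha))
      refine ⟨V, i, hpV, ?_⟩
      rw [← hab, κ.map_inc hO hE₁ hE _ _ _ _ hε]
      exact hE.isOmega_inc hO _ _
    · intro he
      obtain ⟨α, rfl⟩ := (hE.isOmega_iff hO
        (κ.anchorSurj h₁.anchorSurj h₂.anchorSurj) h e).1 he
      exact hE.anchor_inc hO h α

theorem isExact_of_ker {E : Algebroid O U} {k : ℤ} (hO : IsSmooth O) (hE : E.IsAlg k)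
    (hs : E.AnchorSurj)
    (hker : ∀ {W : Opens X} (h : W ≤ U) (e : E.sec W h), E.anchor h e = 0 → ∀ p ∈ W,
      ∃ (V : Opens X) (i : V ≤ W) (_ : p ∈ V) (α : _), E.res h i e = E.inc (i.trans h) α) :
    E.IsExact where
  surj {W} h ξ p hp := by
    obtain ⟨V, i, hpV, e, he⟩ := hs h ξ p hp
    exact ⟨V, i, _, hpV, e, he⟩
  ker {W} h e := by
    constructor
    · intro he
      refine isOmega_of_local h e fun p hp => ?_
      obtain ⟨V, i, hpV, α, hα⟩ := hker h e he p hp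
      exact ⟨V, i, hpV, hα ▸ hE.isOmega_inc hO _ _⟩
    · intro he
      obtain ⟨α, rfl⟩ := (hE.isOmega_iff hO hs h e).1 he
      exact hE.anchor_inc hO h α

/-! ### Descent along the anchor map -/

section AnchorSurj

variable {F : Algebroid O U} (hs : F.AnchorSurj)

/-- The anchor map, as a locally surjective map of sheaves. -/
def AnchorSurj.locSurj : SheafOn.LocSurj F.toSheafOn (vfSheaf O U) where
  map h := F.anchor h
  map_res h i e := (F.res_anchor h i e).symm
  surj {W} h ξ p hp := hs h (show VF O W from ξ) p hp

variable (hact : ∀ {W : Opens X} (h : W ≤ U) (f : Fn O W) (e : F.sec W h),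
  F.anchor h (F.act h f e) = f • F.anchor h e)
include hs hact

/-- Functionals on the sections of `F` which vanish on the kernel of the anchor map are given by
1-forms. -/
theorem AnchorSurj.exists_form₁ {W : Opens X} (h : W ≤ U)
    (g : ∀ (V : Opens X) (i : V ≤ W), F.sec V (i.trans h) →ₗ[ℂ] Fn O V)
    (g_res : ∀ (V : Opens X) (i : V ≤ W) (V' : Opens X) (j : V' ≤ V) (m : F.sec V (i.trans h)),
      resFn O j (g V i m) = g V' (j.trans i) (F.res _ j m))
    (g_ker : ∀ (V : Opens X) (i : V ≤ W) (m : F.sec V (i.trans h)), F.anchor _ m = 0 → g V i m = 0)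
    (g_act : ∀ (V : Opens X) (i : V ≤ W) (f : Fn O V) (m : F.sec V (i.trans h)),
      g V i (F.act _ f m) = f * g V i m) :
    ∃ β : Form O 1 W, ∀ (V : Opens X) (i : V ≤ W) (m : F.sec V (i.trans h)),
      Form.ev (Form.res i β) (F.anchor _ m) = g V i m := by
  let R : SheafOn.LinRel (vfSheaf O W) (fnSheaf O W) :=
    (AnchorSurj.locSurj (F := F.restrict h) (AnchorSurj.restrict hs h)).liftRel (G := fnSheaf O W) (fun {V} i => g V i)
      (fun {V V'} i j m => (g_res V i V' j m).symm) (fun {V} i m hm => g_ker V i m hm)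
  let φ : ∀ {V : Opens X} (_ : V ≤ W), VF O V →ₗ[ℂ] Fn O V := fun i => R.toFun i
  have φ_res : ∀ {V V' : Opens X} (i : V ≤ W) (j : V' ≤ V) (ξ : VF O V),
      resFn O j (φ i ξ) = φ (j.trans i) (VF.res j ξ) := fun i j ξ => (R.toFun_res i j ξ).symm
  have hφ : ∀ {V : Opens X} (i : V ≤ W) (m : F.sec V (i.trans h)), φ i (F.anchor _ m) = g V i m :=
    fun i m => R.toFun_eq i ⟨m, rfl, rfl⟩
  refine ⟨Form.mk₁ (fun V i => { toFun := φ i, map_add' := map_add _, map_smul' := fun f ξ => ?_ })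
    (fun V i V' j ξ => φ_res i j ξ), fun V i m => hφ i m⟩
  refine Fn.eq_of_local O fun p hp => ?_
  obtain ⟨V', j, hpV', m, hm⟩ := hs (i.trans h) ξ p hp
  refine ⟨V', j, hpV', ?_⟩
  rw [φ_res, VF.res_smul, ← hm, ← hact, hφ, g_act, RingHom.id_apply, smul_eq_mul, map_mul, φ_res,
    ← hm, hφ]

end AnchorSurj

/-! ### The radical of the pairing -/

section radical

variable {F : Algebroid O U} {K₀ : F.Ideal} {k : ℤ} (hF : IsLevel k F fun h a b => a - b ∈ K₀.mem h)

/-- The ideal of the sections which are killed by the anchor map and orthogonal to all sections. -/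
def radical : F.Ideal where
  mem {W} h :=
    { carrier := {n | F.anchor h n = 0 ∧ ∀ (V : Opens X) (i : V ≤ W) (m : F.sec V (i.trans h)),
        F.pairing (i.trans h) (F.res h i n) m = 0}
      add_mem' := by
        rintro a b ⟨ha, ha'⟩ ⟨hb, hb'⟩
        refine ⟨by rw [map_add, ha, hb, add_zero], fun V i m => ?_⟩
        rw [map_add, LinearMap.map_add₂, ha', hb', add_zero]
      zero_mem' := ⟨map_zero _, fun V i m => by rw [map_zero, LinearMap.map_zero₂]⟩
      smul_mem' := by
        rintro c a ⟨ha, ha'⟩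
        refine ⟨by rw [map_smul, ha, smul_zero], fun V i m => ?_⟩
        rw [map_smul, LinearMap.map_smul₂, ha', smul_zero] }
  res_mem := by
    rintro W V h i n ⟨hn, hn'⟩
    refine ⟨by rw [← F.res_anchor, hn, map_zero], fun V' j m => ?_⟩
    rw [F.res_res]
    exact hn' V' _ m
  local_mem := by
    intro W h n H
    refine ⟨VF.eq_of_local fun p hp => ?_, fun V i m => Fn.eq_of_local O fun p hp => ?_⟩
    · obtain ⟨V, i, hpV, e, -⟩ := H p hp
      exact ⟨V, i, hpV, by rw [F.res_anchor, e, map_zero]⟩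
    · obtain ⟨V', i', hpV', -, e⟩ := H p (i hp)
      refine ⟨V ⊓ V', inf_le_left, ⟨hp, hpV'⟩, ?_⟩
      have := e (V ⊓ V') inf_le_right (F.res _ inf_le_left m)
      rw [F.res_res] at this
      rw [F.res_pairing, F.res_res, this, map_zero]
  act_mem := by
    rintro W h f n ⟨hn, hn'⟩
    refine ⟨by rw [hF.anchor_act, hn, smul_zero], fun V i m => ?_⟩
    rw [F.res_act, hF.pairing_act, hn', ← F.res_anchor, hn]
    simp
  bracket_mem := by
    rintro W h b n ⟨hn, hn'⟩
    refine ⟨by rw [hF.anchor_bracket, hn, VF.bracket_zero], fun V i m => ?_⟩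
    have := hF.pairing_invariant (i.trans h) (F.res h i b) (F.res h i n) m
    rw [hn', hn', map_zero, add_zero] at this
    rw [F.res_bracket, ← this]
  mem_bracket := by
    rintro W h b n ⟨hn, hn'⟩
    refine ⟨by rw [hF.anchor_bracket, hn, VF.zero_bracket], fun V i m => ?_⟩
    have h₁ := hF.pairing_invariant (i.trans h) (F.res h i b) (F.res h i n) m
    rw [hn', hn', map_zero, add_zero] at h₁
    have h₂ := K₀.eq_zero_pairing _ m (hF.bracket_symm (i.trans h) (F.res h i n) (F.res h i b))
    rw [hn', map_zero, sub_zero, LinearMap.map_add₂, ← h₁, add_zero] at h₂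
    rw [F.res_bracket, h₂]
  anchor_eq_zero := by
    rintro W h n ⟨hn, -⟩
    exact hn
  pairing_eq_zero := by
    rintro W h b n ⟨-, hn⟩
    rw [hF.pairing_symm]
    simpa [F.res_self] using hn W le_rfl b
  eq_zero_pairing := by
    rintro W h b n ⟨-, hn⟩
    simpa [F.res_self] using hn W le_rfl b

theorem le_radical {W : Opens X} (h : W ≤ U) {n : F.sec W h} (hn : n ∈ K₀.mem h) :
    n ∈ (radical hF).mem h :=
  ⟨K₀.anchor_eq_zero h hn, fun _ i m => K₀.eq_zero_pairing _ m (K₀.res_mem h i hn)⟩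

theorem IsLevel.mono {F : Algebroid O U} {k : ℤ}
    {r r' : ∀ {W : Opens X} (h : W ≤ U), F.sec W h → F.sec W h → Prop}
    (hF : IsLevel k F r) (H : ∀ {W : Opens X} (h : W ≤ U) (a b : F.sec W h), r h a b → r' h a b) :
    IsLevel k F r' where
  one_act h v := H _ _ _ (hF.one_act h v)
  act_act h f g v := H _ _ _ (hF.act_act h f g v)
  jacobi h a b c := H _ _ _ (hF.jacobi h a b c)
  anchor_bracket := hF.anchor_bracket
  pairing_symm := hF.pairing_symm
  anchor_der := hF.anchor_der
  bracket_act h v v' f := H _ _ _ (hF.bracket_act h v v' f)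
  bracket_symm h v v' := H _ _ _ (hF.bracket_symm h v v')
  anchor_act := hF.anchor_act
  pairing_act := hF.pairing_act
  pairing_invariant := hF.pairing_invariant
  der_mul h f g := H _ _ _ (hF.der_mul h f g)
  bracket_der h v f := H _ _ _ (hF.bracket_der h v f)
  pairing_der := hF.pairing_der
  inc_act h f α := H _ _ _ (hF.inc_act h f α)
  inc_d h f := H _ _ _ (hF.inc_d h f)

/-- The quotient by the radical. -/
theorem quot_radical_isAlg : (F.quot (radical hF)).IsAlg k :=
  Ideal.quot_isAlg _ (hF.mono fun h _ _ => le_radical hF h)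

variable (hO : IsSmooth O) (hs : F.AnchorSurj)
include hO hs

/-- A section which is orthogonal to the kernel of the anchor map pairs with all sections like a
1-form. -/
theorem exists_sub_inc_mem_radical {W : Opens X} (h : W ≤ U) (n : F.sec W h)
    (hn' : ∀ (V : Opens X) (i : V ≤ W) (m : F.sec V (i.trans h)), F.anchor _ m = 0 →
      F.pairing (i.trans h) (F.res h i n) m = 0) (hn : F.anchor h n = 0) :
    ∃ β : Form O 1 W, n - F.inc h β ∈ (radical hF).mem h := by
  have hQ := quot_radical_isAlg hF
  have hinc : ∀ {V : Opens X} (i : V ≤ U) (m : F.sec V i) (β : Form O 1 V),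
      F.pairing i (F.inc i β) m = Form.ev β (F.anchor i m) := by
    intro V i m β
    rw [← (radical hF).pairing_proj, ← (radical hF).inc_eq_proj, hQ.inc_pairing hO,
      (radical hF).anchor_proj]
  have hinc' : ∀ β : Form O 1 W, F.anchor h (F.inc h β) = 0 := by
    intro β
    rw [← (radical hF).anchor_proj, ← (radical hF).inc_eq_proj, hQ.anchor_inc hO]
  obtain ⟨β, hβ⟩ := hs.exists_form₁ hF.anchor_act h (fun V i => F.pairing (i.trans h) (F.res h i n))
    (fun V i V' j m => by rw [F.res_pairing, F.res_res]) hn' (fun V i f m => by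
      rw [hF.pairing_symm, hF.pairing_act, ← F.res_anchor, hn, hF.pairing_symm]
      simp)
  refine ⟨β, by rw [map_sub, hn, hinc', sub_zero], fun V i m => ?_⟩
  rw [map_sub, map_sub, LinearMap.sub_apply, F.res_inc, hinc, hβ, sub_self]

end radical

/-! ### Differences of extensions of `A` -/

section difference

variable {A : LieAlgebroid O} {E₁ E₂ : Algebroid O U} (π₁ : Projection A E₁) (π₂ : Projection A E₂)
  {k₁ k₂ : ℤ} (hO : IsSmooth O) (hA : A.IsTransitive) (hE₁ : E₁.IsAlg k₁) (hE₂ : E₂.IsAlg k₂)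

/-- The fiber product over `A` of two extensions of `A`, with the difference of the pairings. -/
abbrev fiberOver : Algebroid O U :=
  fiberProduct (π₁.toMapTo hO hE₁) (π₂.toMapTo hO hE₂) (-1)

local notation "𝓟" => fiberOver π₁ π₂ hO hE₁ hE₂

theorem fiberOver_surj {W : Opens X} (h : W ≤ U) (a : A.Sec W) (p : X) (hp : p ∈ W) :
    ∃ (V : Opens X) (i : V ≤ W) (_ : p ∈ V) (x : (𝓟).sec V (i.trans h)),
      π₁.app (i.trans h) (fst x) = A.res le_top i a := by
  obtain ⟨V, i, hV, hpV, e, he⟩ := π₁.surj h a p hp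
  obtain ⟨V', j, hV', hpV', e', he'⟩ := π₂.surj (i.trans h) (A.res le_top i a) p hpV
  have e₁ : π₁.app (j.trans (i.trans h)) (E₁.res _ j e) = A.res le_top j (A.res le_top i a) := by
    rw [π₁.app_res, he]
  refine ⟨V', j.trans i, hpV', pair (E₁.res _ j e) e' (e₁.trans he'.symm), ?_⟩
  exact e₁.trans (A.res_res _ _ _ _)

include hA in
theorem fiberOver_anchorSurj : (𝓟).AnchorSurj := by
  intro W h ξ p hp
  obtain ⟨V, i, hpV, a, ha⟩ := hA W ξ p hp
  obtain ⟨V', j, hpV', x, hx⟩ := fiberOver_surj π₁ π₂ hO hE₁ hE₂ (i.trans h) a p hpV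
  refine ⟨V', j.trans i, hpV', x, ?_⟩
  rw [anchor_eq, ← π₁.anchor_app, hx, ← A.res_anchor, ha, VF.res_res]

theorem fiberOver_isLevel : IsLevel (k₁ + -1 * k₂) 𝓟
    fun h a b => a - b ∈ (diagIdeal (π₁.toMapTo hO hE₁) (π₂.toMapTo hO hE₂) hO hE₁ hE₂
      (π₁.anchorSurj hA) (by norm_num : (-1 : ℤ) * -1 = 1)).mem h :=
  fiberProduct_isLevel hE₁ hE₂ (by norm_num) _ fun _ α _ a b => ⟨α, a, b⟩

/-- The ideal by which `E₁ ×_A E₂` is divided to obtain `E₁ - E₂`. -/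
abbrev diffIdeal : (𝓟).Ideal :=
  radical (fiberOver_isLevel π₁ π₂ hO hA hE₁ hE₂)

local notation "𝓚" => diffIdeal π₁ π₂ hO hA hE₁ hE₂

/-- The difference of two extensions `E₁`, `E₂` of `A` which induce the same pairing: the quotient
of `E₁ ×_A E₂` by the radical of the difference of the pairings.  It is an exact algebroid. -/
def diff : Algebroid O U := Algebroid.quot _ 𝓚

local notation "𝓓" => diff π₁ π₂ hO hA hE₁ hE₂

theorem diff_isAlg : (𝓓).IsAlg (k₁ + -1 * k₂) := quot_radical_isAlg _

/-- The class in `E₁ - E₂` of a pair of sections with the same image in `A`. -/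
def diffMk {W : Opens X} (h : W ≤ U) (a : E₁.sec W h) (b : E₂.sec W h)
    (w : π₁.app h a = π₂.app h b) : (𝓓).sec W h :=
  (𝓚).proj h (pair a b w)

local notation "δ" => diffMk π₁ π₂ hO hA hE₁ hE₂

section

variable {π₁ π₂ hO hA hE₁ hE₂}

theorem diffMk_congr {W : Opens X} {h : W ≤ U} {a a' : E₁.sec W h} {b b' : E₂.sec W h}
    (ha : a = a') (hb : b = b') (w : π₁.app h a = π₂.app h b) (w' : π₁.app h a' = π₂.app h b') :
    δ h a b w = δ h a' b' w' := by
  subst ha hb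
  rfl

variable {W : Opens X} (h : W ≤ U) {a a' : E₁.sec W h} {b b' : E₂.sec W h}
  (w : π₁.app h a = π₂.app h b) (w' : π₁.app h a' = π₂.app h b')

theorem diffMk_res {V : Opens X} (i : V ≤ W)
    (w₁ : π₁.app (i.trans h) (E₁.res h i a) = π₂.app (i.trans h) (E₂.res h i b)) :
    (𝓓).res h i (δ h a b w)
      = δ (i.trans h) (E₁.res h i a) (E₂.res h i b) w₁ :=
  (𝓚).proj_res h i _

theorem diffMk_add (w₁ : π₁.app h (a + a') = π₂.app h (b + b')) :
    δ h (a + a') (b + b') w₁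
      = δ h a b w + δ h a' b' w' :=
  map_add ((𝓚).proj h) (pair a b w) (pair a' b' w')

theorem diffMk_sub (w₁ : π₁.app h (a - a') = π₂.app h (b - b')) :
    δ h (a - a') (b - b') w₁
      = δ h a b w - δ h a' b' w' :=
  map_sub ((𝓚).proj h) (pair a b w) (pair a' b' w')

theorem diffMk_csmul (c : ℂ) (w₁ : π₁.app h (c • a) = π₂.app h (c • b)) :
    δ h (c • a) (c • b) w₁ = c • δ h a b w :=
  map_smul ((𝓚).proj h) c (pair a b w)

theorem diffMk_act (f : Fn O W) (w₁ : π₁.app h (E₁.act h f a) = π₂.app h (E₂.act h f b)) :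
    δ h (E₁.act h f a) (E₂.act h f b) w₁
      = (𝓓).act h f (δ h a b w) :=
  ((𝓚).act_proj h f (pair a b w)).symm

theorem diffMk_bracket
    (w₁ : π₁.app h (E₁.bracket h a a') = π₂.app h (E₂.bracket h b b')) :
    δ h (E₁.bracket h a a') (E₂.bracket h b b') w₁
      = (𝓓).bracket h (δ h a b w)
          (δ h a' b' w') :=
  ((𝓚).bracket_proj h (pair a b w) (pair a' b' w')).symm

theorem anchor_diffMk : (𝓓).anchor h (δ h a b w)
    = E₁.anchor h a := (𝓚).anchor_proj h (pair a b w)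

theorem pairing_diffMk : (𝓓).pairing h
      (δ h a b w) (δ h a' b' w')
    = E₁.pairing h a a' - E₂.pairing h b b' := by
  refine ((𝓚).pairing_proj h (pair a b w) (pair a' b' w')).trans ?_
  rw [pairing_eq, neg_one_smul, ← sub_eq_add_neg]
  rfl

theorem diffMk_inc_zero (α : Form O 1 W) (w₁ : π₁.app h (E₁.inc h α) = π₂.app h 0) :
    δ h (E₁.inc h α) 0 w₁ = (𝓓).inc h α := rfl

theorem diffMk_der_zero (f : Fn O W) (w₁ : π₁.app h (E₁.der h f) = π₂.app h 0) :
    δ h (E₁.der h f) 0 w₁ = (𝓓).der h f := rfl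

variable (π₁ π₂ hO hA hE₁ hE₂) in
theorem diff_anchorSurj : (𝓓).AnchorSurj := by
  intro W h ξ p hp
  obtain ⟨V, i, hpV, x, hx⟩ := fiberOver_anchorSurj π₁ π₂ hO hA hE₁ hE₂ h ξ p hp
  exact ⟨V, i, hpV, _, ((𝓚).anchor_proj _ x).trans hx⟩

/-- A pair represents zero if its anchor is zero and it is orthogonal to all pairs. -/
theorem diffMk_eq_zero (h0 : E₁.anchor h a = 0)
    (H : ∀ (V : Opens X) (i : V ≤ W) (c : E₁.sec V (i.trans h)) (d : E₂.sec V (i.trans h)),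
      π₁.app (i.trans h) c = π₂.app (i.trans h) d →
      E₁.pairing (i.trans h) (E₁.res h i a) c = E₂.pairing (i.trans h) (E₂.res h i b) d) :
    δ h a b w = 0 := by
  refine ((𝓚).proj_eq_zero h _).2 ⟨h0, fun V i m => ?_⟩
  have := H V i (fst m) (snd m) (app_fst m)
  rw [pairing_eq, neg_one_smul, ← sub_eq_add_neg, sub_eq_zero]
  exact this

theorem diffMk_inc_inc (α : Form O 1 W) (w₁ : π₁.app h (E₁.inc h α) = π₂.app h (E₂.inc h α)) :
    δ h (E₁.inc h α) (E₂.inc h α) w₁ = 0 := by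
  refine diffMk_eq_zero h w₁ (hE₁.anchor_inc hO h α) fun V i c d hcd => ?_
  rw [E₁.res_inc, E₂.res_inc, hE₁.inc_pairing hO, hE₂.inc_pairing hO, ← π₁.anchor_app, hcd,
    π₂.anchor_app]

end

/-- If `E₁` and `E₂` induce the same pairing on the isotropy of `A`, then `E₁ - E₂` is exact. -/
theorem diff_isExact {P : InvariantPairing A} (h₁ : π₁.Induces P) (h₂ : π₂.Induces P) :
    (𝓓).IsExact := by
  refine isExact_of_ker hO (diff_isAlg π₁ π₂ hO hA hE₁ hE₂) (diff_anchorSurj π₁ π₂ hO hA hE₁ hE₂)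
    fun {W} h d hd p hp => ?_
  obtain ⟨V, i, hpV, x, hx⟩ := (𝓚).exists_rep₁ h d p hp
  have hx0 : (𝓟).anchor (i.trans h) x = 0 := by
    rw [← (𝓚).anchor_proj, ← hx]
    exact ((𝓓).res_anchor h i d).symm.trans (by rw [hd, map_zero])
  obtain ⟨β, hβ⟩ := exists_sub_inc_mem_radical (fiberOver_isLevel π₁ π₂ hO hA hE₁ hE₂) hO
    (fiberOver_anchorSurj π₁ π₂ hO hA hE₁ hE₂) (i.trans h) x (fun V' j m hm => by
      have hi : ∀ {V : Opens X} (i : V ≤ U) (y : (𝓟).sec V i),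
          (𝓟).anchor i y = 0 → A.anchor V (π₁.app i (fst y)) = 0 := by
        intro V i y hy
        rw [π₁.anchor_app]
        exact hy
      have hy : (𝓟).anchor _
          ((𝓟).res (i.trans h) j x) = 0 := by
        rw [← (𝓟).res_anchor, hx0, map_zero]
      have e₁ := h₁ _ _ _ ⟨_, hi _ _ hy⟩ ⟨_, hi _ _ hm⟩ rfl rfl
      have e₂ := h₂ _ (snd ((𝓟).res (i.trans h) j x)) (snd m)
        ⟨_, hi _ _ hy⟩ ⟨_, hi _ _ hm⟩ (app_fst ((𝓟).res (i.trans h) j x)).symm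
        (app_fst m).symm
      rw [pairing_eq, e₁, e₂, neg_one_smul, add_neg_cancel]) hx0
  refine ⟨V, i, hpV, β, hx.trans ?_⟩
  exact ((𝓚).proj_eq_proj _ _ _).2 hβ

end difference

end Algebroid

end

section

variable {O : StructureSheaf X} {U : Opens X}

namespace Algebroid

theorem IsExact.exists_inc {E : Algebroid O U} (hE' : E.IsExact) (hO : IsSmooth O) {k : ℤ}
    (hE : E.IsAlg k) {W : Opens X} (h : W ≤ U) (e : E.sec W h) (he : E.anchor h e = 0) :
    ∃ α, e = E.inc h α :=
  (hE.isOmega_iff hO hE'.anchorSurj h e).1 ((hE'.ker h e).1 he)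

theorem _root_.Algebroids.Projection.exists_inc {A : LieAlgebroid O} {E : Algebroid O U}
    (π : Projection A E) (hO : IsSmooth O) (hA : A.IsTransitive) {k : ℤ}
    (hE : E.IsAlg k) {W : Opens X} (h : W ≤ U) (e : E.sec W h) (he : π.app h e = 0) :
    ∃ α, e = E.inc h α :=
  (hE.isOmega_iff hO (π.anchorSurj hA) h e).1 ((π.ker h e).1 he)

theorem _root_.Algebroids.Projection.app_inc {A : LieAlgebroid O} {E : Algebroid O U}
    (π : Projection A E) (hO : IsSmooth O) {k : ℤ} (hE : E.IsAlg k) {W : Opens X} (h : W ≤ U)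
    (α : Form O 1 W) : π.app h (E.inc h α) = 0 :=
  (π.ker h _).2 (hE.isOmega_inc hO h α)

/-! ### Projections of sums and differences to a Lie algebroid -/

section projections

variable {A : LieAlgebroid O} {E₁ E₂ E : Algebroid O U} {ε : ℤ} {k₁ k₂ k : ℤ} (hO : IsSmooth O)
  (hE₁ : E₁.IsAlg k₁) (hE₂ : E₂.IsAlg k₂)

/-- The first projection of the fiber product, as a linear map. -/
def fstₗ {p₁ : MapTo A E₁} {p₂ : MapTo A E₂} {W : Opens X} (h : W ≤ U) :
    (fiberProduct p₁ p₂ ε).sec W h →ₗ[ℂ] E₁.sec W h where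
  toFun := fst
  map_add' _ _ := rfl
  map_smul' _ _ := rfl

/-- The second projection of the fiber product, as a linear map. -/
def sndₗ {p₁ : MapTo A E₁} {p₂ : MapTo A E₂} {W : Opens X} (h : W ≤ U) :
    (fiberProduct p₁ p₂ ε).sec W h →ₗ[ℂ] E₂.sec W h where
  toFun := snd
  map_add' _ _ := rfl
  map_smul' _ _ := rfl

/-- The first projection of the fiber product, followed by a map to `A`. -/
def fiberLeft (p : MapTo A E₁) : MapTo A (fiberProduct (anchorMap hO hE₁) (anchorMap hO hE₂) ε) where
  app h := (p.app h).comp (fstₗ h)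
  app_res h i x := p.app_res h i (fst x)
  app_act h f x := p.app_act h f (fst x)
  app_bracket h x y := p.app_bracket h (fst x) (fst y)
  anchor_app h x := p.anchor_app h (fst x)
  app_der h f := p.app_der h f
  app_inc h α := p.app_inc h α

/-- The second projection of the fiber product, followed by a map to `A`. -/
def fiberRight (p : MapTo A E₂) :
    MapTo A (fiberProduct (anchorMap hO hE₁) (anchorMap hO hE₂) ε) where
  app h := (p.app h).comp (sndₗ h)
  app_res h i x := p.app_res h i (snd x)
  app_act h f x := p.app_act h f (snd x)
  app_bracket h x y := p.app_bracket h (snd x) (snd y)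
  anchor_app h x := (p.anchor_app h (snd x)).trans (anchor_fst x).symm
  app_der h _ := map_zero (p.app h)
  app_inc h _ := map_zero (p.app h)

namespace Combination

variable (κ : Combination ε E₁ E₂ E) (hE : E.IsAlg k) (hε : ε * ε = 1)

/-- The projection `(a, b) ↦ π(a)` of `E₁ + ε E₂`, for `E₂` exact. -/
def projLeft (π : Projection A E₁) (hA : A.IsTransitive) (h₂ : E₂.IsExact) : Projection A E :=
  κ.projection hO hE₁ hE₂ hE (fiberLeft hO hE₁ hE₂ (π.toMapTo hO hE₁))
    (fun h α _ _ => π.app_inc hO hE₁ h α) (κ.anchorSurj (π.anchorSurj hA) h₂.anchorSurj) hε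
    (fun h a p hp => by
      obtain ⟨V, i, hV, hpV, e, he⟩ := π.surj h a p hp
      obtain ⟨V', j, hpV', b, hb⟩ := h₂.anchorSurj (i.trans h) (E₁.anchor _ e) p hpV
      refine ⟨V', j.trans i, hpV', pair (E₁.res _ j e) b ((E₁.res_anchor _ j e).symm.trans hb.symm),
        ?_⟩
      refine (π.app_res _ j e).trans ?_
      rw [he, A.res_res])
    (fun h a b w hab => by
      obtain ⟨α, rfl⟩ := π.exists_inc hO hA hE₁ h a hab
      obtain ⟨β, rfl⟩ := h₂.exists_inc hO hE₂ h b (w.symm.trans (hE₁.anchor_inc hO h α))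
      exact ⟨α, β, rfl, rfl⟩)

theorem projLeft_map (π : Projection A E₁) (hA : A.IsTransitive) (h₂ : E₂.IsExact)
    {W : Opens X} (h : W ≤ U) (a : E₁.sec W h) (b : E₂.sec W h) (w) :
    (κ.projLeft hO hE₁ hE₂ hE hε π hA h₂).app h (κ.map h a b w) = π.app h a :=
  κ.descendApp_map hO hE₁ hE₂ hE _ (fun h α _ _ => π.app_inc hO hE₁ h α) h a b w

/-- The projection `(a, b) ↦ π(b)` of `E₁ + ε E₂`, for `E₁` exact. -/
def projRight (π : Projection A E₂) (hA : A.IsTransitive) (h₁ : E₁.IsExact) : Projection A E :=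
  κ.projection hO hE₁ hE₂ hE (fiberRight hO hE₁ hE₂ (π.toMapTo hO hE₂))
    (fun h _ β _ => π.app_inc hO hE₂ h β) (κ.anchorSurj h₁.anchorSurj (π.anchorSurj hA)) hε
    (fun h a p hp => by
      obtain ⟨V, i, hV, hpV, e, he⟩ := π.surj h a p hp
      obtain ⟨V', j, hpV', b, hb⟩ := h₁.anchorSurj (i.trans h) (E₂.anchor _ e) p hpV
      refine ⟨V', j.trans i, hpV', pair b (E₂.res _ j e) (hb.trans (E₂.res_anchor _ j e)), ?_⟩
      refine (π.app_res _ j e).trans ?_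
      rw [he, A.res_res])
    (fun h a b w hab => by
      obtain ⟨β, rfl⟩ := π.exists_inc hO hA hE₂ h b hab
      obtain ⟨α, rfl⟩ := h₁.exists_inc hO hE₁ h a (w.trans (hE₂.anchor_inc hO h β))
      exact ⟨α, β, rfl, rfl⟩)

theorem projRight_map (π : Projection A E₂) (hA : A.IsTransitive) (h₁ : E₁.IsExact)
    {W : Opens X} (h : W ≤ U) (a : E₁.sec W h) (b : E₂.sec W h) (w) :
    (κ.projRight hO hE₁ hE₂ hE hε π hA h₁).app h (κ.map h a b w) = π.app h b :=
  κ.descendApp_map hO hE₁ hE₂ hE _ (fun h _ β _ => π.app_inc hO hE₂ h β) h a b w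

variable {P : InvariantPairing A}

theorem projLeft_induces (π : Projection A E₁) (hA : A.IsTransitive) (h₂ : E₂.IsExact)
    (hπ : π.Induces P) : (κ.projLeft hO hE₁ hE₂ hE hε π hA h₂).Induces P := by
  intro W h e e' x x' hx hx'
  refine Fn.eq_of_local O fun p hp => ?_
  obtain ⟨V, i, hpV, a, a', b, b', w, w', hab, hab'⟩ := κ.surj₂ h e e' p hp
  have hy : π.app _ a = A.res le_top i x := by
    rw [← hx, ← (κ.projLeft hO hE₁ hE₂ hE hε π hA h₂).app_res, ← hab, projLeft_map]
  have hy' : π.app _ a' = A.res le_top i x' := by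
    rw [← hx', ← (κ.projLeft hO hE₁ hE₂ hE hε π hA h₂).app_res, ← hab', projLeft_map]
  have h0 : ∀ z : A.isotropy W, A.anchor V (A.res le_top i z) = 0 := fun z => by
    rw [← A.res_anchor, LinearMap.mem_ker.1 z.2, _root_.map_zero]
  obtain ⟨β, rfl⟩ := h₂.exists_inc hO hE₂ _ b (by rw [← w, ← π.anchor_app, hy, h0])
  refine ⟨V, i, hpV, ?_⟩
  rw [E.res_pairing, ← hab, ← hab', κ.pairing_map, hE₂.inc_pairing hO, ← w', ← π.anchor_app, hy',
    h0, Form.ev_zero, smul_zero, add_zero, P.res_val i x x' ⟨_, h0 x⟩ ⟨_, h0 x'⟩ rfl rfl]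
  exact hπ _ _ _ ⟨_, h0 x⟩ ⟨_, h0 x'⟩ hy hy'

theorem projRight_induces (hε1 : ε = 1) (π : Projection A E₂) (hA : A.IsTransitive)
    (h₁ : E₁.IsExact) (hπ : π.Induces P) :
    (κ.projRight hO hE₁ hE₂ hE hε π hA h₁).Induces P := by
  intro W h e e' x x' hx hx'
  refine Fn.eq_of_local O fun p hp => ?_
  obtain ⟨V, i, hpV, a, a', b, b', w, w', hab, hab'⟩ := κ.surj₂ h e e' p hp
  have hy : π.app _ b = A.res le_top i x := by
    rw [← hx, ← (κ.projRight hO hE₁ hE₂ hE hε π hA h₁).app_res, ← hab, projRight_map]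
  have hy' : π.app _ b' = A.res le_top i x' := by
    rw [← hx', ← (κ.projRight hO hE₁ hE₂ hE hε π hA h₁).app_res, ← hab', projRight_map]
  have h0 : ∀ z : A.isotropy W, A.anchor V (A.res le_top i z) = 0 := fun z => by
    rw [← A.res_anchor, LinearMap.mem_ker.1 z.2, _root_.map_zero]
  obtain ⟨α, rfl⟩ := h₁.exists_inc hO hE₁ _ a (by rw [w, ← π.anchor_app, hy, h0])
  refine ⟨V, i, hpV, ?_⟩
  rw [E.res_pairing, ← hab, ← hab', κ.pairing_map, hE₁.inc_pairing hO, w', ← π.anchor_app, hy',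
    h0, Form.ev_zero, hε1, one_smul, zero_add, P.res_val i x x' ⟨_, h0 x⟩ ⟨_, h0 x'⟩ rfl rfl]
  exact hπ _ _ _ ⟨_, h0 x⟩ ⟨_, h0 x'⟩ hy hy'

end Combination

end projections

end Algebroid

/-! ### Morphisms are isomorphisms -/

section isIso

open Algebroid

variable {A : LieAlgebroid O} {P : InvariantPairing A}

theorem EVAObj.isIso (hO : IsSmooth O) (V V' : EVAObj O U) (φ : V ⟶ V') : IsIso φ := by
  have hV := V.vertex.isAlg
  have hV' := V'.vertex.isAlg
  let φ' : Algebroid.Hom V.alg V'.alg := φ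
  obtain ⟨ψ, h₁, h₂⟩ := φ'.exists_inverse
    (φ'.injective_of_mapTo hO hV hV' V'.exact.anchorSurj (anchorMap hO hV) (anchorMap hO hV')
      (fun h e => φ'.anchor_app h e) (fun h e he => V.exact.exists_inc hO hV h e he))
    (φ'.surj_of_mapTo hO hV hV' (anchorMap hO hV) (anchorMap hO hV')
      (fun h e => φ'.anchor_app h e) (fun h e he => V'.exact.exists_inc hO hV' h e he)
      V.exact.anchorSurj)
  exact ⟨ψ, h₁, h₂⟩

theorem CEXTObj.isIso (hO : IsSmooth O) (hA : A.IsTransitive) (C C' : CEXTObj A P U) (φ : C ⟶ C') :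
    IsIso φ := by
  have hC := C.courant.isAlg
  have hC' := C'.courant.isAlg
  let φ' : CEXTObj.Hom C C' := φ
  obtain ⟨ψ, h₁, h₂⟩ := φ'.hom.exists_inverse
    (φ'.hom.injective_of_mapTo hO hC hC' (C'.proj.anchorSurj hA) (C.proj.toMapTo hO hC)
      (C'.proj.toMapTo hO hC') (fun h e => φ'.proj_hom h e)
      (fun h e he => C.proj.exists_inc hO hA hC h e he))
    (φ'.hom.surj_of_mapTo hO hC hC' (C.proj.toMapTo hO hC)
      (C'.proj.toMapTo hO hC') (fun h e => φ'.proj_hom h e)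
      (fun h e he => C'.proj.exists_inc hO hA hC' h e he)
      (fun h a x hx => by
        obtain ⟨V, i, _, hpV, e, he⟩ := C.proj.surj h a x hx
        exact ⟨V, i, hpV, e, he⟩))
  have hψ : ∀ {W : Opens X} (h : W ≤ U) (e : C'.alg.sec W h), φ'.hom.app h (ψ.app h e) = e :=
    fun {W} h e => congrArg (fun χ : Algebroid.Hom C'.alg C'.alg => χ.app h e) h₂
  exact ⟨⟨ψ, fun h e => by rw [← φ'.proj_hom, hψ]⟩, CEXTObj.Hom.ext h₁, CEXTObj.Hom.ext h₂⟩

end isIso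

/-! ### The pairing induced by a vertex extension -/

section pairing

open Algebroid

theorem _root_.Algebroids.InvariantPairing.ext' {A : LieAlgebroid O} {P P' : InvariantPairing A}
    (h : ∀ (W : Opens X) (x y : A.isotropy W), P.val W x y = P'.val W x y) : P = P' := by
  obtain ⟨v, _, _, _, _⟩ := P
  obtain ⟨v', _, _, _, _⟩ := P'
  obtain rfl : v = v' := funext fun W => LinearMap.ext fun x => LinearMap.ext fun y => h W x y
  rfl

/-- The kernel of a map from a sheaf to the tangent sheaf. -/
def SheafOn.anchorKer (F : SheafOn U) (f : ∀ {W : Opens X} (h : W ≤ U), F.sec W h →ₗ[ℂ] VF O W)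
    (f_res : ∀ {W V : Opens X} (h : W ≤ U) (i : V ≤ W) (a : F.sec W h),
      VF.res i (f h a) = f (i.trans h) (F.res h i a)) : SheafOn U where
  sec _ h := ↥(LinearMap.ker (f h))
  res h i := (F.res h i).restrict fun a ha => by
    rw [LinearMap.mem_ker] at ha ⊢
    rw [← f_res, ha, map_zero]
  res_self h s := Subtype.ext (F.res_self h s.1)
  res_res h i j s := Subtype.ext (F.res_res h i j s.1)
  existsUnique_gluing V h s hs := by
    obtain ⟨t, ht, htu⟩ := F.existsUnique_gluing V h (fun k => (s k).1)
      (fun a b => congrArg Subtype.val (hs a b))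
    refine ⟨⟨t, ?_⟩, fun k => Subtype.ext (ht k), fun t' ht' =>
      Subtype.ext (htu _ fun k => congrArg Subtype.val (ht' k))⟩
    rw [LinearMap.mem_ker]
    refine VF.eq_of_local fun p hp => ?_
    obtain ⟨k, hk⟩ := Opens.mem_iSup.1 hp
    refine ⟨V k, le_iSup V k, hk, ?_⟩
    rw [f_res, ht k, map_zero]
    exact (s k).2

variable {A : LieAlgebroid O} (hO : IsSmooth O) (E : Algebroid O (⊤ : Opens X)) {k : ℤ}
  (hE : E.IsAlg k) (π : Projection A E)
include hO hE

/-- An extension of `A` induces a unique pairing on the isotropy of `A`, because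
`⟨e, i(α)⟩ = 0` if the anchor of `e` is zero. -/
theorem exists_pairing (hA : A.IsTransitive) :
    ∃ P : InvariantPairing A, ∀ P' : InvariantPairing A, π.Induces P' ↔ P' = P := by
  let F : SheafOn (⊤ : Opens X) := SheafOn.anchorKer E.toSheafOn (fun h => E.anchor h)
    (fun h i a => E.res_anchor h i a)
  let G : SheafOn (⊤ : Opens X) := SheafOn.anchorKer A.toSheafOn (fun {W} _ => A.anchor W)
    (fun h i a => A.res_anchor i a)
  let q : SheafOn.LocSurj F G :=
    { map := fun h => (π.app h).restrict fun e he => by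
        rw [LinearMap.mem_ker] at he ⊢
        rw [π.anchor_app, he]
      map_res := fun h i a => Subtype.ext (π.app_res h i a.1)
      surj := fun {W} h x p hp => by
        obtain ⟨V, i, hV, hpV, e, he⟩ := π.surj h (show A.isotropy W from x).1 p hp
        refine ⟨V, i, hpV, ⟨e, ?_⟩, Subtype.ext he⟩
        rw [LinearMap.mem_ker, ← π.anchor_app, he, ← A.res_anchor,
          LinearMap.mem_ker.1 (show A.isotropy W from x).2, map_zero] }
  -- the pairing of `ker(E → T)` descends to `𝔤(A)`: the kernel of `ker(E → T) → 𝔤(A)` consists of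
  -- 1-forms, which are orthogonal to `ker(E → T)`
  obtain ⟨g, g_res, hg⟩ := SheafOn.LocSurj.exists_liftBil (G := fnSheaf O ⊤) q q
    (fun {W} h => ((E.pairing h).domRestrict₁₂ (LinearMap.ker (E.anchor h))
      (LinearMap.ker (E.anchor h)) :
        LinearMap.ker (E.anchor h) →ₗ[ℂ] LinearMap.ker (E.anchor h) →ₗ[ℂ] Fn O W))
    (fun h i a b => (E.res_pairing h i a.1 b.1).symm)
    (fun h a b ha => by
      obtain ⟨α, hα⟩ := π.exists_inc hO hA hE h a.1 (congrArg Subtype.val ha)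
      change E.pairing h a.1 b.1 = 0
      rw [hα, hE.inc_pairing hO, LinearMap.mem_ker.1 b.2, Form.ev_zero])
    (fun h a b hb => by
      obtain ⟨α, hα⟩ := π.exists_inc hO hA hE h b.1 (congrArg Subtype.val hb)
      change E.pairing h a.1 b.1 = 0
      rw [hα, hE.pairing_inc hO, LinearMap.mem_ker.1 a.2, Form.ev_zero])
  let v : ∀ W : Opens X, A.isotropy W →ₗ[ℂ] A.isotropy W →ₗ[ℂ] Fn O W := fun W => g le_top
  have v_res : ∀ {W V : Opens X} (i : V ≤ W) (x y : A.isotropy W) (x' y' : A.isotropy V),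
      (x' : A.Sec V) = A.res le_top i x → (y' : A.Sec V) = A.res le_top i y →
      resFn O i (v W x y) = v V x' y' := by
    intro W V i x y x' y' hx hy
    rw [show x' = G.res le_top i x from Subtype.ext hx, show y' = G.res le_top i y from Subtype.ext hy]
    exact g_res le_top i x y
  have hv : ∀ {W : Opens X} (e e' : E.sec W le_top) (x x' : A.isotropy W),
      π.app le_top e = x → π.app le_top e' = x' → v W x x' = E.pairing le_top e e' := by
    intro W e e' x x' hx hx'
    have he : E.anchor le_top e = 0 := by
      rw [← π.anchor_app, hx, LinearMap.mem_ker.1 x.2]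
    have he' : E.anchor le_top e' = 0 := by
      rw [← π.anchor_app, hx', LinearMap.mem_ker.1 x'.2]
    obtain rfl : x = q.map le_top ⟨e, he⟩ := Subtype.ext hx.symm
    obtain rfl : x' = q.map le_top ⟨e', he'⟩ := Subtype.ext hx'.symm
    exact hg le_top ⟨e, he⟩ ⟨e', he'⟩
  have h0 : ∀ {W V : Opens X} (i : V ≤ W) (z : A.isotropy W),
      A.res le_top i z ∈ A.isotropy V := fun i z => by
    rw [LinearMap.mem_ker, ← A.res_anchor, LinearMap.mem_ker.1 z.2, map_zero]
  have lift : ∀ {W : Opens X} (x y : A.isotropy W), ∀ p ∈ W,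
      ∃ (V : Opens X) (i : V ≤ W) (_ : p ∈ V) (e e' : E.sec V le_top),
        π.app le_top e = A.res le_top i x ∧ π.app le_top e' = A.res le_top i y := by
    intro W x y p hp
    obtain ⟨V, i, hV, hpV, e, he⟩ := π.surj le_top x.1 p hp
    obtain ⟨V', j, hV', hpV', e', he'⟩ := π.surj le_top (A.res le_top i y.1) p hpV
    refine ⟨V', j.trans i, hpV', E.res le_top j e, e', ?_, ?_⟩
    · rw [π.app_res le_top j, he, A.res_res]
    · rw [he', A.res_res]
  have h0' : ∀ {W V : Opens X} (i : V ≤ W) (z : A.isotropy W) (e : E.sec V le_top),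
      π.app le_top e = A.res le_top i z → E.anchor le_top e = 0 := by
    intro W V i z e he
    rw [← π.anchor_app, he, LinearMap.mem_ker.1 (h0 i z)]
  let P : InvariantPairing A :=
    { val := v
      res_val := v_res
      symm := by
        intro W x y
        refine Fn.eq_of_local O fun p hp => ?_
        obtain ⟨V, i, hpV, e, e', he, he'⟩ := lift x y p hp
        refine ⟨V, i, hpV, ?_⟩
        rw [v_res i x y ⟨_, h0 i x⟩ ⟨_, h0 i y⟩ rfl rfl, v_res i y x ⟨_, h0 i y⟩ ⟨_, h0 i x⟩ rfl rfl,
          hv e e' _ _ he he', hv e' e _ _ he' he, hE.pairing_symm]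
      act_left := by
        intro W f x x' y hx'
        refine Fn.eq_of_local O fun p hp => ?_
        obtain ⟨V, i, hpV, e, e', he, he'⟩ := lift x y p hp
        refine ⟨V, i, hpV, ?_⟩
        rw [map_mul, v_res i x y ⟨_, h0 i x⟩ ⟨_, h0 i y⟩ rfl rfl,
          v_res i x' y ⟨_, h0 i x'⟩ ⟨_, h0 i y⟩ rfl rfl,
          hv e e' ⟨_, h0 i x⟩ ⟨_, h0 i y⟩ he he', hv (E.act le_top (resFn O i f) e) e' _ _ (by
            change _ = A.res le_top i x'.1
            rw [π.app_act, he, hx', A.res_act]) he', hE.pairing_act, h0' i x e he]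
        simp
      invariant := by
        intro W a x y x' y' hx' hy'
        refine Fn.eq_of_local O fun p hp => ?_
        obtain ⟨V, i, hpV, e, e', he, he'⟩ := lift x y p hp
        obtain ⟨V', j, hV', hpV', c, hc⟩ := π.surj le_top (A.res le_top i a) p hpV
        refine ⟨V', j.trans i, hpV', ?_⟩
        have h₁ : π.app le_top (E.res le_top j e) = A.res le_top (j.trans i) x := by
          rw [π.app_res le_top j, he, A.res_res]
        have h₂ : π.app le_top (E.res le_top j e') = A.res le_top (j.trans i) y := by
          rw [π.app_res le_top j, he', A.res_res]
        have h₃ : π.app le_top c = A.res le_top (j.trans i) a := by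
          rw [hc, A.res_res]
        rw [VF.res_app, map_add, v_res _ x y ⟨_, h0 _ x⟩ ⟨_, h0 _ y⟩ rfl rfl,
          v_res _ x' y ⟨_, h0 _ x'⟩ ⟨_, h0 _ y⟩ rfl rfl,
          v_res _ x y' ⟨_, h0 _ x⟩ ⟨_, h0 _ y'⟩ rfl rfl,
          hv _ _ _ _ h₁ h₂, hv (E.bracket le_top c (E.res le_top j e)) _ _ _ (by
            change _ = A.res le_top _ x'.1
            rw [π.app_bracket, h₁, hx', h₃, A.res_bracket]) h₂,
          hv _ (E.bracket le_top c (E.res le_top j e')) _ _ h₁ (by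
            change _ = A.res le_top _ y'.1
            rw [π.app_bracket, h₂, hy', h₃, A.res_bracket]),
          ← hE.pairing_invariant, A.res_anchor, ← h₃, π.anchor_app] }
  refine ⟨P, fun P' => ⟨fun H => InvariantPairing.ext' fun W x y => ?_, ?_⟩⟩
  · refine Fn.eq_of_local O fun p hp => ?_
    obtain ⟨V, i, hpV, e, e', he, he'⟩ := lift x y p hp
    refine ⟨V, i, hpV, ?_⟩
    rw [P'.res_val i x y ⟨_, h0 i x⟩ ⟨_, h0 i y⟩ rfl rfl,
      P.res_val i x y ⟨_, h0 i x⟩ ⟨_, h0 i y⟩ rfl rfl]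
    exact (H le_top e e' _ _ he he').symm.trans (hv e e' _ _ he he').symm
  · rintro rfl W h e e' x x' hx hx'
    exact (hv e e' x x' hx hx').symm

end pairing

end

section

variable {O : StructureSheaf X} {U : Opens X} {A : LieAlgebroid O} {P : InvariantPairing A}

/-! ### The actions of `ECA` -/

section actions

open Algebroid

variable (hO : IsSmooth O) (hA : A.IsTransitive)

section compare

variable {k₁ k₂ k ε : ℤ} {E₁ E₂ E E' : Algebroid O U}

/-- Two combinations of the same algebroids are canonically isomorphic. -/
def Algebroid.Combination.compare (κ : Combination ε E₁ E₂ E) (κ' : Combination ε E₁ E₂ E')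
    (hE₁ : E₁.IsAlg k₁) (hE₂ : E₂.IsAlg k₂) (hE : E.IsAlg k) (hE' : E'.IsAlg k) :
    Algebroid.Hom E E' :=
  κ.mapHom hO hE₁ hE₂ hE₁ hE₂ hE hE' κ' (Algebroid.Hom.id E₁) (Algebroid.Hom.id E₂)

theorem Algebroid.Combination.compare_map (κ : Combination ε E₁ E₂ E) (κ' : Combination ε E₁ E₂ E')
    (hE₁ : E₁.IsAlg k₁) (hE₂ : E₂.IsAlg k₂) (hE : E.IsAlg k) (hE' : E'.IsAlg k) {W : Opens X}
    (h : W ≤ U) (a : E₁.sec W h) (b : E₂.sec W h) (w) :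
    (κ.compare hO κ' hE₁ hE₂ hE hE').app h (κ.map h a b w) = κ'.map h a b w :=
  Combination.mapHom_map _ _ _ _ _ _ _ _ _ _ _ h a b w w

end compare

/-- The sum of an exact Courant algebroid and an exact vertex algebroid. -/
def EVAObj.sum (Q : ECAObj O U) (V : EVAObj O U) : EVAObj O U where
  alg := combine hO Q.courant.isAlg V.vertex.isAlg Q.exact.anchorSurj (ε := 1) (one_mul 1)
  vertex := IsAlg.isVertex (by
    simpa using combine_isAlg hO Q.courant.isAlg V.vertex.isAlg Q.exact.anchorSurj
      (ε := 1) (one_mul 1))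
  exact := (combination hO Q.courant.isAlg V.vertex.isAlg Q.exact.anchorSurj (one_mul 1)).isExact hO Q.courant.isAlg
    V.vertex.isAlg (combine_isAlg hO _ _ Q.exact.anchorSurj _) (one_mul 1) Q.exact V.exact

/-- The canonical map `Q ×_T V → Q + V`. -/
def EVAObj.sumMap (Q : ECAObj O U) (V : EVAObj O U) :
    Combination 1 Q.alg V.alg (EVAObj.sum hO Q V).alg :=
  combination hO Q.courant.isAlg V.vertex.isAlg Q.exact.anchorSurj (one_mul 1)

/-- The morphism `(q, v) ↦ (φ(q), ψ(v))` between sums. -/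
def EVAObj.sumHom {Q Q' : ECAObj O U} {V V' : EVAObj O U} (φ : Algebroid.Hom Q.alg Q'.alg)
    (ψ : Algebroid.Hom V.alg V'.alg) :
    Algebroid.Hom (EVAObj.sum hO Q V).alg (EVAObj.sum hO Q' V').alg :=
  (EVAObj.sumMap hO Q V).mapHom hO Q.courant.isAlg V.vertex.isAlg Q'.courant.isAlg V'.vertex.isAlg
    (EVAObj.sum hO Q V).vertex.isAlg (EVAObj.sum hO Q' V').vertex.isAlg (EVAObj.sumMap hO Q' V') φ ψ

theorem EVAObj.sumHom_map {Q Q' : ECAObj O U} {V V' : EVAObj O U} (φ : Algebroid.Hom Q.alg Q'.alg)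
    (ψ : Algebroid.Hom V.alg V'.alg) {W : Opens X} (h : W ≤ U) (q : Q.alg.sec W h)
    (v : V.alg.sec W h) (w) (w') :
    (EVAObj.sumHom hO φ ψ).app h ((EVAObj.sumMap hO Q V).map h q v w)
      = (EVAObj.sumMap hO Q' V').map h (φ.app h q) (ψ.app h v) w' :=
  Combination.mapHom_map _ _ _ _ _ _ _ _ _ _ _ h q v w w'

/-- The restriction of a sum is the sum of the restrictions. -/
def EVAObj.sumRes {U' : Opens X} (i : U' ≤ U) (Q : ECAObj O U) (V : EVAObj O U) :
    Algebroid.Hom ((EVAObj.restrict i).obj (EVAObj.sum hO Q V)).alg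
      (EVAObj.sum hO ((ECAObj.restrict i).obj Q) ((EVAObj.restrict i).obj V)).alg :=
  ((EVAObj.sumMap hO Q V).restrict i).compare hO
    (EVAObj.sumMap hO ((ECAObj.restrict i).obj Q) ((EVAObj.restrict i).obj V))
    (Q.courant.isAlg.restrict i) (V.vertex.isAlg.restrict i)
    ((EVAObj.sum hO Q V).vertex.isAlg.restrict i)
    (EVAObj.sum hO ((ECAObj.restrict i).obj Q) ((EVAObj.restrict i).obj V)).vertex.isAlg

theorem EVAObj.sumRes_map {U' : Opens X} (i : U' ≤ U) (Q : ECAObj O U) (V : EVAObj O U)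
    {W : Opens X} (h : W ≤ U') (q : Q.alg.sec W (h.trans i)) (v : V.alg.sec W (h.trans i)) (w) :
    (EVAObj.sumRes hO i Q V).app h ((EVAObj.sumMap hO Q V).map (h.trans i) q v w)
      = (EVAObj.sumMap hO ((ECAObj.restrict i).obj Q) ((EVAObj.restrict i).obj V)).map h q v w :=
  Combination.compare_map hO ((EVAObj.sumMap hO Q V).restrict i) _ _ _ _ _ h q v w

/-- The action of `ECA` on `EVA`. -/
def evaAction : EVAAction O where
  act U :=
    { obj := fun QV => EVAObj.sum hO QV.1 QV.2
      map := fun f => EVAObj.sumHom hO f.1 f.2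
      map_id := fun QV => (EVAObj.sumMap hO QV.1 QV.2).hom_ext fun h q v w =>
        EVAObj.sumHom_map hO _ _ h q v w w
      map_comp := fun {QV QV' QV''} f g => (EVAObj.sumMap hO QV.1 QV.2).hom_ext fun h q v w => by
        have w' : QV'.1.alg.anchor h (Algebroid.Hom.app f.1 h q)
            = QV'.2.alg.anchor h (Algebroid.Hom.app f.2 h v) := by
          rw [Algebroid.Hom.anchor_app, Algebroid.Hom.anchor_app, w]
        have w'' : QV''.1.alg.anchor h (Algebroid.Hom.app g.1 h (Algebroid.Hom.app f.1 h q))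
            = QV''.2.alg.anchor h (Algebroid.Hom.app g.2 h (Algebroid.Hom.app f.2 h v)) := by
          exact (Algebroid.Hom.anchor_app g.1 h _).trans
            (w'.trans (Algebroid.Hom.anchor_app g.2 h _).symm)
        refine (EVAObj.sumHom_map hO _ _ h q v w w'').trans ?_
        refine Eq.trans ?_ (congrArg ((EVAObj.sumHom hO g.1 g.2).app h)
          (EVAObj.sumHom_map hO f.1 f.2 h q v w w')).symm
        exact (EVAObj.sumHom_map hO g.1 g.2 h _ _ w' w'').symm }
  σ Q V := EVAObj.sumMap hO Q V
  σ_natural φ ψ W h q v w w' := EVAObj.sumHom_map hO φ ψ h q v w w'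
  resIso i Q V :=
    haveI := EVAObj.isIso hO _ _ (EVAObj.sumRes hO i Q V)
    asIso (X := (EVAObj.restrict i).obj (EVAObj.sum hO Q V))
      (Y := EVAObj.sum hO ((ECAObj.restrict i).obj Q) ((EVAObj.restrict i).obj V))
      (EVAObj.sumRes hO i Q V)
  resIso_σ i Q V W h q v w := EVAObj.sumRes_map hO i Q V h q v w

/-- A homomorphism from `E₁ + ε E₂` is compatible with projections to `A` if it is so on pairs. -/
theorem Algebroid.Combination.proj_hom {ε : ℤ} {E₁ E₂ E E' : Algebroid O U}
    (κ : Combination ε E₁ E₂ E)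
    (π : Projection A E) (π' : Projection A E') (φ : Algebroid.Hom E E')
    (H : ∀ {W : Opens X} (h : W ≤ U) (a : E₁.sec W h) (b : E₂.sec W h) (w),
      π'.app h (φ.app h (κ.map h a b w)) = π.app h (κ.map h a b w))
    {W : Opens X} (h : W ≤ U) (e : E.sec W h) : π'.app h (φ.app h e) = π.app h e := by
  refine A.eq_of_local _ fun p hp => ?_
  obtain ⟨V, i, hpV, a, b, w, hab⟩ := κ.surj h e p hp
  exact ⟨V, i, hpV, by rw [← π'.app_res, ← φ.app_res, ← hab, H, hab, π.app_res]⟩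

/-- The sum of an exact Courant algebroid and a Courant extension of `A`. -/
def CEXTObj.sum (Q : ECAObj O U) (C : CEXTObj A P U) : CEXTObj A P U where
  alg := combine hO Q.courant.isAlg C.courant.isAlg Q.exact.anchorSurj (ε := 1) (one_mul 1)
  courant := IsAlg.isCourant (by
    simpa using combine_isAlg hO Q.courant.isAlg C.courant.isAlg Q.exact.anchorSurj
      (ε := 1) (one_mul 1))
  proj := (combination hO Q.courant.isAlg C.courant.isAlg Q.exact.anchorSurj (one_mul 1)).projRight hO Q.courant.isAlg
    C.courant.isAlg (combine_isAlg hO _ _ Q.exact.anchorSurj _) (one_mul 1) C.proj hA Q.exact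
  induces := Combination.projRight_induces hO Q.courant.isAlg C.courant.isAlg _ _ _ rfl C.proj hA
    Q.exact C.induces

/-- The canonical map `Q ×_T C → Q + C`. -/
def CEXTObj.sumMap (Q : ECAObj O U) (C : CEXTObj A P U) :
    Combination 1 Q.alg C.alg (CEXTObj.sum hO hA Q C).alg :=
  combination hO Q.courant.isAlg C.courant.isAlg Q.exact.anchorSurj (one_mul 1)

theorem CEXTObj.proj_sumMap (Q : ECAObj O U) (C : CEXTObj A P U) {W : Opens X} (h : W ≤ U)
    (q : Q.alg.sec W h) (c : C.alg.sec W h) (w) :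
    (CEXTObj.sum hO hA Q C).proj.app h ((CEXTObj.sumMap hO hA Q C).map h q c w)
      = C.proj.app h c  :=
  Combination.projRight_map hO Q.courant.isAlg C.courant.isAlg
    (CEXTObj.sumMap hO hA Q C) (combine_isAlg hO _ _ Q.exact.anchorSurj _) (one_mul 1) C.proj hA
    Q.exact h q c w

/-- The morphism `(q, c) ↦ (φ(q), ψ(c))` between sums. -/
def CEXTObj.sumHom {Q Q' : ECAObj O U} {C C' : CEXTObj A P U} (φ : Algebroid.Hom Q.alg Q'.alg)
    (ψ : CEXTObj.Hom C C') :
    CEXTObj.Hom (CEXTObj.sum hO hA Q C) (CEXTObj.sum hO hA Q' C') where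
  hom := (CEXTObj.sumMap hO hA Q C).mapHom hO Q.courant.isAlg C.courant.isAlg Q'.courant.isAlg
    C'.courant.isAlg (CEXTObj.sum hO hA Q C).courant.isAlg (CEXTObj.sum hO hA Q' C').courant.isAlg
    (CEXTObj.sumMap hO hA Q' C') φ ψ.hom
  proj_hom := (CEXTObj.sumMap hO hA Q C).proj_hom _ _ _ fun h q c w => by
    rw [Combination.mapHom_map (w' := by rw [φ.anchor_app, ψ.hom.anchor_app, w]),
      CEXTObj.proj_sumMap, CEXTObj.proj_sumMap, ψ.proj_hom]

theorem CEXTObj.sumHom_map {Q Q' : ECAObj O U} {C C' : CEXTObj A P U}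
    (φ : Algebroid.Hom Q.alg Q'.alg) (ψ : CEXTObj.Hom C C') {W : Opens X} (h : W ≤ U)
    (q : Q.alg.sec W h) (c : C.alg.sec W h) (w) (w') :
    (CEXTObj.sumHom hO hA φ ψ).hom.app h ((CEXTObj.sumMap hO hA Q C).map h q c w)
      = (CEXTObj.sumMap hO hA Q' C').map h (φ.app h q) (ψ.hom.app h c) w' :=
  Combination.mapHom_map _ _ _ _ _ _ _ _ _ _ _ h q c w w'

/-- The comparison of the restriction of a sum with the sum of the restrictions. -/
def CEXTObj.sumResHom {U' : Opens X} (i : U' ≤ U) (Q : ECAObj O U) (C : CEXTObj A P U) :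
    Algebroid.Hom ((CEXTObj.restrict i).obj (CEXTObj.sum hO hA Q C)).alg
      (CEXTObj.sum hO hA ((ECAObj.restrict i).obj Q) ((CEXTObj.restrict i).obj C)).alg :=
  ((CEXTObj.sumMap hO hA Q C).restrict i).compare hO
    (CEXTObj.sumMap hO hA ((ECAObj.restrict i).obj Q) ((CEXTObj.restrict i).obj C))
    (Q.courant.isAlg.restrict i) (C.courant.isAlg.restrict i)
    ((CEXTObj.sum hO hA Q C).courant.isAlg.restrict i)
    (CEXTObj.sum hO hA ((ECAObj.restrict i).obj Q) ((CEXTObj.restrict i).obj C)).courant.isAlg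

theorem CEXTObj.sumResHom_map {U' : Opens X} (i : U' ≤ U) (Q : ECAObj O U) (C : CEXTObj A P U)
    {W : Opens X} (h : W ≤ U') (q : Q.alg.sec W (h.trans i)) (c : C.alg.sec W (h.trans i)) (w) :
    (CEXTObj.sumResHom hO hA i Q C).app h ((CEXTObj.sumMap hO hA Q C).map (h.trans i) q c w)
      = (CEXTObj.sumMap hO hA ((ECAObj.restrict i).obj Q) ((CEXTObj.restrict i).obj C)).map
          h q c w :=
  Combination.compare_map hO ((CEXTObj.sumMap hO hA Q C).restrict i) _ _ _ _ _ h q c w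

/-- The restriction of a sum is the sum of the restrictions. -/
def CEXTObj.sumRes {U' : Opens X} (i : U' ≤ U) (Q : ECAObj O U) (C : CEXTObj A P U) :
    CEXTObj.Hom ((CEXTObj.restrict i).obj (CEXTObj.sum hO hA Q C))
      (CEXTObj.sum hO hA ((ECAObj.restrict i).obj Q) ((CEXTObj.restrict i).obj C)) where
  hom := CEXTObj.sumResHom hO hA i Q C
  proj_hom := ((CEXTObj.sumMap hO hA Q C).restrict i).proj_hom _ _ _ fun h q c w => by
    refine (congrArg (Projection.app _ h) (CEXTObj.sumResHom_map hO hA i Q C h q c w)).trans ?_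
    refine (CEXTObj.proj_sumMap hO hA ((ECAObj.restrict i).obj Q) ((CEXTObj.restrict i).obj C)
      h q c w).trans ?_
    exact (CEXTObj.proj_sumMap hO hA Q C (h.trans i) q c w).symm

theorem CEXTObj.sumRes_map {U' : Opens X} (i : U' ≤ U) (Q : ECAObj O U) (C : CEXTObj A P U)
    {W : Opens X} (h : W ≤ U') (q : Q.alg.sec W (h.trans i)) (c : C.alg.sec W (h.trans i)) (w) :
    (CEXTObj.sumRes hO hA i Q C).hom.app h ((CEXTObj.sumMap hO hA Q C).map (h.trans i) q c w)
      = (CEXTObj.sumMap hO hA ((ECAObj.restrict i).obj Q) ((CEXTObj.restrict i).obj C)).map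
          h q c w := CEXTObj.sumResHom_map hO hA i Q C h q c w

/-- The action of `ECA` on `CEXT(A)_P`. -/
def cextAction : CEXTAction A P where
  act U :=
    { obj := fun QC => CEXTObj.sum hO hA QC.1 QC.2
      map := fun f => CEXTObj.sumHom hO hA f.1 f.2
      map_id := fun QC => CEXTObj.Hom.ext <|
        (CEXTObj.sumMap hO hA QC.1 QC.2).hom_ext fun h q v w =>
          CEXTObj.sumHom_map hO hA _ (𝟙 QC.2) h q v w w
      map_comp := fun {QC QC' QC''} f g => CEXTObj.Hom.ext <|
        (CEXTObj.sumMap hO hA QC.1 QC.2).hom_ext fun h q c w => by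
        have w' : QC'.1.alg.anchor h (Algebroid.Hom.app f.1 h q)
            = QC'.2.alg.anchor h ((CEXTObj.Hom.hom f.2).app h c) := by
          rw [Algebroid.Hom.anchor_app, Algebroid.Hom.anchor_app, w]
        have w'' : QC''.1.alg.anchor h (Algebroid.Hom.app g.1 h (Algebroid.Hom.app f.1 h q))
            = QC''.2.alg.anchor h
              ((CEXTObj.Hom.hom g.2).app h ((CEXTObj.Hom.hom f.2).app h c)) := by
          exact (Algebroid.Hom.anchor_app g.1 h _).trans
            (w'.trans (Algebroid.Hom.anchor_app (CEXTObj.Hom.hom g.2) h _).symm)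
        refine (CEXTObj.sumHom_map hO hA _ (f ≫ g).2 h q c w w'').trans ?_
        refine Eq.trans ?_ (congrArg ((CEXTObj.sumHom hO hA g.1 g.2).hom.app h)
          (CEXTObj.sumHom_map hO hA f.1 f.2 h q c w w')).symm
        exact (CEXTObj.sumHom_map hO hA g.1 g.2 h _ _ w' w'').symm }
  σ Q C := CEXTObj.sumMap hO hA Q C
  σ_proj Q C W h q c w := CEXTObj.proj_sumMap hO hA Q C h q c w
  σ_natural φ ψ W h q c w w' := CEXTObj.sumHom_map hO hA φ ψ h q c w w'
  resIso i Q C :=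
    haveI := CEXTObj.isIso hO hA _ _ (CEXTObj.sumRes hO hA i Q C)
    asIso (X := (CEXTObj.restrict i).obj (CEXTObj.sum hO hA Q C))
      (Y := CEXTObj.sum hO hA ((ECAObj.restrict i).obj Q) ((CEXTObj.restrict i).obj C))
      (CEXTObj.sumRes hO hA i Q C)
  resIso_σ i Q C W h q c w := CEXTObj.sumRes_map hO hA i Q C h q c w

end actions

end

section

variable {O : StructureSheaf X} {U : Opens X} {A : LieAlgebroid O} {P : InvariantPairing A}

/-! ### The functor `V ↦ Â - V` -/

section difference

open Algebroid

variable (hO : IsSmooth O) (hA : A.IsTransitive) (Ahat : VertexExtension A)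
  (hP : Ahat.proj.Induces P)

/-- The difference `Â - V`. -/
def VertexExtension.diffObj (V : EVAObj O U) : CEXTObj A P U where
  alg := combine hO (Ahat.vertex.isAlg.restrict le_top) V.vertex.isAlg
    (AnchorSurj.restrict (Ahat.proj.anchorSurj hA) le_top) (ε := -1) (by norm_num)
  courant := IsAlg.isCourant (by
    simpa using combine_isAlg hO (Ahat.vertex.isAlg.restrict le_top) V.vertex.isAlg
      (AnchorSurj.restrict (Ahat.proj.anchorSurj hA) le_top) (ε := -1) (by norm_num))
  proj := (combination hO (Ahat.vertex.isAlg.restrict le_top) V.vertex.isAlg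
    (AnchorSurj.restrict (Ahat.proj.anchorSurj hA) le_top) (ε := -1) (by norm_num)).projLeft hO
      (Ahat.vertex.isAlg.restrict le_top) V.vertex.isAlg
      (combine_isAlg hO _ _ (AnchorSurj.restrict (Ahat.proj.anchorSurj hA) le_top) _) (by norm_num)
      (Ahat.proj.restrict le_top) hA V.exact
  induces := Combination.projLeft_induces hO (Ahat.vertex.isAlg.restrict le_top) V.vertex.isAlg
    (combination hO _ _ (AnchorSurj.restrict (Ahat.proj.anchorSurj hA) le_top) _)
    (combine_isAlg hO _ _ (AnchorSurj.restrict (Ahat.proj.anchorSurj hA) le_top) _) (by norm_num)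
    (Ahat.proj.restrict le_top) hA V.exact (fun h e e' x x' => hP _ e e' x x')

/-- The canonical map `Â ×_T V → Â - V`. -/
def VertexExtension.diffMap (V : EVAObj O U) :
    Combination (-1) (Ahat.alg.restrict (le_top : U ≤ ⊤)) V.alg
      (Ahat.diffObj hO hA hP V).alg :=
  combination hO (Ahat.vertex.isAlg.restrict le_top) V.vertex.isAlg
    (AnchorSurj.restrict (Ahat.proj.anchorSurj hA) le_top) (by norm_num)

theorem VertexExtension.proj_diffMap (V : EVAObj O U) {W : Opens X} (h : W ≤ U)
    (a : Ahat.alg.sec W le_top) (v : V.alg.sec W h)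
    (w : Ahat.alg.anchor le_top a = V.alg.anchor h v) :
    (Ahat.diffObj hO hA hP V).proj.app h ((Ahat.diffMap hO hA hP V).map h a v w)
      = Ahat.proj.app le_top a :=
  Combination.projLeft_map hO (Ahat.vertex.isAlg.restrict le_top) V.vertex.isAlg
    (Ahat.diffMap hO hA hP V)
    (combine_isAlg hO _ _ (AnchorSurj.restrict (Ahat.proj.anchorSurj hA) le_top) _) (by norm_num)
    (Ahat.proj.restrict le_top) hA V.exact h a v w

/-- The morphism `(a, v) ↦ (a, ψ(v))` between differences. -/
def VertexExtension.diffAlgHom {V V' : EVAObj O U} (ψ : Algebroid.Hom V.alg V'.alg) :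
    Algebroid.Hom (Ahat.diffObj hO hA hP V).alg (Ahat.diffObj hO hA hP V').alg :=
  (Ahat.diffMap hO hA hP V).mapHom hO (Ahat.vertex.isAlg.restrict le_top) V.vertex.isAlg
    (Ahat.vertex.isAlg.restrict le_top) V'.vertex.isAlg (Ahat.diffObj hO hA hP V).courant.isAlg
    (Ahat.diffObj hO hA hP V').courant.isAlg (Ahat.diffMap hO hA hP V') (Algebroid.Hom.id _) ψ

theorem VertexExtension.diffAlgHom_map {V V' : EVAObj O U} (ψ : Algebroid.Hom V.alg V'.alg)
    {W : Opens X} (h : W ≤ U) (a : Ahat.alg.sec W le_top) (v : V.alg.sec W h)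
    (w : Ahat.alg.anchor le_top a = V.alg.anchor h v)
    (w' : Ahat.alg.anchor le_top a = V'.alg.anchor h (ψ.app h v)) :
    (Ahat.diffAlgHom hO hA hP ψ).app h ((Ahat.diffMap hO hA hP V).map h a v w)
      = (Ahat.diffMap hO hA hP V').map h a (ψ.app h v) w' :=
  (Ahat.diffMap hO hA hP V).mapHom_map hO (Ahat.vertex.isAlg.restrict le_top) V.vertex.isAlg
    (Ahat.vertex.isAlg.restrict le_top) V'.vertex.isAlg (Ahat.diffObj hO hA hP V).courant.isAlg
    (Ahat.diffObj hO hA hP V').courant.isAlg (Ahat.diffMap hO hA hP V') (Algebroid.Hom.id _) ψ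
    h a v w w'

/-- The morphism `(a, v) ↦ (a, ψ(v))` of extensions of `A`. -/
def VertexExtension.diffHom {V V' : EVAObj O U} (ψ : Algebroid.Hom V.alg V'.alg) :
    CEXTObj.Hom (Ahat.diffObj hO hA hP V) (Ahat.diffObj hO hA hP V') where
  hom := Ahat.diffAlgHom hO hA hP ψ
  proj_hom := (Ahat.diffMap hO hA hP V).proj_hom _ _ _ fun h a v w => by
    refine (congrArg (Projection.app _ h)
      (Ahat.diffAlgHom_map hO hA hP ψ h a v w (w.trans (ψ.anchor_app h v).symm))).trans ?_
    exact (Ahat.proj_diffMap hO hA hP V' h a _ _).trans (Ahat.proj_diffMap hO hA hP V h a v w).symm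

/-- The functor `V ↦ Â - V` on sections over `U`. -/
def VertexExtension.diffFunctor (U : Opens X) : EVAObj O U ⥤ CEXTObj A P U where
  obj V := Ahat.diffObj hO hA hP V
  map ψ := Ahat.diffHom hO hA hP ψ
  map_id V := CEXTObj.Hom.ext <| (Ahat.diffMap hO hA hP V).hom_ext fun h a v w =>
    Ahat.diffAlgHom_map hO hA hP (Algebroid.Hom.id V.alg) h a v w w
  map_comp {V V' V''} φ ψ := CEXTObj.Hom.ext <| (Ahat.diffMap hO hA hP V).hom_ext
    fun h a v w => by
      have w' : Ahat.alg.anchor le_top a = V'.alg.anchor h (Algebroid.Hom.app φ h v) :=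
        w.trans (Algebroid.Hom.anchor_app φ h v).symm
      have w'' : Ahat.alg.anchor le_top a
          = V''.alg.anchor h (Algebroid.Hom.app ψ h (Algebroid.Hom.app φ h v)) :=
        w'.trans (Algebroid.Hom.anchor_app ψ h _).symm
      refine (Ahat.diffAlgHom_map hO hA hP _ h a v w w'').trans ?_
      refine Eq.trans ?_ (congrArg ((Ahat.diffAlgHom hO hA hP ψ).app h)
        (Ahat.diffAlgHom_map hO hA hP φ h a v w w')).symm
      exact (Ahat.diffAlgHom_map hO hA hP ψ h a _ w' w'').symm

/-- The comparison of the difference of restrictions with the restriction of a difference. -/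
def VertexExtension.diffResAlg {U' : Opens X} (i : U' ≤ U) (V : EVAObj O U) :
    Algebroid.Hom (Ahat.diffObj hO hA hP ((EVAObj.restrict i).obj V)).alg
      ((CEXTObj.restrict i).obj (Ahat.diffObj hO hA hP V)).alg :=
  (Ahat.diffMap hO hA hP ((EVAObj.restrict i).obj V)).compare hO
    ((Ahat.diffMap hO hA hP V).restrict i)
    (Ahat.vertex.isAlg.restrict le_top) (V.vertex.isAlg.restrict i)
    (Ahat.diffObj hO hA hP ((EVAObj.restrict i).obj V)).courant.isAlg
    ((Ahat.diffObj hO hA hP V).courant.isAlg.restrict i)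

theorem VertexExtension.diffResAlg_map {U' : Opens X} (i : U' ≤ U) (V : EVAObj O U)
    {W : Opens X} (h : W ≤ U') (a : Ahat.alg.sec W le_top) (v : V.alg.sec W (h.trans i))
    (w : Ahat.alg.anchor le_top a = V.alg.anchor (h.trans i) v) :
    (Ahat.diffResAlg hO hA hP i V).app h
        ((Ahat.diffMap hO hA hP ((EVAObj.restrict i).obj V)).map h a v w)
      = (Ahat.diffMap hO hA hP V).map (h.trans i) a v w :=
  Combination.compare_map hO (Ahat.diffMap hO hA hP ((EVAObj.restrict i).obj V))
    ((Ahat.diffMap hO hA hP V).restrict i) _ _ _ _ h a v w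

/-- The difference of restrictions is the restriction of the difference. -/
def VertexExtension.diffRes {U' : Opens X} (i : U' ≤ U) (V : EVAObj O U) :
    CEXTObj.Hom (Ahat.diffObj hO hA hP ((EVAObj.restrict i).obj V))
      ((CEXTObj.restrict i).obj (Ahat.diffObj hO hA hP V)) where
  hom := Ahat.diffResAlg hO hA hP i V
  proj_hom := (Ahat.diffMap hO hA hP ((EVAObj.restrict i).obj V)).proj_hom _ _ _
    fun h a v w => by
      refine (congrArg (Projection.app _ h) (Ahat.diffResAlg_map hO hA hP i V h a v w)).trans ?_
      refine (Ahat.proj_diffMap hO hA hP V (h.trans i) a v w).trans ?_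
      exact (Ahat.proj_diffMap hO hA hP ((EVAObj.restrict i).obj V) h a v w).symm

/-- The compatibility of `V ↦ Â - V` with restriction. -/
def VertexExtension.diffResIso {U' : Opens X} (i : U' ≤ U) :
    EVAObj.restrict i ⋙ Ahat.diffFunctor hO hA hP U'
      ≅ Ahat.diffFunctor hO hA hP U ⋙ CEXTObj.restrict i :=
  NatIso.ofComponents (fun V =>
    haveI := CEXTObj.isIso hO hA (Ahat.diffObj hO hA hP ((EVAObj.restrict i).obj V))
      ((CEXTObj.restrict i).obj (Ahat.diffObj hO hA hP V)) (Ahat.diffRes hO hA hP i V)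
    asIso (X := Ahat.diffObj hO hA hP ((EVAObj.restrict i).obj V))
      (Y := (CEXTObj.restrict i).obj (Ahat.diffObj hO hA hP V))
      (Ahat.diffRes hO hA hP i V))
    fun {V V'} ψ => CEXTObj.Hom.ext <|
      (Ahat.diffMap hO hA hP ((EVAObj.restrict i).obj V)).hom_ext fun h a v w => by
        have w' : Ahat.alg.anchor le_top a
            = V'.alg.anchor (h.trans i) (Algebroid.Hom.app ψ (h.trans i) v) :=
          w.trans (Algebroid.Hom.anchor_app ψ (h.trans i) v).symm
        refine (congrArg ((Ahat.diffResAlg hO hA hP i V').app h) (Ahat.diffAlgHom_map hO hA hP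
          ((EVAObj.restrict i).map ψ) h a v w w')).trans ?_
        refine (Ahat.diffResAlg_map hO hA hP i V' h a _ w').trans ?_
        refine Eq.trans ?_ (congrArg ((Ahat.diffAlgHom hO hA hP ψ).app (h.trans i))
          (Ahat.diffResAlg_map hO hA hP i V h a v w)).symm
        exact (Ahat.diffAlgHom_map hO hA hP ψ (h.trans i) a v w w').symm

/-- The morphism of stacks `V ↦ Â - V`. -/
def VertexExtension.diffTrans : Pseudofunctor.StrongTrans (EVA O) (CEXT A P) where
  app a := (Ahat.diffFunctor hO hA hP a.as.unop).toCatHom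
  naturality f := Cat.Hom.isoMk (Ahat.diffResIso hO hA hP (leOfHom f.as.unop))
  naturality_naturality {a b f g} η := by
    obtain rfl := LocallyDiscrete.eq_of_hom η
    obtain rfl : η = 𝟙 f := Subsingleton.elim _ _
    rw [(EVA O).map₂_id, (CEXT A P).map₂_id]
    exact ((congrArg (· ≫ _) (Bicategory.id_whiskerRight _ _)).trans (Category.id_comp _)).trans
      ((congrArg (_ ≫ ·) (Bicategory.whiskerLeft_id _ _)).trans (Category.comp_id _)).symm
  naturality_id a := by
    refine Cat.Hom₂.ext (NatTrans.ext (funext fun V => CEXTObj.Hom.ext ?_))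
    refine (Ahat.diffMap hO hA hP ((EVAObj.restrict (leOfHom (𝟙 a.as.unop))).obj V)).hom_ext
      fun h c v w => ?_
    refine (Ahat.diffResAlg_map hO hA hP (leOfHom (𝟙 a.as.unop)) V h c v w).trans ?_
    exact (Ahat.diffAlgHom_map hO hA hP (Algebroid.Hom.id V.alg) h c v w w).symm
  naturality_comp {a b c} f g := by
    refine Cat.Hom₂.ext (NatTrans.ext (funext fun V => CEXTObj.Hom.ext ?_))
    refine (Ahat.diffMap hO hA hP
      ((EVAObj.restrict (leOfHom (f ≫ g).as.unop)).obj V)).hom_ext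
      fun h v' v w => ?_
    have iab := leOfHom f.as.unop
    have ibc := leOfHom g.as.unop
    refine (Ahat.diffResAlg_map hO hA hP (leOfHom (f ≫ g).as.unop) V h v' v w).trans ?_
    refine Eq.trans ?_ (congrArg (fun x => (Ahat.diffResAlg hO hA hP (leOfHom f.as.unop) V).app
      (h.trans ibc) ((Ahat.diffResAlg hO hA hP (leOfHom g.as.unop)
        ((EVAObj.restrict (leOfHom f.as.unop)).obj V)).app h x))
      (Ahat.diffAlgHom_map hO hA hP (Algebroid.Hom.id _) h v' v w w)).symm
    refine Eq.trans ?_ (congrArg (fun x => (Ahat.diffResAlg hO hA hP (leOfHom f.as.unop) V).app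
      (h.trans ibc) x)
      (Ahat.diffResAlg_map hO hA hP (leOfHom g.as.unop)
        ((EVAObj.restrict (leOfHom f.as.unop)).obj V) h v' v w)).symm
    exact (Ahat.diffResAlg_map hO hA hP (leOfHom f.as.unop) V (h.trans ibc) v' v w).symm

/-- The functor `V ↦ Â - V`, with its canonical maps. -/
def VertexExtension.difference : DifferenceFunctor Ahat P where
  functor := Ahat.diffTrans hO hA hP
  δ V := Ahat.diffMap hO hA hP V
  δ_proj V _ h a v w := Ahat.proj_diffMap hO hA hP V h a v w
  δ_natural ψ _ h a v w w' := Ahat.diffAlgHom_map hO hA hP ψ h a v w w'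
  δ_res i V _ h a v w := Ahat.diffResAlg_map hO hA hP i V h a v w

end difference

end

section

variable {O : StructureSheaf X} {U : Opens X} {A : LieAlgebroid O} {P : InvariantPairing A}

/-! ### The functor `V ↦ Â - V` is an equivalence -/

namespace Algebroid

/-- A 1-form vanishes if it is orthogonal to sections with all possible anchors. -/
theorem IsLevel.form_eq_zero {E : Algebroid O U} {k : ℤ} (hO : IsSmooth O) (hE : E.IsAlg k)
    {W : Opens X} (h : W ≤ U) (α : Form O 1 W)
    (H : ∀ (V : Opens X) (i : V ≤ W) (ξ : VF O V), ∀ p ∈ V,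
      ∃ (V' : Opens X) (j : V' ≤ V) (_ : p ∈ V') (e : E.sec V' (j.trans (i.trans h))),
        E.anchor _ e = VF.res j ξ ∧ E.pairing _ (E.inc _ (Form.res (j.trans i) α)) e = 0) :
    α = 0 := by
  refine Form.ext₁ fun V i ξ => Fn.eq_of_local O fun p hp => ?_
  obtain ⟨V', j, hpV', e, he, h0⟩ := H V i ξ p hp
  refine ⟨V', j, hpV', ?_⟩
  rw [hE.inc_pairing hO, he] at h0
  rw [Form.res_ev, Form.res_res, h0, map_zero, Form.zero_ev, map_zero]

section difference

variable {E V V' D D' : Algebroid O U} {k₁ k₂ k k' : ℤ} (hO : IsSmooth O) (hA : A.IsTransitive)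
  (hE : E.IsAlg k₁) (hV : V.IsAlg k₂) (hV' : V'.IsAlg k₂) (hD : D.IsAlg k) (hD' : D'.IsAlg k')
  (hVe : V.IsExact) (hVe' : V'.IsExact)
  (π : Projection A E) (ρ : Projection A D) (ρ' : Projection A D')
  (κ : Combination (-1) E V D) (κ' : Combination (-1) E V' D')
  (hκ : ∀ {W : Opens X} (h : W ≤ U) (a : E.sec W h) (v : V.sec W h) (w),
    ρ.app h (κ.map h a v w) = π.app h a)
  (hκ' : ∀ {W : Opens X} (h : W ≤ U) (a : E.sec W h) (v : V'.sec W h) (w),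
    ρ'.app h (κ'.map h a v w) = π.app h a)

include hO hE κ' π hA in
/-- A morphism is determined by the morphism of differences which it induces. -/
theorem differenceHom_unique (φ ψ : Hom V V')
    (H : ∀ {W : Opens X} (h : W ≤ U) (a : E.sec W h) (v : V.sec W h),
      E.anchor h a = V.anchor h v → ∀ (w w'),
      κ'.map h a (φ.app h v) w = κ'.map h a (ψ.app h v) w') : φ = ψ := by
  refine Hom.ext_app fun h v => V'.eq_of_local h fun p hp => ?_
  obtain ⟨W', i, hp', a, ha⟩ := π.anchorSurj hA h (V.anchor h v) p hp
  refine ⟨W', i, hp', ?_⟩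
  rw [V.res_anchor] at ha
  have w : E.anchor (i.trans h) a = V'.anchor _ (φ.app _ (V.res h i v)) := by
    rw [φ.anchor_app, ha]
  have w' : E.anchor (i.trans h) a = V'.anchor _ (ψ.app _ (V.res h i v)) := by
    rw [ψ.anchor_app, ha]
  obtain ⟨α, h1, h2⟩ := κ'.eq_of_map_eq _ (H (i.trans h) a (V.res h i v) ha w w')
  rw [sub_self] at h1
  have hα : α = 0 := hE.inc_injective hO (π.anchorSurj hA) _ (h1.symm.trans (map_zero _).symm)
  rw [hα, map_zero, smul_zero, neg_zero, sub_eq_zero] at h2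
  rw [← φ.app_res, ← ψ.app_res, h2]

variable (χ : Hom D D') (hχ : ∀ {W : Opens X} (h : W ≤ U) (d : D.sec W h),
  ρ'.app h (χ.app h d) = ρ.app h d)

include hO hA hD' ρ' in
theorem _root_.Algebroids.Projection.exists_eq_add_inc {W : Opens X} (h : W ≤ U) (d d' : D'.sec W h)
    (e : ρ'.app h d = ρ'.app h d') : ∃ α, d = d' + D'.inc h α := by
  obtain ⟨α, hα⟩ := ρ'.exists_inc hO hA hD' h (d - d') (by rw [map_sub, e, sub_self])
  exact ⟨α, by rw [← hα]; abel⟩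

include hO hA hE hV' hD' κ' hκ hκ' hχ hVe' in
/-- Given `a`, a morphism of differences maps `(a, v)` to some `(a, v')`. -/
theorem exists_difference_eq {W : Opens X} (h : W ≤ U) (a : E.sec W h) (v : V.sec W h)
    (w : E.anchor h a = V.anchor h v) (p : X) (hp : p ∈ W) :
    ∃ (W' : Opens X) (i : W' ≤ W) (_ : p ∈ W') (v' : V'.sec W' (i.trans h))
      (w₁ : E.anchor (i.trans h) (E.res h i a) = V.anchor (i.trans h) (V.res h i v))
      (w₂ : E.anchor (i.trans h) (E.res h i a) = V'.anchor (i.trans h) v'),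
      χ.app (i.trans h) (κ.map _ (E.res h i a) (V.res h i v) w₁)
        = κ'.map (i.trans h) (E.res h i a) v' w₂ := by
  obtain ⟨W', i, hp', v', hv'⟩ := hVe'.anchorSurj h (E.anchor h a) p hp
  have w₁ : E.anchor (i.trans h) (E.res h i a) = V.anchor _ (V.res h i v) := by
    rw [← E.res_anchor, ← V.res_anchor, w]
  have w₂ : E.anchor (i.trans h) (E.res h i a) = V'.anchor _ v' := by
    rw [← E.res_anchor, hv']
  obtain ⟨α, hα⟩ := ρ'.exists_eq_add_inc hO hA hD' _ (χ.app (i.trans h) (κ.map _ _ _ w₁))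
    (κ'.map _ _ _ w₂) (by rw [hχ, hκ, hκ'])
  have w₃ : E.anchor (i.trans h) (E.res h i a) = V'.anchor _ (v' - V'.inc _ α) := by
    rw [map_sub, hV'.anchor_inc hO, sub_zero, w₂]
  refine ⟨W', i, hp', v' - V'.inc _ α, w₁, w₃, hα.trans ?_⟩
  have w₄ : E.anchor (i.trans h) (E.res h i a + E.inc _ 0)
      = V'.anchor _ (v' + V'.inc _ (-α)) := by
    rw [map_zero, add_zero, map_neg, ← sub_eq_add_neg, w₃]
  rw [κ'.congr (E := D') (by rw [map_zero, add_zero]) (by rw [map_neg, sub_eq_add_neg]) w₃ w₄,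
    κ'.map_add_inc hO hE hV' hD' _ _ _ _ _ w₂ w₄ (by norm_num)]
  simp

include hO hA hE hV' hD' hκ hκ' hχ hVe hVe' in
/-- A morphism of differences over `A` is the identity on pairs `(g, 0)`. -/
theorem differenceHom_zero {W : Opens X} (h : W ≤ U) (g : E.sec W h)
    (w : E.anchor h g = V.anchor h 0) (w' : E.anchor h g = V'.anchor h 0) :
    χ.app h (κ.map h g 0 w) = κ'.map h g 0 w' := by
  obtain ⟨α, hα⟩ := ρ'.exists_eq_add_inc hO hA hD' h (χ.app h (κ.map h g 0 w))
    (κ'.map h g 0 w') (by rw [hχ, hκ, hκ'])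
  have : α = 0 := by
    refine hD'.form_eq_zero hO h α fun W' i ξ p hp => ?_
    obtain ⟨W₁, j, hp₁, a, ha⟩ := π.anchorSurj hA (i.trans h) ξ p hp
    obtain ⟨W₂, l, hp₂, v, hv⟩ := hVe.anchorSurj (j.trans (i.trans h)) (E.anchor _ a) p hp₁
    have w₁ : E.anchor (l.trans (j.trans (i.trans h))) (E.res _ l a) = V.anchor _ v := by
      rw [← E.res_anchor, hv]
    obtain ⟨W₃, m, hp₃, v', w₂, w₃, e⟩ := exists_difference_eq hO hA hE hV' hD' hVe' π ρ ρ'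
      κ κ' hκ hκ' χ hχ _ _ v w₁ p hp₂
    have t : W₃ ≤ W := m.trans (l.trans (j.trans i))
    refine ⟨W₃, m.trans (l.trans j), hp₃, χ.app _ (κ.map _ _ _ w₂), ?_, ?_⟩
    · rw [χ.anchor_app, κ.anchor_map, E.res_res, ← E.res_anchor, ha, VF.res_res]
    · have wg : E.anchor (t.trans h) (E.res h t g) = V.anchor (t.trans h) 0 := by
        rw [← E.res_anchor, w, map_zero, map_zero, map_zero]
      have wg' : E.anchor (t.trans h) (E.res h t g) = V'.anchor (t.trans h) 0 := by
        rw [← E.res_anchor, w', map_zero, map_zero, map_zero]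
      have r : D.res h t (κ.map h g 0 w) = κ.map (t.trans h) (E.res h t g) 0 wg := by
        rw [← κ.map_res h t g 0 w (by rw [map_zero, wg])]
        exact κ.congr rfl (map_zero _) _ _
      have r' : D'.res h t (κ'.map h g 0 w') = κ'.map (t.trans h) (E.res h t g) 0 wg' := by
        rw [← κ'.map_res h t g 0 w' (by rw [map_zero, wg'])]
        exact κ'.congr rfl (map_zero _) _ _
      have hα' : D'.inc (t.trans h) (Form.res t α)
          = χ.app _ (κ.map _ _ _ wg) - κ'.map _ _ _ wg' := by
        rw [← D'.res_inc h t α, ← sub_eq_of_eq_add' hα, map_sub, ← χ.app_res, r, r']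
      refine (congrArg (fun x => D'.pairing _ x _) hα').trans ?_
      rw [map_sub, LinearMap.sub_apply, χ.pairing_app, κ.pairing_map, e, κ'.pairing_map]
      simp
  rw [hα, this, map_zero, add_zero]

/-- The relation `v ↦ v'` if a morphism of differences maps `(a, v)` to `(a, v')` for some `a`. -/
def differenceRel : HomRel V V' where
  rel h v v' := ∃ a w w', χ.app h (κ.map h a v w) = κ'.map h a v' w'
  res := by
    rintro W W' h i v v' ⟨a, w, w', e⟩
    have w₁ : E.anchor (i.trans h) (E.res h i a) = V.anchor (i.trans h) (V.res h i v) := by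
      rw [← E.res_anchor, w, V.res_anchor]
    have w₂ : E.anchor (i.trans h) (E.res h i a) = V'.anchor (i.trans h) (V'.res h i v') := by
      rw [← E.res_anchor, w', V'.res_anchor]
    exact ⟨_, w₁, w₂, by rw [κ.map_res h i a v w w₁, κ'.map_res h i a v' w' w₂, χ.app_res, e]⟩
  add := by
    rintro W h v v₁ v' v₁' ⟨a, w, w', e⟩ ⟨a₁, w₁, w₁', e₁⟩
    exact ⟨a + a₁, by rw [map_add, map_add, w, w₁], by rw [map_add, map_add, w', w₁'], by
      rw [κ.map_add h _ _ _ _ w w₁, κ'.map_add h _ _ _ _ w' w₁', map_add, e, e₁]⟩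
  smul := by
    rintro W h c v v' ⟨a, w, w', e⟩
    exact ⟨c • a, by rw [map_smul, map_smul, w], by rw [map_smul, map_smul, w'], by
      rw [κ.map_csmul hE hV hD h c _ _ w, κ'.map_csmul hE hV' hD' h c _ _ w', map_smul, e]⟩
  uniq := by
    rintro W h v' ⟨a, w, w', e⟩
    have w₀ : E.anchor h a = V'.anchor h 0 := by rw [w, map_zero, map_zero]
    rw [differenceHom_zero hO hA hE hV' hD' hVe hVe' π ρ ρ' κ κ' hκ hκ' χ hχ h a w w₀]
      at e
    obtain ⟨α, h1, h2⟩ := κ'.eq_of_map_eq _ e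
    rw [sub_self] at h1
    have hα : α = 0 := hE.inc_injective hO (π.anchorSurj hA) _ (h1.symm.trans (map_zero _).symm)
    rw [hα, map_zero, smul_zero, neg_zero, zero_sub, neg_eq_zero] at h2
    exact h2
  total := by
    intro W h v p hp
    obtain ⟨W₁, i, hp₁, a, ha⟩ := π.anchorSurj hA h (V.anchor h v) p hp
    obtain ⟨W₂, j, hp₂, v', w₁, w₂, e⟩ := exists_difference_eq hO hA hE hV' hD' hVe' π ρ ρ'
      κ κ' hκ hκ' χ hχ _ a (V.res h i v) (ha.trans (V.res_anchor _ _ _)) p hp₁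
    refine ⟨W₂, j.trans i, hp₂, v', _, ?_, w₂, ?_⟩
    · rw [← V.res_res h i j]
      exact w₁
    · rw [← e]
      exact congrArg _ (κ.congr rfl (V.res_res h i j v).symm _ _)
  act := by
    rintro W h f v v' ⟨a, w, w', e⟩
    exact ⟨E.act h f a, by rw [hE.anchor_act, hV.anchor_act, w],
      by rw [hE.anchor_act, hV'.anchor_act, w'], by
      rw [κ.map_act h f _ _ w, κ'.map_act h f _ _ w', χ.app_act, e]⟩
  bracket := by
    rintro W h v v₁ v' v₁' ⟨a, w, w', e⟩ ⟨a₁, w₁, w₁', e₁⟩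
    exact ⟨E.bracket h a a₁, by rw [hE.anchor_bracket, hV.anchor_bracket, w, w₁],
      by rw [hE.anchor_bracket, hV'.anchor_bracket, w', w₁'], by
      rw [κ.map_bracket h _ _ _ _ w w₁, κ'.map_bracket h _ _ _ _ w' w₁', χ.app_bracket, e, e₁]⟩
  anchor := by
    rintro W h v v' ⟨a, w, w', e⟩
    rw [← w, w']
  pairing := by
    rintro W h v v₁ v' v₁' ⟨a, w, w', e⟩ ⟨a₁, w₁, w₁', e₁⟩
    have := χ.pairing_app h (κ.map h a v w) (κ.map h a₁ v₁ w₁)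
    rw [e, e₁, κ.pairing_map, κ'.pairing_map] at this
    simpa using this
  der h f := by
    have w : E.anchor h 0 = V.anchor h (V.der h f) := by rw [map_zero, hV.anchor_der]
    have w' : E.anchor h 0 = V'.anchor h (V'.der h f) := by rw [map_zero, hV'.anchor_der]
    have w₀ : E.anchor h (E.der h 0) = V.anchor h (V.der h f) := by rw [map_zero, w]
    have w₀' : E.anchor h (E.der h 0) = V'.anchor h (V'.der h f) := by rw [map_zero, w']
    refine ⟨0, w, w', ?_⟩
    rw [κ.congr (map_zero _).symm rfl w w₀, κ'.congr (map_zero _).symm rfl w' w₀', κ.map_der,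
      κ'.map_der, map_add, map_zsmul, χ.app_der, χ.app_der]

include hO hA hE hV hV' hD hD' hκ hκ' hχ hVe hVe' in
/-- Every morphism of differences over `A` is induced by a morphism. -/
theorem exists_of_differenceHom : ∃ ψ : Hom V V', ∀ {W : Opens X} (h : W ≤ U) (a : E.sec W h)
    (v : V.sec W h) (w) (w'), χ.app h (κ.map h a v w) = κ'.map h a (ψ.app h v) w' := by
  let R := differenceRel hO hA hE hV hV' hD hD' hVe hVe' π ρ ρ' κ κ' hκ hκ' χ hχ
  refine ⟨R.toHom, fun h a v w w' => D'.eq_of_local h fun p hp => ?_⟩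
  obtain ⟨W₁, i, hp₁, v', w₁, w₂, e⟩ := exists_difference_eq hO hA hE hV' hD' hVe' π ρ ρ'
    κ κ' hκ hκ' χ hχ h a v w p hp
  refine ⟨W₁, i, hp₁, ?_⟩
  have hv' : R.toHom.app (i.trans h) (V.res h i v) = v' := R.toHom_eq _ ⟨_, w₁, w₂, e⟩
  rw [← χ.app_res, ← κ.map_res h i a v w w₁, e, ← κ'.map_res h i a _ w'
    (by rw [← R.toHom.app_res, hv', w₂])]
  exact κ'.congr rfl (hv'.symm.trans (R.toHom.app_res h i v)) _ _

end difference

section essSurj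

variable {E C D : Algebroid O U} {k₁ k₂ k : ℤ} (hO : IsSmooth O) (hA : A.IsTransitive)
  (hE : E.IsAlg k₁) (hC : C.IsAlg k₂) (hD : D.IsAlg k)
  (π₁ : Projection A E) (π₂ : Projection A C) (h₁ : π₁.Induces P) (h₂ : π₂.Induces P)
  (κ : Combination (-1) E (diff π₁ π₂ hO hA hE hC) D)

local notation "𝓓" => diff π₁ π₂ hO hA hE hC
local notation "δ" => diffMk π₁ π₂ hO hA hE hC

theorem anchor_eq_of_projection_eq {W : Opens X} (h : W ≤ U) {a : E.sec W h} {c : C.sec W h}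
    (w : π₁.app h a = π₂.app h c) : E.anchor h a = (𝓓).anchor h (δ h a c w) :=
  (anchor_diffMk h w).symm

include h₁ h₂ in
/-- Locally, every section of `E - (E - C)` is the class of `(a, (a, c))` for some `a` and `c` with the
same image in `A`. -/
theorem exists_eq_map_diffMk {W : Opens X} (h : W ≤ U) (e : D.sec W h) (p : X) (hp : p ∈ W) :
    ∃ (V : Opens X) (i : V ≤ W) (_ : p ∈ V) (a : E.sec V (i.trans h)) (c : C.sec V (i.trans h))
      (w : π₁.app (i.trans h) a = π₂.app (i.trans h) c)
      (w' : E.anchor (i.trans h) a = (𝓓).anchor (i.trans h) (δ (i.trans h) a c w)),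
      κ.map (i.trans h) a (δ (i.trans h) a c w) w' = D.res h i e := by
  have hQ := diff_isAlg π₁ π₂ hO hA hE hC
  obtain ⟨V, i, hpV, a, b, w, e₁⟩ := κ.surj h e p hp
  obtain ⟨V', j, hV', hpV', c, hc⟩ := π₂.surj (i.trans h) (π₁.app (i.trans h) a) p hpV
  have t : V' ≤ U := j.trans (i.trans h)
  have w₁ : π₁.app t (E.res _ j a) = π₂.app t c := by rw [hc, ← π₁.app_res]
  have w₂ := anchor_eq_of_projection_eq hO hA hE hC π₁ π₂ t w₁
  have w₃ : E.anchor t (E.res _ j a) = (𝓓).anchor t ((𝓓).res _ j b) := by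
    rw [← E.res_anchor, w, ← (𝓓).res_anchor]
  -- `b` and the class of `(a, c)` have the same anchor, so that they differ by a 1-form `α`, which is
  -- absorbed by changing `c`
  obtain ⟨α, hα⟩ := (diff_isExact π₁ π₂ hO hA hE hC h₁ h₂).exists_inc hO hQ t
    ((𝓓).res _ j b - δ t (E.res _ j a) c w₁) (by
      rw [map_sub, ← w₃, ← w₂, sub_self])
  have w₄ : π₁.app t (E.res _ j a) = π₂.app t (c - C.inc t α) := by
    rw [map_sub, π₂.app_inc hO hC, sub_zero, w₁]
  have w₅ : π₁.app t (0 : E.sec V' t) = π₂.app t (C.inc t α) := by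
    rw [map_zero, π₂.app_inc hO hC]
  have w₆ : π₁.app t (E.inc t α) = π₂.app t (C.inc t α) := by
    rw [π₁.app_inc hO hE, π₂.app_inc hO hC]
  have w₇ : π₁.app t (E.inc t α) = π₂.app t (0 : C.sec V' t) := by
    rw [map_zero, π₁.app_inc hO hE]
  have e₂ : δ t 0 (C.inc t α) w₅ = -(𝓓).inc t α := by
    rw [← diffMk_inc_zero t α w₇, ← zero_sub, ← diffMk_inc_inc t α w₆,
      ← diffMk_sub t w₆ w₇ (by rw [sub_self, sub_zero, w₅])]
    exact diffMk_congr (sub_self _).symm (sub_zero _).symm _ _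
  have e₃ : (𝓓).res _ j b = δ t (E.res _ j a) (c - C.inc t α) w₄ := by
    have : δ t (E.res _ j a) (c - C.inc t α) w₄
        = δ t (E.res _ j a) c w₁ - δ t 0 (C.inc t α) w₅ := by
      rw [← diffMk_sub t w₁ w₅ (by rw [sub_zero, w₄])]
      exact diffMk_congr (sub_zero _).symm rfl _ _
    rw [this, e₂, ← hα]
    abel
  refine ⟨V', j.trans i, hpV', E.res _ j a, c - C.inc t α, w₄,
    anchor_eq_of_projection_eq hO hA hE hC π₁ π₂ t w₄, ?_⟩
  rw [← D.res_res h i j, ← e₁, ← κ.map_res _ j a b w w₃]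
  exact κ.congr rfl e₃.symm _ _

/-- The relation `(a, (a, c)) ↦ c` between `E - (E - C)` and `C`. -/
def diffDiffRel : HomRel D C where
  rel h e c := ∃ (a : E.sec _ h) (w : π₁.app h a = π₂.app h c) (w' : _),
    κ.map h a (δ h a c w) w' = e
  res := by
    rintro W V h i _ c ⟨a, w, w', rfl⟩
    have w₁ : π₁.app (i.trans h) (E.res h i a) = π₂.app (i.trans h) (C.res h i c) := by
      rw [π₁.app_res, w, π₂.app_res]
    have w₂ := anchor_eq_of_projection_eq hO hA hE hC π₁ π₂ _ w₁
    refine ⟨_, w₁, w₂, ?_⟩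
    rw [← κ.map_res h i a _ w' (by rw [diffMk_res h w i w₁, w₂])]
    exact κ.congr rfl (diffMk_res h w i w₁).symm _ _
  add := by
    rintro W h _ _ c c' ⟨a, w, w', rfl⟩ ⟨a₁, w₁, w₁', rfl⟩
    have w₂ : π₁.app h (a + a₁) = π₂.app h (c + c') := by rw [map_add, map_add, w, w₁]
    have w₃ := anchor_eq_of_projection_eq hO hA hE hC π₁ π₂ h w₂
    refine ⟨a + a₁, w₂, w₃, ?_⟩
    rw [← κ.map_add h _ _ _ _ w' w₁' (by rw [← diffMk_add h w w₁ w₂, w₃])]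
    exact κ.congr rfl (diffMk_add h w w₁ w₂) _ _
  smul := by
    rintro W h r _ c ⟨a, w, w', rfl⟩
    have w₂ : π₁.app h (r • a) = π₂.app h (r • c) := by rw [map_smul, map_smul, w]
    have w₃ := anchor_eq_of_projection_eq hO hA hE hC π₁ π₂ h w₂
    refine ⟨r • a, w₂, w₃, ?_⟩
    rw [← κ.map_csmul hE (diff_isAlg π₁ π₂ hO hA hE hC) hD h r _ _ w'
      (by rw [← diffMk_csmul h w r w₂, w₃])]
    exact κ.congr rfl (diffMk_csmul h w r w₂) _ _
  uniq := by
    rintro W h c ⟨a, w, w', e⟩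
    obtain ⟨α, rfl, e₂⟩ := (κ.ker h _ _ _).1 e
    have w₀ : π₁.app h (E.inc h α) = π₂.app h (0 : C.sec W h) := by
      rw [map_zero, π₁.app_inc hO hE]
    obtain ⟨β, rfl⟩ := π₂.exists_inc hO hA hC h c (by rw [← w, π₁.app_inc hO hE])
    have w₁ : π₁.app h (E.inc h β) = π₂.app h (C.inc h β) := by
      rw [π₁.app_inc hO hE, π₂.app_inc hO hC]
    have w₂ : π₁.app h (E.inc h (α - β)) = π₂.app h (0 : C.sec W h) := by
      rw [map_zero, π₁.app_inc hO hE]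
    have e₃ : δ h (E.inc h α) (C.inc h β) w = (𝓓).inc h (α - β) := by
      rw [← diffMk_inc_zero h (α - β) w₂, ← sub_zero (δ h _ _ w),
        ← diffMk_inc_inc h β w₁, ← diffMk_sub h w w₁ (by rw [map_sub, map_sub, w, w₁])]
      exact diffMk_congr (map_sub _ _ _).symm (sub_self _) _ _
    rw [e₃, neg_one_smul, neg_neg] at e₂
    have := (diff_isAlg π₁ π₂ hO hA hE hC).inc_injective hO (diff_anchorSurj π₁ π₂ hO hA hE hC) h e₂
    rw [sub_eq_self.1 this, map_zero]
  total := by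
    intro W h e p hp
    obtain ⟨V, i, hpV, a, c, w, w', hac⟩ := exists_eq_map_diffMk hO hA hE hC π₁ π₂ h₁ h₂ κ h e p hp
    exact ⟨V, i, hpV, c, a, w, w', hac⟩
  act := by
    rintro W h f _ c ⟨a, w, w', rfl⟩
    have w₂ : π₁.app h (E.act h f a) = π₂.app h (C.act h f c) := by
      rw [π₁.app_act, π₂.app_act, w]
    have w₃ := anchor_eq_of_projection_eq hO hA hE hC π₁ π₂ h w₂
    refine ⟨_, w₂, w₃, ?_⟩
    rw [← κ.map_act h f _ _ w' (by rw [← diffMk_act h w f w₂, w₃])]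
    exact κ.congr rfl (diffMk_act h w f w₂) _ _
  bracket := by
    rintro W h _ _ c c' ⟨a, w, w', rfl⟩ ⟨a₁, w₁, w₁', rfl⟩
    have w₂ : π₁.app h (E.bracket h a a₁) = π₂.app h (C.bracket h c c') := by
      rw [π₁.app_bracket, π₂.app_bracket, w, w₁]
    have w₃ := anchor_eq_of_projection_eq hO hA hE hC π₁ π₂ h w₂
    refine ⟨_, w₂, w₃, ?_⟩
    rw [← κ.map_bracket h _ _ _ _ w' w₁' (by rw [← diffMk_bracket h w w₁ w₂, w₃])]
    exact κ.congr rfl (diffMk_bracket h w w₁ w₂) _ _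
  anchor := by
    rintro W h _ c ⟨a, w, w', rfl⟩
    rw [κ.anchor_map, ← π₁.anchor_app, w, π₂.anchor_app]
  pairing := by
    rintro W h _ _ c c' ⟨a, w, w', rfl⟩ ⟨a₁, w₁, w₁', rfl⟩
    rw [κ.pairing_map, pairing_diffMk]
    simp
  der h f := by
    have w : π₁.app h (0 : E.sec _ h) = π₂.app h (C.der h f) := by
      rw [map_zero, ← hC.inc_d, π₂.app_inc hO hC]
    have w₁ : π₁.app h (E.der h f) = π₂.app h (0 : C.sec _ h) := by
      rw [map_zero, ← hE.inc_d, π₁.app_inc hO hE]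
    have w₂ : π₁.app h (E.inc h (Form.d f)) = π₂.app h (C.inc h (Form.d f)) := by
      rw [π₁.app_inc hO hE, π₂.app_inc hO hC]
    have w₃ : π₁.app h (E.der h f) = π₂.app h (C.der h f) := by
      rw [← hE.inc_d, ← hC.inc_d, w₂]
    have e₁ : δ h 0 (C.der h f) w = (𝓓).der h (-f) := by
      rw [map_neg, ← diffMk_der_zero h f w₁, ← zero_sub, ← diffMk_inc_inc h (Form.d f) w₂,
        diffMk_congr (hE.inc_d h f) (hC.inc_d h f) w₂ w₃,
        ← diffMk_sub h w₃ w₁ (by rw [sub_self, sub_zero, w])]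
      exact diffMk_congr (sub_self _).symm (sub_zero _).symm _ _
    have w₄ := anchor_eq_of_projection_eq hO hA hE hC π₁ π₂ h w
    have w₅ : E.anchor h (E.der h 0) = (𝓓).anchor h ((𝓓).der h (-f)) := by
      rw [← e₁, ← w₄, map_zero]
    refine ⟨0, w, w₄, ?_⟩
    rw [κ.congr (map_zero _).symm e₁ w₄ w₅, κ.map_der]
    simp

end essSurj

end Algebroid

section equivalence

open Algebroid

variable {Ahat : VertexExtension A} (hO : IsSmooth O) (hA : A.IsTransitive)
  (hP : Ahat.proj.Induces P) (F : DifferenceFunctor Ahat P)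

include hO hA in
theorem DifferenceFunctor.faithful (U : Opens X) : (functorOn F.functor U).Faithful where
  map_injective {V V'} φ ψ e := by
    refine differenceHom_unique hO hA (Ahat.vertex.isAlg.restrict le_top) (V := V.alg)
      (Ahat.proj.restrict (le_top : U ≤ ⊤)) (F.δ V') φ ψ fun h a v w₀ w w' => ?_
    exact (F.δ_natural φ h a v w₀ w).symm.trans
      ((congrArg (fun χ : _ ⟶ _ => (CEXTObj.Hom.hom χ).app h ((F.δ V).map h a v w₀)) e).trans
        (F.δ_natural ψ h a v w₀ w'))

include hO hA in
theorem DifferenceFunctor.full (U : Opens X) : (functorOn F.functor U).Full where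
  map_surjective {V V'} χ := by
    obtain ⟨ψ, hψ⟩ := exists_of_differenceHom hO hA (Ahat.vertex.isAlg.restrict le_top)
      V.vertex.isAlg V'.vertex.isAlg ((functorOn F.functor U).obj V).courant.isAlg
      ((functorOn F.functor U).obj V').courant.isAlg V.exact V'.exact
      (Ahat.proj.restrict (le_top : U ≤ ⊤)) _ _ (F.δ V) (F.δ V') (F.δ_proj V) (F.δ_proj V')
      (CEXTObj.Hom.hom χ) (CEXTObj.Hom.proj_hom χ)
    refine ⟨ψ, CEXTObj.Hom.ext <| (F.δ V).hom_ext fun h a v w => ?_⟩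
    have w' := w.trans (Algebroid.Hom.anchor_app ψ h v).symm
    exact (F.δ_natural (V' := V') ψ h a v w w').trans (hψ h a v w w').symm

/-- The exact vertex algebroid `Â - C`. -/
def CEXTObj.complement (C : CEXTObj A P U) : EVAObj O U where
  alg := diff (Ahat.proj.restrict (le_top : U ≤ ⊤)) C.proj hO hA
    (Ahat.vertex.isAlg.restrict le_top) C.courant.isAlg
  vertex := IsAlg.isVertex (by
    simpa using diff_isAlg (Ahat.proj.restrict (le_top : U ≤ ⊤)) C.proj hO hA
      (Ahat.vertex.isAlg.restrict le_top) C.courant.isAlg)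
  exact := diff_isExact (Ahat.proj.restrict (le_top : U ≤ ⊤)) C.proj hO hA
    (Ahat.vertex.isAlg.restrict le_top) C.courant.isAlg (fun h e e' x x' => hP _ e e' x x')
    C.induces

include hO hA hP in
theorem DifferenceFunctor.essSurj (U : Opens X) : (functorOn F.functor U).EssSurj where
  mem_essImage C := by
    let V := CEXTObj.complement hO hA hP C
    let R := diffDiffRel hO hA (Ahat.vertex.isAlg.restrict le_top) C.courant.isAlg
      ((functorOn F.functor U).obj V).courant.isAlg (Ahat.proj.restrict (le_top : U ≤ ⊤)) C.proj
      (fun h e e' x x' => hP _ e e' x x') C.induces (F.δ V)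
    let χ : CEXTObj.Hom ((functorOn F.functor U).obj V) C :=
      { hom := R.toHom
        proj_hom := fun {W} h e => by
          refine A.eq_of_local _ fun p hp => ?_
          obtain ⟨W', i, hpV, r⟩ := R.exists_rel h e p hp
          refine ⟨W', i, hpV, ?_⟩
          obtain ⟨a, w, w', e'⟩ := r
          refine (C.proj.app_res h i _).symm.trans (w.symm.trans ?_)
          refine (F.δ_proj V (i.trans h) a _ w').symm.trans ?_
          exact (congrArg _ e').trans (Projection.app_res _ h i e) }
    have := CEXTObj.isIso hO hA _ _ χ
    exact ⟨V, ⟨asIso (X := (functorOn F.functor U).obj V) (Y := C) χ⟩⟩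

include hO hA hP in
/-- The functor `V ↦ Â - V` is an equivalence. -/
theorem DifferenceFunctor.isEquivalence (U : Opens X) :
    (functorOn F.functor U).IsEquivalence where
  faithful := F.faithful hO hA U
  full := F.full hO hA U
  essSurj := F.essSurj hO hA hP U

end equivalence

end

section

variable {O : StructureSheaf X} {U : Opens X} {A : LieAlgebroid O} {P : InvariantPairing A}

/-! ### Compatibility of `V ↦ Â - V` with the actions -/

namespace Algebroid

variable {E Q V S D₁ D₂ D₃ : Algebroid O U} {k₁ k₂ k₃ l₀ l₁ l₂ l₃ : ℤ} (hO : IsSmooth O)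
  (hE : E.IsAlg k₁) (hQ : Q.IsAlg k₂) (hV : V.IsAlg k₃) (hS : S.IsAlg l₀) (hD₁ : D₁.IsAlg l₁)
  (hD₂ : D₂.IsAlg l₂) (hD₃ : D₃.IsAlg l₃) (hQ' : Q.neg.IsAlg k₂)
  (σ : Combination 1 Q V S) (δ₁ : Combination (-1) E S D₁) (δ₂ : Combination (-1) E V D₂)
  (σ₂ : Combination 1 Q.neg D₂ D₃)

/-- Local generators of `E - (Q + V)`. -/
theorem exists_eq_map_map {W : Opens X} (h : W ≤ U) (e : D₁.sec W h) (p : X) (hp : p ∈ W) :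
    ∃ (W' : Opens X) (i : W' ≤ W) (_ : p ∈ W') (a : E.sec W' (i.trans h))
      (q : Q.sec W' (i.trans h)) (v : V.sec W' (i.trans h))
      (w₁ : Q.anchor (i.trans h) q = V.anchor (i.trans h) v)
      (w₂ : E.anchor (i.trans h) a = S.anchor (i.trans h) (σ.map (i.trans h) q v w₁)),
      δ₁.map (i.trans h) a (σ.map (i.trans h) q v w₁) w₂ = D₁.res h i e := by
  obtain ⟨W₁, i, hp₁, a, s, w, e₁⟩ := δ₁.surj h e p hp
  obtain ⟨W₂, j, hp₂, q, v, w₁, e₂⟩ := σ.surj (i.trans h) s p hp₁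
  have w' : E.anchor (j.trans (i.trans h)) (E.res _ j a)
      = S.anchor (j.trans (i.trans h)) (S.res _ j s) := by
    rw [← E.res_anchor, ← S.res_anchor, w]
  refine ⟨W₂, j.trans i, hp₂, E.res _ j a, q, v, w₁, by rw [e₂]; exact w', ?_⟩
  rw [← D₁.res_res h i j, ← e₁, ← δ₁.map_res _ j a s w w']
  exact δ₁.congr rfl e₂ _ _

theorem hom_ext_map_map {D : Algebroid O U} {φ ψ : Hom D₁ D}
    (H : ∀ {W : Opens X} (h : W ≤ U) (a : E.sec W h) (q : Q.sec W h) (v : V.sec W h)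
      (w₁ : Q.anchor h q = V.anchor h v) (w₂ : E.anchor h a = S.anchor h (σ.map h q v w₁)),
      φ.app h (δ₁.map h a (σ.map h q v w₁) w₂) = ψ.app h (δ₁.map h a (σ.map h q v w₁) w₂)) :
    φ = ψ := by
  refine Hom.ext_app fun h e => D.eq_of_local h fun p hp => ?_
  obtain ⟨V, i, hpV, a, q, v, w₁, w₂, e'⟩ := exists_eq_map_map σ δ₁ h e p hp
  exact ⟨V, i, hpV, by rw [← φ.app_res, ← ψ.app_res, ← e', H]⟩

/-- The relation `(a, (q, v)) ↦ (q, (a, v))` between `E - (Q + V)` and `-Q + (E - V)`. -/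
def exchangeRel : HomRel D₁ D₃ where
  rel h e e' := ∃ (a : E.sec _ h) (q : Q.sec _ h) (v : V.sec _ h)
    (w₁ : Q.anchor h q = V.anchor h v) (w₂ : E.anchor h a = S.anchor h (σ.map h q v w₁))
    (w₃ : E.anchor h a = V.anchor h v) (w₄ : Q.anchor h q = D₂.anchor h (δ₂.map h a v w₃)),
    δ₁.map h a (σ.map h q v w₁) w₂ = e ∧ σ₂.map h q (δ₂.map h a v w₃) w₄ = e'
  res := by
    rintro W W' h i _ _ ⟨a, q, v, w₁, w₂, w₃, w₄, rfl, rfl⟩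
    have u₁ : Q.anchor (i.trans h) (Q.res h i q) = V.anchor (i.trans h) (V.res h i v) := by
      rw [← Q.res_anchor, w₁, V.res_anchor]
    have u₃ : E.anchor (i.trans h) (E.res h i a) = V.anchor (i.trans h) (V.res h i v) := by
      rw [← E.res_anchor, w₃, V.res_anchor]
    have s₁ := σ.map_res h i q v w₁ u₁
    have s₂ := δ₂.map_res h i a v w₃ u₃
    have u₂ : E.anchor (i.trans h) (E.res h i a) = S.anchor (i.trans h) (S.res h i (σ.map h q v w₁)) := by
      rw [← E.res_anchor, w₂, S.res_anchor]
    have u₄ : Q.anchor (i.trans h) (Q.res h i q)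
        = D₂.anchor (i.trans h) (D₂.res h i (δ₂.map h a v w₃)) := by
      rw [← Q.res_anchor, w₄, D₂.res_anchor]
    exact ⟨_, _, _, u₁, by rw [s₁, u₂], u₃, by rw [s₂, u₄],
      (δ₁.congr rfl s₁ _ u₂).trans (δ₁.map_res h i a _ w₂ u₂),
      (σ₂.congr rfl s₂ _ u₄).trans (σ₂.map_res h i q _ w₄ u₄)⟩
  add := by
    rintro W h _ _ _ _ ⟨a, q, v, w₁, w₂, w₃, w₄, rfl, rfl⟩ ⟨a', q', v', w₁', w₂', w₃', w₄', rfl, rfl⟩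
    have u₁ : Q.anchor h (q + q') = V.anchor h (v + v') := by rw [map_add, map_add, w₁, w₁']
    have u₃ : E.anchor h (a + a') = V.anchor h (v + v') := by rw [map_add, map_add, w₃, w₃']
    have s₁ := σ.map_add h _ _ _ _ w₁ w₁' u₁
    have s₂ := δ₂.map_add h _ _ _ _ w₃ w₃' u₃
    have u₂ : E.anchor h (a + a') = S.anchor h (σ.map h q v w₁ + σ.map h q' v' w₁') := by
      rw [map_add, map_add, w₂, w₂']
    have u₄ : Q.anchor h (q + q') = D₂.anchor h (δ₂.map h a v w₃ + δ₂.map h a' v' w₃') := by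
      rw [map_add, map_add, w₄, w₄']
    exact ⟨_, _, _, u₁, by rw [s₁, u₂], u₃, by rw [s₂, u₄],
      (δ₁.congr rfl s₁ _ u₂).trans (δ₁.map_add h _ _ _ _ w₂ w₂' u₂),
      (σ₂.congr rfl s₂ _ u₄).trans (σ₂.map_add h _ _ _ _ w₄ w₄' u₄)⟩
  smul := by
    rintro W h c _ _ ⟨a, q, v, w₁, w₂, w₃, w₄, rfl, rfl⟩
    have u₁ : Q.anchor h (c • q) = V.anchor h (c • v) := by rw [map_smul, map_smul, w₁]
    have u₃ : E.anchor h (c • a) = V.anchor h (c • v) := by rw [map_smul, map_smul, w₃]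
    have s₁ := σ.map_csmul hQ hV hS h c _ _ w₁ u₁
    have s₂ := δ₂.map_csmul hE hV hD₂ h c _ _ w₃ u₃
    have u₂ : E.anchor h (c • a) = S.anchor h (c • σ.map h q v w₁) := by
      rw [map_smul, map_smul, w₂]
    have u₄ : Q.anchor h (c • q) = D₂.anchor h (c • δ₂.map h a v w₃) := by
      rw [map_smul, map_smul, w₄]
    exact ⟨_, _, _, u₁, by rw [s₁, u₂], u₃, by rw [s₂, u₄],
      (δ₁.congr rfl s₁ _ u₂).trans (δ₁.map_csmul hE hS hD₁ h c _ _ w₂ u₂),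
      (σ₂.congr rfl s₂ _ u₄).trans (σ₂.map_csmul hQ' hD₂ hD₃ h c _ _ w₄ u₄)⟩
  uniq := by
    rintro W h _ ⟨a, q, v, w₁, w₂, w₃, w₄, e, rfl⟩
    obtain ⟨α, rfl, e₁⟩ := (δ₁.ker h _ _ _).1 e
    have u : Q.anchor h (Q.inc h α) = V.anchor h 0 := by rw [hQ.anchor_inc hO, map_zero]
    rw [neg_one_smul, neg_neg, ← σ.map_inc_zero hO hQ hS h α u] at e₁
    obtain ⟨β, e₂, e₃⟩ := σ.eq_of_map_eq _ e₁
    rw [sub_zero, one_smul] at e₃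
    obtain rfl := e₃
    obtain rfl : q = Q.inc h (α + β) := by rw [map_add, ← e₂]; abel
    have u₃ : E.anchor h (E.inc h α) = V.anchor h (V.inc h (-β)) := by
      rw [hE.anchor_inc hO, hV.anchor_inc hO]
    refine (σ₂.ker h _ _ _).2 ⟨-(α + β), ?_, ?_⟩
    · change _ = -(Q.inc h (-(α + β)))
      rw [map_neg, neg_neg]
    · rw [δ₂.congr rfl (map_neg _ _).symm w₃ u₃, δ₂.map_inc hO hE hD₂ h α (-β) u₃ (by norm_num),
        one_smul, map_neg, neg_neg, neg_one_smul, neg_neg]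
  total := by
    intro W h e p hp
    obtain ⟨W', i, hp', a, q, v, w₁, w₂, e'⟩ := exists_eq_map_map σ δ₁ h e p hp
    have w₃ : E.anchor (i.trans h) a = V.anchor (i.trans h) v := by
      rw [w₂, σ.anchor_map, w₁]
    have w₄ : Q.anchor (i.trans h) q = D₂.anchor (i.trans h) (δ₂.map (i.trans h) a v w₃) := by
      rw [δ₂.anchor_map, w₃, w₁]
    exact ⟨W', i, hp', σ₂.map _ q _ w₄, a, q, v, w₁, w₂, w₃, w₄, e', rfl⟩
  act := by
    rintro W h f _ _ ⟨a, q, v, w₁, w₂, w₃, w₄, rfl, rfl⟩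
    have u₁ : Q.anchor h (Q.act h f q) = V.anchor h (V.act h f v) := by
      rw [hQ.anchor_act, hV.anchor_act, w₁]
    have u₃ : E.anchor h (E.act h f a) = V.anchor h (V.act h f v) := by
      rw [hE.anchor_act, hV.anchor_act, w₃]
    have s₁ := σ.map_act h f _ _ w₁ u₁
    have s₂ := δ₂.map_act h f _ _ w₃ u₃
    have u₂ : E.anchor h (E.act h f a) = S.anchor h (S.act h f (σ.map h q v w₁)) := by
      rw [hE.anchor_act, hS.anchor_act, w₂]
    have u₄ : Q.anchor h (Q.act h f q) = D₂.anchor h (D₂.act h f (δ₂.map h a v w₃)) := by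
      rw [hQ.anchor_act, hD₂.anchor_act, w₄]
    exact ⟨_, _, _, u₁, by rw [s₁, u₂], u₃, by rw [s₂, u₄],
      (δ₁.congr rfl s₁ _ u₂).trans (δ₁.map_act h f _ _ w₂ u₂),
      (σ₂.congr rfl s₂ _ u₄).trans (σ₂.map_act h f _ _ w₄ u₄)⟩
  bracket := by
    rintro W h _ _ _ _ ⟨a, q, v, w₁, w₂, w₃, w₄, rfl, rfl⟩ ⟨a', q', v', w₁', w₂', w₃', w₄', rfl, rfl⟩
    have u₁ : Q.anchor h (Q.bracket h q q') = V.anchor h (V.bracket h v v') := by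
      rw [hQ.anchor_bracket, hV.anchor_bracket, w₁, w₁']
    have u₃ : E.anchor h (E.bracket h a a') = V.anchor h (V.bracket h v v') := by
      rw [hE.anchor_bracket, hV.anchor_bracket, w₃, w₃']
    have s₁ := σ.map_bracket h _ _ _ _ w₁ w₁' u₁
    have s₂ := δ₂.map_bracket h _ _ _ _ w₃ w₃' u₃
    have u₂ : E.anchor h (E.bracket h a a')
        = S.anchor h (S.bracket h (σ.map h q v w₁) (σ.map h q' v' w₁')) := by
      rw [hE.anchor_bracket, hS.anchor_bracket, w₂, w₂']
    have u₄ : Q.anchor h (Q.bracket h q q')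
        = D₂.anchor h (D₂.bracket h (δ₂.map h a v w₃) (δ₂.map h a' v' w₃')) := by
      rw [hQ.anchor_bracket, hD₂.anchor_bracket, w₄, w₄']
    exact ⟨_, _, _, u₁, by rw [s₁, u₂], u₃, by rw [s₂, u₄],
      (δ₁.congr rfl s₁ _ u₂).trans (δ₁.map_bracket h _ _ _ _ w₂ w₂' u₂),
      (σ₂.congr rfl s₂ _ u₄).trans (σ₂.map_bracket h _ _ _ _ w₄ w₄' u₄)⟩
  anchor := by
    rintro W h _ _ ⟨a, q, v, w₁, w₂, w₃, w₄, rfl, rfl⟩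
    refine (σ₂.anchor_map h q _ w₄).trans ?_
    rw [δ₁.anchor_map, w₃]
    exact w₁
  pairing := by
    rintro W h _ _ _ _ ⟨a, q, v, w₁, w₂, w₃, w₄, rfl, rfl⟩ ⟨a', q', v', w₁', w₂', w₃', w₄', rfl, rfl⟩
    refine (σ₂.pairing_map h q q' _ _ w₄ w₄').trans ?_
    rw [δ₁.pairing_map, σ.pairing_map, δ₂.pairing_map]
    change -(Q.pairing h q q') + _ = _
    rw [one_smul, one_smul, neg_one_smul, neg_one_smul]
    abel
  der h f := by
    have u₁ : Q.anchor h 0 = V.anchor h 0 := by rw [map_zero, map_zero]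
    have u₃ : E.anchor h (E.der h f) = V.anchor h 0 := by rw [hE.anchor_der, map_zero]
    have s₁ := σ.map_zero h u₁
    have s₂ := δ₂.map_der_zero hE h f u₃
    have u₂ : E.anchor h (E.der h f) = S.anchor h 0 := by rw [hE.anchor_der, map_zero]
    have u₄ : Q.anchor h 0 = D₂.anchor h (D₂.der h f) := by rw [hD₂.anchor_der, map_zero]
    have u₅ : Q.neg.anchor h (Q.neg.der h 0) = D₂.anchor h (D₂.der h f) := by
      rw [hD₂.anchor_der, map_zero, map_zero]
    refine ⟨E.der h f, 0, 0, u₁, by rw [s₁, u₂], u₃, by rw [s₂, u₄],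
      (δ₁.congr rfl s₁ _ u₂).trans (δ₁.map_der_zero hE h f u₂), ?_⟩
    refine (σ₂.congr (map_zero (Q.neg.der h)).symm s₂ _ u₅).trans ?_
    rw [σ₂.map_der, map_zero, one_smul, zero_add]

end Algebroid

section antiCommutes

open Algebroid

variable {Ahat : VertexExtension A} (hO : IsSmooth O) (hA : A.IsTransitive)
  (F : DifferenceFunctor Ahat P) (actE : EVAAction O) (actC : CEXTAction A P)

/-- The relation `(a, (q, v)) ↦ (q, (a, v))` between `Â - (Q + V)` and `-Q + (Â - V)`. -/
def DifferenceFunctor.exchange (Q : ECAObj O U) (V : EVAObj O U) :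
    HomRel ((functorOn F.functor U).obj ((actE.act U).obj (Q, V))).alg
      ((actC.act U).obj ((ECAObj.neg U).obj Q, (functorOn F.functor U).obj V)).alg :=
  exchangeRel hO (Ahat.vertex.isAlg.restrict le_top) Q.courant.isAlg V.vertex.isAlg
    ((actE.act U).obj (Q, V)).vertex.isAlg
    ((functorOn F.functor U).obj ((actE.act U).obj (Q, V))).courant.isAlg
    ((functorOn F.functor U).obj V).courant.isAlg
    ((actC.act U).obj ((ECAObj.neg U).obj Q, (functorOn F.functor U).obj V)).courant.isAlg
    Q.courant.neg.isAlg (actE.σ Q V) (F.δ ((actE.act U).obj (Q, V))) (F.δ V)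
    (actC.σ ((ECAObj.neg U).obj Q) ((functorOn F.functor U).obj V))

/-- The morphism `(a, (q, v)) ↦ (q, (a, v))`. -/
def DifferenceFunctor.exchangeHom (Q : ECAObj O U) (V : EVAObj O U) :
    CEXTObj.Hom ((functorOn F.functor U).obj ((actE.act U).obj (Q, V)))
      ((actC.act U).obj ((ECAObj.neg U).obj Q, (functorOn F.functor U).obj V)) where
  hom := (F.exchange hO actE actC Q V).toHom
  proj_hom {W} h e := by
    refine A.eq_of_local _ fun p hp => ?_
    obtain ⟨W', i, hpV, r⟩ := (F.exchange hO actE actC Q V).exists_rel h e p hp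
    refine ⟨W', i, hpV, ?_⟩
    obtain ⟨a, q, v, w₁, w₂, w₃, w₄, e₁, e₂⟩ := r
    refine (Projection.app_res _ h i _).symm.trans ((congrArg _ e₂.symm).trans ?_)
    refine (actC.σ_proj ((ECAObj.neg U).obj Q) _ (i.trans h) q _ w₄).trans ((F.δ_proj V (i.trans h) a v w₃).trans ?_)
    refine (F.δ_proj ((actE.act U).obj (Q, V)) (i.trans h) a _ w₂).symm.trans ?_
    exact (congrArg _ e₁).trans (Projection.app_res _ h i e)

theorem DifferenceFunctor.exchangeHom_map (Q : ECAObj O U) (V : EVAObj O U)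
    {W : Opens X} (h : W ≤ U)
    (a : Ahat.alg.sec W le_top) (q : Q.alg.sec W h) (v : V.alg.sec W h)
    (w₁ : Q.alg.anchor h q = V.alg.anchor h v)
    (w₂ : Ahat.alg.anchor le_top a
      = ((actE.act U).obj (Q, V)).alg.anchor h ((actE.σ Q V).map h q v w₁))
    (w₃ : Ahat.alg.anchor le_top a = V.alg.anchor h v)
    (w₄ : ((ECAObj.neg U).obj Q).alg.anchor h q
      = ((functorOn F.functor U).obj V).alg.anchor h ((F.δ V).map h a v w₃)) :
    (F.exchangeHom hO actE actC Q V).hom.app h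
        ((F.δ ((actE.act U).obj (Q, V))).map h a ((actE.σ Q V).map h q v w₁) w₂)
      = (actC.σ ((ECAObj.neg U).obj Q) ((functorOn F.functor U).obj V)).map h q
          ((F.δ V).map h a v w₃) w₄ :=
  (F.exchange hO actE actC Q V).toHom_eq h ⟨a, q, v, w₁, w₂, w₃, w₄, rfl, rfl⟩

include hO hA in
/-- The functor `V ↦ Â - V` anti-commutes with the actions of `ECA`. -/
theorem DifferenceFunctor.antiCommutes : F.AntiCommutes actE actC := by
  intro U
  have inst : ∀ QV : ECAObj O U × EVAObj O U,
      IsIso (X := (functorOn F.functor U).obj ((actE.act U).obj QV))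
        (Y := (actC.act U).obj ((ECAObj.neg U).obj QV.1, (functorOn F.functor U).obj QV.2))
        (F.exchangeHom hO actE actC QV.1 QV.2) := fun QV => CEXTObj.isIso hO hA _ _ _
  refine ⟨NatIso.ofComponents (fun QV => haveI := inst QV
    asIso (X := (functorOn F.functor U).obj ((actE.act U).obj QV))
      (Y := (actC.act U).obj ((ECAObj.neg U).obj QV.1, (functorOn F.functor U).obj QV.2))
      (F.exchangeHom hO actE actC QV.1 QV.2)) fun {QV QV'} φ => ?_,
    fun Q V W h a q v w₁ w₂ w₃ w₄ => F.exchangeHom_map hO actE actC Q V h a q v w₁ w₂ w₃ w₄⟩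
  refine CEXTObj.Hom.ext (hom_ext_map_map (actE.σ QV.1 QV.2) (F.δ ((actE.act U).obj QV))
    fun h a q v w₁ w₂ => ?_)
  obtain ⟨Q, V⟩ := QV
  obtain ⟨Q', V'⟩ := QV'
  have w₃ : Ahat.alg.anchor le_top a = V.alg.anchor h v :=
    w₂.trans (((actE.σ Q V).anchor_map h q v w₁).trans w₁)
  have w₄ : ((ECAObj.neg U).obj Q).alg.anchor h q
      = ((functorOn F.functor U).obj V).alg.anchor h ((F.δ V).map h a v w₃) :=
    w₁.trans (w₃.symm.trans ((F.δ V).anchor_map h a v w₃).symm)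
  have u₁ : Q'.alg.anchor h (Algebroid.Hom.app φ.1 h q)
      = V'.alg.anchor h (Algebroid.Hom.app φ.2 h v) :=
    (Algebroid.Hom.anchor_app φ.1 h q).trans (w₁.trans (Algebroid.Hom.anchor_app φ.2 h v).symm)
  have u₃ : Ahat.alg.anchor le_top a = V'.alg.anchor h (Algebroid.Hom.app φ.2 h v) :=
    w₃.trans (Algebroid.Hom.anchor_app φ.2 h v).symm
  have u₂ : Ahat.alg.anchor le_top a = ((actE.act U).obj (Q', V')).alg.anchor h
      ((actE.σ Q' V').map h (Algebroid.Hom.app φ.1 h q) (Algebroid.Hom.app φ.2 h v) u₁) :=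
    u₃.trans (u₁.symm.trans ((actE.σ Q' V').anchor_map h _ _ u₁).symm)
  have u₄ : ((ECAObj.neg U).obj Q').alg.anchor h (Algebroid.Hom.app φ.1 h q)
      = ((functorOn F.functor U).obj V').alg.anchor h
        ((F.δ V').map h a (Algebroid.Hom.app φ.2 h v) u₃) :=
    u₁.trans (u₃.symm.trans ((F.δ V').anchor_map h a _ u₃).symm)
  have n₁ := actE.σ_natural φ.1 φ.2 h q v w₁ u₁
  have n₂ := F.δ_natural φ.2 h a v w₃ u₃
  have u₅ : Ahat.alg.anchor le_top a = ((actE.act U).obj (Q', V')).alg.anchor h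
      (Algebroid.Hom.app ((actE.act U).map φ) h ((actE.σ Q V).map h q v w₁)) :=
    u₂.trans (congrArg _ n₁.symm)
  have u₆ : ((ECAObj.neg U).obj Q').alg.anchor h (Algebroid.Hom.app φ.1 h q)
      = ((functorOn F.functor U).obj V').alg.anchor h
        ((CEXTObj.Hom.hom ((functorOn F.functor U).map φ.2)).app h ((F.δ V).map h a v w₃)) :=
    u₄.trans (congrArg _ n₂.symm)
  refine (congrArg ((F.exchangeHom hO actE actC Q' V').hom.app h)
    ((F.δ_natural ((actE.act U).map φ) h a _ w₂ u₅).trans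
      ((F.δ ((actE.act U).obj (Q', V'))).congr rfl n₁ u₅ u₂))).trans ?_
  refine (F.exchangeHom_map hO actE actC Q' V' h a _ _ u₁ u₂ u₃ u₄).trans ?_
  refine Eq.trans ?_ (congrArg ((CEXTObj.Hom.hom ((actC.act U).map
    (((ECAObj.neg U).prod (functorOn F.functor U)).map φ))).app h)
      (F.exchangeHom_map hO actE actC Q V h a q v w₁ w₂ w₃ w₄)).symm
  refine Eq.trans ?_ (actC.σ_natural ((ECAObj.neg U).map φ.1) ((functorOn F.functor U).map φ.2) h q
    ((F.δ V).map h a v w₃) w₄ u₆).symm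
  exact (actC.σ ((ECAObj.neg U).obj Q') ((functorOn F.functor U).obj V')).congr rfl n₂.symm u₄ u₆

end antiCommutes

end

section

variable {O : StructureSheaf X} {U : Opens X} {A : LieAlgebroid O}

/-! ### Isometries of extensions and their curvature -/

theorem exists_linearMap_lift {M N E : Type*} [AddCommGroup M] [Module ℂ M] [AddCommGroup N]
    [Module ℂ N] [AddCommGroup E] [Module ℂ E] (j : N →ₗ[ℂ] E) (hj : Function.Injective j)
    (f : M →ₗ[ℂ] E) (H : ∀ m, ∃ n, f m = j n) : ∃ g : M →ₗ[ℂ] N, ∀ m, f m = j (g m) := by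
  choose g hg using H
  exact ⟨{ toFun := g
           map_add' := fun a b => hj (by rw [map_add, ← hg, ← hg, ← hg, map_add])
           map_smul' := fun c a => hj (by
            rw [RingHom.id_apply, map_smul, ← hg, ← hg, map_smul]) }, hg⟩

theorem exists_bilinearMap_lift {M M' N E : Type*} [AddCommGroup M] [Module ℂ M] [AddCommGroup M']
    [Module ℂ M'] [AddCommGroup N] [Module ℂ N] [AddCommGroup E] [Module ℂ E] (j : N →ₗ[ℂ] E)
    (hj : Function.Injective j) (f : M →ₗ[ℂ] M' →ₗ[ℂ] E) (H : ∀ m m', ∃ n, f m m' = j n) :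
    ∃ g : M →ₗ[ℂ] M' →ₗ[ℂ] N, ∀ m m', f m m' = j (g m m') := by
  choose g hg using fun m => exists_linearMap_lift j hj (f m) (H m)
  exact ⟨{ toFun := g
           map_add' := fun a b => LinearMap.ext fun m => hj (by
            rw [LinearMap.add_apply, map_add, ← hg, ← hg, ← hg, map_add, LinearMap.add_apply])
           map_smul' := fun c a => LinearMap.ext fun m => hj (by
            rw [RingHom.id_apply, LinearMap.smul_apply, map_smul, ← hg, ← hg, map_smul,
              LinearMap.smul_apply]) }, hg⟩

namespace Algebroid

variable {E E' E'' : Algebroid O U}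

theorem AnchorSurj.exists_lifts (hs : E.AnchorSurj) {W : Opens X} (h : W ≤ U) (p : X) (hp : p ∈ W)
    (n : ℕ) (ξ : Fin n → VF O W) : ∃ (V : Opens X) (i : V ≤ W) (_ : p ∈ V)
      (e : Fin n → E.sec V (i.trans h)), ∀ k, E.anchor _ (e k) = VF.res i (ξ k) := by
  induction n with
  | zero => exact ⟨W, le_rfl, hp, Fin.elim0, fun k => k.elim0⟩
  | succ n ih =>
    obtain ⟨V, i, hpV, e, he⟩ := ih (fun k => ξ k.succ)
    obtain ⟨V', j, hpV', e', he'⟩ := hs (i.trans h) (VF.res i (ξ 0)) p hpV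
    refine ⟨V', j.trans i, hpV', Fin.cons e' fun k => E.res _ j (e k), fun k => ?_⟩
    refine Fin.cases ?_ (fun k => ?_) k
    · exact he'.trans (VF.res_res _ _ _)
    · rw [Fin.cons_succ, ← E.res_anchor, he, VF.res_res]

section

variable {k : ℤ} (hO : IsSmooth O) (hE : E.IsAlg k)
include hO hE

theorem IsLevel.add_inc_bracket_add_inc {W : Opens X} (h : W ≤ U) (a b : E.sec W h)
    (α β : Form O 1 W) : E.bracket h (a + E.inc h α) (b + E.inc h β)
      = E.bracket h a b + E.inc h (Form.lie (E.anchor h a) β - Form.lie (E.anchor h b) α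
        + Form.d (Form.ev α (E.anchor h b))) := by
  have h0 : E.bracket h (E.inc h α) (E.inc h β) = 0 := by
    rw [hE.bracket_inc hO, hE.anchor_inc hO]
    have : Form.lie (0 : VF O W) β = 0 := by
      have := Form.csmul_lie (0 : ℂ) (0 : VF O W) β
      rwa [zero_smul, zero_smul] at this
    rw [this, map_zero]
  rw [map_add, map_add, LinearMap.add_apply, LinearMap.add_apply, h0,
    hE.bracket_inc hO, hE.inc_bracket hO, map_add, map_sub, map_sub]
  abel

theorem IsLevel.add_inc_pairing_add_inc {W : Opens X} (h : W ≤ U) (a b : E.sec W h)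
    (α β : Form O 1 W) : E.pairing h (a + E.inc h α) (b + E.inc h β)
      = E.pairing h a b + (Form.ev β (E.anchor h a) + Form.ev α (E.anchor h b)) := by
  rw [map_add, map_add, LinearMap.add_apply, LinearMap.add_apply, hE.pairing_inc hO,
    hE.inc_pairing hO, hE.pairing_inc hO, hE.anchor_inc hO, Form.ev_zero]
  abel

end

end Algebroid

/-- A map of extensions of `A` which preserves all of the structure except possibly the bracket. -/
structure Isometry {E E' : Algebroid O U} (π : Projection A E) (π' : Projection A E') where
  app : ∀ {W : Opens X} (h : W ≤ U), E.sec W h →ₗ[ℂ] E'.sec W h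
  app_res : ∀ {W V : Opens X} (h : W ≤ U) (i : V ≤ W) (e : E.sec W h),
    app (i.trans h) (E.res h i e) = E'.res h i (app h e)
  app_act : ∀ {W : Opens X} (h : W ≤ U) (f : Fn O W) (e : E.sec W h),
    app h (E.act h f e) = E'.act h f (app h e)
  proj_app : ∀ {W : Opens X} (h : W ≤ U) (e : E.sec W h), π'.app h (app h e) = π.app h e
  pairing_app : ∀ {W : Opens X} (h : W ≤ U) (a b : E.sec W h),
    E'.pairing h (app h a) (app h b) = E.pairing h a b
  app_inc : ∀ {W : Opens X} (h : W ≤ U) (α : Form O 1 W), app h (E.inc h α) = E'.inc h α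

namespace Isometry

variable {E E' E'' : Algebroid O U} {π : Projection A E} {π' : Projection A E'}
  {π'' : Projection A E''}

theorem anchor_app (τ : Isometry π π') {W : Opens X} (h : W ≤ U) (e : E.sec W h) :
    E'.anchor h (τ.app h e) = E.anchor h e := by
  rw [← π'.anchor_app, τ.proj_app, π.anchor_app]

/-- The composition of isometries. -/
def comp (τ : Isometry π π') (τ' : Isometry π' π'') : Isometry π π'' where
  app h := (τ'.app h).comp (τ.app h)
  app_res h i e := by simp [τ.app_res, τ'.app_res]
  app_act h f e := by simp [τ.app_act, τ'.app_act]
  proj_app h e := by simp [τ.proj_app, τ'.proj_app]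
  pairing_app h a b := by simp [τ.pairing_app, τ'.pairing_app]
  app_inc h f := by simp [τ.app_inc, τ'.app_inc]

/-- The restriction of an isometry to a smaller open subset. -/
def restrict (τ : Isometry π π') {U' : Opens X} (i : U' ≤ U) :
    Isometry (π.restrict i) (π'.restrict i) where
  app h := τ.app (h.trans i)
  app_res h := τ.app_res (h.trans i)
  app_act h := τ.app_act (h.trans i)
  proj_app h := τ.proj_app (h.trans i)
  pairing_app h := τ.pairing_app (h.trans i)
  app_inc h := τ.app_inc (h.trans i)

/-- The curvature of an isometry is the 3-form `H`, which measures the failure of the isometry to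
preserve the bracket: `[τ e, τ e'] = τ [e, e'] + i(H(e, e', ·))`. -/
def HasCurvature (τ : Isometry π π') (H : Form O 3 U) : Prop :=
  ∀ {W : Opens X} (h : W ≤ U) (e e' : E.sec W h),
    E'.bracket h (τ.app h e) (τ.app h e') = τ.app h (E.bracket h e e')
      + E'.inc h (Form.contract (E.anchor h e') (Form.contract (E.anchor h e) (Form.res h H)))

/-- The difference of two isometries is the 2-form `β`: `τ e = σ e + i(β(e, ·))`. -/
def Differ (τ σ : Isometry π π') (β : Form O 2 U) : Prop :=
  ∀ {W : Opens X} (h : W ≤ U) (e : E.sec W h),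
    τ.app h e = σ.app h e + E'.inc h (Form.contract (E.anchor h e) (Form.res h β))

variable {k : ℤ} (hO : IsSmooth O) (hA : A.IsTransitive) (hE : E.IsAlg k) (hE' : E'.IsAlg k)
  (hE'' : E''.IsAlg k)

section difference

variable (τ σ : Isometry π π')

include hO hA hE hE' in
/-- The 1-form `τ e - σ e` vanishes if the anchor of `e` does, since both maps preserve the pairing;
so it descends to a skew-symmetric function of the anchors. -/
theorem exists_differ : ∃ β, τ.Differ σ β := by
  have inj : ∀ {W : Opens X} (h : W ≤ U), Function.Injective (E'.inc h) := fun h =>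
    hE'.inc_injective hO (π'.anchorSurj hA) h
  have key : ∀ (W : Opens X) (h : W ≤ U), ∃ g : E.sec W h →ₗ[ℂ] Form O 1 W,
      ∀ e, (τ.app h - σ.app h) e = E'.inc h (g e) := fun W h =>
    exists_linearMap_lift _ (inj h) _ fun e => by
      obtain ⟨α, hα⟩ := π'.exists_eq_add_inc hO hA hE' h (τ.app h e) (σ.app h e)
        (by rw [τ.proj_app, σ.proj_app])
      exact ⟨α, by rw [LinearMap.sub_apply, hα, add_sub_cancel_left]⟩
  choose α hα' using key
  have hα : ∀ {W : Opens X} (h : W ≤ U) (e : E.sec W h),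
      τ.app h e = σ.app h e + E'.inc h (α W h e) := fun h e => by
    rw [← hα', LinearMap.sub_apply]; abel
  have skew : ∀ {W : Opens X} (h : W ≤ U) (e e' : E.sec W h),
      Form.ev (α W h e) (E.anchor h e') = -Form.ev (α W h e') (E.anchor h e) := fun h e e' => by
    have := τ.pairing_app h e e'
    rw [hα, hα, hE'.add_inc_pairing_add_inc hO, σ.pairing_app, σ.anchor_app, σ.anchor_app] at this
    linear_combination this
  have res : ∀ {W V : Opens X} (h : W ≤ U) (i : V ≤ W) (e : E.sec W h),
      α V (i.trans h) (E.res h i e) = Form.res i (α W h e) := fun h i e => inj _ (by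
    rw [← hα', ← E'.res_inc, ← hα', LinearMap.sub_apply, LinearMap.sub_apply, map_sub, τ.app_res,
      σ.app_res])
  have act : ∀ {W : Opens X} (h : W ≤ U) (f : Fn O W) (e : E.sec W h),
      α W h (E.act h f e) = f • α W h e := fun h f e => inj _ (by
    rw [← hα', hE'.inc_act, ← hα', LinearMap.sub_apply, LinearMap.sub_apply, map_sub, τ.app_act,
      σ.app_act])
  have ker : ∀ {W : Opens X} (h : W ≤ U) (e : E.sec W h), E.anchor h e = 0 → α W h e = 0 := by
    intro W h e he
    refine Form.ext₁ fun V i ξ => Fn.eq_of_local O fun p hp => ?_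
    obtain ⟨V', j, hp', a, ha⟩ := (π.anchorSurj hA) (i.trans h) ξ p hp
    refine ⟨V', j, hp', ?_⟩
    rw [Form.res_ev, Form.res_ev, Form.res_res, Form.res_res, ← ha, ← res h, skew,
      ← E.res_anchor, he, map_zero, map_zero, Form.ev_zero, neg_zero, Form.zero_ev]
  let R := (Algebroid.AnchorSurj.locSurj (π.anchorSurj hA)).liftRel (G := formSheaf O 1 U)
    (fun {W} h => α W h) (fun h i a => res h i a) (fun h a => ker h a)
  have R_eq : ∀ {W : Opens X} (h : W ≤ U) (e : E.sec W h),
      R.toFun h (E.anchor h e) = α W h e := fun h e => R.toFun_eq h ⟨e, rfl, rfl⟩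
  let φ : ∀ {V : Opens X} (_ : V ≤ U), VF O V →ₗ[ℂ] Form O 1 V := fun h => R.toFun h
  have φ_eq : ∀ {W : Opens X} (h : W ≤ U) (e : E.sec W h), φ h (E.anchor h e) = α W h e := R_eq
  have φ_res : ∀ {V V' : Opens X} (h : V ≤ U) (i : V' ≤ V) (ξ : VF O V),
      φ (i.trans h) (VF.res i ξ) = Form.res i (φ h ξ) := fun h i ξ => R.toFun_res h i ξ
  have φ_ev : ∀ {V V' : Opens X} (h : V ≤ U) (i : V' ≤ V) (ξ η : VF O V),
      resFn O i (Form.ev (φ h ξ) η) = Form.ev (φ (i.trans h) (VF.res i ξ)) (VF.res i η) :=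
    fun h i ξ η => by rw [Form.res_ev, φ_res]
  refine ⟨Form.mk₂ (fun V h ξ η => Form.ev (φ h ξ) η)
    (fun V h x x' y => by rw [map_add, Form.add_ev]) (fun V h f x y => ?_) (fun V h x y => ?_)
    (fun V h V' i ξ η => φ_ev h i ξ η), fun {W} h e => ?_⟩
  · refine Fn.eq_of_local O fun p hp => ?_
    obtain ⟨V', i, hp', e, he⟩ := (π.anchorSurj hA) h x p hp
    refine ⟨V', i, hp', ?_⟩
    rw [map_mul, φ_ev, φ_ev, VF.res_smul, ← he, ← hE.anchor_act, φ_eq, φ_eq, act, Form.smul_ev]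
  · refine Fn.eq_of_local O fun p hp => ?_
    obtain ⟨V', i, hp', e, he⟩ := Algebroid.AnchorSurj.exists_lifts (π.anchorSurj hA) h p hp 2 ![x, y]
    refine ⟨V', i, hp', ?_⟩
    have h0 := he 0
    have h1 := he 1
    simp only [Matrix.cons_val_zero, Matrix.cons_val_one] at h0 h1
    rw [map_neg, φ_ev, φ_ev, ← h0, ← h1, φ_eq, φ_eq, skew]
  · rw [hα]
    congr 2
    refine Form.ext₁ fun V i η => ?_
    rw [Form.res_contract, Form.ev_contract, Form.res_res, Form.ev₂_res_mk₂, φ_res, φ_eq]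

end difference

section curvature

variable (τ : Isometry π π')

include hO hA hE hE' in
/-- The 1-form `[τ e, τ e'] - τ [e, e']` is skew-symmetric in `e`, `e'`, and, evaluated at the anchor
of a third section, in all three; hence it depends only on the anchors, and is linear over `O`. -/
theorem exists_hasCurvature : ∃ H, τ.HasCurvature H := by
  have hs : E.AnchorSurj := π.anchorSurj hA
  have inj : ∀ {W : Opens X} (h : W ≤ U), Function.Injective (E'.inc h) := fun h =>
    hE'.inc_injective hO (π'.anchorSurj hA) h
  have key : ∀ (W : Opens X) (h : W ≤ U), ∃ g : E.sec W h →ₗ[ℂ] E.sec W h →ₗ[ℂ] Form O 1 W,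
      ∀ e e', ((E'.bracket h).compl₁₂ (τ.app h) (τ.app h)
        - (E.bracket h).compr₂ (τ.app h) : E.sec W h →ₗ[ℂ] E.sec W h →ₗ[ℂ] E'.sec W h) e e'
          = E'.inc h (g e e') := fun W h =>
    exists_bilinearMap_lift _ (inj h) _ fun e e' => by
      obtain ⟨α, hα⟩ := π'.exists_eq_add_inc hO hA hE' h
        (E'.bracket h (τ.app h e) (τ.app h e')) (τ.app h (E.bracket h e e'))
        (by rw [π'.app_bracket, τ.proj_app, τ.proj_app, τ.proj_app, π.app_bracket])
      exact ⟨α, by simp [hα]⟩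
  choose α hα' using key
  have hα : ∀ {W : Opens X} (h : W ≤ U) (e e' : E.sec W h),
      E'.bracket h (τ.app h e) (τ.app h e') = τ.app h (E.bracket h e e') + E'.inc h (α W h e e') :=
    fun h e e' => by rw [← hα']; simp
  have hα₂ : ∀ {W : Opens X} (h : W ≤ U) (e e' : E.sec W h), E'.inc h (α W h e e')
      = E'.bracket h (τ.app h e) (τ.app h e') - τ.app h (E.bracket h e e') := fun h e e' => by
    rw [hα, add_sub_cancel_left]
  -- The value of `α(e, e')` is the difference of the trilinear forms `⟨[e, e'], e''⟩`.
  have ev : ∀ {W : Opens X} (h : W ≤ U) (e e' e'' : E.sec W h),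
      Form.ev (α W h e e') (E.anchor h e'')
        = E'.pairing h (E'.bracket h (τ.app h e) (τ.app h e')) (τ.app h e'')
          - E.pairing h (E.bracket h e e') e'' := fun h e e' e'' => by
    rw [hα, map_add, LinearMap.add_apply, τ.pairing_app, hE'.inc_pairing hO, τ.anchor_app]
    abel
  have skew : ∀ {W : Opens X} (h : W ≤ U) (e e' : E.sec W h), α W h e e' = -α W h e' e :=
    fun h e e' => inj _ (by
      rw [map_neg, hα₂, hα₂, ← sub_eq_zero]
      have h1 := hE'.bracket_symm h (τ.app h e) (τ.app h e')
      have h2 := congrArg (τ.app h) (hE.bracket_symm h e e')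
      rw [map_add, ← hE.inc_d, τ.app_inc] at h2
      rw [← hE'.inc_d, τ.pairing_app, ← h2] at h1
      rw [sub_neg_eq_add, sub_add_sub_comm, h1, sub_self])
  have skew' : ∀ {W : Opens X} (h : W ≤ U) (e e' e'' : E.sec W h),
      Form.ev (α W h e e') (E.anchor h e'') = -Form.ev (α W h e e'') (E.anchor h e') :=
    fun h e e' e'' => by
      have h1 := hE'.pairing_invariant h (τ.app h e) (τ.app h e') (τ.app h e'')
      rw [τ.pairing_app, τ.anchor_app, hE.pairing_invariant h e e' e'',
        hE'.pairing_symm h (τ.app h e'), hE.pairing_symm h e'] at h1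
      rw [ev, ev]
      linear_combination -h1
  have res : ∀ {W V : Opens X} (h : W ≤ U) (i : V ≤ W) (e e' : E.sec W h),
      α V (i.trans h) (E.res h i e) (E.res h i e') = Form.res i (α W h e e') :=
    fun h i e e' => inj _ (by
      rw [hα₂, ← E'.res_inc, hα₂, map_sub, E'.res_bracket, ← E.res_bracket, τ.app_res, τ.app_res,
        τ.app_res])
  have act : ∀ {W : Opens X} (h : W ≤ U) (f : Fn O W) (e e' : E.sec W h),
      α W h e (E.act h f e') = f • α W h e e' := fun h f e e' => inj _ (by
    rw [hα₂, hE'.inc_act, hα₂, map_sub, τ.app_act, hE'.bracket_act, hE.bracket_act, map_add,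
      τ.app_act, τ.app_act, τ.anchor_app]
    abel)
  have ker : ∀ {W : Opens X} (h : W ≤ U) (e e' : E.sec W h),
      E.anchor h e' = 0 → α W h e e' = 0 := by
    intro W h e e' he
    refine Form.ext₁ fun V i ξ => Fn.eq_of_local O fun p hp => ?_
    obtain ⟨V', j, hp', a, ha⟩ := hs (i.trans h) ξ p hp
    refine ⟨V', j, hp', ?_⟩
    rw [Form.res_ev, Form.res_ev, Form.res_res, Form.res_res, ← ha, ← res h, skew',
      ← E.res_anchor, he, map_zero, map_zero, Form.ev_zero, neg_zero, Form.zero_ev]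
  obtain ⟨g, g_res, g_eq⟩ := hs.locSurj.exists_liftBil hs.locSurj (G := formSheaf O 1 U)
    (fun {W} h => α W h) (fun h i a b => res h i a b)
    (fun {W} h a b h0 => by
      have := (skew h a b).trans (congrArg Neg.neg (ker h b a h0))
      rwa [neg_zero] at this)
    (fun h a b h0 => ker h a b h0)
  let φ : ∀ {V : Opens X} (_ : V ≤ U), VF O V →ₗ[ℂ] VF O V →ₗ[ℂ] Form O 1 V := fun h => g h
  have φ_eq : ∀ {W : Opens X} (h : W ≤ U) (e e' : E.sec W h),
      φ h (E.anchor h e) (E.anchor h e') = α W h e e' := g_eq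
  have φ_res : ∀ {V V' : Opens X} (h : V ≤ U) (i : V' ≤ V) (ξ η : VF O V),
      φ (i.trans h) (VF.res i ξ) (VF.res i η) = Form.res i (φ h ξ η) :=
    fun h i ξ η => (g_res h i ξ η).symm
  have φ_ev : ∀ {V V' : Opens X} (h : V ≤ U) (i : V' ≤ V) (ξ η ζ : VF O V),
      resFn O i (Form.ev (φ h ξ η) ζ)
        = Form.ev (φ (i.trans h) (VF.res i ξ) (VF.res i η)) (VF.res i ζ) :=
    fun h i ξ η ζ => by rw [Form.res_ev, φ_res]
  have loc : ∀ {W : Opens X} (h : W ≤ U) (ξ η ζ : VF O W), ∀ p ∈ W,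
      ∃ (V : Opens X) (i : V ≤ W) (_ : p ∈ V) (a b c : E.sec V (i.trans h)),
        E.anchor _ a = VF.res i ξ ∧ E.anchor _ b = VF.res i η ∧ E.anchor _ c = VF.res i ζ := by
    intro W h ξ η ζ p hp
    obtain ⟨V, i, hpV, e, he⟩ := hs.exists_lifts h p hp 3 ![ξ, η, ζ]
    exact ⟨V, i, hpV, e 0, e 1, e 2, he 0, he 1, he 2⟩
  have φ_skew : ∀ {V : Opens X} (h : V ≤ U) (ξ η ζ : VF O V),
      Form.ev (φ h ξ η) ζ = -Form.ev (φ h η ξ) ζ := fun h ξ η ζ => Fn.eq_of_local O fun p hp => by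
    obtain ⟨V', i, hp', a, b, c, ha, hb, hc⟩ := loc h ξ η ζ p hp
    exact ⟨V', i, hp', by rw [map_neg, φ_ev, φ_ev, ← ha, ← hb, φ_eq, φ_eq, skew, Form.neg_ev]⟩
  have φ_skew' : ∀ {V : Opens X} (h : V ≤ U) (ξ η ζ : VF O V),
      Form.ev (φ h ξ η) ζ = -Form.ev (φ h ξ ζ) η := fun h ξ η ζ => Fn.eq_of_local O fun p hp => by
    obtain ⟨V', i, hp', a, b, c, ha, hb, hc⟩ := loc h ξ η ζ p hp
    exact ⟨V', i, hp', by
      rw [map_neg, φ_ev, φ_ev, ← ha, ← hb, ← hc, φ_eq, φ_eq, skew']⟩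
  refine ⟨Form.mk₃ (fun V h ξ η ζ => Form.ev (φ h ξ η) ζ)
    (fun V h x x' y z => by rw [map_add, LinearMap.add_apply, Form.add_ev])
    (fun V h f x y z => ?_) (fun V h x y z => φ_skew h x y z) (fun V h x y z => φ_skew' h x y z)
    (fun V h V' i ξ η ζ => φ_ev h i ξ η ζ), fun {W} h e e' => ?_⟩
  · rw [φ_skew, φ_skew', Form.ev_smul, φ_skew h x y z, φ_skew' h y x z]
    ring
  · rw [hα]
    congr 2
    refine Form.ext₁ fun V i η => ?_
    rw [Form.res_contract, Form.res_contract, Form.ev_contract_contract, Form.res_res,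
      Form.ev₃_res_mk₃, φ_res, φ_eq]

end curvature

section

variable {τ σ : Isometry π π'} {H H' : Form O 3 U} {β : Form O 2 U}

theorem HasCurvature.comp {τ' : Isometry π' π''} (h : τ.HasCurvature H)
    (h' : τ'.HasCurvature H') : (τ.comp τ').HasCurvature (H + H') := fun i e e' => by
  change E''.bracket i (τ'.app i (τ.app i e)) (τ'.app i (τ.app i e')) = τ'.app i (τ.app i _) + _
  rw [h', h, map_add, τ'.app_inc, τ.anchor_app, τ.anchor_app, add_assoc, ← map_add]
  rfl

theorem HasCurvature.restrict (h : τ.HasCurvature H) {U' : Opens X} (i : U' ≤ U) :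
    (τ.restrict i).HasCurvature (Form.res i H) := fun j e e' => h (j.trans i) e e'

include hO hA hE hE' in
theorem HasCurvature.differ (h : τ.HasCurvature H) (h' : σ.HasCurvature H') (hβ : τ.Differ σ β)
    {V : Opens X} (i : V ≤ U) (ξ η ζ : VF O V) :
    H.on i ![ξ, η, ζ] = H'.on i ![ξ, η, ζ] + β.d₂ i ξ η ζ := by
  unfold Form.d₂
  simp only [Form.on_eq_ev₂, Form.on_eq_ev₃]
  refine Fn.eq_of_local O fun p hp => ?_
  obtain ⟨V', j, hp', e, he⟩ := Algebroid.AnchorSurj.exists_lifts (π.anchorSurj hA) i p hp 3 ![ξ, η, ζ]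
  refine ⟨V', j, hp', ?_⟩
  simp only [map_add, map_sub, Form.res_ev₂, Form.res_ev₃, Form.res_res, VF.res_app,
    VF.res_bracket]
  rw [show VF.res j ξ = _ from (he 0).symm, show VF.res j η = _ from (he 1).symm]
  generalize VF.res j ζ = ζ
  have e₁ := h _ (e 0) (e 1)
  rw [hβ, hβ, hβ, hE'.add_inc_bracket_add_inc hO, h'] at e₁
  have key : ∀ (t : E'.sec V' (j.trans i)) (a b c d : Form O 1 V'),
      t + E'.inc _ a + E'.inc _ b = t + E'.inc _ c + E'.inc _ d → a + b = c + d :=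
    fun t a b c d H => hE'.inc_injective hO (π'.anchorSurj hA) _ (by
      rw [add_assoc, add_assoc] at H
      rw [map_add, map_add, add_left_cancel H])
  have e₂ := key _ _ _ _ _ e₁
  have e₃ := congrArg (fun α => Form.ev α ζ) e₂
  simp only [Form.add_ev, Form.ev_contract_contract] at e₃
  simp only [Form.sub_ev, Form.ev_lie, Form.ev_contract, Form.ev_d, σ.anchor_app,
    hE.anchor_bracket] at e₃
  rw [Form.ev₂_skew _ ⁅E.anchor _ (e 0), ζ⁆, Form.ev₂_skew _ ⁅E.anchor _ (e 1), ζ⁆]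
  linear_combination -e₃

include hO hA hE hE' in
theorem HasCurvature.isClosed (h : τ.HasCurvature H) : H.IsClosed := by
  intro V i ξ₀ ξ₁ ξ₂ ω
  unfold Form.d₃
  simp only [Form.on_eq_ev₃]
  refine Fn.eq_of_local O fun p hp => ?_
  obtain ⟨V', j, hp', e, he⟩ := Algebroid.AnchorSurj.exists_lifts (π.anchorSurj hA) i p hp 3 ![ξ₀, ξ₁, ξ₂]
  refine ⟨V', j, hp', ?_⟩
  simp only [map_add, map_sub, Form.res_ev₃, Form.res_res, VF.res_app, VF.res_bracket, map_zero]
  rw [show VF.res j ξ₀ = _ from (he 0).symm, show VF.res j ξ₁ = _ from (he 1).symm,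
    show VF.res j ξ₂ = _ from (he 2).symm]
  generalize VF.res j ω = ω
  -- The Jacobi identity for `τ a`, `τ b`, `τ c` is an equation between 1-forms.
  have J := hE'.jacobi _ (τ.app _ (e 0)) (τ.app _ (e 1)) (τ.app _ (e 2))
  rw [h, h, h, map_add, map_add, map_add, LinearMap.add_apply, h, h, h, hE'.bracket_inc hO,
    hE'.bracket_inc hO, hE'.inc_bracket hO, hE.jacobi, map_add, τ.anchor_app, τ.anchor_app,
    τ.anchor_app, ← sub_eq_zero] at J
  have key : ∀ (t t' : E'.sec V' (j.trans i)) (a b c d a' b' : Form O 1 V'),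
      t + t' + E'.inc _ a + E'.inc _ b
        - (t + E'.inc _ c + E'.inc _ d + (t' + E'.inc _ a' + E'.inc _ b')) = 0 →
      a + b - c - d - a' - b' = 0 := fun t t' a b c d a' b' H =>
    hE'.inc_injective hO (π'.anchorSurj hA) _ (by
      rw [map_zero, ← H]
      simp only [map_add, map_sub]
      abel)
  have J' := congrArg (fun α => Form.ev α ω) (key _ _ _ _ _ _ _ _ J)
  simp only [Form.add_ev, Form.ev_contract_contract, Form.sub_ev, Form.ev_lie,
    Form.ev_d, hE.anchor_bracket, Form.zero_ev] at J'
  have r := Form.ev₃_skew (Form.res (j.trans i) H)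
  have r' := Form.ev₃_skew' (Form.res (j.trans i) H)
  rw [r _ ⁅E.anchor _ (e 1), E.anchor _ (e 2)⁆, r _ ⁅E.anchor _ (e 0), E.anchor _ (e 2)⁆,
    r' _ _ ⁅_, ω⁆, r _ ⁅_, ω⁆, r' _ _ ⁅_, ω⁆, r _ ⁅_, ω⁆, r' _ _ ⁅_, ω⁆, r _ ⁅_, ω⁆] at J'
  linear_combination J'

end

end Isometry

end

section

variable {O : StructureSheaf X} {U : Opens X} {A : LieAlgebroid O}

/-! ### Connections and local isometries -/

/-- In coordinates, sections of a Courant algebroid with anchors `∂ᵢ` can be corrected by 1-forms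
so as to span an isotropic subspace, and thus define a connection. -/
theorem Algebroid.IsCourant.exists_connection {Q : Algebroid O U} (hO : IsSmooth O)
    (hQ : Q.IsCourant) (C : Coordinates O U) (s : Fin C.n → Q.sec U le_rfl)
    (hs : ∀ i, Q.anchor le_rfl (s i) = C.D i) : Nonempty (Connection Q) := by
  let g : Fin C.n → Fin C.n → Fn O U := fun i j => Q.pairing le_rfl (s i) (s j)
  -- `βᵢ` is minus one half of the `i`-th row of the Gram matrix `g`, so that `gᵢⱼ + βᵢ(∂ⱼ) + βⱼ(∂ᵢ) = 0`
  let β : Fin C.n → Form O 1 U := fun i => (-1 / 2 : ℂ) • ∑ j, g i j • Form.d (C.x j)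
  have hβ : ∀ i j, Form.ev (β i) (C.D j) = (-1 / 2 : ℂ) • g i j := fun i j => by
    simp [β, Form.csmul_ev, C.app_D]
  let t : Fin C.n → Q.sec U le_rfl := fun i => s i + Q.inc le_rfl (β i)
  have ht : ∀ i, Q.anchor le_rfl (t i) = C.D i := fun i => by
    rw [map_add, hQ.isAlg.anchor_inc hO, hs, add_zero]
  have htt : ∀ i j, Q.pairing le_rfl (t i) (t j) = 0 := fun i j => by
    rw [hQ.isAlg.add_inc_pairing_add_inc hO, hs, hs, hβ, hβ]
    change g i j + ((-1 / 2 : ℂ) • Q.pairing le_rfl (s j) (s i) + _) = 0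
    rw [hQ.pairing_symm le_rfl (s j)]
    change g i j + ((-1 / 2 : ℂ) • g i j + (-1 / 2 : ℂ) • g i j) = 0
    rw [← add_smul]
    norm_num
  let m : ∀ {W : Opens X} (_ : W ≤ U), VF O W →ₗ[ℂ] Q.sec W _ := fun {W} h =>
    { toFun := fun ξ => ∑ i, Q.act h (ξ.app (resFn O h (C.x i))) (Q.res le_rfl h (t i))
      map_add' := fun ξ η => by simp [Finset.sum_add_distrib]
      map_smul' := fun c ξ => by
        have : ∀ f : Fn O W, (c • ξ).app f = c • ξ.app f := fun f => rfl
        simp [this, Finset.smul_sum] }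
  have hm : ∀ {W : Opens X} (h : W ≤ U) (ξ : VF O W),
      m h ξ = ∑ i, Q.act h (ξ.app (resFn O h (C.x i))) (Q.res le_rfl h (t i)) := fun _ _ => rfl
  refine ⟨{
    map := m
    map_res := fun {W V} h i ξ => ?_
    map_smul := fun {W} h f ξ => ?_
    anchor_map := fun {W} h ξ => ?_
    isotropic := fun {W} h ξ η => ?_ }⟩
  · rw [hm, hm, map_sum]
    refine Finset.sum_congr rfl fun k _ => ?_
    rw [Q.res_act, Q.res_res, VF.res_app, resFn_resFn]
  · rw [hm, hm, map_sum]
    refine Finset.sum_congr rfl fun k _ => ?_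
    rw [hQ.act_act, VF.smul_app]
  · rw [hm, map_sum]
    conv_rhs => rw [C.expand _ h ξ]
    refine Finset.sum_congr rfl fun k _ => ?_
    rw [hQ.anchor_act, ← Q.res_anchor, ht]
  · rw [hm, hm, map_sum]
    refine Finset.sum_eq_zero fun k _ => ?_
    rw [map_sum, LinearMap.sum_apply]
    refine Finset.sum_eq_zero fun l _ => ?_
    rw [hQ.pairing_act, hQ.pairing_symm, hQ.pairing_act, ← Q.res_pairing, htt, map_zero, mul_zero,
      mul_zero]

namespace Isometry

variable {E E' : Algebroid O U} {π : Projection A E} {π' : Projection A E'}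

/-- A relation which is locally the graph of an isometry defines an isometry. -/
theorem exists_of_rel (R : SheafOn.LinRel E.toSheafOn E'.toSheafOn)
    (act : ∀ {W : Opens X} (h : W ≤ U) (f : Fn O W) {e : E.sec W h} {e' : E'.sec W h},
      R.rel h e e' → R.rel h (E.act h f e) (E'.act h f e'))
    (proj : ∀ {W : Opens X} (h : W ≤ U) {e : E.sec W h} {e' : E'.sec W h},
      R.rel h e e' → π'.app h e' = π.app h e)
    (pairing : ∀ {W : Opens X} (h : W ≤ U) {a b : E.sec W h} {a' b' : E'.sec W h},
      R.rel h a a' → R.rel h b b' → E'.pairing h a' b' = E.pairing h a b)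
    (inc : ∀ {W : Opens X} (h : W ≤ U) (α : Form O 1 W), R.rel h (E.inc h α) (E'.inc h α)) :
    ∃ τ : Isometry π π', ∀ {W : Opens X} (h : W ≤ U) {e : E.sec W h} {e' : E'.sec W h},
      R.rel h e e' → τ.app h e = e' := by
  refine ⟨{
    app := R.toFun
    app_res := R.toFun_res
    app_act := fun h f e => E'.eq_of_local h fun p hp => ?_
    proj_app := fun h e => A.eq_of_local le_top fun p hp => ?_
    pairing_app := fun h a b => Fn.eq_of_local O fun p hp => ?_
    app_inc := fun h α => R.toFun_eq h (inc h α) }, fun h _ _ r => R.toFun_eq h r⟩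
  · obtain ⟨V, i, hpV, r⟩ := R.exists_rel h e p hp
    refine ⟨V, i, hpV, ?_⟩
    rw [← R.toFun_res, E.res_act, E'.res_act]
    exact R.toFun_eq _ (act _ _ r)
  · obtain ⟨V, i, hpV, r⟩ := R.exists_rel h e p hp
    refine ⟨V, i, hpV, ?_⟩
    rw [← π.app_res, ← π'.app_res]
    exact proj _ r
  · obtain ⟨V, i, hpV, r, r'⟩ := R.exists_rel₂ h a b p hp
    refine ⟨V, i, hpV, ?_⟩
    rw [E.res_pairing, E'.res_pairing]
    exact pairing _ r r'

variable {k : ℤ} {P : InvariantPairing A} (hO : IsSmooth O) (hA : A.IsTransitive)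
  (hE : E.IsAlg k) (hE' : E'.IsAlg k) (hπ : π.Induces P) (hπ' : π'.Induces P)

local notation "𝓓" => Algebroid.diff π' π hO hA hE' hE
local notation "δ" => Algebroid.diffMk π' π hO hA hE' hE

include hπ hπ' in
/-- A connection on `E' - E` defines an isometry `τ` from `E` to `E'`, such that
`(τ e, e)` represents the horizontal lift of the anchor of `e`. -/
theorem exists_of_connection (N : Connection (𝓓)) :
    Nonempty (Isometry π π') := by
  have hD := Algebroid.diff_isAlg π' π hO hA hE' hE
  have hD' := Algebroid.diff_isExact π' π hO hA hE' hE hπ' hπ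
  let R : SheafOn.LinRel E.toSheafOn E'.toSheafOn :=
    { rel := fun h e e' => ∃ w, δ h e' e w = N.map h (E.anchor h e)
      res := by
        rintro W V h i e e' ⟨w, r⟩
        have w' : π'.app (i.trans h) (E'.res h i e') = π.app (i.trans h) (E.res h i e) := by
          rw [π.app_res, π'.app_res, w]
        refine ⟨w', ?_⟩
        rw [← E.res_anchor, N.map_res, ← r]
        exact (Algebroid.diffMk_res h w i w').symm
      add := by
        rintro W h a b a' b' ⟨w, r⟩ ⟨w', r'⟩
        refine ⟨by rw [map_add, map_add, w, w'], ?_⟩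
        refine (Algebroid.diffMk_add h w w' _).trans ?_
        rw [r, r', map_add, map_add]
      smul := by
        rintro W h c a a' ⟨w, r⟩
        refine ⟨by rw [map_smul, map_smul, w], ?_⟩
        refine (Algebroid.diffMk_csmul h w c _).trans ?_
        rw [r, map_smul, map_smul]
      uniq := by
        rintro W h y ⟨w, r⟩
        obtain ⟨α, rfl⟩ := π'.exists_inc hO hA hE' h y (by rw [w, map_zero])
        have h0 : (𝓓).inc h α
            = (𝓓).inc h 0 :=
          r.trans (by rw [map_zero, map_zero, map_zero])
        rw [hD.inc_injective hO hD'.anchorSurj h h0, map_zero]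
      total := by
        intro W h e p hp
        obtain ⟨V, i, hV, hpV, e', he'⟩ := π'.surj h (π.app h e) p hp
        have w : π'.app (i.trans h) e' = π.app (i.trans h) (E.res h i e) := by
          rw [he', π.app_res]
        obtain ⟨α, hα⟩ := hD'.exists_inc hO hD (i.trans h)
          (N.map (i.trans h) (E.anchor _ (E.res h i e))
            - δ (i.trans h) e' (E.res h i e) w) (by
          rw [map_sub, N.anchor_map]
          refine sub_eq_zero.2 (Eq.trans ?_ (Algebroid.anchor_diffMk _ w).symm)
          rw [← π.anchor_app, ← π'.anchor_app, w])
        have w₁ : π'.app (i.trans h) (E'.inc _ α) = π.app (i.trans h) 0 := by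
          rw [π'.app_inc hO hE', map_zero]
        have w₂ : π'.app (i.trans h) (E'.inc _ α + e') = π.app (i.trans h) (E.res h i e) := by
          rw [map_add, w₁, w, map_zero, zero_add]
        refine ⟨V, i, hpV, E'.inc _ α + e', w₂, ?_⟩
        refine ((Algebroid.diffMk_congr rfl (zero_add _).symm w₂ (by rw [zero_add, w₂])).trans
          (Algebroid.diffMk_add (i.trans h) w₁ w _)).trans ?_
        refine (congrArg (· + δ (i.trans h) e' (E.res h i e) w)
          ((Algebroid.diffMk_inc_zero (i.trans h) α w₁).trans hα.symm)).trans ?_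
        exact sub_add_cancel _ _ }
  obtain ⟨τ, -⟩ := exists_of_rel (π := π) (π' := π') R
    (by
      rintro W h f e e' ⟨w, r⟩
      refine ⟨by rw [π.app_act, π'.app_act, w], ?_⟩
      rw [hE.anchor_act, N.map_smul, ← r]
      exact Algebroid.diffMk_act h w f _)
    (by
      rintro W h e e' ⟨w, r⟩
      exact w)
    (by
      rintro W h a b a' b' ⟨w, r⟩ ⟨w', r'⟩
      have := Algebroid.pairing_diffMk (hO := hO) (hA := hA) (hE₁ := hE') (hE₂ := hE) h w w'
      rw [r, r', N.isotropic] at this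
      exact (sub_eq_zero.1 this.symm))
    (by
      intro W h α
      refine ⟨by rw [π.app_inc hO hE, π'.app_inc hO hE'], ?_⟩
      rw [hE.anchor_inc hO, map_zero]
      exact Algebroid.diffMk_inc_inc h α _)
  exact ⟨τ⟩

include hO hA hE hE' hπ hπ' in
/-- In coordinates, there is an isometry if there are sections with anchors `∂ᵢ` which are equal
modulo `Ω¹`. -/
theorem exists_of_coordinates (C : Coordinates O U) (s : Fin C.n → E.sec U le_rfl)
    (s' : Fin C.n → E'.sec U le_rfl) (hs : ∀ i, E.anchor le_rfl (s i) = C.D i)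
    (hs' : ∀ i, π'.app le_rfl (s' i) = π.app le_rfl (s i)) : Nonempty (Isometry π π') := by
  have hD : (𝓓).IsAlg 0 :=
    (show k + -1 * k = 0 by ring) ▸ Algebroid.diff_isAlg π' π hO hA hE' hE
  obtain ⟨N⟩ := hD.isCourant.exists_connection hO C
    (fun i => δ le_rfl (s' i) (s i) (hs' i)) fun i => by
      refine (Algebroid.anchor_diffMk _ (hs' i)).trans ?_
      rw [← π'.anchor_app, hs', π.anchor_app, hs]
  exact exists_of_connection hO hA hE hE' hπ hπ' N

include hO hA hE hE' hπ hπ' in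
/-- Any two extensions of `A` of the same level which induce the same pairing are locally
isometric. -/
theorem exists_local {p : X} (hp : p ∈ U) : ∃ (V : Opens X) (i : V ≤ U) (_ : p ∈ V),
    Nonempty (Isometry (π.restrict i) (π'.restrict i)) := by
  obtain ⟨V, i, hpV, ⟨C⟩⟩ := hO.exists_coordinates_le hp
  obtain ⟨V₁, i₁, hp₁, s, hs⟩ :=
    Algebroid.AnchorSurj.exists_lifts (π.anchorSurj hA) i p hpV C.n C.D
  have key : ∀ (n : ℕ) (a : Fin n → A.Sec V₁), ∃ (V₂ : Opens X) (i₂ : V₂ ≤ V₁) (_ : p ∈ V₂)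
      (s' : Fin n → E'.sec V₂ (i₂.trans (i₁.trans i))),
      ∀ l, π'.app _ (s' l) = A.res le_top i₂ (a l) := by
    intro n
    induction n with
    | zero => exact fun a => ⟨V₁, le_rfl, hp₁, Fin.elim0, fun l => l.elim0⟩
    | succ n ih =>
      intro a
      obtain ⟨V₂, i₂, hp₂, s', hs'⟩ := ih fun l => a l.succ
      obtain ⟨V₃, i₃, h₃, hp₃, e, he⟩ := π'.surj (i₂.trans (i₁.trans i)) (A.res le_top i₂ (a 0)) p hp₂
      refine ⟨V₃, i₃.trans i₂, hp₃, Fin.cons e fun l => E'.res _ i₃ (s' l), fun l => ?_⟩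
      refine Fin.cases ?_ (fun l => ?_) l
      · exact he.trans (A.res_res _ _ _ _)
      · rw [Fin.cons_succ, π'.app_res, hs', A.res_res]
  obtain ⟨V₂, i₂, hp₂, s', hs'⟩ := key C.n fun l => π.app _ (s l)
  refine ⟨V₂, i₂.trans (i₁.trans i), hp₂, exists_of_coordinates (P := P) hO hA (hE.restrict _)
    (hE'.restrict _) (fun h => hπ (h.trans (i₂.trans (i₁.trans i))))
    (fun h => hπ' (h.trans (i₂.trans (i₁.trans i))))
    ((C.restrict i₁).restrict i₂) (fun l => E.res _ i₂ (s l)) s' (fun l => ?_) (fun l => ?_)⟩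
  · exact (E.res_anchor _ i₂ (s l)).symm.trans (congrArg (VF.res i₂) (hs l))
  · exact (hs' l).trans (π.app_res _ i₂ (s l)).symm

end Isometry

end

section

variable {O : StructureSheaf X} {U : Opens X} {A : LieAlgebroid O}

/-! ### The class of a family of extensions -/

open Classical in
theorem H2.mk_eq_mk {c c' c'' : PointedCover X} (r : c ≤ c'') (r' : c' ≤ c'') (s : cocycles O c)
    (s' : cocycles O c')
    (h : Cochain.refine O r s.1 - Cochain.refine O r' s'.1 ∈ coboundaries O c'') :
    H2.mk O s = H2.mk O s' := by
  unfold H2.mk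
  rw [← Module.DirectLimit.of_f (hij := r), ← Module.DirectLimit.of_f (hij := r')]
  refine congrArg _ ?_
  exact (Submodule.Quotient.eq _).2 h

open Classical in
theorem H2.mk_neg {c : PointedCover X} (s : cocycles O c) : H2.mk O (-s) = -H2.mk O s :=
  map_neg (Module.DirectLimit.of ℂ (PointedCover X) (CoverH2 O) (CoverH2.refine O) c)
    (Submodule.Quotient.mk s)

namespace Isometry

variable {E E' Q : Algebroid O U} {π : Projection A E} {π' : Projection A E'}

/-- The isometry `e ↦ (∇(π e), e)` from `E` to `E' = Q + E` given by a connection `∇` on `Q`. -/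
def ofConnection {k : ℤ} (hQ : Q.IsCourant) (hE : E.IsAlg k) (hE' : E'.IsAlg k) (hO : IsSmooth O)
    (φ : Algebroid.Combination 1 Q E E') (N : Connection Q)
    (hφ : ∀ {W : Opens X} (h : W ≤ U) (q : Q.sec W h) (e : E.sec W h)
      (w : Q.anchor h q = E.anchor h e), π'.app h (φ.map h q e w) = π.app h e) :
    Isometry π π' where
  app {W} h :=
    { toFun := fun e => φ.map h (N.map h (E.anchor h e)) e (N.anchor_map h _)
      map_add' := fun e e' => by
        rw [← φ.map_add h _ _ _ _ _ _ (by rw [map_add, map_add, N.anchor_map, N.anchor_map])]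
        exact φ.congr (by rw [map_add, map_add]) rfl _ _
      map_smul' := fun a e => by
        rw [RingHom.id_apply, ← φ.map_csmul hQ.isAlg hE hE' h a _ _ _
          (by rw [map_smul, map_smul, N.anchor_map])]
        exact φ.congr (by rw [map_smul, map_smul]) rfl _ _ }
  app_res h i e := by
    refine Eq.trans ?_ (φ.map_res h i _ e (N.anchor_map h _)
      (by rw [← Q.res_anchor, N.anchor_map, E.res_anchor]))
    exact φ.congr (by rw [← E.res_anchor, N.map_res]) rfl _ _
  app_act h f e := by
    refine Eq.trans ?_ (φ.map_act h f _ e (N.anchor_map h _)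
      (by rw [hQ.anchor_act, N.anchor_map, hE.anchor_act]))
    exact φ.congr (by rw [hE.anchor_act, N.map_smul]) rfl _ _
  proj_app h e := hφ h _ e _
  pairing_app h a b := by
    refine (φ.pairing_map h _ _ a b _ _).trans ?_
    rw [N.isotropic, one_smul, zero_add]
  app_inc h α := by
    have w : Q.anchor h 0 = E.anchor h 0 := by rw [map_zero, map_zero]
    have w' : Q.anchor h (0 + Q.inc h 0) = E.anchor h (0 + E.inc h α) := by
      rw [map_zero, add_zero, map_zero, zero_add, hE.anchor_inc hO]
    refine (φ.congr (by rw [hE.anchor_inc hO, map_zero, map_zero, add_zero]) (zero_add _).symm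
      _ w').trans ((φ.map_add_inc hO hQ.isAlg hE hE' h 0 0 0 α w w' (by norm_num)).trans ?_)
    rw [φ.map_zero, zero_add, zero_add, one_smul]

theorem ofConnection_app {k : ℤ} (hQ : Q.IsCourant) (hE : E.IsAlg k) (hE' : E'.IsAlg k)
    (hO : IsSmooth O) (φ : Algebroid.Combination 1 Q E E') (N : Connection Q)
    (hφ : ∀ {W : Opens X} (h : W ≤ U) (q : Q.sec W h) (e : E.sec W h)
      (w : Q.anchor h q = E.anchor h e), π'.app h (φ.map h q e w) = π.app h e)
    {W : Opens X} (h : W ≤ U) (e : E.sec W h) (q : Q.sec W h) (w : Q.anchor h q = E.anchor h e)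
    (hq : q = N.map h (E.anchor h e)) :
    (ofConnection hQ hE hE' hO φ N hφ).app h e = φ.map h q e w :=
  φ.congr hq.symm rfl _ _

theorem ofConnection_hasCurvature {k : ℤ} (hQ : Q.IsCourant) (hE : E.IsAlg k) (hE' : E'.IsAlg k)
    (hO : IsSmooth O) (φ : Algebroid.Combination 1 Q E E') (N : Connection Q)
    (hφ : ∀ {W : Opens X} (h : W ≤ U) (q : Q.sec W h) (e : E.sec W h)
      (w : Q.anchor h q = E.anchor h e), π'.app h (φ.map h q e w) = π.app h e)
    {H : Form O 3 U} (hN : N.HasCurvature H) :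
    (ofConnection hQ hE hE' hO φ N hφ).HasCurvature H := fun {W} h e e' => by
  have b := sub_eq_iff_eq_add'.1 (hN h (E.anchor h e) (E.anchor h e'))
  have w : Q.anchor h (N.map h (E.anchor h (E.bracket h e e'))) = E.anchor h (E.bracket h e e') :=
    N.anchor_map h _
  have w' : Q.anchor h (N.map h (E.anchor h (E.bracket h e e')) + Q.inc h
      (Form.contract (E.anchor h e') (Form.contract (E.anchor h e) (Form.res h H))))
      = E.anchor h (E.bracket h e e' + E.inc h 0) := by
    rw [map_add, hQ.isAlg.anchor_inc hO, map_zero, add_zero, add_zero, w]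
  refine (φ.map_bracket h _ _ e e' (N.anchor_map h _) (N.anchor_map h _)
    (by rw [hQ.anchor_bracket, N.anchor_map, N.anchor_map, hE.anchor_bracket])).symm.trans ?_
  refine (φ.congr (by rw [b, hE.anchor_bracket]) (by rw [map_zero, add_zero]) _ w').trans ?_
  refine (φ.map_add_inc hO hQ.isAlg hE hE' h _ _ _ 0 w w' (by norm_num)).trans ?_
  rw [smul_zero, add_zero]
  rfl

end Isometry

theorem Form.contract_res_add {p : ℕ} {W V : Opens X} (i : V ≤ W) (ξ : VF O V)
    (B B' : Form O (p + 1) W) : Form.contract ξ (Form.res i (B + B'))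
      = Form.contract ξ (Form.res i B) + Form.contract ξ (Form.res i B') := rfl

/-- A 2-form on `W` is determined by the sections `i(B(e, ·))` of an extension. -/
theorem Form.eq_of_inc_contract {U' : Opens X} {E : Algebroid O U} {E' : Algebroid O U'} {k : ℤ}
    (hO : IsSmooth O) (hs : E.AnchorSurj) (hE' : E'.IsAlg k) (hs' : E'.AnchorSurj) {W : Opens X}
    (h : W ≤ U) (h' : W ≤ U') (B B' : Form O 2 W)
    (H : ∀ (V : Opens X) (i : V ≤ W) (e : E.sec V (i.trans h)),
      E'.inc (i.trans h') (Form.contract (E.anchor (i.trans h) e) (Form.res i B))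
        = E'.inc (i.trans h') (Form.contract (E.anchor (i.trans h) e) (Form.res i B'))) :
    B = B' := by
  refine Form.ext₂ fun V i ξ η => Fn.eq_of_local O fun p hp => ?_
  obtain ⟨V', j, hp', a, ha⟩ := hs (i.trans h) ξ p hp
  refine ⟨V', j, hp', ?_⟩
  have := hE'.inc_injective hO hs' _ (H V' (j.trans i) a)
  rw [Form.res_ev₂, Form.res_ev₂, ← ha, Form.res_res, Form.res_res, ← Form.ev_contract,
    ← Form.ev_contract, this]

variable {c c' : PointedCover X} {E : ∀ x, Algebroid O (c.nhd x)}
  {E' : ∀ x, Algebroid O (c'.nhd x)}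

/-- Isometries `τ_{xy} : E_y → E_x` and the cocycle of their curvatures `H_{xy}` and of the
differences `B_{xyz}` of `τ_{xy} τ_{yz}` and `τ_{xz}`. -/
structure IsometryCocycle (π : ∀ x, Projection A (E x)) where
  τ : ∀ x y, Isometry ((π y).restrict (inf_le_right : c.nhd x ⊓ c.nhd y ≤ c.nhd y))
    ((π x).restrict (inf_le_left : c.nhd x ⊓ c.nhd y ≤ c.nhd x))
  cocycle : cocycles O c
  curvature : ∀ x y, (τ x y).HasCurvature (cocycle.1.2 x y)
  difference : ∀ (x y z : X) (W : Opens X) (hx : W ≤ c.nhd x) (hy : W ≤ c.nhd y)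
    (hz : W ≤ c.nhd z) (e : (E z).sec W hz),
    (τ x y).app (le_inf hx hy) ((τ y z).app (le_inf hy hz) e)
      = (show (E x).sec W hx from (τ x z).app (le_inf hx hz) e)
        + (E x).inc hx (Form.contract ((E z).anchor hz e)
            (Form.res (le_inf (le_inf hx hy) hz) (cocycle.1.1 x y z)))

section

variable {π : ∀ x, Projection A (E x)} {π' : ∀ x, Projection A (E' x)} {k : ℤ}
  (hO : IsSmooth O) (hA : A.IsTransitive) (hE : ∀ x, (E x).IsAlg k) (hE' : ∀ x, (E' x).IsAlg k)

/-- The isometries `e ↦ (∇(π e), e)` given by the connections. -/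
def TorsorCocycle.isometryCocycle (D : TorsorCocycle c E)
    (hD : ∀ (x y : X) (W : Opens X) (hx : W ≤ c.nhd x) (hy : W ≤ c.nhd y)
      (q : (D.Q x y).alg.sec W (le_inf hx hy)) (e : (E y).sec W hy)
      (w : (D.Q x y).alg.anchor (le_inf hx hy) q = (E y).anchor hy e),
      (π x).app hx ((D.φ x y).map (le_inf hx hy) q e w) = (π y).app hy e) :
    IsometryCocycle π where
  τ x y := Isometry.ofConnection (D.Q x y).courant ((hE y).restrict _) ((hE x).restrict _) hO
    (D.φ x y) (D.conn x y) fun h q e w =>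
      hD x y _ (h.trans inf_le_left) (h.trans inf_le_right) q e w
  cocycle := D.cocycle
  curvature x y := Isometry.ofConnection_hasCurvature _ _ _ _ _ _ _ (D.curvature x y)
  difference x y z W hx hy hz e := by
    have wyz := (D.conn y z).anchor_map (le_inf hy hz) ((E z).anchor hz e)
    have h₁ := ((D.φ y z).anchor_map (le_inf hy hz) _ _ wyz).trans wyz
    have w₂ := ((D.conn x y).anchor_map (le_inf hx hy) ((E z).anchor hz e)).trans
      (wyz.symm.trans ((D.φ y z).anchor_map (le_inf hy hz) _ _ wyz).symm)
    refine Eq.trans ?_ (D.difference x y z W hx hy hz ((E z).anchor hz e) e wyz w₂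
      ((D.conn x z).anchor_map (le_inf hx hz) _))
    exact Isometry.ofConnection_app _ _ _ _ _ _ _ _ _ _ w₂ (congrArg _ h₁.symm)


namespace IsometryCocycle

include hO hA hE in
/-- Isometries `τ_{xy}` determine a cocycle. -/
theorem exists_of_isometries
    (τ : ∀ x y, Isometry ((π y).restrict (inf_le_right : c.nhd x ⊓ c.nhd y ≤ c.nhd y))
      ((π x).restrict (inf_le_left : c.nhd x ⊓ c.nhd y ≤ c.nhd x))) :
    Nonempty (IsometryCocycle π) := by
  have hs : ∀ x, (E x).AnchorSurj := fun x => (π x).anchorSurj hA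
  have inj : ∀ (x : X) {W : Opens X} (h : W ≤ c.nhd x), Function.Injective ((E x).inc h) :=
    fun x {W} h => (hE x).inc_injective hO (hs x) h
  choose H hH using fun x y => (τ x y).exists_hasCurvature hO hA ((hE y).restrict _)
    ((hE x).restrict _)
  have z₁ : ∀ x y z : X, c.nhd x ⊓ c.nhd y ⊓ c.nhd z ≤ c.nhd x ⊓ c.nhd y := fun _ _ _ => inf_le_left
  have z₂ : ∀ x y z : X, c.nhd x ⊓ c.nhd y ⊓ c.nhd z ≤ c.nhd y ⊓ c.nhd z := fun _ _ _ =>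
    inf_le_inf_right _ inf_le_right
  have z₃ : ∀ x y z : X, c.nhd x ⊓ c.nhd y ⊓ c.nhd z ≤ c.nhd x ⊓ c.nhd z := fun _ _ _ =>
    inf_le_inf_right _ inf_le_left
  let σ : ∀ x y z, Isometry ((π z).restrict ((z₃ x y z).trans inf_le_right))
      ((π x).restrict ((z₃ x y z).trans inf_le_left)) := fun x y z =>
    Isometry.comp (E' := (E y).restrict ((z₁ x y z).trans inf_le_right))
      (π' := (π y).restrict ((z₁ x y z).trans inf_le_right))
      ((τ y z).restrict (z₂ x y z)) ((τ x y).restrict (z₁ x y z))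
  have hσ : ∀ x y z, (σ x y z).HasCurvature (Form.res (z₂ x y z) (H y z) + Form.res (z₁ x y z) (H x y)) :=
    fun x y z => Isometry.HasCurvature.comp (Isometry.HasCurvature.restrict (hH y z) (z₂ x y z))
      (Isometry.HasCurvature.restrict (hH x y) (z₁ x y z))
  choose B hB using fun x y z => (σ x y z).exists_differ hO hA ((hE z).restrict _)
    ((hE x).restrict _) ((τ x z).restrict (z₃ x y z))
  have diff : ∀ (x y z : X) (W : Opens X) (hx : W ≤ c.nhd x) (hy : W ≤ c.nhd y)
      (hz : W ≤ c.nhd z) (e : (E z).sec W hz),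
      (τ x y).app (le_inf hx hy) ((τ y z).app (le_inf hy hz) e)
        = (show (E x).sec W hx from (τ x z).app (le_inf hx hz) e)
          + (E x).inc hx (Form.contract ((E z).anchor hz e)
            (Form.res (le_inf (le_inf hx hy) hz) (B x y z))) :=
    fun x y z W hx hy hz e => hB x y z (le_inf (le_inf hx hy) hz) e
  refine ⟨⟨τ, ⟨(B, H), fun x y z t V hx hy hz ht ξ => ?_, fun x y z V hx hy hz ξ η ζ => ?_,
    fun x y => Isometry.HasCurvature.isClosed hO hA ((hE y).restrict _) ((hE x).restrict _)
      (hH x y)⟩, hH, diff⟩⟩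
  · -- Both sides of the cocycle identity compare `τ_{xy} τ_{yz} τ_{zt}` with `τ_{xt}`.
    have key : Form.res (le_inf (le_inf hy hz) ht) (B y z t)
          + Form.res (le_inf (le_inf hx hy) ht) (B x y t)
        = Form.res (le_inf (le_inf hx hz) ht) (B x z t)
          + Form.res (le_inf (le_inf hx hy) hz) (B x y z) := by
      refine Form.eq_of_inc_contract hO (hs t) (hE x) (hs x) ht hx _ _ fun V' i e => ?_
      have e₁ := diff x y z V' (i.trans hx) (i.trans hy) (i.trans hz)
        ((τ z t).app (le_inf (i.trans hz) (i.trans ht)) e)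
      rw [diff y z t V' (i.trans hy) (i.trans hz) (i.trans ht) e,
        diff x z t V' (i.trans hx) (i.trans hz) (i.trans ht) e] at e₁
      have e₂ := ((τ x y).app (le_inf (i.trans hx) (i.trans hy))).map_add
        ((τ y t).app (le_inf (i.trans hy) (i.trans ht)) e)
        ((E y).inc (i.trans hy) (Form.contract ((E t).anchor (i.trans ht) e)
            (Form.res (i.trans (le_inf (le_inf hy hz) ht)) (B y z t))))
      have e₃ := (τ x y).app_inc (le_inf (i.trans hx) (i.trans hy))
        (Form.contract ((E t).anchor (i.trans ht) e)
            (Form.res (i.trans (le_inf (le_inf hy hz) ht)) (B y z t)))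
      rw [show (E z).anchor (i.trans hz) ((τ z t).app (le_inf (i.trans hz) (i.trans ht)) e)
        = (E t).anchor (i.trans ht) e from (τ z t).anchor_app _ e] at e₁
      have e₄ := ((congrArg₂ (· + ·) (diff x y t V' (i.trans hx) (i.trans hy) (i.trans ht) e)
        e₃).symm.trans e₂.symm).trans e₁
      rw [Form.contract_res_add, Form.contract_res_add, map_add, map_add]
      refine (add_comm _ _).trans (add_left_cancel
        (a := (show (E x).sec V' _ from (τ x t).app (le_inf (i.trans hx) (i.trans ht)) e)) ?_)
      rw [← add_assoc, ← add_assoc]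
      exact e₄
    have := congrArg (fun B => B.on le_rfl ξ) key
    change (B y z t).on _ ξ + (B x y t).on _ ξ = (B x z t).on _ ξ + (B x y z).on _ ξ at this
    change (B y z t).on _ ξ - (B x z t).on _ ξ + (B x y t).on _ ξ - (B x y z).on _ ξ = 0
    linear_combination this
  · have := Isometry.HasCurvature.differ hO hA ((hE z).restrict _) ((hE x).restrict _)
      (hσ x y z) (Isometry.HasCurvature.restrict (hH x z) (z₃ x y z)) (hB x y z) (le_inf (le_inf hx hy) hz) ξ η ζ
    change (H y z).on _ _ + (H x y).on _ _ = (H x z).on _ _ + (B x y z).d₂ _ _ _ _ at this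
    change (B x y z).d₂ _ _ _ _ = (H y z).on _ _ - (H x z).on _ _ + (H x y).on _ _
    linear_combination -this

/-- The restriction of isometries to a refinement of the cover. -/
abbrev res (D : IsometryCocycle π) {V : X → Opens X} (i : ∀ x, V x ≤ c.nhd x) (x y : X) :
    Isometry ((π y).restrict ((inf_le_right : V x ⊓ V y ≤ V y).trans (i y)))
      ((π x).restrict ((inf_le_left : V x ⊓ V y ≤ V x).trans (i x))) :=
  (D.τ x y).restrict (inf_le_inf (i x) (i y))

include hO hA hE hE' in
/-- Families of extensions which are locally isometric have the same class. -/
theorem class_eq {P : InvariantPairing A} (hπ : ∀ x, (π x).Induces P)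
    (hπ' : ∀ x, (π' x).Induces P) (D : IsometryCocycle π) (D' : IsometryCocycle π') :
    H2.mk O D.cocycle = H2.mk O D'.cocycle := by
  choose V k₀ hV ρ' using fun x => Isometry.exists_local (U := c.nhd x ⊓ c'.nhd x)
    (π := (π x).restrict inf_le_left) (π' := (π' x).restrict inf_le_right) hO hA
    ((hE x).restrict _) ((hE' x).restrict _) (fun h => hπ x (h.trans inf_le_left))
    (fun h => hπ' x (h.trans inf_le_right)) (p := x) ⟨c.mem x, c'.mem x⟩
  have i : ∀ x, V x ≤ c.nhd x := fun x => (k₀ x).trans inf_le_left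
  have j : ∀ x, V x ≤ c'.nhd x := fun x => (k₀ x).trans inf_le_right
  let ρ : ∀ x, Isometry ((π x).restrict (i x)) ((π' x).restrict (j x)) := fun x => (ρ' x).some
  let c'' : PointedCover X := ⟨V, hV⟩
  choose η hη using fun x => (ρ x).exists_hasCurvature hO hA ((hE x).restrict _)
    ((hE' x).restrict _)
  let σ : ∀ x y, Isometry ((π y).restrict ((inf_le_right : V x ⊓ V y ≤ V y).trans (i y)))
      ((π' x).restrict ((inf_le_left : V x ⊓ V y ≤ V x).trans (j x))) := fun x y =>
    (D.res i x y).comp ((ρ x).restrict inf_le_left)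
  let σ' : ∀ x y, Isometry ((π y).restrict ((inf_le_right : V x ⊓ V y ≤ V y).trans (i y)))
      ((π' x).restrict ((inf_le_left : V x ⊓ V y ≤ V x).trans (j x))) := fun x y =>
    Isometry.comp ((ρ y).restrict inf_le_right) (D'.res j x y)
  have hσ : ∀ x y, (σ x y).HasCurvature
      (Form.res (inf_le_inf (i x) (i y)) (D.cocycle.1.2 x y) + Form.res inf_le_left (η x)) :=
    fun x y => Isometry.HasCurvature.comp (Isometry.HasCurvature.restrict (D.curvature x y) _)
      (Isometry.HasCurvature.restrict (hη x) _)
  have hσ' : ∀ x y, (σ' x y).HasCurvature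
      (Form.res inf_le_right (η y) + Form.res (inf_le_inf (j x) (j y)) (D'.cocycle.1.2 x y)) :=
    fun x y => Isometry.HasCurvature.comp (Isometry.HasCurvature.restrict (hη y) _)
      (Isometry.HasCurvature.restrict (D'.curvature x y) _)
  choose β hβ using fun x y => (σ x y).exists_differ hO hA ((hE y).restrict _)
    ((hE' x).restrict _) (σ' x y)
  refine H2.mk_eq_mk (c'' := c'') i j D.cocycle D'.cocycle ⟨β, η, fun x =>
    Isometry.HasCurvature.isClosed hO hA ((hE x).restrict _) ((hE' x).restrict _) (hη x),
    fun x y z W hx hy hz ξ => ?_, fun x y W hx hy ξ₀ ξ₁ ξ₂ => ?_⟩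
  · -- Both sides compare `ρ_x τ_{xy} τ_{yz}` with `τ'_{xz} ρ_z`.
    have key : Form.res (le_inf hx hz) (β x z)
          + Form.res (le_inf (le_inf (hx.trans (i x)) (hy.trans (i y))) (hz.trans (i z)))
            (D.cocycle.1.1 x y z)
        = Form.res (le_inf hy hz) (β y z) + Form.res (le_inf hx hy) (β x y)
          + Form.res (le_inf (le_inf (hx.trans (j x)) (hy.trans (j y))) (hz.trans (j z)))
            (D'.cocycle.1.1 x y z) := by
      refine Form.eq_of_inc_contract hO ((π z).anchorSurj hA) (hE' x) ((π' x).anchorSurj hA)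
        (hz.trans (i z)) (hx.trans (j x)) _ _ fun V' l e => ?_
      have lx := l.trans hx
      have ly := l.trans hy
      have lz := l.trans hz
      have hDxyz := D.difference x y z V' (lx.trans (i x)) (ly.trans (i y)) (lz.trans (i z)) e
      have hDxyz' := D'.difference x y z V' (lx.trans (j x)) (ly.trans (j y)) (lz.trans (j z))
        ((ρ z).app lz e)
      rw [show (E' z).anchor (lz.trans (j z)) ((ρ z).app lz e) = (E z).anchor (lz.trans (i z)) e
        from (ρ z).anchor_app lz e] at hDxyz'
      have b : ∀ (x y : X) (lx : V' ≤ V x) (ly : V' ≤ V y) (e : (E y).sec V' (ly.trans (i y))),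
          (ρ x).app lx ((D.τ x y).app (le_inf (lx.trans (i x)) (ly.trans (i y))) e)
            = (show (E' x).sec V' (lx.trans (j x)) from
                (D'.τ x y).app (le_inf (lx.trans (j x)) (ly.trans (j y))) ((ρ y).app ly e))
              + (E' x).inc (lx.trans (j x)) (Form.contract ((E y).anchor (ly.trans (i y)) e)
                (Form.res (le_inf lx ly) (β x y))) := fun x y lx ly e => hβ x y (le_inf lx ly) e
      have b₁ := b x y lx ly ((D.τ y z).app (le_inf (ly.trans (i y)) (lz.trans (i z))) e)
      rw [show (E y).anchor (ly.trans (i y))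
          ((D.τ y z).app (le_inf (ly.trans (i y)) (lz.trans (i z))) e)
        = (E z).anchor (lz.trans (i z)) e from (D.τ y z).anchor_app _ e, b y z ly lz e] at b₁
      have b₂ := ((D'.τ x y).app (le_inf (lx.trans (j x)) (ly.trans (j y)))).map_add
        ((D'.τ y z).app (le_inf (ly.trans (j y)) (lz.trans (j z))) ((ρ z).app lz e))
        ((E' y).inc (ly.trans (j y)) (Form.contract ((E z).anchor (lz.trans (i z)) e)
            (Form.res (le_inf ly lz) (β y z))))
      have b₃ := (D'.τ x y).app_inc (le_inf (lx.trans (j x)) (ly.trans (j y)))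
        (Form.contract ((E z).anchor (lz.trans (i z)) e) (Form.res (le_inf ly lz) (β y z)))
      have b₄ := b₂.trans (congrArg₂ (· + ·) hDxyz' b₃)
      have b₅ := ((ρ x).app lx).map_add
        (show (E x).sec V' (lx.trans (i x)) from
          (D.τ x z).app (le_inf (lx.trans (i x)) (lz.trans (i z))) e)
        ((E x).inc (lx.trans (i x)) (Form.contract ((E z).anchor (lz.trans (i z)) e) (Form.res
          (le_inf (le_inf (lx.trans (i x)) (ly.trans (i y))) (lz.trans (i z))) (D.cocycle.1.1 x y z))))
      have b₆ := b₅.trans (congrArg₂ (· + ·) (b x z lx lz e) ((ρ x).app_inc lx _))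
      have b₇ := (b₆.symm.trans (congrArg ((ρ x).app lx) hDxyz.symm)).trans (b₁.trans
        (congrArg (· + (E' x).inc (lx.trans (j x)) (Form.contract ((E z).anchor (lz.trans (i z)) e)
          (Form.res (le_inf lx ly) (β x y)))) b₄))
      rw [Form.contract_res_add, Form.contract_res_add, Form.contract_res_add, map_add, map_add,
        map_add]
      refine add_left_cancel (a := (show (E' x).sec V' (lx.trans (j x)) from
        (D'.τ x z).app (le_inf (lx.trans (j x)) (lz.trans (j z))) ((ρ z).app lz e))) ?_
      rw [← add_assoc]
      refine Eq.trans b₇ ?_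
      have comm : ∀ (G : AddCommGroup ((E' x).sec V' (lx.trans (j x)))) (t a b c :
          (E' x).sec V' (lx.trans (j x))), t + a + b + c = t + (b + c + a) := fun _ t a b c => by abel
      exact comm _ _ _ _ _
    have := congrArg (fun B => B.on le_rfl ξ) key
    change (β x z).on _ ξ + (D.cocycle.1.1 x y z).on _ ξ = (β y z).on _ ξ + (β x y).on _ ξ
      + (D'.cocycle.1.1 x y z).on _ ξ at this
    change (D.cocycle.1.1 x y z).on _ ξ - (D'.cocycle.1.1 x y z).on _ ξ
      = (β y z).on _ ξ - (β x z).on _ ξ + (β x y).on _ ξ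
    linear_combination this
  · have := Isometry.HasCurvature.differ hO hA ((hE y).restrict _) ((hE' x).restrict _)
      (hσ x y) (hσ' x y) (hβ x y) (le_inf hx hy) ξ₀ ξ₁ ξ₂
    change (D.cocycle.1.2 x y).on _ _ + (η x).on _ _ = (η y).on _ _ + (D'.cocycle.1.2 x y).on _ _
      + (β x y).d₂ _ _ _ _ at this
    change (D.cocycle.1.2 x y).on _ _ - (D'.cocycle.1.2 x y).on _ _ = (β x y).d₂ _ _ _ _
      + ((η y).on _ _ - (η x).on _ _)
    linear_combination this

end IsometryCocycle

end

end

section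

variable {O : StructureSheaf X} {U : Opens X}

/-! ### Split algebroids `T ⊕ Ω¹` -/

namespace Form

variable {W : Opens X}

@[simp] theorem lie_neg (ξ : VF O W) (α : Form O 1 W) : lie ξ (-α) = -lie ξ α :=
  ext₁ fun V i η => by simp only [map_neg, res_lie, neg_ev, ev_lie]; ring

@[simp] theorem lie_sub (ξ : VF O W) (α β : Form O 1 W) : lie ξ (α - β) = lie ξ α - lie ξ β := by
  rw [sub_eq_add_neg, lie_add, lie_neg, sub_eq_add_neg]

end Form

variable (O U) in
/-- The sheaf `T ⊕ Ω¹`. -/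
def splitSheaf : SheafOn U where
  sec W _ := VF O W × Form O 1 W
  res _ i := (VF.res i).prodMap (Form.res i)
  res_self _ _ := rfl
  res_res _ _ _ _ := rfl
  existsUnique_gluing V h s hs := by
    obtain ⟨ξ, hξ, hξ'⟩ := VF.existsUnique_gluing V (fun a => (s a).1)
      (fun a b => congrArg Prod.fst (hs a b))
    obtain ⟨α, hα, hα'⟩ := Form.existsUnique_gluing V (fun a => (s a).2)
      (fun a b => congrArg Prod.snd (hs a b))
    refine ⟨(ξ, α), fun a => Prod.ext (hξ a) (hα a), fun y hy => ?_⟩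
    exact Prod.ext (hξ' _ fun a => congrArg Prod.fst (hy a))
      (hα' _ fun a => congrArg Prod.snd (hy a))

variable (O U) in
/-- Correction terms which deform the standard structure of `T ⊕ Ω¹`. -/
structure Twist where
  /-- the correction of the action -/
  γ : ∀ {W : Opens X} (_ : W ≤ U), Fn O W →ₗ[ℂ] VF O W →ₗ[ℂ] Form O 1 W
  /-- the correction of the pairing -/
  p : ∀ {W : Opens X} (_ : W ≤ U), VF O W →ₗ[ℂ] VF O W →ₗ[ℂ] Fn O W
  /-- the correction of the bracket -/
  c : ∀ {W : Opens X} (_ : W ≤ U), VF O W →ₗ[ℂ] VF O W →ₗ[ℂ] Form O 1 W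
  res_γ : ∀ {W V : Opens X} (h : W ≤ U) (i : V ≤ W) (f : Fn O W) (ξ : VF O W),
    Form.res i (γ h f ξ) = γ (i.trans h) (resFn O i f) (VF.res i ξ)
  res_p : ∀ {W V : Opens X} (h : W ≤ U) (i : V ≤ W) (ξ η : VF O W),
    resFn O i (p h ξ η) = p (i.trans h) (VF.res i ξ) (VF.res i η)
  res_c : ∀ {W V : Opens X} (h : W ≤ U) (i : V ≤ W) (ξ η : VF O W),
    Form.res i (c h ξ η) = c (i.trans h) (VF.res i ξ) (VF.res i η)

/-- The conditions under which a twist defines an algebroid of level `k`. -/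
structure Twist.IsLevel (k : ℤ) (T : Twist O U) : Prop where
  one_γ : ∀ {W : Opens X} (h : W ≤ U) (ξ : VF O W), T.γ h 1 ξ = 0
  γ_mul : ∀ {W : Opens X} (h : W ≤ U) (f g : Fn O W) (ξ : VF O W),
    f • T.γ h g ξ + T.γ h f (g • ξ)
      = T.γ h (f * g) ξ + k • (ξ.app f • Form.d g + ξ.app g • Form.d f)
  p_symm : ∀ {W : Opens X} (h : W ≤ U) (ξ η : VF O W), T.p h ξ η = T.p h η ξ
  p_smul : ∀ {W : Opens X} (h : W ≤ U) (f : Fn O W) (ξ η : VF O W),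
    T.p h (f • ξ) η + Form.ev (T.γ h f ξ) η = f * T.p h ξ η - k • ξ.app (η.app f)
  c_symm : ∀ {W : Opens X} (h : W ≤ U) (ξ η : VF O W),
    T.c h ξ η + T.c h η ξ = Form.d (T.p h ξ η)
  c_smul : ∀ {W : Opens X} (h : W ≤ U) (f : Fn O W) (ξ η : VF O W),
    T.c h ξ (f • η) + Form.lie ξ (T.γ h f η)
      = f • T.c h ξ η + T.γ h (ξ.app f) η + T.γ h f ⁅ξ, η⁆
  p_invariant : ∀ {W : Opens X} (h : W ≤ U) (ξ η ζ : VF O W),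
    ξ.app (T.p h η ζ) = Form.ev (T.c h ξ η) ζ + Form.ev (T.c h ξ ζ) η
      + T.p h ⁅ξ, η⁆ ζ + T.p h η ⁅ξ, ζ⁆
  jacobi : ∀ {W : Opens X} (h : W ≤ U) (ξ η ζ : VF O W),
    Form.lie ξ (T.c h η ζ) + T.c h ξ ⁅η, ζ⁆
      = Form.lie η (T.c h ξ ζ) + T.c h η ⁅ξ, ζ⁆ + T.c h ⁅ξ, η⁆ ζ - Form.lie ζ (T.c h ξ η)
        + Form.d (Form.ev (T.c h ξ η) ζ)

namespace Twist

variable (T : Twist O U)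

/-- The action `f * (ξ, α) = (f ξ, f α + γ(f, ξ))`. -/
def act {W : Opens X} (h : W ≤ U) :
    Fn O W →ₗ[ℂ] (VF O W × Form O 1 W) →ₗ[ℂ] (VF O W × Form O 1 W) :=
  LinearMap.mk₂ ℂ (fun f v => (f • v.1, f • v.2 + T.γ h f v.1))
    (fun f g v => Prod.ext (add_smul f g v.1) (by
      simp only [Prod.snd_add, map_add, LinearMap.add_apply, add_smul]; abel))
    (fun a f v => Prod.ext (smul_assoc a f v.1) (by
      simp only [Prod.smul_snd, map_smul, LinearMap.smul_apply, smul_assoc, smul_add]))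
    (fun f v w => Prod.ext (smul_add f v.1 w.1) (by
      simp only [Prod.snd_add, Prod.fst_add, map_add, smul_add]; abel))
    (fun a f v => Prod.ext (smul_algebra_smul_comm a f v.1) (by
      simp only [Prod.smul_snd, Prod.smul_fst, map_smul, smul_add, smul_algebra_smul_comm]))

/-- The bracket `[(ξ, α), (η, β)] = ([ξ, η], L_ξ β - L_η α + d(α(η)) + c(ξ, η))`. -/
def bracket {W : Opens X} (h : W ≤ U) :
    (VF O W × Form O 1 W) →ₗ[ℂ] (VF O W × Form O 1 W) →ₗ[ℂ] (VF O W × Form O 1 W) :=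
  LinearMap.mk₂ ℂ (fun v w => (⁅v.1, w.1⁆, Form.lie v.1 w.2 - Form.lie w.1 v.2
      + Form.d (Form.ev v.2 w.1) + T.c h v.1 w.1))
    (fun f g v => Prod.ext (VF.add_bracket _ _ _) (by
      simp only [Prod.snd_add, Prod.fst_add, Form.lie_add, Form.add_lie, Form.add_ev, Form.d_add,
        map_add, LinearMap.add_apply]; abel))
    (fun a f v => Prod.ext (VF.csmul_bracket _ _ _) (by
      simp only [Prod.smul_snd, Prod.smul_fst, Form.lie_csmul, Form.csmul_lie, Form.csmul_ev,
        Form.d_csmul, map_smul, LinearMap.smul_apply, smul_add, smul_sub]))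
    (fun f v w => Prod.ext (VF.bracket_add _ _ _) (by
      simp only [Prod.snd_add, Prod.fst_add, Form.lie_add, Form.add_lie, Form.ev_add, Form.d_add,
        map_add]; abel))
    (fun a f v => Prod.ext (VF.bracket_csmul _ _ _) (by
      simp only [Prod.smul_snd, Prod.smul_fst, Form.lie_csmul, Form.csmul_lie, Form.ev_csmul,
        Form.d_csmul, map_smul, smul_add, smul_sub]))

/-- The pairing `⟨(ξ, α), (η, β)⟩ = α(η) + β(ξ) + p(ξ, η)`. -/
def pairing {W : Opens X} (h : W ≤ U) :
    (VF O W × Form O 1 W) →ₗ[ℂ] (VF O W × Form O 1 W) →ₗ[ℂ] Fn O W :=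
  LinearMap.mk₂ ℂ (fun v w => Form.ev v.2 w.1 + Form.ev w.2 v.1 + T.p h v.1 w.1)
    (fun f g v => by
      simp only [Prod.snd_add, Prod.fst_add, Form.add_ev, Form.ev_add, map_add,
        LinearMap.add_apply]; abel)
    (fun a f v => by
      simp only [Prod.smul_snd, Prod.smul_fst, Form.csmul_ev, Form.ev_csmul, map_smul,
        LinearMap.smul_apply, smul_add])
    (fun f v w => by
      simp only [Prod.snd_add, Prod.fst_add, Form.add_ev, Form.ev_add, map_add]; abel)
    (fun a f v => by
      simp only [Prod.smul_snd, Prod.smul_fst, Form.csmul_ev, Form.ev_csmul, map_smul, smul_add])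

/-- The algebroid `T ⊕ Ω¹` with these operations. -/
def algebroid : Algebroid O U where
  toSheafOn := splitSheaf O U
  act {W} h := T.act h
  bracket {W} h := T.bracket h
  anchor {W} h := LinearMap.fst ℂ (VF O W) (Form O 1 W)
  pairing {W} h := T.pairing h
  der {W} h := (LinearMap.inr ℂ (VF O W) (Form O 1 W)).comp Form.dₗ
  inc {W} h := LinearMap.inr ℂ (VF O W) (Form O 1 W)
  res_act h i f v := Prod.ext (VF.res_smul i f v.1) (by
    change Form.res i (f • v.2 + T.γ h f v.1) = resFn O i f • Form.res i v.2 + _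
    rw [map_add, Form.res_smul, T.res_γ]; rfl)
  res_bracket {W V} h i v w := Prod.ext (VF.res_bracket i v.1 w.1) (by
    change Form.res i (Form.lie v.1 w.2 - Form.lie w.1 v.2 + Form.d (Form.ev v.2 w.1)
      + T.c h v.1 w.1) = Form.lie (VF.res i v.1) (Form.res i w.2) - Form.lie (VF.res i w.1)
        (Form.res i v.2) + Form.d (Form.ev (Form.res i v.2) (VF.res i w.1)) + T.c _ (VF.res i v.1) (VF.res i w.1)
    rw [map_add, map_add, map_sub, Form.res_lie, Form.res_lie, Form.res_d, Form.res_ev, T.res_c])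
  res_anchor h i v := rfl
  res_pairing {W V} h i v w := by
    change resFn O i (Form.ev v.2 w.1 + Form.ev w.2 v.1 + T.p h v.1 w.1) =
      Form.ev (Form.res i v.2) (VF.res i w.1) + Form.ev (Form.res i w.2) (VF.res i v.1)
        + T.p _ (VF.res i v.1) (VF.res i w.1)
    rw [map_add, map_add, Form.res_ev, Form.res_ev, T.res_p]
  res_der h i f := Prod.ext (map_zero (VF.res i)) (Form.res_d i f)
  res_inc h i α := Prod.ext (map_zero (VF.res i)) rfl

variable {T}

/-- Terms in `Ω¹` satisfy the identities of the untwisted `T ⊕ Ω¹` by Cartan calculus; what is left in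
each of the identities is one of the conditions on `γ`, `p` and `c`. -/
theorem IsLevel.isAlg {k : ℤ} (hT : T.IsLevel k) : T.algebroid.IsAlg k where
  one_act {W} h v := Prod.ext (one_smul (Fn O W) v.1) (by
    change (1 : Fn O W) • v.2 + T.γ h 1 v.1 = v.2
    rw [hT.one_γ, add_zero, one_smul])
  act_act {W} h f g v := Prod.ext (by
      change f • g • v.1 = (f * g) • v.1 + k • ((v.1.app f) • (0 : VF O W) + v.1.app g • (0 : VF O W))
      rw [smul_zero, smul_zero, add_zero, smul_zero, add_zero, mul_smul]) (by
    change f • (g • v.2 + T.γ h g v.1) + T.γ h f (g • v.1) = (f * g) • v.2 + T.γ h (f * g) v.1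
      + k • ((v.1.app f • Form.d g + T.γ h (v.1.app f) 0)
        + (v.1.app g • Form.d f + T.γ h (v.1.app g) 0))
    rw [map_zero, map_zero, add_zero, add_zero, smul_add, mul_smul, add_assoc, add_assoc,
      hT.γ_mul])
  jacobi {W} h a b c := Prod.ext (VF.jacobi _ _ _) (by
    obtain ⟨ξ, α⟩ := a
    obtain ⟨η, β⟩ := b
    obtain ⟨ζ, γ⟩ := c
    change Form.lie ξ (Form.lie η γ - Form.lie ζ β + Form.d (Form.ev β ζ) + T.c h η ζ)
        - Form.lie ⁅η, ζ⁆ α + Form.d (Form.ev α ⁅η, ζ⁆) + T.c h ξ ⁅η, ζ⁆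
      = Form.lie ⁅ξ, η⁆ γ - Form.lie ζ (Form.lie ξ β - Form.lie η α + Form.d (Form.ev α η)
          + T.c h ξ η) + Form.d (Form.ev (Form.lie ξ β - Form.lie η α + Form.d (Form.ev α η)
          + T.c h ξ η) ζ) + T.c h ⁅ξ, η⁆ ζ
        + (Form.lie η (Form.lie ξ γ - Form.lie ζ α + Form.d (Form.ev α ζ) + T.c h ξ ζ)
          - Form.lie ⁅ξ, ζ⁆ β + Form.d (Form.ev β ⁅ξ, ζ⁆) + T.c h η ⁅ξ, ζ⁆)
    have J := hT.jacobi h ξ η ζ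
    have l₁ := Form.lie_lie ξ η γ
    have l₂ := Form.lie_lie ξ ζ β
    have l₃ := Form.lie_lie η ζ α
    simp only [Form.lie_add, Form.lie_sub, Form.lie_d, Form.add_ev, Form.sub_ev, Form.ev_lie,
      Form.ev_d, Form.d_add, Form.d_sub]
    rw [l₁, l₂, l₃, ← sub_eq_zero]
    rw [← sub_eq_zero] at J
    refine Eq.trans ?_ J
    abel)
  anchor_bracket h v w := rfl
  pairing_symm {W} h v w := by
    change Form.ev v.2 w.1 + Form.ev w.2 v.1 + T.p h v.1 w.1
      = Form.ev w.2 v.1 + Form.ev v.2 w.1 + T.p h w.1 v.1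
    rw [hT.p_symm, add_comm (Form.ev v.2 w.1)]
  anchor_der h f := rfl
  bracket_act {W} h v w f := Prod.ext (VF.bracket_smul _ _ _) (by
    obtain ⟨ξ, α⟩ := v
    obtain ⟨η, β⟩ := w
    change Form.lie ξ (f • β + T.γ h f η) - Form.lie (f • η) α + Form.d (Form.ev α (f • η))
        + T.c h ξ (f • η)
      = ξ.app f • β + T.γ h (ξ.app f) η + (f • (Form.lie ξ β - Form.lie η α
        + Form.d (Form.ev α η) + T.c h ξ η) + T.γ h f ⁅ξ, η⁆)
    have J := hT.c_smul h f ξ η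
    rw [← sub_eq_zero] at J ⊢
    refine Eq.trans ?_ J
    simp only [Form.lie_add, Form.lie_smul, Form.smul_lie, Form.ev_smul, Form.d_mul, smul_add,
      smul_sub]
    abel)
  bracket_symm {W} h v w := Prod.ext (by
      change ⁅v.1, w.1⁆ + ⁅w.1, v.1⁆ = 0
      rw [VF.bracket_skew v.1 w.1, add_neg_cancel]) (by
    change Form.lie v.1 w.2 - Form.lie w.1 v.2 + Form.d (Form.ev v.2 w.1) + T.c h v.1 w.1
        + (Form.lie w.1 v.2 - Form.lie v.1 w.2 + Form.d (Form.ev w.2 v.1) + T.c h w.1 v.1)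
      = Form.d (Form.ev v.2 w.1 + Form.ev w.2 v.1 + T.p h v.1 w.1)
    rw [Form.d_add, Form.d_add, ← hT.c_symm]
    abel)
  anchor_act h f v := rfl
  pairing_act {W} h f v w := by
    change Form.ev (f • v.2 + T.γ h f v.1) w.1 + Form.ev w.2 (f • v.1) + T.p h (f • v.1) w.1
      = f * (Form.ev v.2 w.1 + Form.ev w.2 v.1 + T.p h v.1 w.1) - k • v.1.app (w.1.app f)
    have J := hT.p_smul h f v.1 w.1
    rw [Form.add_ev, Form.smul_ev, Form.ev_smul]
    linear_combination J
  pairing_invariant {W} h v w w' := by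
    obtain ⟨ξ, α⟩ := v
    obtain ⟨η, β⟩ := w
    obtain ⟨ζ, γ⟩ := w'
    change ξ.app (Form.ev β ζ + Form.ev γ η + T.p h η ζ)
      = Form.ev (Form.lie ξ β - Form.lie η α + Form.d (Form.ev α η) + T.c h ξ η) ζ
          + Form.ev γ ⁅ξ, η⁆ + T.p h ⁅ξ, η⁆ ζ
        + (Form.ev β ⁅ξ, ζ⁆ + Form.ev (Form.lie ξ γ - Form.lie ζ α + Form.d (Form.ev α ζ)
          + T.c h ξ ζ) η + T.p h η ⁅ξ, ζ⁆)
    have J := hT.p_invariant h ξ η ζ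
    rw [map_add, map_add, J]
    simp only [Form.add_ev, Form.sub_ev, Form.ev_lie, Form.ev_d]
    rw [VF.bracket_skew η ζ, Form.ev_neg]
    ring
  der_mul {W} h f g := Prod.ext (by
      change (0 : VF O W) = f • (0 : VF O W) + g • (0 : VF O W)
      rw [smul_zero, smul_zero, add_zero]) (by
    change Form.d (f * g) = f • Form.d g + T.γ h f 0 + (g • Form.d f + T.γ h g 0)
    rw [map_zero, map_zero, add_zero, add_zero, Form.d_mul])
  bracket_der {W} h v f := Prod.ext (VF.bracket_zero _) (by
    change Form.lie v.1 (Form.d f) - Form.lie 0 v.2 + Form.d (Form.ev v.2 0) + T.c h v.1 0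
      = Form.d (v.1.app f)
    have l0 : Form.lie (0 : VF O W) v.2 = 0 := by
      have := Form.csmul_lie (0 : ℂ) (0 : VF O W) v.2
      rwa [zero_smul, zero_smul] at this
    have d0 : Form.d (0 : Fn O W) = 0 := map_zero (Form.dₗ (O := O) (W := W))
    rw [l0, Form.ev_zero, d0, map_zero, Form.lie_d, sub_zero, add_zero, add_zero])
  pairing_der {W} h v f := by
    change Form.ev v.2 0 + Form.ev (Form.d f) v.1 + T.p h v.1 0 = v.1.app f
    rw [Form.ev_zero, map_zero, Form.ev_d, zero_add, add_zero]
  inc_act {W} h f α := Prod.ext (smul_zero f).symm (by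
    change f • α = f • α + T.γ h f 0
    rw [map_zero, add_zero])
  inc_d h f := rfl

theorem IsLevel.isExact {k : ℤ} (hO : IsSmooth O) (hT : T.IsLevel k) : T.algebroid.IsExact :=
  Algebroid.isExact_of_ker hO hT.isAlg
    (fun {W} _ ξ _ hp => ⟨W, le_rfl, hp, (ξ, 0), rfl⟩)
    (fun {W} _ e he _ hp => ⟨W, le_rfl, hp, e.2, Prod.ext he rfl⟩)

end Twist

end

section

variable {O : StructureSheaf X} {U : Opens X}

/-! ### The exact Courant algebroid with a given curvature -/

namespace Form

/-- The bilinear map `(ξ, η) ↦ H(ξ, η, ·)`. -/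
def contract₂ {W : Opens X} (H : Form O 3 W) : VF O W →ₗ[ℂ] VF O W →ₗ[ℂ] Form O 1 W :=
  LinearMap.mk₂ ℂ (fun ξ η => contract η (contract ξ H))
    (fun ξ ξ' η => ext₁ fun V i ζ => by
      simp only [map_add, res_contract, add_ev, ev_contract_contract, ev₃_add_left])
    (fun a ξ η => ext₁ fun V i ζ => by
      simp only [map_smul, csmul_ev, res_contract, ev_contract_contract,
        ← smul_one_smul (Fn O V) a (VF.res i ξ), ev₃_smul_left, smul_mul_assoc, one_mul])
    (fun ξ η η' => ext₁ fun V i ζ => by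
      simp only [map_add, res_contract, add_ev, ev_contract_contract, ev₃_add_mid])
    (fun a ξ η => ext₁ fun V i ζ => by
      simp only [map_smul, csmul_ev, res_contract, ev_contract_contract,
        ← smul_one_smul (Fn O V) a (VF.res i η), ev₃_smul_mid, smul_mul_assoc, one_mul])

@[simp] theorem ev_contract₂ {W : Opens X} (H : Form O 3 W) (ξ η ζ : VF O W) :
    ev (contract₂ H ξ η) ζ = ev₃ H ξ η ζ := ev_contract_contract H ξ η ζ

theorem res_contract₂ {W V : Opens X} (i : V ≤ W) (H : Form O 3 W) (ξ η : VF O W) :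
    res i (contract₂ H ξ η) = contract₂ (res i H) (VF.res i ξ) (VF.res i η) := rfl

end Form

namespace Twist

/-- The twist by the 3-form `H`. -/
def ofForm (H : Form O 3 U) : Twist O U where
  γ _ := 0
  p _ := 0
  c h := Form.contract₂ (Form.res h H)
  res_γ _ _ _ _ := rfl
  res_p _ i _ _ := map_zero (resFn O i)
  res_c h i ξ η := Form.res_contract₂ i (Form.res h H) ξ η

/-- The Jacobi identity of the twist by `H` is the equation `dH = 0`. -/
theorem ofForm_isLevel {H : Form O 3 U} (hH : H.IsClosed) : (ofForm H).IsLevel 0 where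
  one_γ _ _ := rfl
  γ_mul {W} h f g ξ := by
    change f • (0 : Form O 1 W) + 0 = 0 + (0 : ℤ) • _
    rw [smul_zero, zero_smul]
  p_symm _ _ _ := rfl
  p_smul {W} h f ξ η := by
    change (0 : Fn O W) + 0 = f * 0 - (0 : ℤ) • _
    rw [mul_zero, zero_smul, sub_zero, add_zero]
  c_symm {W} h ξ η := by
    change Form.contract₂ (Form.res h H) ξ η + Form.contract₂ (Form.res h H) η ξ
      = Form.dₗ (0 : Fn O W)
    rw [map_zero]
    refine Form.ext₁ fun V i ζ => ?_
    rw [map_add, Form.res_contract₂, Form.res_contract₂, Form.add_ev, Form.ev_contract₂,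
      Form.ev_contract₂, Form.ev₃_skew, neg_add_cancel]
    rfl
  c_smul {W} h f ξ η := by
    change Form.contract₂ (Form.res h H) ξ (f • η) + Form.lie ξ 0
      = f • Form.contract₂ (Form.res h H) ξ η + 0 + 0
    refine Form.ext₁ fun V i ζ => ?_
    simp [Form.res_contract₂, Form.res_smul, VF.res_smul, Form.res_lie]
  p_invariant {W} h ξ η ζ := by
    change ξ.app (0 : Fn O W) = Form.ev (Form.contract₂ (Form.res h H) ξ η) ζ
      + Form.ev (Form.contract₂ (Form.res h H) ξ ζ) η + 0 + 0
    rw [map_zero, Form.ev_contract₂, Form.ev_contract₂, Form.ev₃_skew' _ ξ ζ η]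
    ring
  jacobi {W} h ξ η ζ := by
    let K := Form.res h H
    change Form.lie ξ (Form.contract₂ K η ζ) + Form.contract₂ K ξ ⁅η, ζ⁆
      = Form.lie η (Form.contract₂ K ξ ζ) + Form.contract₂ K η ⁅ξ, ζ⁆ + Form.contract₂ K ⁅ξ, η⁆ ζ
        - Form.lie ζ (Form.contract₂ K ξ η) + Form.d (Form.ev (Form.contract₂ K ξ η) ζ)
    refine Form.ext₁ fun V i ω => ?_
    have J := hH V (i.trans h) (VF.res i ξ) (VF.res i η) (VF.res i ζ) ω
    simp only [Form.d₃, Form.on_eq_ev₃] at J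
    simp only [map_add, map_sub, Form.res_lie, Form.res_contract₂, Form.add_ev, Form.sub_ev,
      Form.ev_lie, Form.ev_contract₂, Form.res_d, Form.ev_d, Form.res_ev₃, VF.res_bracket]
    set L := Form.res (i.trans h) H
    set ξ' := VF.res i ξ
    set η' := VF.res i η
    set ζ' := VF.res i ζ
    have rot : ∀ a b c, Form.ev₃ L a b c = Form.ev₃ L c a b := fun a b c => by
      rw [Form.ev₃_skew' L a b c, Form.ev₃_skew L a c b, neg_neg]
    change ξ'.app (Form.ev₃ L η' ζ' ω) - Form.ev₃ L η' ζ' ⁅ξ', ω⁆ + Form.ev₃ L ξ' ⁅η', ζ'⁆ ω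
      = η'.app (Form.ev₃ L ξ' ζ' ω) - Form.ev₃ L ξ' ζ' ⁅η', ω⁆ + Form.ev₃ L η' ⁅ξ', ζ'⁆ ω
        + Form.ev₃ L ⁅ξ', η'⁆ ζ' ω - (ζ'.app (Form.ev₃ L ξ' η' ω) - Form.ev₃ L ξ' η' ⁅ζ', ω⁆)
        + ω.app (Form.ev₃ L ξ' η' ζ')
    rw [rot η' ζ' ⁅ξ', ω⁆, rot ξ' ζ' ⁅η', ω⁆, rot ξ' η' ⁅ζ', ω⁆, Form.ev₃_skew L ξ' ⁅η', ζ'⁆ ω,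
      Form.ev₃_skew L η' ⁅ξ', ζ'⁆ ω]
    linear_combination J

end Twist

/-- The exact Courant algebroid `T ⊕ Ω¹` twisted by a closed 3-form. -/
def ECAObj.ofForm (hO : IsSmooth O) (H : Form O 3 U) (hH : H.IsClosed) : ECAObj O U where
  alg := (Twist.ofForm H).algebroid
  courant := (Twist.ofForm_isLevel hH).isAlg.isCourant
  exact := (Twist.ofForm_isLevel hH).isExact hO

/-- The connection `ξ ↦ (ξ, 0)` on a twist of `T ⊕ Ω¹` by a 3-form. -/
def Twist.connection (H : Form O 3 U) : Connection (Twist.ofForm H).algebroid where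
  map {W} _ := LinearMap.inl ℂ (VF O W) (Form O 1 W)
  map_res h i ξ := Prod.ext rfl (map_zero (Form.res i)).symm
  map_smul {W} h f ξ := Prod.ext rfl (by
    change (0 : Form O 1 W) = f • 0 + 0
    rw [smul_zero, add_zero])
  anchor_map _ _ := rfl
  isotropic {W} h ξ η := by
    change Form.ev (0 : Form O 1 W) η + Form.ev (0 : Form O 1 W) ξ + 0 = 0
    rw [Form.zero_ev, Form.zero_ev, add_zero, add_zero]

theorem Twist.connection_hasCurvature (H : Form O 3 U) :
    (Twist.connection H).HasCurvature H := fun {W} h ξ η => Prod.ext (sub_self ⁅ξ, η⁆) (by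
  change Form.lie ξ (0 : Form O 1 W) - Form.lie η 0 + Form.dₗ (Form.ev (0 : Form O 1 W) η)
    + Form.contract₂ (Form.res h H) ξ η - 0 = Form.contract₂ (Form.res h H) ξ η
  have l0 : ∀ ξ : VF O W, Form.lie ξ (0 : Form O 1 W) = 0 := fun ξ => by
    have := Form.lie_csmul (0 : ℂ) ξ (0 : Form O 1 W)
    rwa [zero_smul, zero_smul] at this
  rw [l0, l0, Form.zero_ev, map_zero, sub_zero, add_zero, sub_zero, zero_add])

end

section

variable {O : StructureSheaf X} {U : Opens X}

/-! ### The vertex algebroid of a coordinate system -/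

/-- The derivative of a matrix of functions along a vector field. -/
def VF.mapMatrix {W : Opens X} {n : ℕ} (ω : VF O W) (A : Matrix (Fin n) (Fin n) (Fn O W)) :
    Matrix (Fin n) (Fin n) (Fn O W) := A.map ω.app

namespace VF

variable {W : Opens X} {n : ℕ} (ω : VF O W) (A B : Matrix (Fin n) (Fin n) (Fn O W))

theorem mapMatrix_add : ω.mapMatrix (A + B) = ω.mapMatrix A + ω.mapMatrix B :=
  Matrix.ext fun _ _ => map_add ω.app _ _

theorem mapMatrix_sub : ω.mapMatrix (A - B) = ω.mapMatrix A - ω.mapMatrix B :=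
  Matrix.ext fun _ _ => map_sub ω.app _ _

theorem mapMatrix_mul : ω.mapMatrix (A * B) = ω.mapMatrix A * B + A * ω.mapMatrix B :=
  Matrix.ext fun i j => by
    change ω.app ((A * B) i j) = _
    rw [Matrix.mul_apply, map_sum, Matrix.add_apply, Matrix.mul_apply, Matrix.mul_apply,
      ← Finset.sum_add_distrib]
    refine Finset.sum_congr rfl fun k _ => ?_
    rw [VF.app_mul]
    change _ = ω.app (A i k) * B k j + A i k * ω.app (B k j)
    ring

theorem bracket_mapMatrix (ξ : VF O W) : (⁅ξ, ω⁆ : VF O W).mapMatrix A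
    = ξ.mapMatrix (ω.mapMatrix A) - ω.mapMatrix (ξ.mapMatrix A) :=
  Matrix.ext fun i j => VF.bracket_app ξ ω (A i j)

theorem app_trace : ω.app A.trace = (ω.mapMatrix A).trace := map_sum ω.app _ _

end VF

namespace Coordinates

variable (C : Coordinates O U)

theorem vf_eq (ξ : VF O U) : ξ = ∑ i, ξ.app (C.x i) • C.D i := by
  conv_lhs => rw [C.expand U le_rfl ξ]
  simp only [resFn_self]
  rfl

theorem app_eq (ξ : VF O U) (f : Fn O U) : ξ.app f = ∑ i, ξ.app (C.x i) * (C.D i).app f := by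
  rw [← Form.ev_d, C.vf_eq ξ, Form.ev_sum]
  simp only [Form.ev_smul, Form.ev_d, ← C.vf_eq ξ]

include C in
/-- A 1-form is determined by its values on global vector fields. -/
theorem form_ext {α β : Form O 1 U} (h : ∀ ω, Form.ev α ω = Form.ev β ω) : α = β := by
  rw [C.form_eq α, C.form_eq β]
  exact Finset.sum_congr rfl fun k _ => by rw [h]

theorem D_comm (i j : Fin C.n) (f : Fn O U) :
    (C.D i).app ((C.D j).app f) = (C.D j).app ((C.D i).app f) := by
  have h : (⁅C.D i, C.D j⁆ : VF O U) = 0 := by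
    rw [C.vf_eq ⁅C.D i, C.D j⁆]
    refine Finset.sum_eq_zero fun k _ => ?_
    have : ∀ l m (ξ : VF O U), ξ.app ((C.D l).app (C.x m)) = 0 := fun l m ξ => by
      rw [C.app_D]
      split_ifs
      · exact ξ.app.map_one_eq_zero
      · exact map_zero ξ.app
    rw [VF.bracket_app, this, this, sub_zero, zero_smul]
  rw [← sub_eq_zero, ← VF.bracket_app, h]
  rfl

/-- The Jacobian matrix `(∂_j ξ^i)` of a vector field. -/
def jac (ξ : VF O U) : Matrix (Fin C.n) (Fin C.n) (Fn O U) :=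
  Matrix.of fun i j => (C.D j).app (ξ.app (C.x i))

theorem jac_apply (ξ : VF O U) (i j : Fin C.n) : C.jac ξ i j = (C.D j).app (ξ.app (C.x i)) := rfl

theorem jac_add (ξ η : VF O U) : C.jac (ξ + η) = C.jac ξ + C.jac η :=
  Matrix.ext fun _ j => map_add (C.D j).app _ _

theorem jac_csmul (a : ℂ) (ξ : VF O U) : C.jac (a • ξ) = a • C.jac ξ :=
  Matrix.ext fun i j => (C.D j).app.map_smul a (ξ.app (C.x i))

theorem jac_smul (f : Fn O U) (ξ : VF O U) (i j : Fin C.n) :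
    C.jac (f • ξ) i j = f * C.jac ξ i j + (C.D j).app f * ξ.app (C.x i) := by
  rw [jac_apply, VF.smul_app, VF.app_mul, jac_apply]
  ring

theorem jac_bracket (ξ η : VF O U) : C.jac ⁅ξ, η⁆
    = ξ.mapMatrix (C.jac η) + C.jac η * C.jac ξ - (η.mapMatrix (C.jac ξ) + C.jac ξ * C.jac η) := by
  have key : ∀ (ξ η : VF O U) (i j : Fin C.n), (C.D j).app (ξ.app (η.app (C.x i)))
      = (ξ.mapMatrix (C.jac η) + C.jac η * C.jac ξ) i j := fun ξ η i j => by
    rw [C.app_eq ξ, map_sum, Matrix.add_apply, Matrix.mul_apply]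
    change _ = ξ.app ((C.D j).app (η.app (C.x i))) + _
    rw [C.app_eq ξ ((C.D j).app _), ← Finset.sum_add_distrib]
    refine Finset.sum_congr rfl fun k _ => ?_
    rw [VF.app_mul, C.D_comm k j, jac_apply, jac_apply]
  refine Matrix.ext fun i j => ?_
  rw [jac_apply, VF.bracket_app, map_sub, key, key]
  rfl

/-- The correction of the action. -/
def γ (f : Fn O U) (ξ : VF O U) : Form O 1 U := -∑ k, ξ.app (C.x k) • Form.d ((C.D k).app f)

/-- The correction of the pairing. -/
def p (ξ η : VF O U) : Fn O U := -(C.jac ξ * C.jac η).trace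

/-- The correction of the bracket. -/
def c (ξ η : VF O U) : Form O 1 U := -∑ j, ∑ i, C.jac η j i • Form.d (C.jac ξ i j)

theorem p_eq (ξ η : VF O U) : C.p ξ η = -∑ j, ∑ i, C.jac ξ i j * C.jac η j i := by
  rw [p, Matrix.trace, Finset.sum_comm]
  rfl

theorem p_symm (ξ η : VF O U) : C.p ξ η = C.p η ξ := by
  rw [p, p, Matrix.trace_mul_comm]

theorem ev_c (ξ η ω : VF O U) :
    Form.ev (C.c ξ η) ω = -(C.jac η * ω.mapMatrix (C.jac ξ)).trace := by
  rw [c, Form.neg_ev, Form.sum_ev]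
  refine congrArg _ (Finset.sum_congr rfl fun j _ => ?_)
  rw [Form.sum_ev]
  refine Finset.sum_congr rfl fun i _ => ?_
  rw [Form.smul_ev, Form.ev_d]
  rfl

theorem ev_γ (f : Fn O U) (ξ η : VF O U) :
    Form.ev (C.γ f ξ) η = -∑ k, ξ.app (C.x k) * η.app ((C.D k).app f) := by
  rw [γ, Form.neg_ev, Form.sum_ev]
  refine congrArg _ (Finset.sum_congr rfl fun k _ => ?_)
  rw [Form.smul_ev, Form.ev_d]

theorem γ_mul (f g : Fn O U) (ξ : VF O U) : f • C.γ g ξ + C.γ f (g • ξ)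
    = C.γ (f * g) ξ + (ξ.app f • Form.d g + ξ.app g • Form.d f) := by
  refine C.form_ext fun ω => ?_
  simp only [Form.add_ev, Form.smul_ev, ev_γ, Form.ev_d, VF.smul_app, C.app_eq ξ f, C.app_eq ξ g,
    VF.app_mul, map_add, Finset.mul_sum, Finset.sum_mul, mul_neg, ← Finset.sum_neg_distrib,
    ← Finset.sum_add_distrib]
  refine Finset.sum_congr rfl fun k _ => ?_
  ring

theorem p_smul (f : Fn O U) (ξ η : VF O U) :
    C.p (f • ξ) η + Form.ev (C.γ f ξ) η = f * C.p ξ η - ξ.app (η.app f) := by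
  have h : ξ.app (η.app f) = ∑ j, ∑ i, (C.D j).app f * ξ.app (C.x i) * C.jac η j i
      + ∑ k, ξ.app (C.x k) * η.app ((C.D k).app f) := by
    have h₁ : ∀ j, ξ.app (η.app (C.x j) * (C.D j).app f)
        = ∑ i, (C.D j).app f * ξ.app (C.x i) * C.jac η j i
          + ∑ k, ξ.app (C.x k) * (η.app (C.x j) * (C.D j).app ((C.D k).app f)) := fun j => by
      rw [VF.app_mul, C.app_eq ξ (η.app (C.x j)), C.app_eq ξ ((C.D j).app f), Finset.mul_sum,
        Finset.mul_sum, add_comm]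
      simp only [jac_apply]
      refine congrArg₂ _ (Finset.sum_congr rfl fun i _ => ?_) (Finset.sum_congr rfl fun i _ => ?_)
      · ring
      · rw [C.D_comm j i]
        ring
    rw [C.app_eq η f, map_sum, Finset.sum_congr rfl fun j _ => h₁ j, Finset.sum_add_distrib]
    refine congrArg _ (Finset.sum_comm.trans (Finset.sum_congr rfl fun k _ => ?_))
    rw [C.app_eq η ((C.D k).app f), Finset.mul_sum]
  rw [ev_γ, h, p_eq, p_eq]
  simp only [jac_smul, add_mul, Finset.sum_add_distrib, mul_neg, Finset.mul_sum, mul_assoc]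
  ring

theorem c_symm (ξ η : VF O U) : C.c ξ η + C.c η ξ = Form.d (C.p ξ η) := by
  refine C.form_ext fun ω => ?_
  rw [Form.add_ev, ev_c, ev_c, Form.ev_d, p, map_neg, VF.app_trace, VF.mapMatrix_mul,
    Matrix.trace_add, Matrix.trace_mul_comm (C.jac η)]
  ring

theorem c_smul (f : Fn O U) (ξ η : VF O U) : C.c ξ (f • η) + Form.lie ξ (C.γ f η)
    = f • C.c ξ η + C.γ (ξ.app f) η + C.γ f ⁅ξ, η⁆ := by
  have h₁ : C.c ξ (f • η)
      = f • C.c ξ η - ∑ j, ∑ i, η.app (C.x j) • (C.D i).app f • Form.d (C.jac ξ i j) := by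
    simp only [c, jac_smul, add_smul, Finset.sum_add_distrib, smul_neg, Finset.smul_sum, mul_smul,
      smul_comm ((C.D _).app f) (η.app _), neg_add, sub_eq_add_neg]
  have h₂ : Form.lie ξ (C.γ f η) = -∑ k, ξ.app (η.app (C.x k)) • Form.d ((C.D k).app f)
      - ∑ k, η.app (C.x k) • Form.d (ξ.app ((C.D k).app f)) := by
    have hs : ∀ α : Fin C.n → Form O 1 U, Form.lie ξ (∑ k, α k) = ∑ k, Form.lie ξ (α k) :=
      fun α => map_sum (AddMonoidHom.mk' (Form.lie ξ) (Form.lie_add ξ)) α _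
    simp only [γ, Form.lie_neg, hs, Form.lie_smul, Form.lie_d, Finset.sum_add_distrib, neg_add,
      sub_eq_add_neg]
  have h₃ : C.γ (ξ.app f) η
      = -∑ k, ∑ i, η.app (C.x k) • (C.D i).app f • Form.d (C.jac ξ i k)
        - ∑ i, η.app (ξ.app (C.x i)) • Form.d ((C.D i).app f)
        - ∑ k, η.app (C.x k) • Form.d (ξ.app ((C.D k).app f)) := by
    have e : ∀ k, (C.D k).app (ξ.app f)
        = ∑ i, C.jac ξ i k * (C.D i).app f + ξ.app ((C.D k).app f) := fun k => by
      rw [C.app_eq ξ f, C.app_eq ξ ((C.D k).app f), map_sum, ← Finset.sum_add_distrib]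
      refine Finset.sum_congr rfl fun i _ => ?_
      rw [VF.app_mul, C.D_comm k i, jac_apply]
      ring
    have e' : ∑ i, η.app (ξ.app (C.x i)) • Form.d ((C.D i).app f)
        = ∑ k, ∑ i, η.app (C.x k) • C.jac ξ i k • Form.d ((C.D i).app f) := by
      rw [Finset.sum_comm]
      refine Finset.sum_congr rfl fun i _ => ?_
      rw [C.app_eq η, Finset.sum_smul]
      exact Finset.sum_congr rfl fun k _ => mul_smul _ _ _
    simp only [γ, e, e', Form.d_add, Form.d_sum, Form.d_mul, smul_add, Finset.smul_sum,
      Finset.sum_add_distrib]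
    abel
  have h₄ : C.γ f ⁅ξ, η⁆ = ∑ i, η.app (ξ.app (C.x i)) • Form.d ((C.D i).app f)
      - ∑ k, ξ.app (η.app (C.x k)) • Form.d ((C.D k).app f) := by
    simp only [γ, VF.bracket_app, sub_smul, Finset.sum_sub_distrib, neg_sub]
  rw [h₁, h₂, h₃, h₄]
  abel

theorem p_invariant (ξ η ζ : VF O U) : ξ.app (C.p η ζ) = Form.ev (C.c ξ η) ζ
    + Form.ev (C.c ξ ζ) η + C.p ⁅ξ, η⁆ ζ + C.p η ⁅ξ, ζ⁆ := by
  rw [ev_c, ev_c, p, p, p, map_neg, VF.app_trace, VF.mapMatrix_mul, jac_bracket, jac_bracket]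
  simp only [add_mul, sub_mul, mul_add, mul_sub, Matrix.trace_add, Matrix.trace_sub,
    ← Matrix.mul_assoc]
  linear_combination Matrix.trace_mul_comm (C.jac ζ) (η.mapMatrix (C.jac ξ))
    + Matrix.trace_mul_cycle (C.jac η) (C.jac ζ) (C.jac ξ)

theorem jacobi (ξ η ζ : VF O U) : Form.lie ξ (C.c η ζ) + C.c ξ ⁅η, ζ⁆
    = Form.lie η (C.c ξ ζ) + C.c η ⁅ξ, ζ⁆ + C.c ⁅ξ, η⁆ ζ - Form.lie ζ (C.c ξ η)
      + Form.d (Form.ev (C.c ξ η) ζ) := by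
  refine C.form_ext fun ω => ?_
  have lie : ∀ ξ η ζ : VF O U, Form.ev (Form.lie ξ (C.c η ζ)) ω
      = -((ξ.mapMatrix (C.jac ζ) * ω.mapMatrix (C.jac η)).trace
        + (C.jac ζ * ω.mapMatrix (ξ.mapMatrix (C.jac η))).trace) := fun ξ η ζ => by
    rw [Form.ev_lie, ev_c, ev_c, map_neg, VF.app_trace, VF.mapMatrix_mul, VF.bracket_mapMatrix,
      mul_sub, Matrix.trace_add, Matrix.trace_sub]
    ring
  simp only [Form.add_ev, Form.sub_ev, lie, Form.ev_d]
  simp only [ev_c, map_neg, VF.app_trace]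
  simp only [jac_bracket, VF.mapMatrix_mul, VF.mapMatrix_sub, VF.mapMatrix_add, mul_add,
    add_mul, mul_sub, sub_mul, Matrix.trace_add, Matrix.trace_sub, ← Matrix.mul_assoc]
  linear_combination
    Matrix.trace_mul_comm (ω.mapMatrix (C.jac η)) (ζ.mapMatrix (C.jac ξ))
      + Matrix.trace_mul_cycle (C.jac ζ) (ω.mapMatrix (C.jac η)) (C.jac ξ)
      - Matrix.trace_mul_cycle (C.jac ζ) (ω.mapMatrix (C.jac ξ)) (C.jac η)

/-! #### Naturality -/

theorem res_jac (C : Coordinates O U) {V : Opens X} (i : V ≤ U) (ξ : VF O U) (j k : Fin C.n) :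
    resFn O i (C.jac ξ j k) = (C.restrict i).jac (VF.res i ξ) j k := by
  rw [jac_apply, VF.res_app, VF.res_app]
  rfl

theorem res_γ (C : Coordinates O U) {V : Opens X} (i : V ≤ U) (f : Fn O U) (ξ : VF O U) :
    Form.res i (C.γ f ξ) = (C.restrict i).γ (resFn O i f) (VF.res i ξ) := by
  simp only [γ, map_neg, map_sum, Form.res_smul, Form.res_d, VF.res_app]
  rfl

theorem res_p (C : Coordinates O U) {V : Opens X} (i : V ≤ U) (ξ η : VF O U) :
    resFn O i (C.p ξ η) = (C.restrict i).p (VF.res i ξ) (VF.res i η) := by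
  simp only [p_eq, map_neg, map_sum, map_mul, res_jac]
  rfl

theorem res_c (C : Coordinates O U) {V : Opens X} (i : V ≤ U) (ξ η : VF O U) :
    Form.res i (C.c ξ η) = (C.restrict i).c (VF.res i ξ) (VF.res i η) := by
  simp only [c, map_neg, map_sum, Form.res_smul, Form.res_d, res_jac]
  rfl

theorem restrict_restrict (C : Coordinates O U) {V V' : Opens X} (i : V ≤ U) (j : V' ≤ V) :
    (C.restrict i).restrict j = C.restrict (j.trans i) := by
  have : (fun k => resFn O j (resFn O i (C.x k))) = fun k => resFn O (j.trans i) (C.x k) :=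
    funext fun k => resFn_resFn O i j (C.x k)
  unfold restrict
  congr 1

end Coordinates

/-- The twist of `T ⊕ Ω¹` given by a coordinate system. -/
def Coordinates.twist (C : Coordinates O U) : Twist O U where
  γ h := LinearMap.mk₂ ℂ (C.restrict h).γ
    (fun f g ξ => by simp only [Coordinates.γ, map_add, Form.d_add, smul_add,
      Finset.sum_add_distrib, neg_add])
    (fun a f ξ => by simp only [Coordinates.γ, Derivation.map_smul, Form.d_csmul,
      smul_algebra_smul_comm, Finset.smul_sum, smul_neg])
    (fun f ξ η => by simp only [Coordinates.γ, VF.add_app, add_smul, Finset.sum_add_distrib,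
      neg_add])
    (fun a f ξ => by
      have : ∀ g, (a • ξ).app g = a • ξ.app g := fun _ => rfl
      simp only [Coordinates.γ, this, smul_assoc, Finset.smul_sum, smul_neg])
  p h := LinearMap.mk₂ ℂ (C.restrict h).p
    (fun ξ ξ' η => by simp only [Coordinates.p, Coordinates.jac_add, add_mul, Matrix.trace_add,
      neg_add])
    (fun a ξ η => by simp only [Coordinates.p, Coordinates.jac_csmul, Matrix.smul_mul,
      Matrix.trace_smul, smul_neg])
    (fun ξ η η' => by simp only [Coordinates.p, Coordinates.jac_add, mul_add, Matrix.trace_add,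
      neg_add])
    (fun a ξ η => by simp only [Coordinates.p, Coordinates.jac_csmul, Matrix.mul_smul,
      Matrix.trace_smul, smul_neg])
  c h := LinearMap.mk₂ ℂ (C.restrict h).c
    (fun ξ ξ' η => by simp only [Coordinates.c, Coordinates.jac_add, Matrix.add_apply,
      Form.d_add, smul_add, Finset.sum_add_distrib, neg_add])
    (fun a ξ η => by simp only [Coordinates.c, Coordinates.jac_csmul, Matrix.smul_apply,
      Form.d_csmul, smul_algebra_smul_comm, Finset.smul_sum, smul_neg])
    (fun ξ η η' => by simp only [Coordinates.c, Coordinates.jac_add, Matrix.add_apply,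
      add_smul, Finset.sum_add_distrib, neg_add])
    (fun a ξ η => by simp only [Coordinates.c, Coordinates.jac_csmul, Matrix.smul_apply,
      smul_assoc, Finset.smul_sum, smul_neg])
  res_γ h i f ξ := by
    refine ((C.restrict h).res_γ i f ξ).trans ?_
    rw [Coordinates.restrict_restrict]
    rfl
  res_p h i ξ η := by
    refine ((C.restrict h).res_p i ξ η).trans ?_
    rw [Coordinates.restrict_restrict]
    rfl
  res_c h i ξ η := by
    refine ((C.restrict h).res_c i ξ η).trans ?_
    rw [Coordinates.restrict_restrict]
    rfl

theorem Coordinates.twist_isLevel (C : Coordinates O U) : C.twist.IsLevel 1 where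
  one_γ {W} h ξ := by
    change (C.restrict h).γ 1 ξ = 0
    simp only [Coordinates.γ, Derivation.map_one_eq_zero]
    have : Form.d (0 : Fn O W) = 0 := map_zero (Form.dₗ (O := O) (W := W))
    simp only [this, smul_zero, Finset.sum_const_zero, neg_zero]
  γ_mul h f g ξ := ((C.restrict h).γ_mul f g ξ).trans (by rw [one_smul]; rfl)
  p_symm h := (C.restrict h).p_symm
  p_smul h f ξ η := ((C.restrict h).p_smul f ξ η).trans (by rw [one_smul]; rfl)
  c_symm h := (C.restrict h).c_symm
  c_smul h := (C.restrict h).c_smul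
  p_invariant h := (C.restrict h).p_invariant
  jacobi h := (C.restrict h).jacobi

/-- The exact vertex algebroid of a coordinate system. -/
def Coordinates.vertexAlgebroid (hO : IsSmooth O) (C : Coordinates O U) : EVAObj O U where
  alg := C.twist.algebroid
  vertex := C.twist_isLevel.isAlg.isVertex
  exact := C.twist_isLevel.isExact hO

end

section

variable {O : StructureSheaf X} {U : Opens X} {A : LieAlgebroid O}

/-! ### The exact Courant algebroid of an isometry -/

namespace Isometry

variable {E E' : Algebroid O U} {π : Projection A E} {π' : Projection A E'}

section

variable {k : ℤ} (hO : IsSmooth O) (hA : A.IsTransitive) (hE : E.IsAlg k) (hE' : E'.IsAlg k)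
  (τ : Isometry π π') {H : Form O 3 U} (hH : τ.HasCurvature H)

/-- An isometry from `E` to `E'` of curvature `H` exhibits `E'` as the sum `Q + E`, where `Q` is
`T ⊕ Ω¹` twisted by `H`: the pair `((ξ, α), e)` represents `τ e + i α`. -/
def combination : Algebroid.Combination 1 (Twist.ofForm H).algebroid E E' where
  map {W} h q e _ := τ.app h e + E'.inc h (show VF O W × Form O 1 W from q).2
  map_res {W V} h i q e _ _ := by
    obtain ⟨ξ, α⟩ := q
    change τ.app _ (E.res h i e) + E'.inc _ (Form.res i α) = E'.res h i (τ.app h e + E'.inc h α)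
    rw [map_add, τ.app_res, E'.res_inc]
  map_add {W} h q q' e e' _ _ _ := by
    obtain ⟨ξ, α⟩ := q
    obtain ⟨ξ', α'⟩ := q'
    change τ.app h (e + e') + E'.inc h (α + α')
      = τ.app h e + E'.inc h α + (τ.app h e' + E'.inc h α')
    rw [map_add, map_add]
    abel
  map_act {W} h f q e _ _ := by
    obtain ⟨ξ, α⟩ := q
    change τ.app h (E.act h f e) + E'.inc h (f • α + 0) = E'.act h f (τ.app h e + E'.inc h α)
    rw [add_zero, map_add, τ.app_act, hE'.inc_act]
  map_bracket {W} h q q' e e' w w' _ := by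
    obtain ⟨ξ, α⟩ := q
    obtain ⟨ξ', α'⟩ := q'
    have w : ξ = E.anchor h e := w
    have w' : ξ' = E.anchor h e' := w'
    subst w w'
    refine Eq.trans ?_ (Algebroid.IsLevel.add_inc_bracket_add_inc hO hE' h _ _ α α').symm
    rw [τ.anchor_app, τ.anchor_app, hH h e e']
    refine (congrArg (τ.app h (E.bracket h e e') + ·) (map_add (E'.inc h) _ _)).trans ?_
    rw [add_comm (E'.inc h _) (E'.inc h _), ← add_assoc]
    rfl
  anchor_map {W} h q e w := by
    obtain ⟨ξ, α⟩ := q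
    change E'.anchor h (τ.app h e + E'.inc h α) = ξ
    rw [map_add, hE'.anchor_inc hO, add_zero, τ.anchor_app]
    exact Eq.symm w
  pairing_map {W} h q q' e e' w w' := by
    obtain ⟨ξ, α⟩ := q
    obtain ⟨ξ', α'⟩ := q'
    have w : ξ = E.anchor h e := w
    have w' : ξ' = E.anchor h e' := w'
    subst w w'
    change E'.pairing h (τ.app h e + E'.inc h α) (τ.app h e' + E'.inc h α')
      = Form.ev α (E.anchor h e') + Form.ev α' (E.anchor h e) + 0 + (1 : ℤ) • E.pairing h e e'
    rw [Algebroid.IsLevel.add_inc_pairing_add_inc hO hE', τ.pairing_app, τ.anchor_app,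
      τ.anchor_app, one_smul]
    ring
  map_der {W} h f g _ := by
    change τ.app h (E.der h g) + E'.inc h (Form.d f) = E'.der h f + (1 : ℤ) • E'.der h g
    rw [one_smul, ← hE.inc_d, τ.app_inc, hE'.inc_d, hE'.inc_d, add_comm]
  surj {W} h e' p hp := by
    obtain ⟨V, i, hV, hpV, e, he⟩ := π.surj h (π'.app h e') p hp
    obtain ⟨α, hα⟩ := π'.exists_inc hO hA hE' (i.trans h) (E'.res h i e' - τ.app (i.trans h) e)
      (by rw [map_sub, τ.proj_app, he, π'.app_res, sub_self])
    refine ⟨V, i, hpV, ((E.anchor (i.trans h) e, α) : VF O V × Form O 1 V), e, rfl, ?_⟩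
    change τ.app (i.trans h) e + E'.inc (i.trans h) α = _
    rw [← hα, add_sub_cancel]
  ker {W} h q e w := by
    obtain ⟨ξ, α⟩ := q
    change τ.app h e + E'.inc h α = 0 ↔ ∃ β : Form O 1 W,
      ((ξ, α) : VF O W × Form O 1 W) = (0, β) ∧ e = -((1 : ℤ) • E.inc h β)
    have w : ξ = E.anchor h e := w
    constructor
    · intro r
      obtain ⟨β, rfl⟩ := π.exists_inc hO hA hE h e (by
        rw [← τ.proj_app, eq_neg_of_add_eq_zero_left r, map_neg, π'.app_inc hO hE', neg_zero])
      rw [τ.app_inc, ← map_add] at r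
      have r := hE'.inc_injective hO (π'.anchorSurj hA) h (r.trans (map_zero _).symm)
      rw [hE.anchor_inc hO] at w
      refine ⟨α, by rw [w], ?_⟩
      rw [one_smul, ← map_neg, eq_neg_of_add_eq_zero_left r]
    · rintro ⟨β, hβ, rfl⟩
      obtain ⟨-, rfl⟩ := Prod.ext_iff.1 hβ
      rw [map_neg, map_zsmul, τ.app_inc, one_smul, neg_add_cancel]

end

end Isometry

section

variable {c : PointedCover X} {E : ∀ x, Algebroid O (c.nhd x)} {π : ∀ x, Projection A (E x)}
  {k : ℤ} (hO : IsSmooth O) (hA : A.IsTransitive) (hE : ∀ x, (E x).IsAlg k)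

/-- The torsor cocycle of local isometries. -/
def IsometryCocycle.torsorCocycle (D : IsometryCocycle π) : TorsorCocycle c E where
  Q x y := ECAObj.ofForm hO (D.cocycle.1.2 x y) (D.cocycle.2.2.2 x y)
  φ x y := Isometry.combination hO hA ((hE y).restrict _) ((hE x).restrict _) (D.τ x y)
    (D.curvature x y)
  conn x y := Twist.connection (D.cocycle.1.2 x y)
  cocycle := D.cocycle
  curvature x y := Twist.connection_hasCurvature _
  difference x y z W hx hy hz ξ e w₁ w₂ w₃ := by
    have w : ξ = (E z).anchor hz e := w₁
    subst w
    change (show (E x).sec W hx from (D.τ x y).app (le_inf hx hy)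
        ((show (E y).sec W hy from (D.τ y z).app (le_inf hy hz) e)
          + (E y).inc hy (0 : Form O 1 W)))
          + (E x).inc hx (0 : Form O 1 W)
      = (show (E x).sec W hx from (D.τ x z).app (le_inf hx hz) e) + (E x).inc hx (0 : Form O 1 W)
        + (E x).inc hx _
    have e0 : ((E x).inc hx) (0 : Form O 1 W) = 0 := map_zero _
    have e1 : (show (E y).sec W hy from (D.τ y z).app (le_inf hy hz) e)
        + (E y).inc hy (0 : Form O 1 W) = (D.τ y z).app (le_inf hy hz) e := by
      rw [map_zero, add_zero]
    rw [e0, add_zero, add_zero]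
    exact (congrArg ((D.τ x y).app (le_inf hx hy)) e1).trans
      (D.difference x y z W hx hy hz e)

theorem IsometryCocycle.proj_torsorCocycle (D : IsometryCocycle π) (x y : X) (W : Opens X)
    (hx : W ≤ c.nhd x) (hy : W ≤ c.nhd y)
    (q : ((D.torsorCocycle hO hA hE).Q x y).alg.sec W (le_inf hx hy)) (e : (E y).sec W hy)
    (w : ((D.torsorCocycle hO hA hE).Q x y).alg.anchor (le_inf hx hy) q = (E y).anchor hy e) :
    (π x).app hx (((D.torsorCocycle hO hA hE).φ x y).map (le_inf hx hy) q e w)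
      = (π y).app hy e := by
  refine (map_add ((π x).app hx) _ _).trans ?_
  refine (congrArg₂ _ ((D.τ x y).proj_app (le_inf hx hy) e)
    ((π x).app_inc hO (hE x) hx _)).trans (add_zero _)

end

end

section

variable {O : StructureSheaf X} {U : Opens X} {A : LieAlgebroid O}

/-! ### Isometries of differences -/

namespace Isometry

variable {E₁ V V' C C' : Algebroid O U} {ω : Projection (tangent O) V}
  {ω' : Projection (tangent O) V'} {π : Projection A C} {π' : Projection A C'} {ε k₁ k₂ k : ℤ}
  (hO : IsSmooth O) (hE₁ : E₁.IsAlg k₁) (hV : V.IsAlg k₂) (hV' : V'.IsAlg k₂) (hC : C.IsAlg k)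
  (hC' : C'.IsAlg k) (hε : ε * ε = 1) (κ : Algebroid.Combination ε E₁ V C)
  (κ' : Algebroid.Combination ε E₁ V' C') (τ : Isometry ω ω')

include hO hE₁ hV hV' hC hC' in
/-- An isometry `τ` between `V` and `V'` induces an isometry `(a, v) ↦ (a, τ v)` between
`E₁ + ε V` and `E₁ + ε V'`. -/
theorem exists_combine (hπ : ∀ {W : Opens X} (h : W ≤ U) (a : E₁.sec W h) (v v' w w'),
      π'.app h (κ'.map h a v' w') = π.app h (κ.map h a v w)) :
    ∃ σ : Isometry π π', ∀ {W : Opens X} (h : W ≤ U) (a : E₁.sec W h) (v : V.sec W h) (w)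
      (w' : E₁.anchor h a = V'.anchor h (τ.app h v)),
      σ.app h (κ.map h a v w) = κ'.map h a (τ.app h v) w' := by
  have key : ∀ {W : Opens X} {h : W ≤ U} {a : E₁.sec W h} {v : V.sec W h},
      E₁.anchor h a = V.anchor h v → E₁.anchor h a = V'.anchor h (τ.app h v) :=
    fun w => w.trans (τ.anchor_app _ _).symm
  let R : SheafOn.LinRel C.toSheafOn C'.toSheafOn :=
    { rel := fun h e e' => ∃ a v w w', κ.map h a v w = e ∧ κ'.map h a (τ.app h v) w' = e'
      res := by
        rintro W W' h i _ _ ⟨a, v, w, w', rfl, rfl⟩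
        have w₁ : E₁.anchor (i.trans h) (E₁.res h i a) = V.anchor (i.trans h) (V.res h i v) := by
          rw [← E₁.res_anchor, w, V.res_anchor]
        refine ⟨_, _, w₁, key w₁, κ.map_res h i a v w w₁, ?_⟩
        rw [← κ'.map_res h i _ _ w' (by rw [← τ.app_res]; exact key w₁)]
        exact κ'.congr rfl (τ.app_res h i v) _ _
      add := by
        rintro W h _ _ _ _ ⟨a, v, w, w', rfl, rfl⟩ ⟨a₁, v₁, w₁, w₁', rfl, rfl⟩
        have w₂ : E₁.anchor h (a + a₁) = V.anchor h (v + v₁) := by rw [map_add, map_add, w, w₁]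
        refine ⟨a + a₁, v + v₁, w₂, key w₂, κ.map_add _ _ _ _ _ _ _ _, ?_⟩
        rw [← κ'.map_add h _ _ _ _ w' w₁' (by rw [← map_add]; exact key w₂)]
        exact κ'.congr rfl (map_add _ _ _) _ _
      smul := by
        rintro W h c _ _ ⟨a, v, w, w', rfl, rfl⟩
        have w₁ : E₁.anchor h (c • a) = V.anchor h (c • v) := by rw [map_smul, map_smul, w]
        refine ⟨c • a, c • v, w₁, key w₁, κ.map_csmul hE₁ hV hC h c a v w _, ?_⟩
        rw [← κ'.map_csmul hE₁ hV' hC' h c _ _ w' (by rw [← map_smul]; exact key w₁)]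
        exact κ'.congr rfl (map_smul _ _ _) _ _
      uniq := by
        rintro W h _ ⟨a, v, w, w', h0, rfl⟩
        obtain ⟨α, rfl, rfl⟩ := (κ.ker h a v w).1 h0
        refine (κ'.ker h _ _ _).2 ⟨α, rfl, ?_⟩
        rw [map_neg, map_zsmul, τ.app_inc]
      total := fun h e p hp => by
        obtain ⟨W', i, hpV, a, v, w, hav⟩ := κ.surj h e p hp
        exact ⟨W', i, hpV, _, a, v, w, key w, hav, rfl⟩ }
  obtain ⟨σ, hσ⟩ := exists_of_rel (π := π) (π' := π') R
    (by
      rintro W h f _ _ ⟨a, v, w, w', rfl, rfl⟩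
      have w₁ : E₁.anchor h (E₁.act h f a) = V.anchor h (V.act h f v) := by
        rw [hE₁.anchor_act, hV.anchor_act, w]
      refine ⟨_, _, w₁, key w₁, κ.map_act _ _ _ _ _ _, ?_⟩
      rw [← κ'.map_act h f _ _ w' (by rw [← τ.app_act]; exact key w₁)]
      exact κ'.congr rfl (τ.app_act _ _ _) _ _)
    (by
      rintro W h _ _ ⟨a, v, w, w', rfl, rfl⟩
      exact hπ h a v _ w w')
    (by
      rintro W h _ _ _ _ ⟨a, v, w, w', rfl, rfl⟩ ⟨a₁, v₁, w₁, w₁', rfl, rfl⟩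
      rw [κ.pairing_map, κ'.pairing_map, τ.pairing_app])
    (by
      intro W h α
      have w : E₁.anchor h (E₁.inc h α) = V.anchor h 0 := by rw [hE₁.anchor_inc hO, map_zero]
      refine ⟨_, _, w, key w, κ.map_inc_zero hO hE₁ hC h α w, ?_⟩
      rw [← κ'.map_inc_zero hO hE₁ hC' h α (by rw [hE₁.anchor_inc hO, map_zero])]
      exact κ'.congr rfl (map_zero _) _ _)
  exact ⟨σ, fun h a v w w' => hσ h ⟨a, v, w, w', rfl, rfl⟩⟩

variable {κ κ' τ} {σ : Isometry π π'} (hσ : ∀ {W : Opens X} (h : W ≤ U) (a : E₁.sec W h)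
  (v : V.sec W h) (w) (w' : E₁.anchor h a = V'.anchor h (τ.app h v)),
    σ.app h (κ.map h a v w) = κ'.map h a (τ.app h v) w')

include hO hE₁ hV hV' hC' hε hσ in
/-- The isometry of differences induced by an isometry of curvature `H` has curvature `-H`. -/
theorem HasCurvature.combine {H : Form O 3 U} (hτ : τ.HasCurvature H) :
    σ.HasCurvature (ε • H) := fun {W} h e e' => by
  have key : ∀ {W : Opens X} {h : W ≤ U} {a : E₁.sec W h} {v : V.sec W h},
      E₁.anchor h a = V.anchor h v → E₁.anchor h a = V'.anchor h (τ.app h v) :=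
    fun w => w.trans (τ.anchor_app _ _).symm
  have main : ∀ {W : Opens X} (l : W ≤ U) (a a₂ : E₁.sec W l) (v v₂ : V.sec W l)
      (w₁ : E₁.anchor l a = V.anchor l v) (w₂ : E₁.anchor l a₂ = V.anchor l v₂),
      C'.bracket l (σ.app l (κ.map l a v w₁)) (σ.app l (κ.map l a₂ v₂ w₂))
        = σ.app l (C.bracket l (κ.map l a v w₁) (κ.map l a₂ v₂ w₂))
          + C'.inc l (Form.contract (C.anchor l (κ.map l a₂ v₂ w₂))
            (Form.contract (C.anchor l (κ.map l a v w₁)) (Form.res l (ε • H)))) := by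
    intro W l a a₂ v v₂ w₁ w₂
    have wb : E₁.anchor l (E₁.bracket l a a₂) = V.anchor l (V.bracket l v v₂) := by
      rw [hE₁.anchor_bracket, hV.anchor_bracket, w₁, w₂]
    have w0 : E₁.anchor l (E₁.bracket l a a₂ + E₁.inc l 0)
        = V'.anchor l (τ.app l (V.bracket l v v₂) + V'.inc l (Form.contract (V.anchor l v₂)
          (Form.contract (V.anchor l v) (Form.res l H)))) := by
      rw [map_add, map_add, hE₁.anchor_inc hO, hV'.anchor_inc hO, add_zero, add_zero]
      exact key wb
    have e₁ : C'.bracket l (κ'.map l a (τ.app l v) (key w₁)) (κ'.map l a₂ (τ.app l v₂) (key w₂))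
        = κ'.map l (E₁.bracket l a a₂ + E₁.inc l 0) (τ.app l (V.bracket l v v₂)
          + V'.inc l (Form.contract (V.anchor l v₂)
            (Form.contract (V.anchor l v) (Form.res l H)))) w0 := by
      rw [← κ'.map_bracket l _ _ _ _ (key w₁) (key w₂) (by
        rw [hE₁.anchor_bracket, hV'.anchor_bracket, key w₁, key w₂])]
      exact κ'.congr (by rw [map_zero, add_zero]) (hτ l v v₂) _ _
    rw [hσ l a v w₁ (key w₁), hσ l a₂ v₂ w₂ (key w₂), e₁,
      κ'.map_add_inc hO hE₁ hV' hC' l _ _ _ _ (key wb) w0 hε, zero_add, κ.anchor_map, κ.anchor_map,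
      w₁, w₂, ← κ.map_bracket l _ _ _ _ w₁ w₂ wb, hσ l _ _ wb (key wb)]
    refine congrArg (fun α => _ + C'.inc l α) (Form.ext₁ fun _ _ _ => ?_)
    rfl
  refine C'.eq_of_local h fun p hp => ?_
  obtain ⟨V₁, i, hp₁, a₁, v₁, w₁, r₁⟩ := κ.surj h e p hp
  obtain ⟨V₂, j, hp₂, a₂, v₂, w₂, r₂⟩ := κ.surj (i.trans h) (C.res h i e') p hp₁
  refine ⟨V₂, j.trans i, hp₂, ?_⟩
  have w₁' : E₁.anchor (j.trans (i.trans h)) (E₁.res (i.trans h) j a₁)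
      = V.anchor (j.trans (i.trans h)) (V.res (i.trans h) j v₁) := by
    rw [← E₁.res_anchor, w₁, V.res_anchor]
  have r₁' := κ.map_res (i.trans h) j a₁ v₁ w₁ w₁'
  rw [r₁, C.res_res] at r₁'
  rw [C.res_res] at r₂
  rw [map_add, C'.res_bracket, C'.res_inc, Form.res_contract, Form.res_contract, C.res_anchor,
    C.res_anchor, ← σ.app_res, ← σ.app_res, ← σ.app_res, C.res_bracket, ← r₁', ← r₂]
  exact main _ _ _ _ _ w₁' w₂

end Isometry

end

section

variable {O : StructureSheaf X} {U : Opens X} {A : LieAlgebroid O} {P : InvariantPairing A}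

/-! ### The classes of the torsors -/

/-- An exact vertex algebroid as an extension of the tangent sheaf. -/
def EVAObj.projection (V : EVAObj O U) : Projection (tangent O) V.alg where
  app := V.alg.anchor
  app_res h i e := (V.alg.res_anchor h i e).symm
  app_act := V.vertex.anchor_act
  app_bracket := V.vertex.anchor_bracket
  anchor_app _ _ := rfl
  surj := V.exact.surj
  ker := V.exact.ker

variable (O) in
/-- The zero pairing on the (zero) kernel of the identity of the tangent sheaf. -/
def tangentPairing : InvariantPairing (tangent O) where
  val _ := 0
  res_val i _ _ _ _ _ _ := map_zero (resFn O i)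
  symm _ _ := rfl
  act_left f _ _ _ _ := (mul_zero f).symm
  invariant {W} a _ _ _ _ _ _ :=
    (map_zero ((tangent O).anchor W a).app).trans (add_zero (0 : Fn O W)).symm

theorem EVAObj.projection_induces (hO : IsSmooth O) (V : EVAObj O U) :
    (V.projection).Induces (tangentPairing O) := by
  intro W h e e' x x' hx hx'
  have he : V.alg.anchor h e = 0 := hx.trans x.2
  have he' : V.alg.anchor h e' = 0 := hx'.trans x'.2
  obtain ⟨α, rfl⟩ := V.exact.exists_inc hO V.vertex.isAlg h e he
  rw [V.vertex.isAlg.inc_pairing hO, he', Form.ev_zero]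
  rfl

section

variable {c : PointedCover X} {E₁ : Algebroid O (⊤ : Opens X)} {V C : ∀ x, Algebroid O (c.nhd x)}
  {ω : ∀ x, Projection (tangent O) (V x)} {π : ∀ x, Projection A (C x)} {ε k₁ k₂ k : ℤ}

/-- The isometries `(a, v) ↦ (a, τ v)` of sums or differences `E₁ + ε V_x` have the cocycle `ε s`
if the isometries `τ` have the cocycle `s`. -/
theorem IsometryCocycle.exists_combine (hO : IsSmooth O) (hE₁ : E₁.IsAlg k₁)
    (hV : ∀ x, (V x).IsAlg k₂) (hC : ∀ x, (C x).IsAlg k) (hε : ε * ε = 1)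
    (κ : ∀ x, Algebroid.Combination ε (E₁.restrict le_top) (V x) (C x))
    (hπ : ∀ (x y : X) {W : Opens X} (hx : W ≤ c.nhd x) (hy : W ≤ c.nhd y) (a v v' w w'),
      (π y).app hy ((κ y).map hy a v' w') = (π x).app hx ((κ x).map hx a v w))
    (D : IsometryCocycle ω) : ∃ D' : IsometryCocycle π, D'.cocycle = ε • D.cocycle := by
  choose σ hσ using fun x y => Isometry.exists_combine hO (hE₁.restrict le_top)
    ((hV y).restrict _) ((hV x).restrict _) ((hC y).restrict _) ((hC x).restrict _)
    ((κ y).restrict (inf_le_right : c.nhd x ⊓ c.nhd y ≤ c.nhd y))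
    ((κ x).restrict (inf_le_left : c.nhd x ⊓ c.nhd y ≤ c.nhd x)) (D.τ x y)
    (π := (π y).restrict inf_le_right) (π' := (π x).restrict inf_le_left)
    (fun h a v v' w w' => hπ y x (h.trans inf_le_right) (h.trans inf_le_left) a v v' w w')
  refine ⟨{
    τ := σ
    cocycle := ε • D.cocycle
    curvature := fun x y => ?_
    difference := fun x y z W hx hy hz e => ?_ }, rfl⟩
  · have : (σ x y).HasCurvature (ε • D.cocycle.1.2 x y) :=
      Isometry.HasCurvature.combine hO (hE₁.restrict le_top) ((hV y).restrict _)
        ((hV x).restrict _) ((hC x).restrict _) hε (hσ x y) (D.curvature x y)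
    exact @this
  · have key : ∀ (x y : X) {W : Opens X} (hx : W ≤ c.nhd x) (hy : W ≤ c.nhd y)
        {a : E₁.sec W le_top} {v : (V y).sec W hy},
        E₁.anchor le_top a = (V y).anchor hy v →
        E₁.anchor le_top a = (V x).anchor hx ((D.τ x y).app (le_inf hx hy) v) :=
      fun x y _ hx hy _ _ w => w.trans ((D.τ x y).anchor_app (le_inf hx hy) _).symm
    have main : ∀ {W : Opens X} (hx : W ≤ c.nhd x) (hy : W ≤ c.nhd y) (hz : W ≤ c.nhd z)
        (a : E₁.sec W le_top) (v : (V z).sec W hz) (w : E₁.anchor le_top a = (V z).anchor hz v),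
        (σ x y).app (le_inf hx hy) ((σ y z).app (le_inf hy hz) ((κ z).map hz a v w))
          = (show (C x).sec W hx from (σ x z).app (le_inf hx hz) ((κ z).map hz a v w))
            + (C x).inc hx (Form.contract ((C z).anchor hz ((κ z).map hz a v w))
              (Form.res (le_inf (le_inf hx hy) hz) ((ε • D.cocycle).1.1 x y z))) := by
      intro W hx hy hz a v w
      have wy := key y z hy hz w
      have wx := key x y hx hy wy
      have wx' := key x z hx hz w
      have w0 : E₁.anchor le_top (a + E₁.inc le_top 0) = (V x).anchor hx
          ((show (V x).sec W hx from (D.τ x z).app (le_inf hx hz) v) + (V x).inc hx (Form.contract ((V z).anchor hz v)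
            (Form.res (le_inf (le_inf hx hy) hz) (D.cocycle.1.1 x y z)))) := by
        rw [map_zero, add_zero]
        refine wx'.trans (Eq.trans ?_ (map_add ((V x).anchor hx) _ _).symm)
        rw [(hV x).anchor_inc hO, add_zero]
      have e₁ : (κ x).map hx a _ wx = (κ x).map hx (a + E₁.inc le_top 0) _ w0 :=
        (κ x).congr (show a = a + E₁.inc le_top 0 by rw [map_zero, add_zero])
          (D.difference x y z W hx hy hz v) _ _
      have e₂ := (κ x).map_add_inc hO (hE₁.restrict le_top) (hV x) (hC x) hx a
        ((D.τ x z).app (le_inf hx hz) v) 0 (Form.contract ((V z).anchor hz v)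
            (Form.res (le_inf (le_inf hx hy) hz) (D.cocycle.1.1 x y z))) wx' w0 hε
      refine (congrArg ((σ x y).app (le_inf hx hy)) (hσ y z (le_inf hy hz) a v w wy)).trans ?_
      refine (hσ x y (le_inf hx hy) a _ wy wx).trans (e₁.trans (e₂.trans ?_))
      refine congrArg₂ (fun s t : (C x).sec W hx => s + t)
        (hσ x z (le_inf hx hz) a v w wx').symm (congrArg ((C x).inc hx) ?_)
      have e₃ : (C z).anchor hz ((κ z).map hz a v w) = (V z).anchor hz v :=
        ((κ z).anchor_map hz a v w).trans w
      rw [e₃, zero_add]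
      rfl
    refine (C x).eq_of_local hx fun p hp => ?_
    obtain ⟨V₁, i, hpV, a, v, w, r⟩ := (κ z).surj hz e p hp
    refine ⟨V₁, i, hpV, ?_⟩
    have m := main (i.trans hx) (i.trans hy) (i.trans hz) a v w
    rw [r] at m
    refine ((σ x y).app_res (le_inf hx hy) i _).symm.trans ?_
    refine (congrArg ((σ x y).app _) ((σ y z).app_res (le_inf hy hz) i e).symm).trans ?_
    refine Eq.trans (Eq.trans m ?_) (map_add ((C x).res hx i) _ _).symm
    refine congrArg₂ (fun s t : (C x).sec V₁ _ => s + t) ((σ x z).app_res (le_inf hx hz) i e) ?_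
    rw [(C x).res_inc, Form.res_contract, (C z).res_anchor]
    rfl

end

variable (O) in
/-- The class of the torsor of exact vertex algebroids is defined. -/
theorem exists_isometryCocycle (hO : IsSmooth O) : ∃ (c : PointedCover X)
    (V : ∀ x, EVAObj O (c.nhd x)), Nonempty (IsometryCocycle fun x => (V x).projection) := by
  choose N hN C using fun p => hO.exists_coordinates p
  let c : PointedCover X := ⟨N, hN⟩
  let C' : ∀ x, Coordinates O (c.nhd x) := fun x => (C x).some
  let V : ∀ x, EVAObj O (c.nhd x) := fun x => (C' x).vertexAlgebroid hO
  refine ⟨c, V, IsometryCocycle.exists_of_isometries hO tangent_isTransitive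
    (fun x => (V x).vertex.isAlg) fun x y => Nonempty.some ?_⟩
  refine Isometry.exists_of_coordinates hO tangent_isTransitive ((V y).vertex.isAlg.restrict _)
    ((V x).vertex.isAlg.restrict _) (P := tangentPairing O)
    (fun h => (V y).projection_induces hO (h.trans inf_le_right))
    (fun h => (V x).projection_induces hO (h.trans inf_le_left))
    ((C' x).restrict inf_le_left) (fun i => ((VF.res inf_le_left ((C' x).D i), 0) : VF O _ × Form O 1 _))
    (fun i => ((VF.res inf_le_left ((C' x).D i), 0) : VF O _ × Form O 1 _)) (fun i => rfl)
    (fun i => rfl)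

/-- The classes of the torsors of exact vertex algebroids and of Courant extensions are well defined
and opposite to each other. -/
theorem exists_class (hO : IsSmooth O) (hA : A.IsTransitive) (Ahat : VertexExtension A)
    (hP : Ahat.proj.Induces P) : ∃ κ : H2 O, (∀ κ' : H2 O, IsClassOfEVA O κ' ↔ κ' = κ) ∧
      (∀ κ' : H2 O, IsClassOfCEXT A P κ' ↔ κ' = -κ) := by
  obtain ⟨c, V, ⟨D⟩⟩ := exists_isometryCocycle O hO
  obtain ⟨D', hD'⟩ := D.exists_combine (π := fun x => (Ahat.diffObj hO hA hP (V x)).proj) hO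
    Ahat.vertex.isAlg (fun x => (V x).vertex.isAlg)
    (fun x => (Ahat.diffObj hO hA hP (V x)).courant.isAlg) (ε := -1) (by norm_num)
    (fun x => Ahat.diffMap hO hA hP (V x)) fun x y _ hx hy a v v' w w' =>
      (Ahat.proj_diffMap hO hA hP (V y) hy a v' w').trans
        (Ahat.proj_diffMap hO hA hP (V x) hx a v w).symm
  rw [neg_one_zsmul] at hD'
  refine ⟨H2.mk O D.cocycle, fun κ' => ⟨?_, ?_⟩, fun κ' => ⟨?_, ?_⟩⟩
  · rintro ⟨c', V', D₁, rfl⟩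
    refine IsometryCocycle.class_eq hO tangent_isTransitive (fun x => (V' x).vertex.isAlg)
      (fun x => (V x).vertex.isAlg) (fun x => (V' x).projection_induces hO)
      (fun x => (V x).projection_induces hO)
      (D₁.isometryCocycle hO (fun x => (V' x).vertex.isAlg) fun x y W hx hy q e w => ?_) D
    exact ((D₁.φ x y).anchor_map (le_inf hx hy) q e w).trans w
  · rintro rfl
    exact ⟨c, V, D.torsorCocycle hO tangent_isTransitive fun x => (V x).vertex.isAlg, rfl⟩
  · rintro ⟨c', C, D₁, h, rfl⟩
    rw [← H2.mk_neg, ← hD']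
    exact IsometryCocycle.class_eq hO hA (fun x => (C x).courant.isAlg)
      (fun x => (Ahat.diffObj hO hA hP (V x)).courant.isAlg) (fun x => (C x).induces)
      (fun x => (Ahat.diffObj hO hA hP (V x)).induces)
      (D₁.isometryCocycle hO (fun x => (C x).courant.isAlg) h) D'
  · rintro rfl
    rw [← H2.mk_neg, ← hD']
    exact ⟨c, fun x => Ahat.diffObj hO hA hP (V x),
      D'.torsorCocycle hO hA fun x => (Ahat.diffObj hO hA hP (V x)).courant.isAlg,
      fun x y W hx hy q e w => D'.proj_torsorCocycle hO hA _ x y W hx hy q e w, rfl⟩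

end

end Algebroids

end

theorem mainTheorem4 {X : TopCat.{u}} (O : Algebroids.StructureSheaf X)
    (hO : Algebroids.IsSmooth O) (A : Algebroids.LieAlgebroid O) (hA : A.IsTransitive)
    (hA' : A.IsLocallyFreeOfFiniteRank) (Ahat : Algebroids.VertexExtension A) :
    ∃ P : Algebroids.InvariantPairing A,
      -- `P` is the pairing induced by the vertex extension
      (∀ P' : Algebroids.InvariantPairing A, Ahat.proj.Induces P' ↔ P' = P) ∧
      -- `EVA` and `CEXT(A)_P` are fibered in groupoids
      (∀ (U : Opens X) (V V' : Algebroids.EVAObj O U) (f : V ⟶ V'), IsIso f) ∧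
      (∀ (U : Opens X) (C C' : Algebroids.CEXTObj A P U) (f : C ⟶ C'), IsIso f) ∧
      -- the actions of `ECA` and the functor `V ↦ Â - V` exist
      Nonempty (Algebroids.EVAAction O) ∧
      Nonempty (Algebroids.CEXTAction A P) ∧
      Nonempty (Algebroids.DifferenceFunctor Ahat P) ∧
      -- the functor is an equivalence and anti-commutes with the actions
      (∀ F : Algebroids.DifferenceFunctor Ahat P,
        (∀ U : Opens X, (Algebroids.functorOn F.functor U).IsEquivalence) ∧
        ∀ (actE : Algebroids.EVAAction O) (actC : Algebroids.CEXTAction A P),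
          F.AntiCommutes actE actC) ∧
      -- the classes of the two torsors are well defined and opposite
      ∃ κ : Algebroids.H2 O,
        (∀ κ' : Algebroids.H2 O, Algebroids.IsClassOfEVA O κ' ↔ κ' = κ) ∧
        (∀ κ' : Algebroids.H2 O, Algebroids.IsClassOfCEXT A P κ' ↔ κ' = -κ) := by
  obtain ⟨P, hP⟩ := Algebroids.exists_pairing hO Ahat.alg Ahat.vertex.isAlg Ahat.proj hA
  have hP' : Ahat.proj.Induces P := (hP P).2 rfl
  exact ⟨P, hP, fun _ => Algebroids.EVAObj.isIso hO, fun _ => Algebroids.CEXTObj.isIso hO hA,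
    ⟨Algebroids.evaAction hO⟩, ⟨Algebroids.cextAction hO hA⟩, ⟨Ahat.difference hO hA hP'⟩,
    fun F => ⟨F.isEquivalence hO hA hP', F.antiCommutes hO hA⟩,
    Algebroids.exists_class hO hA Ahat hP'⟩
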